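/- **Theorem 4.2 (error estimate for the DDG method, fractional diffusion without convection).** *Equation.* Let $1<\alpha<2$, $\varepsilon>0$, $\Omega=[a,b]$ with $a<b$. For $0<\sigma<1$ put $$\Delta_{-\sigma/2}f(x)=\frac{1}{2\cos(\pi\sigma/2)\,\Gamma(\sigma)}\Big(\int_{-\infty}^{x}\frac{f(s)\,ds}{(x-s)^{1-\sigma}}+\int_{x}^{\infty}\frac{f(s)\,ds}{(s-x)^{1-\sigma}}\Big),$$ where functions on $\Omega$ are extended by zero, and let $-(-\Delta)^{\alpha/2}w=\Delta_{(\alpha-2)/2}(w'')$ (the Riesz–Caputo form of the fractional Laplacian; $w''$ is taken on $\Omega$ and extended by zero). Consider $$u_t+\varepsilon(-\Delta)^{\alpha/2}u=g\ \text{ in }(a,b)\times(0,T],\qquad u(a,t)=u(b,t)=0\ \ (0\le t\le T),$$ with a given source $g$; $g=0$ is allowed. *Scheme.* Let $N\ge 1$ and let $a=x_{1/2}<\dots<x_{K+1/2}=b$ be a mesh with cells $D^k=[x_{k-1/2},x_{k+1/2}]$ and $h=\max_k|D^k|$. Let $V_h$ be the space of functions that are polynomials of degree at most $N$ on every cell.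 At interior nodes $[v]=v^+-v^-$ and $\{v\}=(v^++v^-)/2$. At $a$ and $b$ the outer trace of $v$ in $[v]$ is $0$, $\{\partial_xv\}$ is the inner trace, and $[\partial_x^2v]=0$. The numerical flux is $$(\partial_xv)^*=\tfrac{\beta_0}{h}[v]+\{\partial_xv\}+\beta_1h[\partial_x^2v].$$ It is admissible on the mesh with constants $\gamma\in(0,1)$, $\mu\in(0,1]$ if for all $w\in V_h$ $$\gamma\sum_k\|\partial_xw\|^2_{L^2(D^k)}+\sum_{j=0}^{K}\big((\partial_xw)^*[w]+\{\partial_xw\}[w]\big)_{j+1/2}\ \ge\ \mu\sum_{j=0}^{K}\frac{[w]_{j+1/2}^2}{h}.$$ A semidiscrete solution is a triple $u_h,p_h,q_h:[0,T]\to V_h$ with $u_h$ continuous on $[0,T]$, such that for every $t\in(0,T]$ the function $u_h$ is differentiable at $t$ and, for all $v,\psi,\phi\in V_h$ and all $k$, $$((u_h)_t,v)_{D^k}-\varepsilon(p_h,v)_{D^k}=(g,v)_{D^k},\qquad (p_h,\psi)_{D^k}=(\Delta_{(\alpha-2)/2}q_h,\psi)_{D^k},$$ $$\sum_k(q_h,\phi)_{D^k}=-\sum_k(\partial_xu_h,\partial_x\phi)_{D^k}-\sum_{j=0}^{K}\big((\partial_xu_h)^*[\phi]+\{\partial_x\phi\}[u_h]\big)_{j+1/2}.$$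 For $w$ on $\Omega$ with $w(a)=w(b)=0$, a function $\mathcal P w\in V_h$ is called a special projection of $w$ if $(\mathcal Pw-w,r)_{D^k}=0$ for all $k$ and all polynomials $r$ of degree at most $N-2$ (no condition if $N=1$), $\{\mathcal Pw\}=w$ at the interior nodes, and $(\partial_x\mathcal Pw)^*=\partial_xw$ at all nodes. *Claim.* For fixed $\alpha,\varepsilon,a,b,N,\beta_0,\beta_1,\gamma,\mu$ there is an $m\in\mathbb N$ such that for all $0<\tau\le T$ and all real $R,C_0$ there are $C,h_0>0$ with the following property. Let $u\in C^m(\Omega\times[0,T])$ be an exact solution (for some $g$) all of whose space-time derivatives of order at most $m$ are bounded by $R$ (in the norm of multilinear maps). Then for every mesh with $h\le h_0$ on which the flux is admissible with constants $\gamma,\mu$, and every semidiscrete solution (with the same $g$): 1. if $u_h(0)$ is a special projection of $u(\cdot,0)$, then $\|u(\cdot,t)-u_h(\cdot,t)\|_{L^2(\Omega)}\le Ch^{N+1}$ for all $t\in[0,T]$; 2. if only $\|u(\cdot,0)-u_h(0)\|_{L^2(\Omega)}\le C_0h^{N+1}$, then $\|u(\cdot,t)-u_h(\cdot,t)\|_{L^2(\Omega)}\le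 Ch^{N+1}$ for all $t\in[\tau,T]$. -/

import Mathlib

open scoped ContDiff

noncomputable section

/-! ### Fractional operators -/

/-- Left Riemann-Liouville integral of order `σ` on the line. -/
def rlLeft (σ : ℝ) (f : ℝ → ℝ) (x : ℝ) : ℝ :=
  (1 / Real.Gamma σ) * ∫ s in Set.Iio x, f s / (x - s) ^ (1 - σ)

/-- Right Riemann-Liouville integral of order `σ` on the line. -/
def rlRight (σ : ℝ) (f : ℝ → ℝ) (x : ℝ) : ℝ :=
  (1 / Real.Gamma σ) * ∫ s in Set.Ioi x, f s / (s - x) ^ (1 - σ)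

/-- The fractional integral operator `Δ_{-σ/2}`, for `0 < σ < 1`. -/
def fracInt (σ : ℝ) (f : ℝ → ℝ) (x : ℝ) : ℝ :=
  (rlLeft σ f x + rlRight σ f x) / (2 * Real.cos (Real.pi * σ / 2))

/-- The second derivative of `w` on `[a,b]`, extended by zero outside `[a,b]`. -/
def secondDeriv (a b : ℝ) (w : ℝ → ℝ) : ℝ → ℝ :=
  (Set.Icc a b).indicator (iteratedDerivWithin 2 w (Set.Icc a b))

/-- Left Caputo derivative of order `1 < α < 2` on `[a,b]`. -/
def caputoLeft (α a b : ℝ) (w : ℝ → ℝ) (x : ℝ) : ℝ :=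
  rlLeft (2 - α) (secondDeriv a b w) x

/-- Right Caputo derivative of order `1 < α < 2` on `[a,b]`; the sign `(-1)^2` is `1`. -/
def caputoRight (α a b : ℝ) (w : ℝ → ℝ) (x : ℝ) : ℝ :=
  rlRight (2 - α) (secondDeriv a b w) x

/-- The fractional Laplacian `(-Δ)^{α/2}`, `1 < α < 2`, on `[a,b]` in its Riesz-Caputo form.
If the extension of `w` by zero is twice continuously differentiable on the line, the two Caputo
derivatives are those of that extension over `(-∞,x)` and `(x,∞)`. -/
def fracLaplacian (α a b : ℝ) (w : ℝ → ℝ) (x : ℝ) : ℝ :=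
  (caputoLeft α a b w x + caputoRight α a b w x) / (2 * Real.cos (Real.pi * α / 2))

/-! ### Exact solutions -/

/-- `u t x` solves `∂ₜu + ε(-Δ)^{α/2}u = g` in `(a,b) × (0,T]`, is `C^m` on
`[0,T] × [a,b]`, and satisfies homogeneous boundary conditions. -/
structure IsExactSolution (α ε a b T : ℝ) (m : ℕ) (g u : ℝ → ℝ → ℝ) : Prop where
  contDiffOn : ContDiffOn ℝ m (fun z : ℝ × ℝ => u z.1 z.2) (Set.Icc 0 T ×ˢ Set.Icc a b)
  boundary : ∀ t ∈ Set.Icc 0 T, u t a = 0 ∧ u t b = 0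
  equation : ∀ t ∈ Set.Ioc 0 T, ∀ x ∈ Set.Ioo a b,
    derivWithin (fun s => u s x) (Set.Icc 0 T) t + ε * fracLaplacian α a b (u t) x = g t x

/-- All (mixed) derivatives of `u` up to order `m` are bounded by `R` on `[0,T] × [a,b]`. -/
def DerivBound (a b T : ℝ) (m : ℕ) (R : ℝ) (u : ℝ → ℝ → ℝ) : Prop :=
  ∀ i ≤ m, ∀ z ∈ Set.Icc 0 T ×ˢ Set.Icc a b,
    ‖iteratedFDerivWithin ℝ i (fun y : ℝ × ℝ => u y.1 y.2) (Set.Icc 0 T ×ˢ Set.Icc a b) z‖ ≤ R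

/-! ### Meshes and piecewise polynomials -/

/-- A partition of `[a,b]` into `K` cells `[node k, node (k+1)]`. -/
structure DGMesh (a b : ℝ) (K : ℕ) where
  node : Fin (K + 1) → ℝ
  strictMono : StrictMono node
  node_zero : node 0 = a
  node_last : node (Fin.last K) = b

/-- Piecewise polynomials of degree at most `N` on `K` cells: `v k i` is the coefficient of `x^i`
of the polynomial on the `k`-th cell. -/
abbrev DGSpace (K N : ℕ) := Fin K → Fin (N + 1) → ℝ

/-- The polynomial pieces of `v`. -/
def DGSpace.poly {K N : ℕ} (v : DGSpace K N) (k : Fin K) : Polynomial ℝ :=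
  ∑ i : Fin (N + 1), Polynomial.monomial (i : ℕ) (v k i)

/-- Cellwise `n`-th derivative. -/
def DGSpace.dpoly {K N : ℕ} (n : ℕ) (v : DGSpace K N) (k : Fin K) : Polynomial ℝ :=
  Polynomial.derivative^[n] (v.poly k)

namespace DGMesh

variable {a b : ℝ} {K N : ℕ}

/-- The mesh size `h`, the largest cell length. -/
def size (M : DGMesh a b K) : ℝ := ⨆ k : Fin K, (M.node k.succ - M.node k.castSucc)

/-- The integral of `f` over the `k`-th cell. -/
def cellInt (M : DGMesh a b K) (k : Fin K) (f : ℝ → ℝ) : ℝ :=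
  ∫ x in (M.node k.castSucc)..(M.node k.succ), f x

/-- `v` as a function on the line, zero outside `[a,b)`. -/
def toFun (M : DGMesh a b K) (v : DGSpace K N) (x : ℝ) : ℝ :=
  ∑ k : Fin K,
    (Set.Ico (M.node k.castSucc) (M.node k.succ)).indicator (fun y => (v.poly k).eval y) x

/-- The `L²(a,b)` distance of a function and a piecewise polynomial. -/
def l2Dist (M : DGMesh a b K) (w : ℝ → ℝ) (v : DGSpace K N) : ℝ :=
  Real.sqrt (∑ k, M.cellInt k fun x => (w x - (v.poly k).eval x) ^ 2)

/-- The trace from the right at the `j`-th node; zero at the right end point. -/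
def tracePlus (M : DGMesh a b K) (P : Fin K → Polynomial ℝ) (j : Fin (K + 1)) : ℝ :=
  if h : (j : ℕ) < K then (P ⟨j, h⟩).eval (M.node j) else 0

/-- The trace from the left at the `j`-th node; zero at the left end point. -/
def traceMinus (M : DGMesh a b K) (P : Fin K → Polynomial ℝ) (j : Fin (K + 1)) : ℝ :=
  if h : 0 < (j : ℕ) then (P ⟨(j : ℕ) - 1, by omega⟩).eval (M.node j) else 0

/-- `j` is the index of an interior node. -/
def Interior (K : ℕ) (j : Fin (K + 1)) : Prop := 0 < (j : ℕ) ∧ (j : ℕ) < K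

instance (K : ℕ) (j : Fin (K + 1)) : Decidable (Interior K j) :=
  inferInstanceAs (Decidable (_ ∧ _))

/-- The jump `[v] = v⁺ - v⁻`. By the homogeneous boundary conditions, the outer trace of `v` is
zero at the two end points. -/
def jump (M : DGMesh a b K) (v : DGSpace K N) (j : Fin (K + 1)) : ℝ :=
  M.tracePlus (v.dpoly 0) j - M.traceMinus (v.dpoly 0) j

/-- The average `{∂ₓⁿ v}` at an interior node, the inner trace of `∂ₓⁿ v` at an end point. -/
def avg (M : DGMesh a b K) (n : ℕ) (v : DGSpace K N) (j : Fin (K + 1)) : ℝ :=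
  if Interior K j then (M.tracePlus (v.dpoly n) j + M.traceMinus (v.dpoly n) j) / 2
  else M.tracePlus (v.dpoly n) j + M.traceMinus (v.dpoly n) j

/-- The jump `[∂ₓ² v]` at an interior node, zero at an end point. -/
def jumpSecond (M : DGMesh a b K) (v : DGSpace K N) (j : Fin (K + 1)) : ℝ :=
  if Interior K j then M.tracePlus (v.dpoly 2) j - M.traceMinus (v.dpoly 2) j else 0

/-- The numerical flux `(∂ₓv)* = (β₀/h)[v] + {∂ₓv} + β₁h[∂ₓ²v]`. -/
def flux (M : DGMesh a b K) (β₀ β₁ : ℝ) (v : DGSpace K N) (j : Fin (K + 1)) : ℝ :=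
  β₀ / M.size * M.jump v j + M.avg 1 v j + β₁ * M.size * M.jumpSecond v j

/-- The interface terms `(∂ₓv)*[φ] + {∂ₓφ}[v]`, summed over the nodes. -/
def interfaceForm (M : DGMesh a b K) (β₀ β₁ : ℝ) (v φ : DGSpace K N) : ℝ :=
  ∑ j : Fin (K + 1), (M.flux β₀ β₁ v j * M.jump φ j + M.avg 1 φ j * M.jump v j)

/-- Admissibility, with the constants `γ` and `μ`, of the numerical flux on the mesh `M` for
piecewise polynomials of degree at most `N`. -/
def Admissible (M : DGMesh a b K) (N : ℕ) (β₀ β₁ γ μ : ℝ) : Prop :=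
  ∀ w : DGSpace K N,
    μ * ∑ j : Fin (K + 1), (M.jump w j) ^ 2 / M.size ≤
      γ * (∑ k, M.cellInt k fun x => ((w.dpoly 1 k).eval x) ^ 2) + M.interfaceForm β₀ β₁ w w

/-- `(u_h, p_h, q_h)` solves the semidiscrete direct DG scheme for
`∂ₜu - εp = g`, `p = Δ_{(α-2)/2} q`, `q = ∂ₓ²u` on `(0,T]`. -/
structure IsSemidiscreteSolution (M : DGMesh a b K) (α ε β₀ β₁ T : ℝ) (g : ℝ → ℝ → ℝ)
    (uh ph qh : ℝ → DGSpace K N) : Prop where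
  continuousOn : ContinuousOn uh (Set.Icc 0 T)
  evolution : ∀ t ∈ Set.Ioc 0 T, ∃ w : DGSpace K N,
    HasDerivWithinAt uh w (Set.Icc 0 T) t ∧
    ∀ (v : DGSpace K N) (k : Fin K),
      M.cellInt k (fun x => (w.poly k).eval x * (v.poly k).eval x)
        - ε * M.cellInt k (fun x => ((ph t).poly k).eval x * (v.poly k).eval x)
        = M.cellInt k (fun x => g t x * (v.poly k).eval x)
  integral : ∀ t ∈ Set.Ioc 0 T, ∀ (ψ : DGSpace K N) (k : Fin K),
    M.cellInt k (fun x => ((ph t).poly k).eval x * (ψ.poly k).eval x)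
      = M.cellInt k (fun x => fracInt (2 - α) (M.toFun (qh t)) x * (ψ.poly k).eval x)
  diffusion : ∀ t ∈ Set.Ioc 0 T, ∀ φ : DGSpace K N,
    ∑ k, M.cellInt k (fun x => ((qh t).poly k).eval x * (φ.poly k).eval x)
      = -(∑ k, M.cellInt k (fun x => ((uh t).dpoly 1 k).eval x * (φ.dpoly 1 k).eval x))
        - M.interfaceForm β₀ β₁ (uh t) φ

/-- `P` is the special projection of `w` (with `w a = w b = 0`) that preserves the moments of
degree at most `N - 2` on every cell, the interior point values in the average, and the fluxes. -/
structure IsFluxProjection (M : DGMesh a b K) (β₀ β₁ : ℝ) (w : ℝ → ℝ) (P : DGSpace K N) :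
    Prop where
  moments : ∀ (k : Fin K) (r : Polynomial ℝ), r.natDegree + 2 ≤ N →
    M.cellInt k (fun x => ((P.poly k).eval x - w x) * r.eval x) = 0
  average : ∀ j : Fin (K + 1), Interior K j → M.avg 0 P j = w (M.node j)
  flux_eq : ∀ j : Fin (K + 1), M.flux β₀ β₁ P j = derivWithin w (Set.Icc a b) (M.node j)

end DGMesh

end

/-! ### Bilinear forms on a finite-dimensional space and an energy estimate -/

section EnergyMethod

variable {V : Type*} [NormedAddCommGroup V] [NormedSpace ℝ V] [FiniteDimensional ℝ V]

/-! On the piecewise polynomials let `m` be the `L²` product, `b` the form of the Riesz potential,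
and `B` the bilinear form of the direct DG discretization; because of the flux terms `B` need not be
symmetric. Let `P` be the Ritz projection of `u` with respect to `B`, let `e = P - uh`, and let `q`
be the `L²` projection of `u''` minus `qh`. Then `m e' v = ε' b q v + O(h^(N+1)) ‖v‖` and `m q φ =
-B e φ` with no residual in the second equation. The special projection satisfies the equations of
the Ritz projection, so in the first claim `e 0 = 0`.

Testing with `e` fails, since `b q e` has no sign. Let `A` be the discrete inverse of the potential,
`b (A v) φ = m v φ`. Testing with `A e` gives `(1/2) d/dt m (A e) e = -ε' B e e + residual`;
coercivity of `B` dissipates the broken energy of `e`, and `m (A e) e` dominates `m e e` because `b`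
is bounded by `m`. For the second claim the energy is weighted by `t²`. The extra term `2 t m (A e)
e` equals `2 t B f e`, where `B f φ = m (A e) φ`, and it is absorbed by the dissipation `B f f` of
the auxiliary energy `m (A f) f`. See `EnergyStructure.bound_of_initial_zero` and
`EnergyStructure.bound_of_initial_le`.

The residual term requires `‖A v‖² ≤ C energy v` uniformly in the mesh, which is a stability bound
for a discrete integral equation of the first kind (`DGMesh.exists_massForm_le_of_rieszForm_eq`). It
rests on the formula `rieszForm_eq_window`: up to a constant the Riesz form is a weighted integral
of squared increments of a primitive. This yields positivity, the inverse estimate `h^σ ‖y‖² ≤ C b y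
y`, and the bound `C h^σ ‖r‖²` of the form on functions `r` with vanishing cell means. The
continuous counterpart is that a density whose potential lies in `H¹₀` is bounded in `L²`
(`sqrt_integral_sq_le_of_equation`). By homogeneity of the kernel, contracting such a density
towards an end point of the interval changes it little in the Riesz form; summing these changes over
dyadic contraction factors gains a geometric series, as `σ < 1`.

Finally, admissibility forces the mesh to be quasi-uniform (`DGMesh.size_le_of_admissible`), and the
Ritz projection has `L²` error `O(h^(N+1))` by an energy estimate against a continuous interpolant
and a duality argument. -/

theorem LinearMap.BilinForm.exists_representative (B : LinearMap.BilinForm ℝ V)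
    (hB : ∀ v, B v v = 0 → v = 0) :
    ∃ S : Module.Dual ℝ V →ₗ[ℝ] V, ∀ l φ, B (S l) φ = l φ := by
  have hinj : Function.Injective (B : V →ₗ[ℝ] Module.Dual ℝ V) := by
    rw [← LinearMap.ker_eq_bot, LinearMap.ker_eq_bot']
    intro v hv
    exact hB v (by rw [hv]; rfl)
  have hdim : Module.finrank ℝ V = Module.finrank ℝ (Module.Dual ℝ V) :=
    (Subspace.dual_finrank_eq).symm
  let e := LinearEquiv.ofInjectiveOfFinrankEq (B : V →ₗ[ℝ] Module.Dual ℝ V) hinj hdim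
  refine ⟨e.symm.toLinearMap, fun l φ => ?_⟩
  have : B (e.symm l) = l := by
    exact e.apply_symm_apply l
  simp [this]

theorem LinearMap.BilinForm.hasDerivWithinAt (β : LinearMap.BilinForm ℝ V) {x y : ℝ → V}
    {x' y' : V} {s : Set ℝ} {t : ℝ} (hx : HasDerivWithinAt x x' s t)
    (hy : HasDerivWithinAt y y' s t) :
    HasDerivWithinAt (fun r => β (x r) (y r)) (β (x t) y' + β x' (y t)) s t := by
  have := (β.toContinuousBilinearMap).hasFDerivWithinAt_of_bilinear hx.hasFDerivWithinAt
    hy.hasFDerivWithinAt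
  simpa [hasDerivWithinAt_iff_hasFDerivWithinAt] using this.hasDerivWithinAt

theorem LinearMap.BilinForm.continuousOn (β : LinearMap.BilinForm ℝ V) {x y : ℝ → V}
    {s : Set ℝ} (hx : ContinuousOn x s) (hy : ContinuousOn y s) :
    ContinuousOn (fun r => β (x r) (y r)) s := by
  have h : Continuous fun p : V × V => β p.1 p.2 :=
    (β.toContinuousBilinearMap).isBoundedBilinearMap.continuous
  exact h.comp_continuousOn (hx.prodMk hy)

theorem LinearMap.hasDerivWithinAt_comp {W : Type*} [NormedAddCommGroup W] [NormedSpace ℝ W]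
    (L : V →ₗ[ℝ] W) {x : ℝ → V} {x' : V} {s : Set ℝ} {t : ℝ}
    (hx : HasDerivWithinAt x x' s t) : HasDerivWithinAt (fun r => L (x r)) (L x') s t :=
  (LinearMap.toContinuousLinearMap L).hasFDerivAt.comp_hasDerivWithinAt t hx

theorem LinearMap.continuousOn_comp {W : Type*} [NormedAddCommGroup W] [NormedSpace ℝ W]
    (L : V →ₗ[ℝ] W) {x : ℝ → V} {s : Set ℝ} (hx : ContinuousOn x s) :
    ContinuousOn (fun r => L (x r)) s :=
  (LinearMap.continuous_of_finiteDimensional L).comp_continuousOn hx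

end EnergyMethod

theorem le_add_mul_of_hasDerivWithinAt_le {φ : ℝ → ℝ} {T C : ℝ}
    (hc : ContinuousOn φ (Set.Icc 0 T))
    (hd : ∀ t ∈ Set.Ioc 0 T, ∃ d ≤ C, HasDerivWithinAt φ d (Set.Icc 0 T) t) {t : ℝ}
    (ht : t ∈ Set.Icc 0 T) : φ t ≤ φ 0 + C * t := by
  have hanti : AntitoneOn (fun s => φ s - C * s) (Set.Icc 0 T) := by
    have hder : ∀ s ∈ Set.Ioo 0 T, ∃ d ≤ C, HasDerivAt φ d s := fun s hs => by
      obtain ⟨d, hdC, hd⟩ := hd s ⟨hs.1, hs.2.le⟩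
      exact ⟨d, hdC, hd.hasDerivAt (Icc_mem_nhds hs.1 hs.2)⟩
    refine antitoneOn_of_deriv_nonpos (convex_Icc 0 T) (hc.sub (by fun_prop)) ?_ ?_
    · intro s hs
      rw [interior_Icc] at hs
      obtain ⟨d, -, hd⟩ := hder s hs
      exact (hd.differentiableAt.sub (by fun_prop)).differentiableWithinAt
    · intro s hs
      rw [interior_Icc] at hs
      obtain ⟨d, hdC, hd⟩ := hder s hs
      have h2 : HasDerivAt (fun s => φ s - C * s) (d - C * 1) s :=
        hd.sub ((hasDerivAt_id s).const_mul C)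
      rw [h2.deriv]
      linarith
  have := hanti (Set.left_mem_Icc.2 (ht.1.trans ht.2)) ht ht.1
  simp only [mul_zero, sub_zero] at this
  linarith

/-! ### Energy estimates for the abstract scheme. -/

section EnergyMethod

variable {V : Type*} [NormedAddCommGroup V] [NormedSpace ℝ V]

/-- The constants in the energy estimates for `m(e', v) = ε b(q, v) + ρ(v)`, `m(q, φ) = -B(e, φ)`:
`m` and `b` are scalar products, `B` is coercive and bounded with respect to the energy `E`, and
the solution operator of `b(y, ·) = m(v, ·)` is bounded from the energy norm to the norm
of `m`. -/
structure EnergyStructure (m b B : LinearMap.BilinForm ℝ V) (E : V → ℝ)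
    (C₁ C₂ C₄ C₅ c : ℝ) : Prop where
  m_symm : ∀ v w, m v w = m w v
  m_pos : ∀ v, v ≠ 0 → 0 < m v v
  b_symm : ∀ v w, b v w = b w v
  b_pos : ∀ v, v ≠ 0 → 0 < b v v
  b_le : ∀ v, b v v ≤ C₁ * m v v
  E_nonneg : ∀ v, 0 ≤ E v
  inverse_le : ∀ y v, (∀ φ, b y φ = m v φ) → m y y ≤ C₂ * E v
  coercive : ∀ v, c * E v ≤ B v v
  bounded : ∀ v w, B v w ^ 2 ≤ C₄ * (E v * E w)
  poincare : ∀ v, m v v ≤ C₅ * E v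

/-- The trajectory `e` solves the perturbed scheme, with perturbation at most `ρ`. -/
def IsPerturbedSolution (m b B : LinearMap.BilinForm ℝ V) (ε T ρ : ℝ) (e : ℝ → V) : Prop :=
  ∀ t ∈ Set.Ioc 0 T, ∃ e' q : V, HasDerivWithinAt e e' (Set.Icc 0 T) t ∧
    (∀ φ, m q φ = - B (e t) φ) ∧ ∀ v, |m e' v - ε * b q v| ≤ ρ * √(m v v)

namespace EnergyStructure

variable {m b B : LinearMap.BilinForm ℝ V} {E : V → ℝ} {C₁ C₂ C₄ C₅ c : ℝ}

theorem nonneg_of_pos {β : LinearMap.BilinForm ℝ V} (h : ∀ v, v ≠ 0 → 0 < β v v) (v : V) :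
    0 ≤ β v v := by
  rcases eq_or_ne v 0 with rfl | hv
  · simp
  · exact (h v hv).le

theorem cauchy_schwarz {β : LinearMap.BilinForm ℝ V} (hs : ∀ v w, β v w = β w v)
    (h : ∀ v, 0 ≤ β v v) (v w : V) : β v w ^ 2 ≤ β v v * β w w :=
  LinearMap.BilinForm.apply_sq_le_of_symm β h ⟨fun x y => by simpa using hs x y⟩ v w

theorem cauchy_schwarz_sqrt {β : LinearMap.BilinForm ℝ V} (hs : ∀ v w, β v w = β w v)
    (h : ∀ v, 0 ≤ β v v) (v w : V) : |β v w| ≤ √(β v v) * √(β w w) := by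
  rw [← Real.sqrt_mul (h v)]
  exact Real.abs_le_sqrt (cauchy_schwarz hs h v w)

/-- `A` supplies the test function `A e`: by symmetry of `b`, the term `b q (A e)` equals `m e q`,
which the scheme turns into `-B e e`. -/
theorem exists_inverse [FiniteDimensional ℝ V] (h : EnergyStructure m b B E C₁ C₂ C₄ C₅ c) :
    ∃ A : V →ₗ[ℝ] V, ∀ v φ, b (A v) φ = m v φ := by
  obtain ⟨S, hS⟩ := b.exists_representative fun v hv => by
    by_contra h0
    exact (h.b_pos v h0).ne' hv
  exact ⟨S ∘ₗ m, fun v φ => by simp [hS]⟩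

theorem m_nonneg (h : EnergyStructure m b B E C₁ C₂ C₄ C₅ c) (v : V) : 0 ≤ m v v :=
  nonneg_of_pos h.m_pos v

theorem inverse_symm (h : EnergyStructure m b B E C₁ C₂ C₄ C₅ c) {A : V →ₗ[ℝ] V}
    (hA : ∀ v φ, b (A v) φ = m v φ) (v w : V) : m (A v) w = m v (A w) := by
  rw [h.m_symm (A v) w, ← hA, h.b_symm, hA]

/-- Cauchy–Schwarz for `b` applied to `m v v = b (A v) v`; one factor `m v v` cancels. This converts
a bound of the weak quantity `m (A e) e` into an `L²` bound. -/
theorem le_inverse (h : EnergyStructure m b B E C₁ C₂ C₄ C₅ c) (hC₁ : 0 ≤ C₁) {A : V →ₗ[ℝ] V}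
    (hA : ∀ v φ, b (A v) φ = m v φ) (v : V) : m v v ≤ C₁ * m (A v) v := by
  have hα : 0 ≤ m (A v) v := by
    rw [h.m_symm, ← hA]; exact nonneg_of_pos h.b_pos _
  have h1 : m v v ^ 2 ≤ m (A v) v * (C₁ * m v v) := by
    calc m v v ^ 2 = b (A v) v ^ 2 := by rw [hA]
      _ ≤ b (A v) (A v) * b v v := cauchy_schwarz h.b_symm (nonneg_of_pos h.b_pos) _ _
      _ ≤ m (A v) v * (C₁ * m v v) := by
        rw [hA, h.m_symm v (A v)]
        exact mul_le_mul_of_nonneg_left (h.b_le v) hα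
  rcases (h.m_nonneg v).eq_or_lt with h2 | h2
  · rw [← h2]; positivity
  · nlinarith

/-- With the test function `A e`, half the derivative of `m (A e) e` is at most `-ε c E(e) + ρ √C₂
√E(e)`. The square is completed, so the energy grows at a constant rate and no exponential in `T`
arises. -/
theorem bound_of_initial_zero [FiniteDimensional ℝ V]
    (h : EnergyStructure m b B E C₁ C₂ C₄ C₅ c) {ε T ρ : ℝ}
    (hε : 0 < ε) (hc : 0 < c) (hC₁ : 0 ≤ C₁) (hC₂ : 0 ≤ C₂) (hρ : 0 ≤ ρ) {e : ℝ → V}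
    (hcont : ContinuousOn e (Set.Icc 0 T)) (he : IsPerturbedSolution m b B ε T ρ e)
    (h0 : e 0 = 0) {t : ℝ} (ht : t ∈ Set.Icc 0 T) :
    m (e t) (e t) ≤ C₁ * (C₂ / (2 * (ε * c)) * T) * ρ ^ 2 := by
  obtain ⟨A, hA⟩ := h.exists_inverse
  have hder : ∀ s ∈ Set.Ioc 0 T, ∃ d ≤ C₂ / (2 * (ε * c)) * ρ ^ 2,
      HasDerivWithinAt (fun r => m (A (e r)) (e r)) d (Set.Icc 0 T) s := by
    intro s hs
    obtain ⟨e', q, hd, hq, hres⟩ := he s hs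
    refine ⟨_, ?_, m.hasDerivWithinAt (A.hasDerivWithinAt_comp hd) hd⟩
    rw [h.inverse_symm hA e' (e s), h.m_symm e' (A (e s))]
    have h1 := (abs_le.1 (hres (A (e s)))).2
    rw [h.b_symm, hA, h.m_symm e', h.m_symm (e s) q, hq] at h1
    have h2 : √(m (A (e s)) (A (e s))) ≤ √C₂ * √(E (e s)) := by
      rw [← Real.sqrt_mul hC₂]
      exact Real.sqrt_le_sqrt (h.inverse_le _ _ (hA _))
    have h3 := h.coercive (e s)
    have h4 := Real.sq_sqrt (h.E_nonneg (e s))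
    have h5 := Real.sq_sqrt hC₂
    set x := √(E (e s))
    set k := √C₂
    have h6 : ρ * √(m (A (e s)) (A (e s))) ≤ ρ * (k * x) := mul_le_mul_of_nonneg_left h2 hρ
    have hεc : 0 < ε * c := mul_pos hε hc
    have h7 : ε * (c * E (e s)) ≤ ε * B (e s) (e s) := mul_le_mul_of_nonneg_left h3 hε.le
    -- The right side is the maximum of the quadratic in `x` on the left.
    have h8 : 2 * (ρ * (k * x)) - 2 * (ε * c) * x ^ 2 ≤ C₂ / (2 * (ε * c)) * ρ ^ 2 := by
      rw [div_mul_eq_mul_div, le_div_iff₀ (by positivity), ← h5]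
      nlinarith [sq_nonneg (k * ρ - 2 * (ε * c) * x)]
    rw [← h4] at h7
    linarith
  have := le_add_mul_of_hasDerivWithinAt_le (m.continuousOn (A.continuousOn_comp hcont) hcont)
    hder ht
  simp only [h0, map_zero, zero_add] at this
  calc m (e t) (e t) ≤ C₁ * m (A (e t)) (e t) := h.le_inverse hC₁ hA _
    _ ≤ C₁ * (C₂ / (2 * (ε * c)) * ρ ^ 2 * t) := mul_le_mul_of_nonneg_left this hC₁
    _ ≤ C₁ * (C₂ / (2 * (ε * c)) * ρ ^ 2 * T) := by
      have : 0 ≤ C₂ / (2 * (ε * c)) * ρ ^ 2 := by positivity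
      gcongr
      exact ht.2
    _ = _ := by ring

/-- Testing the equation of `g` with `g` and moving `A` across by symmetry gives `B g g = m r (A
g)`, and one factor `√(E g)` cancels. Below it serves both for the residual and for the initial
error. -/
theorem energy_of_dual_le (h : EnergyStructure m b B E C₁ C₂ C₄ C₅ c) (hc : 0 < c)
    (hC₂ : 0 ≤ C₂) {A : V →ₗ[ℝ] V} (hA : ∀ v φ, b (A v) φ = m v φ) {g r : V} {ρ : ℝ}
    (hρ : 0 ≤ ρ) (hg : ∀ φ, B g φ = m (A r) φ) (hr : m r r ≤ ρ ^ 2) :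
    √(E g) ≤ √C₂ * ρ / c := by
  have h1 : c * E g ≤ ρ * (√C₂ * √(E g)) := by
    calc c * E g ≤ B g g := h.coercive g
      _ = m r (A g) := by rw [hg, h.inverse_symm hA]
      _ ≤ √(m r r) * √(m (A g) (A g)) :=
        (le_abs_self _).trans (cauchy_schwarz_sqrt h.m_symm h.m_nonneg _ _)
      _ ≤ ρ * (√C₂ * √(E g)) := by
        refine mul_le_mul (Real.sqrt_le_iff.2 ⟨hρ, hr⟩) ?_ (Real.sqrt_nonneg _) hρ
        rw [← Real.sqrt_mul hC₂]
        exact Real.sqrt_le_sqrt (h.inverse_le _ _ (hA g))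
  rw [le_div_iff₀ hc]
  have h2 := Real.sq_sqrt (h.E_nonneg g)
  rcases (Real.sqrt_nonneg (E g)).eq_or_lt with h3 | h3
  · rw [← h3, zero_mul]; positivity
  · have h4 : √(E g) * (√(E g) * c) ≤ √(E g) * (√C₂ * ρ) := by
      calc √(E g) * (√(E g) * c) = c * √(E g) ^ 2 := by ring
        _ ≤ ρ * (√C₂ * √(E g)) := by rw [h2]; exact h1
        _ = _ := by ring
    exact le_of_mul_le_mul_left h4 h3

/-- The absorption argument in real numbers: `x²` and `y²` are the energies of `e` and of the
auxiliary `f`, `d` is `ε c`, and `α`, `β`, `δ` stand for `m (A e) e` and the two halved energy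
derivatives. Half of each dissipation pays for the cross term `2 s l x y`, which fixes `κ = l² /
d²`; the other halves pay for the residuals. -/
theorem weighted_energy_inequality {s T ρ x y k l K κ d α β δ : ℝ} (hs0 : 0 ≤ s) (hsT : s ≤ T)
    (hd : 0 < d) (hκ0 : 0 ≤ κ) (hκl : κ * d ^ 2 = l ^ 2)
    (h3 : α ≤ l * (y * x)) (b1 : β ≤ - d * x ^ 2 + ρ * (k * x))
    (b2 : δ ≤ - d * y ^ 2 + K * ρ * y) :
    2 * (s * α) + s ^ 2 * (2 * β) + κ * (2 * δ)
      ≤ (k ^ 2 * T ^ 2 / d + κ * K ^ 2 / d) * ρ ^ 2 := by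
  have p1 : s * α ≤ s * (l * (y * x)) := mul_le_mul_of_nonneg_left h3 hs0
  have p2 : s ^ 2 * β ≤ s ^ 2 * (- d * x ^ 2 + ρ * (k * x)) :=
    mul_le_mul_of_nonneg_left b1 (sq_nonneg s)
  have p3 : κ * δ ≤ κ * (- d * y ^ 2 + K * ρ * y) := mul_le_mul_of_nonneg_left b2 hκ0
  have q1 : 2 * (l * (y * (s * x))) ≤ d * (s * x) ^ 2 + κ * d * y ^ 2 := by
    have e0 : κ * d = l ^ 2 / d := by rw [← hκl]; field_simp
    rw [e0]
    have e1 : d * (s * x) ^ 2 + l ^ 2 / d * y ^ 2 - 2 * (l * (y * (s * x)))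
        = (d * (s * x) - l * y) ^ 2 / d := by field_simp; ring
    have h0 : 0 ≤ (d * (s * x) - l * y) ^ 2 / d := by positivity
    linarith
  have q2 : 2 * (ρ * k * s * (s * x)) ≤ d * (s * x) ^ 2 + k ^ 2 * T ^ 2 / d * ρ ^ 2 := by
    have e3 : d * (s * x) ^ 2 + k ^ 2 * s ^ 2 / d * ρ ^ 2 - 2 * (ρ * k * s * (s * x))
        = (d * (s * x) - ρ * k * s) ^ 2 / d := by
      field_simp; ring
    have h0 : 0 ≤ (d * (s * x) - ρ * k * s) ^ 2 / d := by positivity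
    have : k ^ 2 * s ^ 2 / d * ρ ^ 2 ≤ k ^ 2 * T ^ 2 / d * ρ ^ 2 := by gcongr
    linarith
  have q3 : 2 * (K * ρ * y) ≤ d * y ^ 2 + K ^ 2 / d * ρ ^ 2 := by
    have e3 : d * y ^ 2 + K ^ 2 / d * ρ ^ 2 - 2 * (K * ρ * y)
        = (d * y - K * ρ) ^ 2 / d := by field_simp; ring
    have h0 : 0 ≤ (d * y - K * ρ) ^ 2 / d := by positivity
    linarith
  have q4 := mul_le_mul_of_nonneg_left q3 hκ0
  have e4 : κ * K ^ 2 / d * ρ ^ 2 = κ * (K ^ 2 / d * ρ ^ 2) := by ring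
  rw [add_mul, e4]
  linarith

/-- The weight `t²` removes the initial value of `m (A e) e`, for which `η` gives no bound through
the available constants. The price `2 t m (A e) e = 2 t B f e`, with `f = G (A e)`, is paid by
adding `κ m (A f) f`. The initial value of this auxiliary energy is bounded by `η²`, because `G`
gains what `A` loses. -/
theorem bound_of_initial_le [FiniteDimensional ℝ V]
    (h : EnergyStructure m b B E C₁ C₂ C₄ C₅ c) {ε T ρ η : ℝ}
    (hε : 0 < ε) (hc : 0 < c) (hC₁ : 0 ≤ C₁) (hC₂ : 0 ≤ C₂) (hC₄ : 0 ≤ C₄) (hC₅ : 0 ≤ C₅)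
    (hρ : 0 ≤ ρ) (hη : 0 ≤ η) {e : ℝ → V}
    (hcont : ContinuousOn e (Set.Icc 0 T)) (he : IsPerturbedSolution m b B ε T ρ e)
    (h0 : m (e 0) (e 0) ≤ η ^ 2) {t : ℝ} (ht : t ∈ Set.Icc 0 T) :
    t ^ 2 * m (e t) (e t) ≤
      C₁ * (C₄ / (ε * c) ^ 2 * (√C₂ * √C₅ * (C₂ / c ^ 2)) * η ^ 2 +
        (C₂ * T ^ 2 / (ε * c) + C₄ / (ε * c) ^ 2 * (C₂ ^ 2 * C₅ / c ^ 2) / (ε * c)) * T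
          * ρ ^ 2) := by
  obtain ⟨A, hA⟩ := h.exists_inverse
  have hεc : 0 < ε * c := mul_pos hε hc
  have hBinj : ∀ v, B v v = 0 → v = 0 := fun v hv => by
    by_contra hne
    have h1 := h.coercive v
    have h2 := h.poincare v
    have h3 := h.m_pos v hne
    have h4 : E v ≤ 0 := by rw [hv] at h1; nlinarith
    nlinarith
  obtain ⟨S, hS⟩ := B.exists_representative hBinj
  obtain ⟨R, hR⟩ := m.exists_representative fun v hv => by
    by_contra hne
    exact (h.m_pos v hne).ne' hv
  set G : V →ₗ[ℝ] V := S ∘ₗ m with hG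
  have hGB : ∀ v φ, B (G v) φ = m v φ := fun v φ => by simp [hG, hS]
  -- `R` represents functionals through `m`, so `R ∘ b` is the inverse of `A`.
  have hAR : ∀ q, A (R (b q)) = q := fun q => by
    by_contra hne
    have h1 := h.b_pos _ (sub_ne_zero.2 hne)
    rw [LinearMap.BilinForm.sub_left, hA, hR, sub_self] at h1
    exact lt_irrefl _ h1
  set κ := C₄ / (ε * c) ^ 2 with hκ
  have hκ0 : 0 ≤ κ := by positivity
  set K := √C₂ * √C₅ * √C₂ / c with hK
  have hK0 : 0 ≤ K := by positivity
  have hK2 : K ^ 2 = C₂ ^ 2 * C₅ / c ^ 2 := by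
    rw [hK, div_pow, mul_pow, mul_pow, Real.sq_sqrt hC₂, Real.sq_sqrt hC₅]; ring
  have hmE : ∀ v, √(m v v) ≤ √C₅ * √(E v) := fun v => by
    rw [← Real.sqrt_mul hC₅]; exact Real.sqrt_le_sqrt (h.poincare v)
  have hAE : ∀ v, √(m (A v) (A v)) ≤ √C₂ * √(E v) := fun v => by
    rw [← Real.sqrt_mul hC₂]; exact Real.sqrt_le_sqrt (h.inverse_le _ _ (hA v))
  have hder : ∀ s ∈ Set.Ioc 0 T, ∃ d ≤ (C₂ * T ^ 2 / (ε * c) + κ * K ^ 2 / (ε * c)) * ρ ^ 2,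
      HasDerivWithinAt (fun r => r ^ 2 * m (A (e r)) (e r)
        + κ * m (A (G (A (e r)))) (G (A (e r)))) d (Set.Icc 0 T) s := by
    intro s hs
    obtain ⟨e', q, hd, hq, hres⟩ := he s hs
    have hdA := A.hasDerivWithinAt_comp hd
    have hdf := G.hasDerivWithinAt_comp hdA
    have hdAf := A.hasDerivWithinAt_comp hdf
    refine ⟨_, ?_, ((((hasDerivAt_id s).hasDerivWithinAt).pow 2).mul
      (m.hasDerivWithinAt hdA hd)).add ((m.hasDerivWithinAt hdAf hdf).const_mul κ)⟩
    -- The residual functional is represented by a vector, so that `e' = ε A⁻¹ q + r` holds exactly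
    -- and operators may be applied to it.
    set r := e' - ε • R (b q) with hr
    have hrv : ∀ v, m r v = m e' v - ε * b q v := fun v => by simp [hr, hR]
    have hrr : m r r ≤ ρ ^ 2 := by
      have h1 := (le_abs_self _).trans (hres r)
      rw [← hrv] at h1
      have h2 := Real.sq_sqrt (h.m_nonneg r)
      have h3 := Real.sqrt_nonneg (m r r)
      rcases h3.eq_or_lt with h4 | h4
      · rw [← h2, ← h4]; simpa using sq_nonneg ρ
      · have : √(m r r) ≤ ρ := by
          have h5 : √(m r r) * √(m r r) ≤ ρ * √(m r r) := by rw [← sq, h2]; exact h1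
          exact le_of_mul_le_mul_right h5 h4
        rw [← h2]; exact pow_le_pow_left₀ h3 this 2
    -- The second equation of the scheme, read through the inverse of `B`.
    have hGq : G q = - e s := by
      have : G q + e s = 0 := hBinj _ (by
        rw [LinearMap.BilinForm.add_left, hGB, hq]; ring)
      exact eq_neg_of_add_eq_zero_left this
    set f := G (A (e s)) with hf
    set g := G (A r) with hg
    -- The evolution equation of `f`: since `A e' = ε q + A r`, its derivative is `-ε e + g`.
    have hf' : G (A e') = - (ε • e s) + g := by
      have : e' = ε • R (b q) + r := by rw [hr]; abel
      rw [this, map_add, map_add, map_smul, map_smul, hAR, hGq, smul_neg]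
    have hgE : √(E g) ≤ √C₂ * ρ / c :=
      h.energy_of_dual_le hc hC₂ hA hρ (fun φ => hGB _ φ) hrr
    have e1 : m (A e') (e s) = m (A (e s)) e' := by
      rw [h.inverse_symm hA e' (e s), h.m_symm e']
    have e2 : m (A (G (A e'))) f = m (A f) (G (A e')) := by
      rw [h.inverse_symm hA, h.m_symm]
    rw [e1, e2, hf']
    have h1 := (abs_le.1 (hres (A (e s)))).2
    rw [h.b_symm, hA, h.m_symm e', h.m_symm (e s) q, hq] at h1
    have h2 := h.coercive (e s)
    -- Here `m (A e) e = B f e`, and boundedness of `B` splits it into the two dissipated energies.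
    have h3 : m (A (e s)) (e s) ≤ √C₄ * (√(E f) * √(E (e s))) := by
      rw [← hGB, ← Real.sqrt_mul (h.E_nonneg f), ← Real.sqrt_mul hC₄]
      exact Real.le_sqrt_of_sq_le (h.bounded f (e s))
    -- Symmetry of `A` alone gives `m (A f) e = m (A e) f = B f f`; symmetry of `B` does not enter.
    have h4 : c * E f ≤ m (A f) (e s) := by
      rw [h.inverse_symm hA f (e s), h.m_symm, ← hGB]
      exact h.coercive f
    have h5 : m (A f) g ≤ K * ρ * √(E f) := by
      calc m (A f) g ≤ √(m (A f) (A f)) * √(m g g) :=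
            (le_abs_self _).trans (cauchy_schwarz_sqrt h.m_symm h.m_nonneg _ _)
        _ ≤ (√C₂ * √(E f)) * (√C₅ * (√C₂ * ρ / c)) := by
          refine mul_le_mul (hAE f) ((hmE g).trans ?_) (Real.sqrt_nonneg _) (by positivity)
          exact mul_le_mul_of_nonneg_left hgE (Real.sqrt_nonneg _)
        _ = K * ρ * √(E f) := by rw [hK]; ring
    have h6 : ρ * √(m (A (e s)) (A (e s))) ≤ ρ * (√C₂ * √(E (e s))) :=
      mul_le_mul_of_nonneg_left (hAE _) hρ
    rw [map_add, map_neg, map_smul, smul_eq_mul]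
    have h7 := Real.sq_sqrt (h.E_nonneg (e s))
    have h8 := Real.sq_sqrt (h.E_nonneg f)
    have h9 := Real.sq_sqrt hC₂
    have h10 := Real.sq_sqrt hC₄
    set x := √(E (e s))
    set y := √(E f)
    set k := √C₂
    set l := √C₄
    have hx : 0 ≤ x := Real.sqrt_nonneg _
    have hy : 0 ≤ y := Real.sqrt_nonneg _
    rw [← h7] at h2
    rw [← h8] at h4
    have hs0 : 0 ≤ s := hs.1.le
    have hκl : κ * (ε * c) ^ 2 = l ^ 2 := by rw [hκ, h10]; field_simp
    have b1 : m (A (e s)) e' ≤ - (ε * c) * x ^ 2 + ρ * (k * x) := by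
      have := mul_le_mul_of_nonneg_left h2 hε.le
      linarith
    have b2 : -(ε * m (A f) (e s)) + m (A f) g ≤ - (ε * c) * y ^ 2 + K * ρ * y := by
      have := mul_le_mul_of_nonneg_left h4 hε.le
      linarith
    have key := weighted_energy_inequality hs0 hs.2 hεc hκ0 hκl h3 b1 b2
    rw [h9] at key
    refine le_trans (le_of_eq ?_) key
    norm_num
    ring
  have hΦ : t ^ 2 * m (A (e t)) (e t) + κ * m (A (G (A (e t)))) (G (A (e t))) ≤
      0 ^ 2 * m (A (e 0)) (e 0) + κ * m (A (G (A (e 0)))) (G (A (e 0)))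
        + (C₂ * T ^ 2 / (ε * c) + κ * K ^ 2 / (ε * c)) * ρ ^ 2 * t :=
    le_add_mul_of_hasDerivWithinAt_le (ContinuousOn.add (ContinuousOn.mul (by fun_prop)
    (m.continuousOn (A.continuousOn_comp hcont) hcont)) (ContinuousOn.mul (by fun_prop)
    (m.continuousOn (A.continuousOn_comp (G.continuousOn_comp (A.continuousOn_comp hcont)))
      (G.continuousOn_comp (A.continuousOn_comp hcont))))) hder ht
  have hα : ∀ v, 0 ≤ m (A v) v := fun v => by
    rw [h.m_symm, ← hA]; exact nonneg_of_pos h.b_pos _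
  set f₀ := G (A (e 0)) with hf₀
  have hf₀E : √(E f₀) ≤ √C₂ * η / c :=
    h.energy_of_dual_le hc hC₂ hA hη (fun φ => hGB _ φ) h0
  have hinit : m (A f₀) f₀ ≤ √C₂ * √C₅ * (C₂ / c ^ 2) * η ^ 2 := by
    calc m (A f₀) f₀ ≤ √(m (A f₀) (A f₀)) * √(m f₀ f₀) :=
          (le_abs_self _).trans (cauchy_schwarz_sqrt h.m_symm h.m_nonneg _ _)
      _ ≤ (√C₂ * (√C₂ * η / c)) * (√C₅ * (√C₂ * η / c)) :=
        mul_le_mul ((hAE _).trans (mul_le_mul_of_nonneg_left hf₀E (Real.sqrt_nonneg _)))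
          ((hmE _).trans (mul_le_mul_of_nonneg_left hf₀E (Real.sqrt_nonneg _)))
          (Real.sqrt_nonneg _) (by positivity)
      _ = √C₂ * √C₅ * (√C₂ ^ 2 / c ^ 2) * η ^ 2 := by ring
      _ = _ := by rw [Real.sq_sqrt hC₂]
  have hκinit := mul_le_mul_of_nonneg_left hinit hκ0
  have hκα := mul_nonneg hκ0 (hα (G (A (e t))))
  have hD : 0 ≤ (C₂ * T ^ 2 / (ε * c) + κ * K ^ 2 / (ε * c)) * ρ ^ 2 := by positivity
  have htT := mul_le_mul_of_nonneg_left ht.2 hD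
  have hfin : t ^ 2 * m (A (e t)) (e t) ≤ κ * (√C₂ * √C₅ * (C₂ / c ^ 2)) * η ^ 2 +
        (C₂ * T ^ 2 / (ε * c) + κ * (C₂ ^ 2 * C₅ / c ^ 2) / (ε * c)) * T * ρ ^ 2 := by
    rw [← hK2]
    linarith
  calc t ^ 2 * m (e t) (e t) ≤ t ^ 2 * (C₁ * m (A (e t)) (e t)) :=
        mul_le_mul_of_nonneg_left (h.le_inverse hC₁ hA _) (sq_nonneg t)
    _ = C₁ * (t ^ 2 * m (A (e t)) (e t)) := by ring
    _ ≤ _ := mul_le_mul_of_nonneg_left hfin hC₁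

end EnergyStructure
end EnergyMethod

/-! ### Square integrable functions on an interval and the Riesz form -/

section RieszForm

open MeasureTheory Set

/-- The square integrable functions on the line that vanish outside `[a,b]`. -/
def L2On (a b : ℝ) : Submodule ℝ (ℝ → ℝ) where
  carrier := {f | MemLp f 2 volume ∧ ∀ x ∉ Icc a b, f x = 0}
  add_mem' := fun hf hg => ⟨hf.1.add hg.1, fun x hx => by simp [hf.2 x hx, hg.2 x hx]⟩
  zero_mem' := ⟨MemLp.zero', fun x _ => rfl⟩
  smul_mem' := fun c f hf => ⟨hf.1.const_smul c, fun x hx => by simp [hf.2 x hx]⟩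

namespace L2On

variable {a b : ℝ} {f g : ℝ → ℝ}

theorem integrable (hf : f ∈ L2On a b) : Integrable f :=
  memLp_one_iff_integrable.1 (hf.1.mono_exponent_of_measure_support_ne_top (s := Icc a b) hf.2
    (by simp) (by norm_num))

theorem integrable_sq (hf : f ∈ L2On a b) : Integrable fun x => f x ^ 2 := hf.1.integrable_sq

theorem integrable_mul (hf : f ∈ L2On a b) (hg : g ∈ L2On a b) :
    Integrable fun x => f x * g x := hf.1.integrable_mul hg.1

theorem of_bounded {C : ℝ} (hm : AEStronglyMeasurable f volume) (hC : ∀ x, |f x| ≤ C)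
    (h0 : ∀ x ∉ Icc a b, f x = 0) : f ∈ L2On a b := by
  have hs : f = (Icc a b).indicator f := by
    ext x
    by_cases hx : x ∈ Icc a b
    · simp [hx]
    · simp [hx, h0 x hx]
  refine ⟨?_, h0⟩
  rw [hs, memLp_indicator_iff_restrict measurableSet_Icc]
  exact MemLp.of_bound hm.restrict C (Filter.Eventually.of_forall fun x => by simpa using hC x)

end L2On

theorem sq_integral_mul_le {X : Type*} [MeasurableSpace X] {μ : Measure X} {f g : X → ℝ}
    (hf : MemLp f 2 μ) (hg : MemLp g 2 μ) :
    (∫ x, f x * g x ∂μ) ^ 2 ≤ (∫ x, f x ^ 2 ∂μ) * ∫ x, g x ^ 2 ∂μ := by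
  have hfg : Integrable (fun x => f x * g x) μ := hf.integrable_mul hg
  have h : ∀ t : ℝ, 0 ≤ (∫ x, g x ^ 2 ∂μ) * (t * t) + (2 * ∫ x, f x * g x ∂μ) * t
      + ∫ x, f x ^ 2 ∂μ := fun t => by
    calc (0 : ℝ) ≤ ∫ x, (f x + t * g x) ^ 2 ∂μ := integral_nonneg fun x => sq_nonneg _
      _ = ∫ x, (f x ^ 2 + (2 * t) * (f x * g x)) + (t * t) * g x ^ 2 ∂μ := by
        congr 1; ext x; ring
      _ = _ := by
        rw [integral_add (f := fun x => f x ^ 2 + (2 * t) * (f x * g x))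
            (hf.integrable_sq.add (hfg.const_mul _)) (hg.integrable_sq.const_mul _),
          integral_add hf.integrable_sq (hfg.const_mul _), integral_const_mul, integral_const_mul]
        ring
  have := discrim_le_zero h
  rw [discrim] at this
  linarith

theorem sq_intervalIntegral_le {f : ℝ → ℝ} {x y : ℝ} (hxy : x ≤ y)
    (hf : MemLp f 2 (volume.restrict (Ioc x y))) :
    (∫ t in x..y, f t) ^ 2 ≤ (y - x) * ∫ t in x..y, f t ^ 2 := by
  have h := sq_integral_mul_le hf (memLp_const (1 : ℝ))
  rw [intervalIntegral.integral_of_le hxy, intervalIntegral.integral_of_le hxy]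
  simpa [hxy, mul_comm] using h

/-- The bilinear form of the kernel `|x - y| ^ (σ - 1)`. -/
noncomputable def rieszForm (σ : ℝ) (f g : ℝ → ℝ) : ℝ :=
  ∫ p : ℝ × ℝ, |p.1 - p.2| ^ (σ - 1) * (f p.1 * g p.2)

theorem integrable_comp_abs_of_integrableOn {f : ℝ → ℝ} (hf : IntegrableOn f (Ioi 0)) :
    Integrable fun t : ℝ => f |t| := by
  have h1 : Integrable ((Ioi 0).indicator f) := hf.integrable_indicator measurableSet_Ioi
  refine (h1.add h1.comp_neg).congr ?_
  have h0 : ∀ᵐ t : ℝ, t ≠ 0 := by simp [ae_iff, measure_singleton]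
  filter_upwards [h0] with t ht
  rcases lt_or_gt_of_ne ht with h | h
  · simp [h, h.le, abs_of_neg h]
  · simp [h, h.le, abs_of_pos h]

theorem integrableOn_truncated_kernel {σ L : ℝ} (hσ : 0 < σ) (hL : 0 ≤ L) :
    Integrable (fun t : ℝ => (Iic L).indicator (fun s => s ^ (σ - 1)) |t|) ∧
      ∫ t : ℝ, (Iic L).indicator (fun s => s ^ (σ - 1)) |t| = 2 * (L ^ σ / σ) := by
  have h1 : IntegrableOn (fun s : ℝ => s ^ (σ - 1)) (Ioc 0 L) := by
    rw [← intervalIntegrable_iff_integrableOn_Ioc_of_le hL]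
    exact intervalIntegral.intervalIntegrable_rpow' (by linarith)
  constructor
  · refine integrable_comp_abs_of_integrableOn (f := (Iic L).indicator (fun s => s ^ (σ - 1))) ?_
    rw [integrableOn_indicator_iff measurableSet_Iic, Iic_inter_Ioi]
    exact h1
  · rw [integral_comp_abs (f := (Iic L).indicator (fun s => s ^ (σ - 1))),
      setIntegral_indicator measurableSet_Iic, Ioi_inter_Iic,
      ← intervalIntegral.integral_of_le hL, integral_rpow (Or.inl (by linarith))]
    simp [hσ.ne']

/-! ### The kernel on functions supported in the interval. -/

section Kernel

variable {σ a b : ℝ} {f g : ℝ → ℝ}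

/-- Truncating the kernel at distance `b - a` makes it integrable on the line and leaves the form
unchanged for functions supported in `[a,b]`. The double integral then factors as for a convolution.
-/
theorem integrable_kernel_mul_left (hσ : 0 < σ) (hab : a ≤ b) (hf : Integrable f) :
    Integrable (fun p : ℝ × ℝ =>
      (Iic (b - a)).indicator (fun s => s ^ (σ - 1)) |p.1 - p.2| * f p.2) ∧
    ∫ p : ℝ × ℝ, (Iic (b - a)).indicator (fun s => s ^ (σ - 1)) |p.1 - p.2| * f p.2
      = 2 * ((b - a) ^ σ / σ) * ∫ x, f x := by
  obtain ⟨hk, hki⟩ := integrableOn_truncated_kernel hσ (sub_nonneg.2 hab)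
  have hint : Integrable (fun p : ℝ × ℝ =>
      (Iic (b - a)).indicator (fun s => s ^ (σ - 1)) |p.1 - p.2| * f p.2) := by
    have := hf.convolution_integrand (ContinuousLinearMap.mul ℝ ℝ) hk
    refine this.congr (Filter.Eventually.of_forall fun p => ?_)
    simp [mul_comm]
  refine ⟨hint, ?_⟩
  rw [Measure.volume_eq_prod, integral_prod_symm _ (by rwa [← Measure.volume_eq_prod])]
  simp only [integral_mul_const]
  have : ∀ y : ℝ, ∫ x : ℝ, (Iic (b - a)).indicator (fun s => s ^ (σ - 1)) |x - y|
      = 2 * ((b - a) ^ σ / σ) := fun y => by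
    rw [integral_sub_right_eq_self
      (fun t => (Iic (b - a)).indicator (fun s => s ^ (σ - 1)) |t|) y, hki]
  simp only [this, integral_const_mul]

/-- The Schur test: `|f g| ≤ (f² + g²) / 2` reduces both the integrability of the form and its bound
by the `L²` norm to the integral of the truncated kernel. -/
theorem kernel_mul_abs_le (hf : f ∈ L2On a b) (hg : g ∈ L2On a b) (p : ℝ × ℝ) :
    |p.1 - p.2| ^ (σ - 1) * (|f p.1| * |g p.2|) ≤
      (1 / 2) * ((Iic (b - a)).indicator (fun s => s ^ (σ - 1)) |p.1 - p.2| * g p.2 ^ 2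
      + (Iic (b - a)).indicator (fun s => s ^ (σ - 1)) |p.2 - p.1| * f p.1 ^ 2) := by
  by_cases h : p.1 ∈ Icc a b ∧ p.2 ∈ Icc a b
  · have h1 : |p.1 - p.2| ≤ b - a := by
      rw [abs_le]; constructor <;> linarith [h.1.1, h.1.2, h.2.1, h.2.2]
    have h2 : |p.2 - p.1| ≤ b - a := by rwa [abs_sub_comm]
    rw [indicator_of_mem (by exact h1), indicator_of_mem (by exact h2), abs_sub_comm p.2 p.1]
    have h3 : 0 ≤ |p.1 - p.2| ^ (σ - 1) := Real.rpow_nonneg (abs_nonneg _) _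
    have h4 : |f p.1| * |g p.2| ≤ (1 / 2) * (g p.2 ^ 2 + f p.1 ^ 2) := by
      rw [← sq_abs (f p.1), ← sq_abs (g p.2)]
      nlinarith [sq_nonneg (|f p.1| - |g p.2|)]
    calc _ ≤ |p.1 - p.2| ^ (σ - 1) * ((1 / 2) * (g p.2 ^ 2 + f p.1 ^ 2)) :=
          mul_le_mul_of_nonneg_left h4 h3
      _ = _ := by ring
  · have h0 : |f p.1| * |g p.2| = 0 := by
      rw [not_and_or] at h
      rcases h with h | h
      · simp [hf.2 _ h]
      · simp [hg.2 _ h]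
    rw [h0, mul_zero]
    have h5 : ∀ t : ℝ, 0 ≤ (Iic (b - a)).indicator (fun s => s ^ (σ - 1)) |t| := fun t => by
      by_cases ht : |t| ∈ Iic (b - a)
      · rw [indicator_of_mem ht]; exact Real.rpow_nonneg (abs_nonneg _) _
      · rw [indicator_of_notMem ht]
    have := h5 (p.1 - p.2)
    have := h5 (p.2 - p.1)
    positivity

theorem integrable_kernel_bound (hσ : 0 < σ) (hab : a ≤ b) (hf : f ∈ L2On a b)
    (hg : g ∈ L2On a b) :
    Integrable (fun p : ℝ × ℝ =>
      (1 / 2) * ((Iic (b - a)).indicator (fun s => s ^ (σ - 1)) |p.1 - p.2| * g p.2 ^ 2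
      + (Iic (b - a)).indicator (fun s => s ^ (σ - 1)) |p.2 - p.1| * f p.1 ^ 2)) := by
  have h1 := (integrable_kernel_mul_left hσ hab (L2On.integrable_sq hg)).1
  have h2 := (integrable_kernel_mul_left hσ hab (L2On.integrable_sq hf)).1.swap
  exact (h1.add h2).const_mul _

theorem aestronglyMeasurable_kernel (hf : f ∈ L2On a b) (hg : g ∈ L2On a b) :
    AEStronglyMeasurable (fun p : ℝ × ℝ => |p.1 - p.2| ^ (σ - 1) * (f p.1 * g p.2)) := by
  refine AEStronglyMeasurable.mul ?_ ((hf.1.1.comp_fst).mul (hg.1.1.comp_snd))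
  exact Measurable.aestronglyMeasurable (by fun_prop)

theorem integrable_kernel (hσ : 0 < σ) (hab : a ≤ b) (hf : f ∈ L2On a b) (hg : g ∈ L2On a b) :
    Integrable (fun p : ℝ × ℝ => |p.1 - p.2| ^ (σ - 1) * (f p.1 * g p.2)) := by
  refine (integrable_kernel_bound hσ hab hf hg).mono' (aestronglyMeasurable_kernel hf hg)
    (Filter.Eventually.of_forall fun p => ?_)
  rw [norm_mul, Real.norm_of_nonneg (Real.rpow_nonneg (abs_nonneg _) _), norm_mul,
    Real.norm_eq_abs, Real.norm_eq_abs]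
  exact kernel_mul_abs_le hf hg p

theorem rieszForm_self_le (hσ : 0 < σ) (hab : a ≤ b) (hf : f ∈ L2On a b) :
    rieszForm σ f f ≤ 2 * ((b - a) ^ σ / σ) * ∫ x, f x ^ 2 := by
  have h1 := integrable_kernel_mul_left hσ hab (L2On.integrable_sq hf)
  calc rieszForm σ f f ≤ ∫ p : ℝ × ℝ,
      (1 / 2) * ((Iic (b - a)).indicator (fun s => s ^ (σ - 1)) |p.1 - p.2| * f p.2 ^ 2
      + (Iic (b - a)).indicator (fun s => s ^ (σ - 1)) |p.2 - p.1| * f p.1 ^ 2) := by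
        refine integral_mono (integrable_kernel hσ hab hf hf)
          (integrable_kernel_bound hσ hab hf hf) fun p => ?_
        refine le_trans ?_ (kernel_mul_abs_le hf hf p)
        rw [← abs_mul]
        exact mul_le_mul_of_nonneg_left (le_abs_self _) (Real.rpow_nonneg (abs_nonneg _) _)
    _ = (1 / 2) * (2 * ((b - a) ^ σ / σ) * (∫ x, f x ^ 2)
        + 2 * ((b - a) ^ σ / σ) * ∫ x, f x ^ 2) := by
      rw [integral_const_mul]
      congr 1
      have h2 := integral_add h1.1 h1.1.swap
      simp only [Function.comp_apply, Prod.fst_swap, Prod.snd_swap] at h2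
      rw [h2, h1.2]
      congr 1
      have h3 := integral_prod_swap (μ := (volume : Measure ℝ)) (ν := (volume : Measure ℝ))
        (fun p : ℝ × ℝ => (Iic (b - a)).indicator (fun s => s ^ (σ - 1)) |p.1 - p.2| * f p.2 ^ 2)
      rw [← Measure.volume_eq_prod, h1.2] at h3
      exact h3
    _ = _ := by ring

theorem rieszForm_comm (f g : ℝ → ℝ) : rieszForm σ f g = rieszForm σ g f := by
  have h3 := integral_prod_swap (μ := (volume : Measure ℝ)) (ν := (volume : Measure ℝ))
        (fun p : ℝ × ℝ => |p.1 - p.2| ^ (σ - 1) * (f p.1 * g p.2))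
  rw [← Measure.volume_eq_prod] at h3
  rw [rieszForm, rieszForm, ← h3]
  congr 1
  ext p
  simp only [Prod.fst_swap, Prod.snd_swap]
  rw [abs_sub_comm, mul_comm (f _)]

/-- The Riesz form on `L²(a,b)`. -/
noncomputable def rieszBilin (hσ : 0 < σ) (hab : a ≤ b) : LinearMap.BilinForm ℝ (L2On a b) :=
  LinearMap.mk₂ ℝ (fun f g => rieszForm σ f g)
    (fun f f' g => by
      rw [rieszForm, rieszForm, rieszForm, ← integral_add (integrable_kernel hσ hab f.2 g.2)
        (integrable_kernel hσ hab f'.2 g.2)]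
      congr 1; ext p; simp only [Submodule.coe_add, Pi.add_apply]; ring)
    (fun c f g => by
      rw [rieszForm, rieszForm, smul_eq_mul, ← integral_const_mul]
      congr 1; ext p; simp only [Submodule.coe_smul, Pi.smul_apply, smul_eq_mul]; ring)
    (fun f g g' => by
      rw [rieszForm, rieszForm, rieszForm, ← integral_add (integrable_kernel hσ hab f.2 g.2)
        (integrable_kernel hσ hab f.2 g'.2)]
      congr 1; ext p; simp only [Submodule.coe_add, Pi.add_apply]; ring)
    (fun c f g => by
      rw [rieszForm, rieszForm, smul_eq_mul, ← integral_const_mul]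
      congr 1; ext p; simp only [Submodule.coe_smul, Pi.smul_apply, smul_eq_mul]; ring)

theorem rieszBilin_apply (hσ : 0 < σ) (hab : a ≤ b) (f g : L2On a b) :
    rieszBilin hσ hab f g = rieszForm σ f g := rfl

end Kernel

end RieszForm

/-! ### The Riesz form as an integral over intervals. -/

section RieszForm

open MeasureTheory Set

/-- The measure `dr dz` on `r > 0`, `z ∈ ℝ`, where `(r,z)` stands for the interval `[z,z+r]`. -/
noncomputable def windowMeasure : Measure (ℝ × ℝ) := (volume.restrict (Ioi 0)).prod volume

instance : SFinite windowMeasure := by unfold windowMeasure; infer_instance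

/-- Two points at distance `d` both lie in `[z,z+r]` for a set of `z` of length `max (r - d) 0`.
Weighted with `r^(σ-3)` and integrated over `r`, this length reproduces the kernel: it vanishes for
`r ≤ d`, and `σ < 1` gives convergence at infinity. -/
theorem integral_window_rpow {σ d : ℝ} (hσ : σ < 1) (hd : 0 < d) :
    IntegrableOn (fun r : ℝ => r ^ (σ - 3) * max (r - d) 0) (Ioi 0) ∧
    ∫ r in Ioi (0 : ℝ), r ^ (σ - 3) * max (r - d) 0 = d ^ (σ - 1) / ((1 - σ) * (2 - σ)) := by
  have e : ∀ r ∈ Ioi d, r ^ (σ - 2) - d * r ^ (σ - 3) = r ^ (σ - 3) * max (r - d) 0 := by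
    intro r hr
    have hr0 : 0 < r := hd.trans hr
    rw [max_eq_left (sub_nonneg.2 (le_of_lt hr)), mul_sub]
    have : r ^ (σ - 2) = r ^ (σ - 3) * r := by
      rw [show σ - 2 = (σ - 3) + 1 by ring, Real.rpow_add hr0, Real.rpow_one]
    rw [this]; ring
  have i1 : IntegrableOn (fun r : ℝ => r ^ (σ - 2)) (Ioi d) :=
    integrableOn_Ioi_rpow_of_lt (by linarith) hd
  have i2 : IntegrableOn (fun r : ℝ => d * r ^ (σ - 3)) (Ioi d) :=
    (integrableOn_Ioi_rpow_of_lt (by linarith) hd).const_mul d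
  have i3 : IntegrableOn (fun r : ℝ => r ^ (σ - 3) * max (r - d) 0) (Ioi d) :=
    (i1.sub i2).congr_fun e measurableSet_Ioi
  have z : EqOn (fun r : ℝ => r ^ (σ - 3) * max (r - d) 0) (fun _ => 0) (Ioc 0 d) := by
    intro r hr
    simp [max_eq_right (sub_nonpos.2 hr.2)]
  have i4 : IntegrableOn (fun r : ℝ => r ^ (σ - 3) * max (r - d) 0) (Ioc 0 d) :=
    (integrableOn_zero).congr_fun z.symm measurableSet_Ioc
  have u : Ioc 0 d ∪ Ioi d = Ioi (0 : ℝ) := Ioc_union_Ioi_eq_Ioi hd.le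
  refine ⟨u ▸ i4.union i3, ?_⟩
  rw [← u, setIntegral_union (by
    rw [Set.disjoint_left]; intro x hx hx'; exact absurd hx.2 (not_le.2 hx')) measurableSet_Ioi
    i4 i3, setIntegral_congr_fun measurableSet_Ioc z, ← setIntegral_congr_fun measurableSet_Ioi e,
    integral_sub i1 i2, integral_const_mul, integral_Ioi_rpow_of_lt (by linarith) hd,
    integral_Ioi_rpow_of_lt (by linarith) hd]
  have h1 : d ^ (σ - 2 + 1) = d ^ (σ - 1) := by congr 1; ring
  have h2 : d * d ^ (σ - 3 + 1) = d ^ (σ - 1) := by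
    have := Real.rpow_add hd 1 (σ - 3 + 1)
    rw [Real.rpow_one] at this
    rw [← this]
    congr 1; ring
  have h3 : (1 - σ) ≠ 0 := by linarith
  have h4 : (2 - σ) ≠ 0 := by linarith
  have h5 : σ - 2 + 1 = -(1 - σ) := by ring
  have h6 : σ - 3 + 1 = -(2 - σ) := by ring
  rw [integral_zero, zero_add, mul_div_assoc', mul_neg, h2, h1, h5, h6]
  field_simp
  ring

/-- The indicator function of `x ∈ [z,z+r]`. -/
noncomputable def window (p : ℝ × ℝ) (x : ℝ) : ℝ := (Icc p.2 (p.2 + p.1)).indicator 1 x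

theorem window_mul_window (p : ℝ × ℝ) (x y : ℝ) :
    window p x * window p y = (Icc (max x y - p.1) (min x y)).indicator 1 p.2 := by
  simp only [window, indicator_apply, mem_Icc, Pi.one_apply, le_min_iff, sub_le_iff_le_add,
    max_le_iff]
  by_cases h1 : p.2 ≤ x ∧ x ≤ p.2 + p.1 <;> by_cases h2 : p.2 ≤ y ∧ y ≤ p.2 + p.1
  · simp [h1, h2]
  · simp only [h1, h2, if_false, mul_zero]
    rw [if_neg]; tauto
  · simp only [h1, h2, if_false, zero_mul]
    rw [if_neg]; tauto
  · simp only [h1, if_false, zero_mul]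
    rw [if_neg]; tauto

theorem window_nonneg (p : ℝ × ℝ) (x : ℝ) : 0 ≤ window p x :=
  indicator_nonneg (fun _ _ => zero_le_one) _

theorem measurable_window : Measurable fun q : (ℝ × ℝ) × ℝ => window q.1 q.2 := by
  have : (fun q : (ℝ × ℝ) × ℝ => window q.1 q.2)
      = ({q : (ℝ × ℝ) × ℝ | q.1.2 ≤ q.2} ∩ {q | q.2 ≤ q.1.2 + q.1.1}).indicator 1 := by
    ext q
    simp [window, indicator_apply]
  rw [this]
  exact measurable_one.indicator ((measurableSet_le (by fun_prop) (by fun_prop)).inter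
    (measurableSet_le (by fun_prop) (by fun_prop)))

theorem integral_window_mul_window {σ : ℝ} (hσ : σ < 1) {x y : ℝ} (hxy : x ≠ y) :
    Integrable (fun p : ℝ × ℝ => p.1 ^ (σ - 3) * (window p x * window p y)) windowMeasure ∧
    ∫ p, p.1 ^ (σ - 3) * (window p x * window p y) ∂windowMeasure
      = |x - y| ^ (σ - 1) / ((1 - σ) * (2 - σ)) := by
  have hd : 0 < |x - y| := abs_pos.2 (sub_ne_zero.2 hxy)
  obtain ⟨hi, he⟩ := integral_window_rpow hσ hd
  have hm : Measurable fun p : ℝ × ℝ => p.1 ^ (σ - 3) * (window p x * window p y) := by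
    have h1 : Measurable fun p : ℝ × ℝ => window p x :=
      measurable_window.comp (measurable_id.prodMk measurable_const)
    have h2 : Measurable fun p : ℝ × ℝ => window p y :=
      measurable_window.comp (measurable_id.prodMk measurable_const)
    exact (measurable_fst.pow_const _).mul (h1.mul h2)
  have hin : ∀ r : ℝ, ∫ z : ℝ, r ^ (σ - 3) * (window (r, z) x * window (r, z) y)
      = r ^ (σ - 3) * max (r - |x - y|) 0 := fun r => by
    simp only [window_mul_window]
    rw [integral_const_mul]
    congr 1
    have : ∫ z : ℝ, (Icc (max x y - r) (min x y)).indicator (1 : ℝ → ℝ) z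
        = max (min x y - (max x y - r)) 0 := by
      rw [integral_indicator_one measurableSet_Icc, Measure.real, Real.volume_Icc,
        ENNReal.toReal_ofReal']
    rw [this]
    congr 1
    rw [← max_sub_min_eq_abs, max_comm y x, min_comm y x]; ring
  have hint : ∀ r : ℝ, Integrable fun z : ℝ => r ^ (σ - 3) * (window (r, z) x * window (r, z) y) :=
    fun r => by
    simp only [window_mul_window]
    refine Integrable.const_mul ?_ _
    exact (integrable_indicator_iff measurableSet_Icc).2 
      (integrableOn_const (C := (1 : ℝ)) (by simp))
  have hI : Integrable (fun p : ℝ × ℝ => p.1 ^ (σ - 3) * (window p x * window p y))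
      windowMeasure := by
    refine (integrable_prod_iff hm.aestronglyMeasurable).2
      ⟨Filter.Eventually.of_forall fun r => hint r, ?_⟩
    refine Integrable.congr (f := fun r : ℝ => r ^ (σ - 3) * max (r - |x - y|) 0) hi ?_
    filter_upwards [ae_restrict_mem measurableSet_Ioi] with r hr
    rw [← hin r]
    congr 1
    ext z
    rw [Real.norm_of_nonneg]
    exact mul_nonneg (Real.rpow_nonneg (le_of_lt hr) _)
      (mul_nonneg (window_nonneg _ _) (window_nonneg _ _))
  refine ⟨hI, ?_⟩
  rw [windowMeasure, integral_prod _ hI]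
  simp only [hin]
  exact he

theorem ae_windowMeasure_pos : ∀ᵐ p ∂windowMeasure, 0 < p.1 := by
  have : windowMeasure = volume.restrict (Ioi (0 : ℝ) ×ˢ univ) := by
    rw [windowMeasure, Measure.volume_eq_prod, ← Measure.prod_restrict, Measure.restrict_univ]
  rw [this]
  filter_upwards [ae_restrict_mem (measurableSet_Ioi.prod MeasurableSet.univ)] with p hp
  exact hp.1

/-- The kernel is replaced by its superposition of products of windows and the order of integration
is exchanged. For each window the integral over both points is a square, namely that of an increment
of a primitive of `f`. -/
theorem rieszForm_eq_window {σ a b : ℝ} (hσ₀ : 0 < σ) (hσ : σ < 1) (hab : a ≤ b) {f : ℝ → ℝ}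
    (hf : f ∈ L2On a b) :
    Integrable (fun p : ℝ × ℝ => p.1 ^ (σ - 3) * (∫ x in p.2..p.2 + p.1, f x) ^ 2)
      windowMeasure ∧
    rieszForm σ f f = (1 - σ) * (2 - σ) *
      ∫ p, p.1 ^ (σ - 3) * (∫ x in p.2..p.2 + p.1, f x) ^ 2 ∂windowMeasure := by
  set H : (ℝ × ℝ) × (ℝ × ℝ) → ℝ := fun q =>
    q.1.1 ^ (σ - 3) * (window q.1 q.2.1 * window q.1 q.2.2) * (f q.2.1 * f q.2.2) with hH
  have hpos := ae_windowMeasure_pos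
  -- The superposition of windows is available only off the diagonal, which is a null set.
  have hdiag : ∀ᵐ q : ℝ × ℝ, q.1 ≠ q.2 := by
    have : (volume : Measure (ℝ × ℝ)) {q | q.1 = q.2} = 0 := by
      rw [Measure.volume_eq_prod, Measure.prod_apply (measurableSet_eq_fun (by fun_prop)
        (by fun_prop))]
      simp [preimage]
    simpa [ae_iff] using this
  have hHm : AEStronglyMeasurable H (windowMeasure.prod volume) := by
    refine AEStronglyMeasurable.mul ?_ ?_
    · refine Measurable.aestronglyMeasurable ?_
      have h1 : Measurable fun q : (ℝ × ℝ) × (ℝ × ℝ) => window q.1 q.2.1 :=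
        measurable_window.comp (measurable_fst.prodMk (measurable_fst.comp measurable_snd))
      have h2 : Measurable fun q : (ℝ × ℝ) × (ℝ × ℝ) => window q.1 q.2.2 :=
        measurable_window.comp (measurable_fst.prodMk (measurable_snd.comp measurable_snd))
      exact ((measurable_fst.comp measurable_fst).pow_const _).mul (h1.mul h2)
    · exact ((hf.1.1.comp_fst).mul (hf.1.1.comp_snd)).comp_snd
  have hker := integrable_kernel hσ₀ hab hf hf
  -- Windows and weight are nonnegative, so integrating the norm of `H` over the windows returns the
  -- kernel times `|f f|`, which is integrable.
  have hHi : Integrable H (windowMeasure.prod volume) := by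
    refine (integrable_prod_iff' hHm).2 ⟨?_, ?_⟩
    · filter_upwards [hdiag] with q hq
      exact (integral_window_mul_window hσ hq).1.mul_const (f q.1 * f q.2)
    · refine (hker.norm.div_const ((1 - σ) * (2 - σ))).congr ?_
      filter_upwards [hdiag] with q hq
      have e1 : ∫ p, ‖H (p, q)‖ ∂windowMeasure
          = ∫ p, p.1 ^ (σ - 3) * (window p q.1 * window p q.2) * |f q.1 * f q.2|
            ∂windowMeasure := by
        refine integral_congr_ae ?_
        filter_upwards [hpos] with p hp
        rw [hH, norm_mul, Real.norm_of_nonneg, Real.norm_eq_abs]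
        exact mul_nonneg (Real.rpow_nonneg hp.le _)
          (mul_nonneg (window_nonneg _ _) (window_nonneg _ _))
      rw [e1, integral_mul_const, (integral_window_mul_window hσ hq).2, norm_mul,
        Real.norm_of_nonneg (Real.rpow_nonneg (abs_nonneg _) _), Real.norm_eq_abs]
      ring
  have hsec : ∀ p : ℝ × ℝ, 0 < p.1 → ∫ q : ℝ × ℝ, H (p, q)
      = p.1 ^ (σ - 3) * (∫ x in p.2..p.2 + p.1, f x) ^ 2 := fun p hp => by
    have e2 : ∀ q : ℝ × ℝ, H (p, q)
        = p.1 ^ (σ - 3) * ((window p q.1 * f q.1) * (window p q.2 * f q.2)) := fun q => by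
      simp only [hH]; ring
    simp only [e2]
    have e3 : ∫ x, window p x * f x = ∫ x in p.2..p.2 + p.1, f x := by
      rw [intervalIntegral.integral_of_le (by linarith), ← integral_Icc_eq_integral_Ioc,
        ← integral_indicator measurableSet_Icc]
      congr 1; ext x
      simp [window, indicator_apply]
    rw [integral_const_mul, Measure.volume_eq_prod,
      integral_prod_mul (fun x => window p x * f x) (fun x => window p x * f x), e3, sq]
  have hsecae : (fun p => ∫ q : ℝ × ℝ, H (p, q)) =ᵐ[windowMeasure]
      fun p => p.1 ^ (σ - 3) * (∫ x in p.2..p.2 + p.1, f x) ^ 2 := by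
    filter_upwards [hpos] with p hp using hsec p hp
  refine ⟨hHi.integral_prod_left.congr hsecae, ?_⟩
  rw [← integral_congr_ae hsecae, ← integral_prod _ hHi, integral_prod_symm _ hHi,
    ← integral_const_mul, rieszForm]
  refine integral_congr_ae ?_
  filter_upwards [hdiag] with q hq
  have h3 : (1 - σ) ≠ 0 := by linarith
  have h4 : (2 - σ) ≠ 0 := by linarith
  simp only [hH]
  rw [integral_mul_const, (integral_window_mul_window hσ hq).2]
  field_simp

theorem rieszForm_nonneg {σ a b : ℝ} (hσ₀ : 0 < σ) (hσ : σ < 1) (hab : a ≤ b) {f : ℝ → ℝ}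
    (hf : f ∈ L2On a b) : 0 ≤ rieszForm σ f f := by
  rw [(rieszForm_eq_window hσ₀ hσ hab hf).2]
  refine mul_nonneg (mul_nonneg (by linarith) (by linarith)) ?_
  refine integral_nonneg_of_ae ?_
  filter_upwards [ae_windowMeasure_pos] with p hp
  exact mul_nonneg (Real.rpow_nonneg hp.le _) (sq_nonneg _)

/-! ### Increments of primitives -/

/-- The mean square of the increments of `F` of length at most `D` on both sides of `x`. -/
noncomputable def increments (F : ℝ → ℝ) (D x : ℝ) : ℝ :=
  (∫ r in (0 : ℝ)..D, (F (x + r) - F x) ^ 2) + ∫ r in (0 : ℝ)..D, (F x - F (x - r)) ^ 2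

theorem increments_nonneg {F : ℝ → ℝ} {D : ℝ} (hD : 0 ≤ D) (x : ℝ) : 0 ≤ increments F D x :=
  add_nonneg (intervalIntegral.integral_nonneg hD fun _ _ => sq_nonneg _)
    (intervalIntegral.integral_nonneg hD fun _ _ => sq_nonneg _)

/-- Insert the intermediate value `F (y - r)` and integrate over `0 < r < y - x`. One part is an
increment to the left of `y`, the other an increment to the right of `x`; this is why `increments`
looks to both sides. -/
theorem sq_sub_mul_le_increments_of_le {F : ℝ → ℝ} (hF : Continuous F) {D x y : ℝ}
    (hxy : x ≤ y) (hD : y - x ≤ D) :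
    (F y - F x) ^ 2 * (y - x) ≤ 2 * (increments F D x + increments F D y) := by
  have hD0 : 0 ≤ D := by linarith
  have hl : 0 ≤ y - x := by linarith
  have h1 : ∫ r in (0 : ℝ)..(y - x), (F y - F x) ^ 2 ≤
      ∫ r in (0 : ℝ)..(y - x), (2 * (F y - F (y - r)) ^ 2 + 2 * (F (y - r) - F x) ^ 2) := by
    refine intervalIntegral.integral_mono_on hl (by simp)
      (Continuous.intervalIntegrable (by fun_prop) _ _) fun r _ => ?_
    nlinarith [sq_nonneg ((F y - F (y - r)) - (F (y - r) - F x))]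
  have h2 : ∫ r in (0 : ℝ)..(y - x), (F (y - r) - F x) ^ 2
      = ∫ r in (0 : ℝ)..(y - x), (F (x + r) - F x) ^ 2 := by
    have := intervalIntegral.integral_comp_sub_left (a := 0) (b := y - x)
      (fun r => (F (x + r) - F x) ^ 2) (y - x)
    simp only [sub_self, sub_zero] at this
    rw [← this]
    congr 1; ext r; congr 3; ring
  rw [intervalIntegral.integral_add (Continuous.intervalIntegrable (by fun_prop) _ _)
    (Continuous.intervalIntegrable (by fun_prop) _ _), intervalIntegral.integral_const_mul,
    intervalIntegral.integral_const_mul, h2, intervalIntegral.integral_const, sub_zero,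
    smul_eq_mul] at h1
  have mono : ∀ G : ℝ → ℝ, Continuous G → ∫ r in (0 : ℝ)..(y - x), G r ^ 2 ≤
      ∫ r in (0 : ℝ)..D, G r ^ 2 := fun G hG => by
    refine intervalIntegral.integral_mono_interval le_rfl hl hD
      (Filter.Eventually.of_forall fun _ => sq_nonneg _)
      (Continuous.intervalIntegrable (by fun_prop) _ _)
  have h3 := mono (fun r => F y - F (y - r)) (by fun_prop)
  have h4 := mono (fun r => F (x + r) - F x) (by fun_prop)
  have h5 : 0 ≤ ∫ r in (0 : ℝ)..D, (F x - F (x - r)) ^ 2 :=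
    intervalIntegral.integral_nonneg hD0 fun _ _ => sq_nonneg _
  have h6 : 0 ≤ ∫ r in (0 : ℝ)..D, (F (y + r) - F y) ^ 2 :=
    intervalIntegral.integral_nonneg hD0 fun _ _ => sq_nonneg _
  unfold increments
  linarith

theorem sq_sub_mul_le_increments {F : ℝ → ℝ} (hF : Continuous F) {D x y : ℝ}
    (hD : |y - x| ≤ D) :
    (F y - F x) ^ 2 * |y - x| ≤ 2 * (increments F D x + increments F D y) := by
  rcases le_total x y with h | h
  · rw [abs_of_nonneg (sub_nonneg.2 h)] at *
    exact sq_sub_mul_le_increments_of_le hF h hD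
  · rw [abs_of_nonpos (sub_nonpos.2 h), neg_sub] at *
    have := sq_sub_mul_le_increments_of_le hF h hD
    calc (F y - F x) ^ 2 * (x - y) = (F x - F y) ^ 2 * (x - y) := by ring
      _ ≤ _ := this
      _ = _ := by ring

/-- The primitive of `f` that vanishes at `a`. -/
noncomputable def primitive (a : ℝ) (f : ℝ → ℝ) (x : ℝ) : ℝ := ∫ t in a..x, f t

theorem continuous_primitive' {a : ℝ} {f : ℝ → ℝ} (hf : Integrable f) :
    Continuous (primitive a f) :=
  intervalIntegral.continuous_primitive (fun _ _ => hf.intervalIntegrable) a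

theorem primitive_sub {a : ℝ} {f : ℝ → ℝ} (hf : Integrable f) (x y : ℝ) :
    primitive a f y - primitive a f x = ∫ t in x..y, f t :=
  intervalIntegral.integral_interval_sub_left hf.intervalIntegrable hf.intervalIntegrable

/-- For `0 < r ≤ D` one has `1 ≤ D^(3-σ) r^(σ-3)`, so unweighted increments are dominated by the
weighted ones in the window formula. Left increments are translates of right ones and double the
constant. -/
theorem integral_increments_le {σ a b : ℝ} (hσ₀ : 0 < σ) (hσ : σ < 1) (hab : a ≤ b) {f : ℝ → ℝ}
    (hf : f ∈ L2On a b) {D : ℝ} (hD : 0 < D) (c : ℝ) :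
    Integrable (increments (primitive c f) D) ∧
    ∫ x, increments (primitive c f) D x
      ≤ 2 / ((1 - σ) * (2 - σ)) * D ^ (3 - σ) * rieszForm σ f f := by
  set F := primitive c f with hFdef
  have hFc : Continuous F := continuous_primitive' (L2On.integrable hf)
  obtain ⟨hi, he⟩ := rieszForm_eq_window hσ₀ hσ hab hf
  have hκ : 0 < (1 - σ) * (2 - σ) := mul_pos (by linarith) (by linarith)
  set μ : Measure (ℝ × ℝ) := (volume.restrict (Ioc 0 D)).prod volume with hμ
  have hμle : μ ≤ windowMeasure :=
    Measure.prod_mono (Measure.restrict_mono Ioc_subset_Ioi_self le_rfl) le_rfl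
  have hΦ : ∀ p : ℝ × ℝ, (∫ x in p.2..p.2 + p.1, f x) = F (p.2 + p.1) - F p.2 := fun p =>
    (primitive_sub (L2On.integrable hf) _ _).symm
  simp only [hΦ] at hi he
  have hiμ : Integrable (fun p : ℝ × ℝ => p.1 ^ (σ - 3) * (F (p.2 + p.1) - F p.2) ^ 2) μ :=
    hi.mono_measure hμle
  have hmem : ∀ᵐ p ∂μ, p.1 ∈ Ioc 0 D := by
    have : μ = volume.restrict (Ioc (0 : ℝ) D ×ˢ univ) := by
      rw [hμ, Measure.volume_eq_prod, ← Measure.prod_restrict, Measure.restrict_univ]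
    rw [this]
    filter_upwards [ae_restrict_mem (measurableSet_Ioc.prod MeasurableSet.univ)] with p hp
    exact hp.1
  have hptw : ∀ᵐ p ∂μ, (F (p.2 + p.1) - F p.2) ^ 2
      ≤ D ^ (3 - σ) * (p.1 ^ (σ - 3) * (F (p.2 + p.1) - F p.2) ^ 2) := by
    filter_upwards [hmem] with p hp
    have h1 : p.1 ^ (3 - σ) ≤ D ^ (3 - σ) := Real.rpow_le_rpow hp.1.le hp.2 (by linarith)
    have h2 : p.1 ^ (3 - σ) * p.1 ^ (σ - 3) = 1 := by
      rw [← Real.rpow_add hp.1]; simp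
    have h3 : 0 ≤ p.1 ^ (σ - 3) := Real.rpow_nonneg hp.1.le _
    rw [← mul_assoc]
    refine le_mul_of_one_le_left (sq_nonneg _) ?_
    rw [← h2]
    exact mul_le_mul_of_nonneg_right h1 h3
  have hcont : Continuous fun p : ℝ × ℝ => (F (p.2 + p.1) - F p.2) ^ 2 := by fun_prop
  have hI : Integrable (fun p : ℝ × ℝ => (F (p.2 + p.1) - F p.2) ^ 2) μ := by
    refine (hiμ.const_mul (D ^ (3 - σ))).mono' hcont.aestronglyMeasurable ?_
    filter_upwards [hptw] with p hp
    rwa [Real.norm_of_nonneg (sq_nonneg _)]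
  have hIle : ∫ p, (F (p.2 + p.1) - F p.2) ^ 2 ∂μ
      ≤ D ^ (3 - σ) * (rieszForm σ f f / ((1 - σ) * (2 - σ))) := by
    calc ∫ p, (F (p.2 + p.1) - F p.2) ^ 2 ∂μ
        ≤ ∫ p, D ^ (3 - σ) * (p.1 ^ (σ - 3) * (F (p.2 + p.1) - F p.2) ^ 2) ∂μ :=
          integral_mono_ae hI (hiμ.const_mul _) hptw
      _ = D ^ (3 - σ) * ∫ p, p.1 ^ (σ - 3) * (F (p.2 + p.1) - F p.2) ^ 2 ∂μ :=
          integral_const_mul _ _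
      _ ≤ D ^ (3 - σ) * ∫ p, p.1 ^ (σ - 3) * (F (p.2 + p.1) - F p.2) ^ 2 ∂windowMeasure := by
          refine mul_le_mul_of_nonneg_left (integral_mono_measure hμle ?_ hi)
            (Real.rpow_nonneg hD.le _)
          filter_upwards [ae_windowMeasure_pos] with p hp
          exact mul_nonneg (Real.rpow_nonneg hp.le _) (sq_nonneg _)
      _ = _ := by rw [he, mul_div_cancel_left₀ _ hκ.ne']
  have hJ : Integrable (fun p : ℝ × ℝ => (F p.2 - F (p.2 - p.1)) ^ 2) μ := by
    have hc2 : Continuous fun p : ℝ × ℝ => (F p.2 - F (p.2 - p.1)) ^ 2 := by fun_prop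
    obtain ⟨h1, h2⟩ := (integrable_prod_iff hcont.aestronglyMeasurable).1 hI
    refine (integrable_prod_iff hc2.aestronglyMeasurable).2 ⟨?_, ?_⟩
    · filter_upwards [h1] with r hr
      have := hr.comp_sub_right r
      simpa using this
    · refine h2.congr (Filter.Eventually.of_forall fun r => ?_)
      have := integral_sub_right_eq_self (fun z => ‖(F (z + r) - F z) ^ 2‖) (μ := volume) r
      simpa using this.symm
  have hJe : ∫ p, (F p.2 - F (p.2 - p.1)) ^ 2 ∂μ = ∫ p, (F (p.2 + p.1) - F p.2) ^ 2 ∂μ := by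
    rw [integral_prod _ hJ, integral_prod _ hI]
    congr 1; ext r
    have := integral_sub_right_eq_self (fun z => (F (z + r) - F z) ^ 2) (μ := volume) r
    simpa using this
  have e1 : ∀ x, ∫ r in (0 : ℝ)..D, (F (x + r) - F x) ^ 2
      = ∫ r in Ioc 0 D, (F (x + r) - F x) ^ 2 := fun x => intervalIntegral.integral_of_le hD.le
  have e2 : ∀ x, ∫ r in (0 : ℝ)..D, (F x - F (x - r)) ^ 2
      = ∫ r in Ioc 0 D, (F x - F (x - r)) ^ 2 := fun x => intervalIntegral.integral_of_le hD.le
  have hi1 := hI.integral_prod_right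
  have hi2 := hJ.integral_prod_right
  constructor
  · refine (hi1.add hi2).congr (Filter.Eventually.of_forall fun x => ?_)
    simp [increments, e1, e2]
  · simp only [increments, e1, e2]
    rw [integral_add hi1 hi2, ← integral_prod_symm _ hI, ← integral_prod_symm _ hJ, hJe]
    calc _ ≤ D ^ (3 - σ) * (rieszForm σ f f / ((1 - σ) * (2 - σ)))
          + D ^ (3 - σ) * (rieszForm σ f f / ((1 - σ) * (2 - σ))) := add_le_add hIle hIle
      _ = _ := by ring

/-! ### Upper bound of the Riesz form when the primitive is small. -/

theorem integral_sq_window_le {f : ℝ → ℝ} (hf : MemLp f 2) {r : ℝ} (hr : 0 < r) :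
    Integrable (fun z => ∫ t in z..z + r, f t ^ 2) ∧
      ∫ z, ∫ t in z..z + r, f t ^ 2 = r * ∫ x, f x ^ 2 := by
  have hk : Integrable ((Ico (-r) 0).indicator (1 : ℝ → ℝ)) :=
    (integrable_indicator_iff measurableSet_Ico).2 (integrableOn_const (C := (1 : ℝ)) (by simp))
  have hki : ∫ x, (Ico (-r) 0).indicator (1 : ℝ → ℝ) x = r := by
    rw [integral_indicator_one measurableSet_Ico]
    simp [hr.le]
  have e : ∀ z, ∫ t, f t ^ 2 * (Ico (-r) 0).indicator (1 : ℝ → ℝ) (z - t)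
      = ∫ t in z..z + r, f t ^ 2 := fun z => by
    rw [intervalIntegral.integral_of_le (by linarith), ← integral_indicator measurableSet_Ioc]
    congr 1; ext t
    simp only [indicator_apply, mem_Ico, mem_Ioc, Pi.one_apply]
    by_cases h : z < t ∧ t ≤ z + r
    · rw [if_pos h, if_pos ⟨by linarith [h.2], by linarith [h.1]⟩, mul_one]
    · rw [if_neg h, if_neg fun h' => h ⟨by linarith [h'.2], by linarith [h'.1]⟩, mul_zero]
  have h1 := hf.integrable_sq.integrable_convolution (ContinuousLinearMap.mul ℝ ℝ) hk
  have h2 := integral_convolution (ContinuousLinearMap.mul ℝ ℝ) hf.integrable_sq hk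
  simp only [convolution, ContinuousLinearMap.mul_apply', e, hki] at h2
  exact ⟨h1.congr (Filter.Eventually.of_forall e), by rw [h2, mul_comm]⟩

/-- Let `J r` be the integral of the squared increments of length `r`. Cauchy–Schwarz bounds it by
`r² ‖f‖²`, the size of the primitive by `4 h² ‖f‖²`. Splitting the weighted integral at `r = h` and
using the first bound below and the second above produces `h^σ`. -/
theorem rieszForm_le_of_primitive {σ a b : ℝ} (hσ₀ : 0 < σ) (hσ : σ < 1) (hab : a ≤ b)
    {f : ℝ → ℝ} (hf : f ∈ L2On a b) {h : ℝ} (hh : 0 < h)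
    (hi : Integrable fun x => primitive a f x ^ 2)
    (hle : ∫ x, primitive a f x ^ 2 ≤ h ^ 2 * ∫ x, f x ^ 2) :
    rieszForm σ f f ≤ (1 - σ) * (2 - σ) * (1 / σ + 4 / (2 - σ)) * h ^ σ * ∫ x, f x ^ 2 := by
  set S := ∫ x, f x ^ 2 with hS
  have hS0 : 0 ≤ S := integral_nonneg fun _ => sq_nonneg _
  obtain ⟨hw, he⟩ := rieszForm_eq_window hσ₀ hσ hab hf
  set F := primitive a f with hF
  set J : ℝ → ℝ := fun r => ∫ z, (∫ x in z..z + r, f x) ^ 2 with hJ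
  have hw' := hw.integral_prod_left
  rw [windowMeasure, integral_prod _ hw] at he
  simp only [integral_const_mul] at hw' he
  have hJ1 : ∀ r, 0 < r → J r ≤ r ^ 2 * S := fun r hr => by
    obtain ⟨i1, i2⟩ := integral_sq_window_le hf.1 hr
    calc J r ≤ ∫ z, r * ∫ t in z..z + r, f t ^ 2 := by
          refine integral_mono_of_nonneg (Filter.Eventually.of_forall fun z => sq_nonneg _)
            (i1.const_mul r) (Filter.Eventually.of_forall fun z => ?_)
          have := sq_intervalIntegral_le (x := z) (y := z + r) (by linarith) (hf.1.restrict _)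
          simpa using this
      _ = r ^ 2 * S := by rw [integral_const_mul, i2]; ring
  have hJ2 : ∀ r, J r ≤ 4 * h ^ 2 * S := fun r => by
    have i1 : Integrable fun z => F (z + r) ^ 2 := hi.comp_add_right r
    have i2 : ∫ z, F (z + r) ^ 2 = ∫ z, F z ^ 2 :=
      integral_add_right_eq_self (fun z => F z ^ 2) r
    calc J r ≤ ∫ z, (2 * F (z + r) ^ 2 + 2 * F z ^ 2) := by
          refine integral_mono_of_nonneg (Filter.Eventually.of_forall fun z => sq_nonneg _)
            ((i1.const_mul 2).add (hi.const_mul 2)) (Filter.Eventually.of_forall fun z => ?_)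
          simp only
          rw [← primitive_sub (L2On.integrable hf) z (z + r) (a := a)]
          nlinarith [sq_nonneg (F (z + r) + F z)]
      _ = 4 * ∫ z, F z ^ 2 := by
          rw [integral_add (i1.const_mul 2) (hi.const_mul 2), integral_const_mul,
            integral_const_mul, i2]; ring
      _ ≤ 4 * h ^ 2 * S := by linarith
  have u : Ioc 0 h ∪ Ioi h = Ioi (0 : ℝ) := Ioc_union_Ioi_eq_Ioi hh.le
  have w1 : IntegrableOn (fun r => r ^ (σ - 3) * J r) (Ioc 0 h) :=
    IntegrableOn.mono_set hw' Ioc_subset_Ioi_self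
  have w2 : IntegrableOn (fun r => r ^ (σ - 3) * J r) (Ioi h) :=
    IntegrableOn.mono_set hw' (Ioi_subset_Ioi hh.le)
  have g1 : IntegrableOn (fun r : ℝ => r ^ (σ - 1) * S) (Ioc 0 h) := by
    refine Integrable.mul_const ?_ S
    have := (intervalIntegral.intervalIntegrable_rpow' (a := 0) (b := h)
      (show -1 < σ - 1 by linarith))
    exact (intervalIntegrable_iff_integrableOn_Ioc_of_le hh.le).1 this
  have g2 : IntegrableOn (fun r : ℝ => r ^ (σ - 3) * (4 * h ^ 2 * S)) (Ioi h) :=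
    (integrableOn_Ioi_rpow_of_lt (by linarith) hh).mul_const _
  have b1 : ∫ r in Ioc 0 h, r ^ (σ - 3) * J r ≤ h ^ σ / σ * S := by
    calc ∫ r in Ioc 0 h, r ^ (σ - 3) * J r ≤ ∫ r in Ioc 0 h, r ^ (σ - 1) * S := by
          refine setIntegral_mono_on w1 g1 measurableSet_Ioc fun r hr => ?_
          have e : r ^ (σ - 1) = r ^ (σ - 3) * r ^ 2 := by
            rw [← Real.rpow_natCast, ← Real.rpow_add hr.1]; congr 1; push_cast; ring
          rw [e, mul_assoc]
          exact mul_le_mul_of_nonneg_left (hJ1 r hr.1) (Real.rpow_nonneg hr.1.le _)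
      _ = _ := by
          rw [integral_mul_const, ← intervalIntegral.integral_of_le hh.le,
            integral_rpow (Or.inl (by linarith))]
          simp [hσ₀.ne']
  have b2 : ∫ r in Ioi h, r ^ (σ - 3) * J r ≤ 4 / (2 - σ) * h ^ σ * S := by
    calc ∫ r in Ioi h, r ^ (σ - 3) * J r ≤ ∫ r in Ioi h, r ^ (σ - 3) * (4 * h ^ 2 * S) := by
          refine setIntegral_mono_on w2 g2 measurableSet_Ioi fun r hr => ?_
          exact mul_le_mul_of_nonneg_left (hJ2 r) (Real.rpow_nonneg (hh.trans hr).le _)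
      _ = _ := by
          rw [integral_mul_const, integral_Ioi_rpow_of_lt (by linarith) hh]
          have e : h ^ σ = h ^ (σ - 3 + 1) * h ^ 2 := by
            rw [← Real.rpow_natCast, ← Real.rpow_add hh]; congr 1; push_cast; ring
          have h4 : (2 - σ) ≠ 0 := by linarith
          have h6 : σ - 3 + 1 = -(2 - σ) := by ring
          rw [e, h6]
          field_simp
  rw [he, ← u, setIntegral_union (by
    rw [Set.disjoint_left]; intro x hx hx'; exact absurd hx.2 (not_le.2 hx')) measurableSet_Ioi
    w1 w2]
  calc _ ≤ (1 - σ) * (2 - σ) * (h ^ σ / σ * S + 4 / (2 - σ) * h ^ σ * S) :=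
        mul_le_mul_of_nonneg_left (add_le_add b1 b2) (mul_nonneg (by linarith) (by linarith))
    _ = _ := by ring

end RieszForm

section RieszForm

open MeasureTheory Set

/-! ### Contractions of the interval -/

/-- The image of the density `w` under the contraction by the factor `1/μ` about `c`. -/
def contract (c μ : ℝ) (w : ℝ → ℝ) (x : ℝ) : ℝ := μ * w (c + μ * (x - c))

theorem integrable_comp_affine {f : ℝ → ℝ} (hf : Integrable f) {μ : ℝ} (hμ : μ ≠ 0) (c : ℝ) :
    Integrable fun x => f (c + μ * (x - c)) := by
  have := (hf.comp_add_right (c - μ * c)).comp_mul_left' hμ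
  refine this.congr (Filter.Eventually.of_forall fun x => ?_)
  simp only
  congr 1; ring

theorem integral_comp_affine (f : ℝ → ℝ) {μ : ℝ} (hμ : 0 < μ) (c : ℝ) :
    ∫ x, f (c + μ * (x - c)) = μ⁻¹ * ∫ x, f x := by
  have := Measure.integral_comp_mul_left (fun x => f (x + (c - μ * c))) μ
  rw [integral_add_right_eq_self f, abs_of_pos (inv_pos.2 hμ), smul_eq_mul] at this
  rw [← this]
  congr 1; ext x; congr 1; ring

section Contract

variable {σ a b c μ : ℝ} {w : ℝ → ℝ}

theorem contract_mem (hc : c ∈ Icc a b) (hμ : 1 ≤ μ) (hw : w ∈ L2On a b) :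
    contract c μ w ∈ L2On a b := by
  have hμ0 : μ ≠ 0 := by linarith
  have h1 : Integrable (contract c μ w) :=
    (integrable_comp_affine (L2On.integrable hw) hμ0 c).const_mul μ
  refine ⟨?_, fun x hx => ?_⟩
  · rw [memLp_two_iff_integrable_sq h1.aestronglyMeasurable]
    refine ((integrable_comp_affine (L2On.integrable_sq hw) hμ0 c).const_mul (μ ^ 2)).congr
      (Filter.Eventually.of_forall fun x => ?_)
    simp only [contract]; ring
  · rw [contract, hw.2, mul_zero]
    intro h
    refine hx ⟨?_, ?_⟩
    · by_contra hlt
      push Not at hlt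
      nlinarith [h.1, hc.1]
    · by_contra hlt
      push Not at hlt
      nlinarith [h.2, hc.2]

theorem integral_contract_sq (hμ : 0 < μ) (w : ℝ → ℝ) :
    ∫ x, contract c μ w x ^ 2 = μ * ∫ x, w x ^ 2 := by
  have := integral_comp_affine (fun x => w x ^ 2) hμ c
  calc ∫ x, contract c μ w x ^ 2 = ∫ x, μ ^ 2 * w (c + μ * (x - c)) ^ 2 := by
        congr 1; ext x; simp only [contract]; ring
    _ = _ := by rw [integral_const_mul, this]; field_simp

/-- The two factors `μ` of the densities cancel the two Jacobians, and the kernel, homogeneous of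
degree `σ - 1`, leaves `μ^(1-σ)`. -/
theorem rieszForm_contract (hσ : 0 < σ) (hc : c ∈ Icc a b) (hμ : 1 ≤ μ) (hw : w ∈ L2On a b) :
    rieszForm σ (contract c μ w) (contract c μ w) = μ ^ (1 - σ) * rieszForm σ w w := by
  have hab : a ≤ b := hc.1.trans hc.2
  have hμ0 : 0 < μ := by linarith
  have hD := contract_mem hc hμ hw
  rw [rieszForm, rieszForm, Measure.volume_eq_prod,
    integral_prod _ (by rw [← Measure.volume_eq_prod]; exact integrable_kernel hσ hab hD hD),
    integral_prod _ (by rw [← Measure.volume_eq_prod]; exact integrable_kernel hσ hab hw hw)]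
  have e1 : ∀ x y, |x - y| ^ (σ - 1) * (contract c μ w x * contract c μ w y)
      = μ ^ (1 - σ) * μ ^ 2 * (|(c + μ * (x - c)) - (c + μ * (y - c))| ^ (σ - 1)
        * (w (c + μ * (x - c)) * w (c + μ * (y - c)))) := fun x y => by
    have h1 : |(c + μ * (x - c)) - (c + μ * (y - c))| = μ * |x - y| := by
      rw [← abs_of_pos hμ0, ← abs_mul, abs_of_pos hμ0]; congr 1; ring
    have h2 : μ ^ (1 - σ) * μ ^ (σ - 1) = 1 := by rw [← Real.rpow_add hμ0]; simp
    rw [h1, Real.mul_rpow hμ0.le (abs_nonneg _), contract, contract]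
    linear_combination (-(μ ^ 2 * |x - y| ^ (σ - 1) * w (c + μ * (x - c)) * w (c + μ * (y - c))))
      * h2
  simp only [e1, integral_const_mul]
  have e2 : ∀ s, ∫ y, |s - (c + μ * (y - c))| ^ (σ - 1) * (w s * w (c + μ * (y - c)))
      = μ⁻¹ * ∫ y, |s - y| ^ (σ - 1) * (w s * w y) := fun s =>
    integral_comp_affine (fun y => |s - y| ^ (σ - 1) * (w s * w y)) hμ0 c
  simp only [e2, integral_const_mul]
  rw [integral_comp_affine (fun s => ∫ y, |s - y| ^ (σ - 1) * (w s * w y)) hμ0 c]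
  field_simp

/-- The factor `μ` in `contract` is what turns contraction of a density into plain dilation of its
primitive based at `c`. -/
theorem primitive_contract (hμ : 0 < μ) (w : ℝ → ℝ) (x : ℝ) :
    primitive c (contract c μ w) x = primitive c w (c + μ * (x - c)) := by
  have := intervalIntegral.integral_comp_mul_add (a := c) (b := x) w hμ.ne' (c - μ * c)
  simp only [primitive, contract, intervalIntegral.integral_const_mul]
  have e : ∀ t, c + μ * (t - c) = μ * t + (c - μ * c) := fun t => by ring
  simp only [e, this, smul_eq_mul]
  rw [show μ * c + (c - μ * c) = c by ring, ← mul_assoc, mul_inv_cancel₀ hμ.ne', one_mul]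

theorem integral_mul_contract (hμ : 0 < μ) (v w : ℝ → ℝ) :
    ∫ x, v x * contract c μ w x = ∫ x, v (c + μ⁻¹ * (x - c)) * w x := by
  have := integral_comp_affine (fun x => v (c + μ⁻¹ * (x - c)) * w x) hμ c
  calc ∫ x, v x * contract c μ w x
      = ∫ x, μ * (v (c + μ⁻¹ * ((c + μ * (x - c)) - c)) * w (c + μ * (x - c))) := by
        congr 1; ext x
        have : c + μ⁻¹ * ((c + μ * (x - c)) - c) = x := by field_simp; ring
        rw [this, contract]; ring
    _ = _ := by rw [integral_const_mul, this]; field_simp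

end Contract

theorem sq_primitive_sub_le {g : ℝ → ℝ} (hg : MemLp g 2) (hgi : Integrable g) {a x y D : ℝ}
    (hD : |x - y| ≤ D) :
    (primitive a g x - primitive a g y) ^ 2 ≤ D * ∫ t in (x - D)..(x + D), g t ^ 2 := by
  have hD0 : 0 ≤ D := (abs_nonneg _).trans hD
  obtain ⟨h1, h2⟩ := abs_le.1 hD
  have hn : 0 ≤ ∫ t in (x - D)..(x + D), g t ^ 2 :=
    intervalIntegral.integral_nonneg (by linarith) fun _ _ => sq_nonneg _
  have hi : IntervalIntegrable (fun t => g t ^ 2) volume (x - D) (x + D) :=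
    hg.integrable_sq.intervalIntegrable
  have key : ∀ u v, x - D ≤ u → u ≤ v → v ≤ x + D → v - u ≤ D →
      (∫ t in u..v, g t) ^ 2 ≤ D * ∫ t in (x - D)..(x + D), g t ^ 2 := by
    intro u v hu huv hv hvu
    refine (sq_intervalIntegral_le huv (hg.restrict _)).trans ?_
    refine mul_le_mul hvu ?_ (intervalIntegral.integral_nonneg huv fun _ _ => sq_nonneg _) hD0
    exact intervalIntegral.integral_mono_interval hu huv hv
      (Filter.Eventually.of_forall fun _ => sq_nonneg _) hi
  rw [primitive_sub hgi]
  rcases le_total y x with h | h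
  · exact key y x (by linarith) h (by linarith) (by linarith)
  · rw [intervalIntegral.integral_symm, neg_sq]
    exact key x y (by linarith) h (by linarith) (by linarith)

theorem primitive_mem {a b : ℝ} (hab : a ≤ b) {g : ℝ → ℝ} (hg : g ∈ L2On a b)
    (h0 : ∫ x in a..b, g x = 0) :
    primitive a g ∈ L2On a b ∧ ∫ x, primitive a g x ^ 2 ≤ (b - a) ^ 2 * ∫ x, g x ^ 2 := by
  have hgi := L2On.integrable hg
  have hout : ∀ x ∉ Icc a b, primitive a g x = 0 := by
    intro x hx
    rw [mem_Icc, not_and_or, not_le, not_le] at hx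
    rcases hx with hx | hx
    · rw [primitive, intervalIntegral.integral_of_ge hx.le]
      rw [setIntegral_congr_ae (g := fun _ => 0) measurableSet_Ioc]
      · simp
      · have : ∀ᵐ t : ℝ, t ≠ a := by simp [ae_iff, measure_singleton]
        filter_upwards [this] with t hta ht
        exact hg.2 t fun h => hta (le_antisymm ht.2 h.1)
    · rw [primitive, ← intervalIntegral.integral_add_adjacent_intervals
        (hgi.intervalIntegrable (a := a) (b := b)) hgi.intervalIntegrable, h0, zero_add,
        intervalIntegral.integral_of_le hx.le]
      rw [setIntegral_congr_fun (g := fun _ => 0) measurableSet_Ioc]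
      · simp
      · intro t ht
        exact hg.2 t fun h => absurd h.2 (not_le.2 ht.1)
  have hb : ∀ x, primitive a g x ^ 2 ≤ (b - a) * ∫ x, g x ^ 2 := by
    intro x
    have hS : 0 ≤ ∫ x, g x ^ 2 := integral_nonneg fun _ => sq_nonneg _
    by_cases hx : x ∈ Icc a b
    · refine (sq_intervalIntegral_le hx.1 (hg.1.restrict _)).trans ?_
      refine mul_le_mul (by linarith [hx.2]) ?_ (intervalIntegral.integral_nonneg hx.1
        fun _ _ => sq_nonneg _) (by linarith)
      rw [intervalIntegral.integral_of_le hx.1]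
      exact setIntegral_le_integral hg.1.integrable_sq
        (Filter.Eventually.of_forall fun _ => sq_nonneg _)
    · rw [hout x hx, zero_pow two_ne_zero]
      exact mul_nonneg (by linarith) hS
  have hmem : primitive a g ∈ L2On a b := by
    refine L2On.of_bounded (C := √((b - a) * ∫ x, g x ^ 2))
      (continuous_primitive' hgi).aestronglyMeasurable (fun x => ?_) hout
    exact Real.abs_le_sqrt (hb x)
  refine ⟨hmem, ?_⟩
  calc ∫ x, primitive a g x ^ 2 = ∫ x in Icc a b, primitive a g x ^ 2 := by
        rw [setIntegral_eq_integral_of_forall_compl_eq_zero]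
        intro x hx; rw [hout x hx]; simp
    _ ≤ ∫ x in Icc a b, (b - a) * ∫ x, g x ^ 2 :=
        setIntegral_mono_on (L2On.integrable_sq hmem).integrableOn
          (integrableOn_const (by simp)) measurableSet_Icc
          fun x _ => hb x
    _ = _ := by simp [hab]; ring

theorem integral_primitive_mul_le {a b : ℝ} (hab : a ≤ b) {g w : ℝ → ℝ} (hg : g ∈ L2On a b)
    (h0 : ∫ x in a..b, g x = 0) (hw : w ∈ L2On a b) :
    ∫ x, primitive a g x * w x ≤ (b - a) * (√(∫ x, g x ^ 2) * √(∫ x, w x ^ 2)) := by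
  obtain ⟨hv, hv2⟩ := primitive_mem hab hg h0
  refine (le_abs_self _).trans ((Real.abs_le_sqrt (sq_integral_mul_le hv.1 hw.1)).trans ?_)
  rw [Real.sqrt_mul (integral_nonneg fun _ => sq_nonneg _), ← mul_assoc]
  refine mul_le_mul_of_nonneg_right ?_ (Real.sqrt_nonneg _)
  refine Real.sqrt_le_iff.2 ⟨mul_nonneg (by linarith) (Real.sqrt_nonneg _), ?_⟩
  rw [mul_pow, Real.sq_sqrt (integral_nonneg fun _ => sq_nonneg _)]
  exact hv2

/-- Translation of a primitive towards the centre of the contraction. -/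
theorem abs_integral_sub_contract_le {a b c μ : ℝ} (hc : c ∈ Icc a b) (hμ : 1 ≤ μ) {g w : ℝ → ℝ}
    (hg : g ∈ L2On a b) (hw : w ∈ L2On a b) (h0 : ∫ x in a..b, g x = 0) :
    |(∫ x, primitive a g x * w x) - ∫ x, primitive a g x * contract c μ w x|
      ≤ 2 * ((μ - 1) * (b - a)) * (√(∫ x, g x ^ 2) * √(∫ x, w x ^ 2)) := by
  have hab : a ≤ b := hc.1.trans hc.2
  have hμ0 : 0 < μ := by linarith
  have hgi := L2On.integrable hg
  have hcont : Continuous (primitive a g) := continuous_primitive' hgi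
  set D := (μ - 1) * (b - a) with hD
  have hD0 : 0 ≤ D := mul_nonneg (by linarith) (by linarith)
  have hv := (primitive_mem hab hg h0).1
  have hvD := contract_mem hc hμ hw
  -- The dilated primitive need not vanish outside `[a,b]`. As `w` does, cutting off the difference
  -- changes no integral and makes it square integrable.
  set k : ℝ → ℝ := (Icc a b).indicator
    fun x => primitive a g x - primitive a g (c + μ⁻¹ * (x - c)) with hk
  have hkw : ∀ x, (primitive a g x - primitive a g (c + μ⁻¹ * (x - c))) * w x = k x * w x := by
    intro x
    by_cases hx : x ∈ Icc a b
    · rw [hk, indicator_of_mem hx]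
    · rw [hw.2 x hx, mul_zero, mul_zero]
  have hcl : ∀ x ∈ Icc a b, |x - (c + μ⁻¹ * (x - c))| ≤ D := by
    intro x hx
    have e : x - (c + μ⁻¹ * (x - c)) = (1 - μ⁻¹) * (x - c) := by ring
    have h1 : μ⁻¹ ≤ 1 := inv_le_one_of_one_le₀ hμ
    have h2 : 1 - μ⁻¹ ≤ μ - 1 := by
      have : μ * μ⁻¹ = 1 := mul_inv_cancel₀ hμ0.ne'
      nlinarith
    rw [e, abs_mul, abs_of_nonneg (by linarith)]
    refine mul_le_mul h2 ?_ (abs_nonneg _) (by linarith)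
    rw [abs_le]; constructor <;> linarith [hx.1, hx.2, hc.1, hc.2]
  have hkb : ∀ x, k x ^ 2 ≤ D * ∫ t in (x - D)..(x + D), g t ^ 2 := by
    intro x
    by_cases hx : x ∈ Icc a b
    · rw [hk, indicator_of_mem hx]
      exact sq_primitive_sub_le hg.1 hgi (hcl x hx)
    · rw [hk, indicator_of_notMem hx, zero_pow two_ne_zero]
      exact mul_nonneg hD0
        (intervalIntegral.integral_nonneg (by linarith) fun _ _ => sq_nonneg _)
  have hkm : k ∈ L2On a b := by
    refine L2On.of_bounded (C := √(D * ∫ x, g x ^ 2)) ?_ (fun x => ?_) fun x hx => by simp [hk, hx]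
    · refine AEStronglyMeasurable.indicator ?_ measurableSet_Icc
      exact Continuous.aestronglyMeasurable (by fun_prop)
    · refine Real.abs_le_sqrt ((hkb x).trans (mul_le_mul_of_nonneg_left ?_ hD0))
      rw [intervalIntegral.integral_of_le (by linarith)]
      exact setIntegral_le_integral hg.1.integrable_sq
        (Filter.Eventually.of_forall fun _ => sq_nonneg _)
  have hk2 : ∫ x, k x ^ 2 ≤ 2 * D ^ 2 * ∫ x, g x ^ 2 := by
    rcases hD0.eq_or_lt with hD00 | hDpos
    · rw [← hD00] at hkb
      have : ∀ x, k x ^ 2 = 0 := fun x => le_antisymm (by simpa using hkb x) (sq_nonneg _)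
      simp only [this, integral_zero, ← hD00]
      simp
    · obtain ⟨i1, i2⟩ := integral_sq_window_le hg.1 (r := 2 * D) (by linarith)
      have i3 := i1.comp_sub_right D
      have i4 := integral_sub_right_eq_self (μ := volume)
        (fun z => ∫ t in z..z + 2 * D, g t ^ 2) D
      have e : ∀ x : ℝ, x - D + 2 * D = x + D := fun x => by ring
      simp only [e] at i3 i4
      calc ∫ x, k x ^ 2 ≤ ∫ x, D * ∫ t in (x - D)..(x + D), g t ^ 2 :=
            integral_mono (L2On.integrable_sq hkm) (i3.const_mul D) hkb
        _ = _ := by rw [integral_const_mul, i4, i2]; ring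
  have e1 : (∫ x, primitive a g x * w x) - ∫ x, primitive a g x * contract c μ w x
      = ∫ x, k x * w x := by
    have i5 : Integrable fun x => primitive a g (c + μ⁻¹ * (x - c)) * w x := by
      have h1 := L2On.integrable_mul hv hw
      have h2 := L2On.integrable_mul hkm hw
      refine (h1.sub h2).congr (Filter.Eventually.of_forall fun x => ?_)
      simp only [Pi.sub_apply]
      rw [← hkw x]; ring
    rw [integral_mul_contract hμ0, ← integral_sub (L2On.integrable_mul hv hw) i5]
    congr 1; ext x; rw [← hkw x]; ring
  rw [e1]
  have hcs := Real.abs_le_sqrt (sq_integral_mul_le hkm.1 hw.1)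
  refine hcs.trans ?_
  rw [Real.sqrt_mul (integral_nonneg fun _ => sq_nonneg _), ← mul_assoc]
  refine mul_le_mul_of_nonneg_right ?_ (Real.sqrt_nonneg _)
  refine Real.sqrt_le_iff.2 ⟨mul_nonneg (by linarith) (Real.sqrt_nonneg _), hk2.trans ?_⟩
  have hg0 : 0 ≤ ∫ x, g x ^ 2 := integral_nonneg fun _ => sq_nonneg _
  have e3 : (2 * D * √(∫ x, g x ^ 2)) ^ 2 = 4 * D ^ 2 * ∫ x, g x ^ 2 := by
    rw [mul_pow, Real.sq_sqrt hg0]; ring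
  rw [e3]
  nlinarith [mul_nonneg (sq_nonneg D) hg0]

/-- A solution of the regularized equation with a primitive on the right changes little under
contractions of the interval. -/
theorem rieszForm_contract_sub_le {σ a b c μ δ : ℝ} (hσ₀ : 0 < σ) (hσ : σ < 1)
    (hc : c ∈ Icc a b) (hμ : 1 ≤ μ) (hδ : 0 ≤ δ) {g w : ℝ → ℝ} (hg : g ∈ L2On a b)
    (h0 : ∫ x in a..b, g x = 0) (hw : w ∈ L2On a b)
    (heq : ∀ φ ∈ L2On a b, rieszForm σ w φ + δ * ∫ x, w x * φ x = ∫ x, primitive a g x * φ x) :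
    rieszForm σ (contract c μ w - w) (contract c μ w - w)
      ≤ 5 * ((μ - 1) * (b - a)) * (√(∫ x, g x ^ 2) * √(∫ x, w x ^ 2)) := by
  have hab : a ≤ b := hc.1.trans hc.2
  have hμ0 : 0 < μ := by linarith
  have hD := contract_mem hc hμ hw
  set W : L2On a b := ⟨w, hw⟩ with hW
  set Z : L2On a b := ⟨contract c μ w, hD⟩ with hZ
  have hexp : rieszForm σ (contract c μ w - w) (contract c μ w - w)
      = rieszForm σ (contract c μ w) (contract c μ w) - 2 * rieszForm σ w (contract c μ w)
        + rieszForm σ w w := by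
    have h1 : rieszBilin hσ₀ hab (Z - W) (Z - W)
        = rieszBilin hσ₀ hab Z Z - rieszBilin hσ₀ hab W Z - rieszBilin hσ₀ hab Z W
          + rieszBilin hσ₀ hab W W := by
      rw [LinearMap.BilinForm.sub_left, LinearMap.BilinForm.sub_right,
        LinearMap.BilinForm.sub_right]; ring
    simp only [rieszBilin_apply, hZ, hW] at h1
    have h2 := rieszForm_comm (σ := σ) (contract c μ w) w
    rw [h2] at h1
    have h3 : ((⟨contract c μ w, hD⟩ - ⟨w, hw⟩ : L2On a b) : ℝ → ℝ) = contract c μ w - w := rfl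
    rw [h3] at h1
    rw [h1]; ring
  have hsq : 0 ≤ ∫ x, (contract c μ w x - w x) ^ 2 := integral_nonneg fun _ => sq_nonneg _
  have hsqe : ∫ x, (contract c μ w x - w x) ^ 2
      = (∫ x, contract c μ w x ^ 2) - 2 * (∫ x, w x * contract c μ w x) + ∫ x, w x ^ 2 := by
    rw [← integral_const_mul, ← integral_sub (L2On.integrable_sq hD)
      ((L2On.integrable_mul hw hD).const_mul 2), ← integral_add
      (f := fun x => contract c μ w x ^ 2 - 2 * (w x * contract c μ w x))
      ((L2On.integrable_sq hD).sub ((L2On.integrable_mul hw hD).const_mul 2))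
      (L2On.integrable_sq hw)]
    congr 1; ext x; ring
  rw [integral_contract_sq hμ0] at hsqe
  rw [rieszForm_contract hσ₀ hc hμ hw] at hexp
  have e1 := heq _ hD
  have e2 := heq _ hw
  have hww : ∫ x, w x * w x = ∫ x, w x ^ 2 := by congr 1; ext x; ring
  rw [hww] at e2
  have hR := rieszForm_nonneg hσ₀ hσ hab hw
  have hw0 : 0 ≤ ∫ x, w x ^ 2 := integral_nonneg fun _ => sq_nonneg _
  -- Contraction multiplies `∫ w²` by exactly `μ`. With the form's factor weakened to `μ` as well,
  -- the equation tested with `w` and with its contraction turns all `δ` terms into `-δ ∫ (contract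
  -- c μ w - w)²`, which is dropped. What remains is `(μ - 1)` times the pairing of the primitive
  -- with `w`, plus twice the translation error: together the factor `1 + 4 = 5`.
  have hpow : μ ^ (1 - σ) ≤ μ := by
    calc μ ^ (1 - σ) ≤ μ ^ (1 : ℝ) := Real.rpow_le_rpow_of_exponent_le hμ (by linarith)
      _ = μ := Real.rpow_one μ
  have hd1 := abs_integral_sub_contract_le hc hμ hg hw h0
  have hvw := integral_primitive_mul_le hab hg h0 hw
  have hd2 := (abs_le.1 hd1).2
  have k1 : μ ^ (1 - σ) * rieszForm σ w w ≤ μ * rieszForm σ w w :=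
    mul_le_mul_of_nonneg_right hpow hR
  have k2 : 0 ≤ δ * ((μ * ∫ x, w x ^ 2) - 2 * (∫ x, w x * contract c μ w x) + ∫ x, w x ^ 2) := by
    rw [← hsqe]; exact mul_nonneg hδ hsq
  have k3 : (μ - 1) * ∫ x, primitive a g x * w x
      ≤ (μ - 1) * ((b - a) * (√(∫ x, g x ^ 2) * √(∫ x, w x ^ 2))) :=
    mul_le_mul_of_nonneg_left hvw (by linarith)
  rw [hexp]
  nlinarith

theorem rieszForm_self_le_of_equation {σ a b δ : ℝ}
    (hab : a ≤ b) (hδ : 0 ≤ δ) {g w : ℝ → ℝ} (hg : g ∈ L2On a b)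
    (h0 : ∫ x in a..b, g x = 0) (hw : w ∈ L2On a b)
    (heq : ∀ φ ∈ L2On a b, rieszForm σ w φ + δ * ∫ x, w x * φ x = ∫ x, primitive a g x * φ x) :
    rieszForm σ w w ≤ (b - a) * (√(∫ x, g x ^ 2) * √(∫ x, w x ^ 2)) := by
  have e2 := heq _ hw
  have hvw := integral_primitive_mul_le hab hg h0 hw
  have : 0 ≤ δ * ∫ x, w x * w x :=
    mul_nonneg hδ (integral_nonneg fun x => mul_self_nonneg _)
  linarith

end RieszForm

section RieszForm

open MeasureTheory Set

/-! ### Regularity of the densities of smooth potentials -/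

theorem sqrt_integral_sq_add_le {X : Type*} [MeasurableSpace X] {μ : Measure X} {f g : X → ℝ}
    (hf : MemLp f 2 μ) (hg : MemLp g 2 μ) :
    √(∫ x, (f x + g x) ^ 2 ∂μ) ≤ √(∫ x, f x ^ 2 ∂μ) + √(∫ x, g x ^ 2 ∂μ) := by
  have hfg : Integrable (fun x => f x * g x) μ := hf.integrable_mul hg
  have hf0 : 0 ≤ ∫ x, f x ^ 2 ∂μ := integral_nonneg fun _ => sq_nonneg _
  have hg0 : 0 ≤ ∫ x, g x ^ 2 ∂μ := integral_nonneg fun _ => sq_nonneg _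
  have hcs := (le_abs_self _).trans (Real.abs_le_sqrt (sq_integral_mul_le hf hg))
  rw [Real.sqrt_mul hf0] at hcs
  have e : ∫ x, (f x + g x) ^ 2 ∂μ
      = (∫ x, f x ^ 2 ∂μ) + 2 * (∫ x, f x * g x ∂μ) + ∫ x, g x ^ 2 ∂μ := by
    rw [← integral_const_mul, ← integral_add hf.integrable_sq (hfg.const_mul 2),
      ← integral_add (f := fun x => f x ^ 2 + 2 * (f x * g x))
        (hf.integrable_sq.add (hfg.const_mul 2)) hg.integrable_sq]
    congr 1; ext x; ring
  refine Real.sqrt_le_iff.2 ⟨by positivity, ?_⟩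
  rw [e, add_sq, Real.sq_sqrt hf0, Real.sq_sqrt hg0]
  linarith

theorem exp_sub_one_le_two_mul {θ : ℝ} (h0 : 0 ≤ θ) (h1 : θ ≤ 1) :
    θ ≤ Real.exp θ - 1 ∧ Real.exp θ - 1 ≤ 2 * θ := by
  constructor
  · linarith [Real.add_one_le_exp θ]
  · have := Real.abs_exp_sub_one_le (x := θ) (by rwa [abs_of_nonneg h0])
    rw [abs_of_nonneg h0] at this
    exact (le_abs_self _).trans this

/-! ### The a priori estimate by dyadic contractions. -/

section APriori

variable {σ a b c s t : ℝ}

/-- The constant in the estimate of increments of primitives along a contraction. -/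
noncomputable def incrementConst (σ L : ℝ) : ℝ :=
  16 / ((1 - σ) * (2 - σ) * L) * (2 * L) ^ (3 - σ)

theorem incrementConst_pos {σ L : ℝ} (hσ : σ < 1) (hL : 0 < L) : 0 < incrementConst σ L := by
  have : 0 < 1 - σ := by linarith
  have : 0 < 2 - σ := by linarith
  unfold incrementConst
  positivity

/-- At distance at least half the interval from `c`, the dilation by `exp θ` moves a point by
between `θ L / 2` and `2 θ L`, with `L = b - a`. The pointwise increment estimate therefore applies
with `D = 2 θ L`; dividing `D^(3-σ)` by the displacement leaves `θ^(2-σ)`. -/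
theorem setIntegral_sq_increment_le (hσ₀ : 0 < σ) (hσ : σ < 1) (hab : a < b) (hc : c ∈ Icc a b)
    (hS : Icc s t ⊆ Icc a b) (hdist : ∀ x ∈ Icc s t, (b - a) / 2 ≤ |x - c|) {f : ℝ → ℝ}
    (hf : f ∈ L2On a b) {θ : ℝ} (hθ0 : 0 < θ) (hθ1 : θ ≤ 1) :
    ∫ x in Icc s t, (primitive c f (c + Real.exp θ * (x - c)) - primitive c f x) ^ 2
      ≤ incrementConst σ (b - a) * θ ^ (2 - σ) * rieszForm σ f f := by
  set F := primitive c f with hF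
  have hFc : Continuous F := continuous_primitive' (L2On.integrable hf)
  set L := b - a with hL
  have hL0 : 0 < L := sub_pos.2 hab
  set μ := Real.exp θ with hμ
  have hμ0 : 0 < μ := Real.exp_pos θ
  obtain ⟨hμ1, hμ2⟩ := exp_sub_one_le_two_mul hθ0.le hθ1
  set D := 2 * θ * L with hD
  have hD0 : 0 < D := by positivity
  obtain ⟨hNi, hN⟩ := integral_increments_le hσ₀ hσ hab.le hf hD0 c
  have hN0 : ∀ x, 0 ≤ increments F D x := fun x => increments_nonneg hD0.le x
  have hNi2 : Integrable fun x => increments F D (c + μ * (x - c)) :=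
    integrable_comp_affine hNi hμ0.ne' c
  have hN2 : ∫ x, increments F D (c + μ * (x - c)) ≤ ∫ x, increments F D x := by
    rw [integral_comp_affine _ hμ0]
    exact mul_le_of_le_one_left (integral_nonneg hN0) (inv_le_one_of_one_le₀ (by linarith))
  have hptw : ∀ x ∈ Icc s t, (F (c + μ * (x - c)) - F x) ^ 2
      ≤ 4 / (θ * L) * (increments F D x + increments F D (c + μ * (x - c))) := by
    intro x hx
    have e : |(c + μ * (x - c)) - x| = (μ - 1) * |x - c| := by
      rw [show (c + μ * (x - c)) - x = (μ - 1) * (x - c) by ring, abs_mul,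
        abs_of_nonneg (by linarith)]
    have hxc : |x - c| ≤ L := by
      have := hS hx
      rw [abs_le]; constructor <;> linarith [this.1, this.2, hc.1, hc.2]
    have h1 : |(c + μ * (x - c)) - x| ≤ D := by
      rw [e, hD]; exact mul_le_mul hμ2 hxc (abs_nonneg _) (by linarith)
    have h2 : θ * (L / 2) ≤ |(c + μ * (x - c)) - x| := by
      rw [e]; exact mul_le_mul hμ1 (hdist x hx) (by positivity) (by linarith)
    have h3 := sq_sub_mul_le_increments hFc h1
    have h4 : (F (c + μ * (x - c)) - F x) ^ 2 * (θ * (L / 2))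
        ≤ 2 * (increments F D x + increments F D (c + μ * (x - c))) :=
      (mul_le_mul_of_nonneg_left h2 (sq_nonneg _)).trans h3
    rw [div_mul_eq_mul_div, le_div_iff₀ (by positivity)]
    linarith
  have hcont : Continuous fun x => (F (c + μ * (x - c)) - F x) ^ 2 := by fun_prop
  calc ∫ x in Icc s t, (F (c + μ * (x - c)) - F x) ^ 2
      ≤ ∫ x in Icc s t, 4 / (θ * L) * (increments F D x + increments F D (c + μ * (x - c))) :=
        setIntegral_mono_on hcont.continuousOn.integrableOn_Icc
          ((hNi.add hNi2).const_mul _).integrableOn measurableSet_Icc hptw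
    _ ≤ ∫ x, 4 / (θ * L) * (increments F D x + increments F D (c + μ * (x - c))) := by
        refine setIntegral_le_integral ((hNi.add hNi2).const_mul _)
          (Filter.Eventually.of_forall fun x => ?_)
        exact mul_nonneg (by positivity) (add_nonneg (hN0 _) (hN0 _))
    _ = 4 / (θ * L) * ((∫ x, increments F D x) + ∫ x, increments F D (c + μ * (x - c))) := by
        rw [integral_const_mul, integral_add hNi hNi2]
    _ ≤ 4 / (θ * L) * (2 * (2 / ((1 - σ) * (2 - σ)) * D ^ (3 - σ) * rieszForm σ f f)) := by
        refine mul_le_mul_of_nonneg_left ?_ (by positivity)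
        linarith
    _ = _ := by
        have e1 : D ^ (3 - σ) = θ ^ (2 - σ) * θ * (2 * L) ^ (3 - σ) := by
          rw [hD, show 2 * θ * L = θ * (2 * L) by ring, Real.mul_rpow hθ0.le (by positivity),
            show 3 - σ = (2 - σ) + 1 by ring, Real.rpow_add hθ0, Real.rpow_one]
        have h1 : (1 - σ) ≠ 0 := by linarith
        have h2 : (2 - σ) ≠ 0 := by linarith
        rw [e1, incrementConst]
        field_simp
        ring

/-- Means of `f` along contractions about `c`. -/
noncomputable def contractionMean (c : ℝ) (f : ℝ → ℝ) (θ x : ℝ) : ℝ :=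
  (primitive c f (c + Real.exp θ * (x - c)) - primitive c f x) / (θ * (x - c))

theorem memLp_contractionMean (hab : a < b) (hdist : ∀ x ∈ Icc s t, (b - a) / 2 ≤ |x - c|)
    {f : ℝ → ℝ} (hf : Integrable f) {θ : ℝ} (hθ0 : 0 < θ) :
    MemLp (contractionMean c f θ) 2 (volume.restrict (Icc s t)) := by
  have hFc : Continuous (primitive c f) := continuous_primitive' hf
  have hcon : ContinuousOn (contractionMean c f θ) (Icc s t) := by
    refine ContinuousOn.div (Continuous.continuousOn (by fun_prop)) (by fun_prop) fun x hx => ?_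
    have h1 := hdist x hx
    have : x - c ≠ 0 := by
      intro h; rw [h, abs_zero] at h1; linarith
    exact mul_ne_zero hθ0.ne' this
  rw [memLp_two_iff_integrable_sq (hcon.aestronglyMeasurable measurableSet_Icc)]
  exact (hcon.pow 2).integrableOn_Icc

/-- The difference of the means at scales `θ` and `2 θ` is a second difference of the primitive of
`f`. It is thus a first difference, at scale `θ`, of the primitive of `contract c (exp θ) f - f`, to
which the increment estimate applies. -/
theorem setIntegral_sq_contractionMean_sub_le (hσ₀ : 0 < σ) (hσ : σ < 1) (hab : a < b)
    (hc : c ∈ Icc a b) (hS : Icc s t ⊆ Icc a b)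
    (hdist : ∀ x ∈ Icc s t, (b - a) / 2 ≤ |x - c|) {f : ℝ → ℝ}
    (hf : f ∈ L2On a b) {θ : ℝ} (hθ0 : 0 < θ) (hθ1 : θ ≤ 1) :
    ∫ x in Icc s t, (contractionMean c f θ x - contractionMean c f (2 * θ) x) ^ 2
      ≤ incrementConst σ (b - a) / (θ * (b - a)) ^ 2 * θ ^ (2 - σ)
        * rieszForm σ (contract c (Real.exp θ) f - f) (contract c (Real.exp θ) f - f) := by
  have hL0 : 0 < b - a := sub_pos.2 hab
  set μ := Real.exp θ with hμ
  have hμ0 : 0 < μ := Real.exp_pos θ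
  have hμ1 : 1 ≤ μ := by linarith [(exp_sub_one_le_two_mul hθ0.le hθ1).1]
  have hD := contract_mem hc hμ1 hf
  have hd : contract c μ f - f ∈ L2On a b := (L2On a b).sub_mem hD hf
  have hH : ∀ x, primitive c (contract c μ f - f) x
      = primitive c f (c + μ * (x - c)) - primitive c f x := fun x => by
    rw [← primitive_contract hμ0]
    exact intervalIntegral.integral_sub (L2On.integrable hD).intervalIntegrable
      (L2On.integrable hf).intervalIntegrable
  have key := setIntegral_sq_increment_le hσ₀ hσ hab hc hS hdist hd hθ0 hθ1
  have m1 := memLp_contractionMean hab hdist (L2On.integrable hf) hθ0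
  have m2 := memLp_contractionMean hab hdist (L2On.integrable hf) (show 0 < 2 * θ by linarith)
  have hHc : Continuous (primitive c (contract c μ f - f)) :=
    continuous_primitive' (L2On.integrable hd)
  have hcont : Continuous fun x => (primitive c (contract c μ f - f) (c + μ * (x - c))
    - primitive c (contract c μ f - f) x) ^ 2 := by fun_prop
  calc ∫ x in Icc s t, (contractionMean c f θ x - contractionMean c f (2 * θ) x) ^ 2
      ≤ ∫ x in Icc s t, 1 / (θ * (b - a)) ^ 2 *
        (primitive c (contract c μ f - f) (c + μ * (x - c))
          - primitive c (contract c μ f - f) x) ^ 2 := by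
        refine setIntegral_mono_on (m1.sub m2).integrable_sq
          (hcont.continuousOn.integrableOn_Icc.const_mul _) measurableSet_Icc fun x hx => ?_
        have h1 := hdist x hx
        have hxc : x - c ≠ 0 := by
          intro h; rw [h, abs_zero] at h1; linarith
        have e2 : Real.exp (2 * θ) = μ * μ := by rw [hμ, ← Real.exp_add]; congr 1; ring
        have e3 : c + μ * (c + μ * (x - c) - c) = c + μ * μ * (x - c) := by ring
        have e4 : contractionMean c f θ x - contractionMean c f (2 * θ) x
            = -(primitive c (contract c μ f - f) (c + μ * (x - c))
              - primitive c (contract c μ f - f) x) / (2 * (θ * (x - c))) := by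
          rw [hH, hH, e3, contractionMean, contractionMean, e2, ← hμ]
          field_simp
          ring
        rw [e4, div_pow, neg_sq, div_mul_eq_mul_div, one_mul]
        refine div_le_div_of_nonneg_left (sq_nonneg _) (by positivity) ?_
        have h5 : ((b - a) / 2) ^ 2 ≤ (x - c) ^ 2 := by
          rw [← sq_abs (x - c)]
          exact pow_le_pow_left₀ (by linarith) h1 2
        have : (2 * (θ * (x - c))) ^ 2 = θ ^ 2 * (4 * (x - c) ^ 2) := by ring
        rw [this, mul_pow]
        refine mul_le_mul_of_nonneg_left ?_ (sq_nonneg θ)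
        linarith
    _ = 1 / (θ * (b - a)) ^ 2 * ∫ x in Icc s t,
        (primitive c (contract c μ f - f) (c + μ * (x - c))
          - primitive c (contract c μ f - f) x) ^ 2 := integral_const_mul _ _
    _ ≤ _ := by
        refine (mul_le_mul_of_nonneg_left key (by positivity)).trans (le_of_eq ?_)
        field_simp

theorem setIntegral_sq_contractionMean_one_le (hσ₀ : 0 < σ) (hσ : σ < 1) (hab : a < b)
    (hc : c ∈ Icc a b) (hS : Icc s t ⊆ Icc a b)
    (hdist : ∀ x ∈ Icc s t, (b - a) / 2 ≤ |x - c|) {f : ℝ → ℝ} (hf : f ∈ L2On a b) :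
    ∫ x in Icc s t, contractionMean c f 1 x ^ 2
      ≤ 4 * incrementConst σ (b - a) / (b - a) ^ 2 * rieszForm σ f f := by
  have hL0 : 0 < b - a := sub_pos.2 hab
  have key := setIntegral_sq_increment_le hσ₀ hσ hab hc hS hdist hf one_pos le_rfl
  have m1 := memLp_contractionMean hab hdist (L2On.integrable hf) one_pos
  have hHc : Continuous (primitive c f) := continuous_primitive' (L2On.integrable hf)
  have hcont : Continuous fun x =>
    (primitive c f (c + Real.exp 1 * (x - c)) - primitive c f x) ^ 2 := by fun_prop
  calc ∫ x in Icc s t, contractionMean c f 1 x ^ 2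
      ≤ ∫ x in Icc s t, 4 / (b - a) ^ 2 *
        (primitive c f (c + Real.exp 1 * (x - c)) - primitive c f x) ^ 2 := by
        refine setIntegral_mono_on m1.integrable_sq
          (hcont.continuousOn.integrableOn_Icc.const_mul _) measurableSet_Icc fun x hx => ?_
        have h1 := hdist x hx
        have h5 : ((b - a) / 2) ^ 2 ≤ (x - c) ^ 2 := by
          rw [← sq_abs (x - c)]
          exact pow_le_pow_left₀ (by linarith) h1 2
        have h6 : 0 < (x - c) ^ 2 := lt_of_lt_of_le (by positivity) h5
        rw [contractionMean, div_pow, one_mul, div_mul_eq_mul_div,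
          div_le_div_iff₀ h6 (by positivity)]
        nlinarith [sq_nonneg (primitive c f (c + Real.exp 1 * (x - c)) - primitive c f x)]
    _ = 4 / (b - a) ^ 2 * ∫ x in Icc s t,
        (primitive c f (c + Real.exp 1 * (x - c)) - primitive c f x) ^ 2 := integral_const_mul _ _
    _ ≤ _ := by
        refine (mul_le_mul_of_nonneg_left key (by positivity)).trans (le_of_eq ?_)
        rw [Real.one_rpow]
        ring

/-- The means are difference quotients at `0` of the primitive along the curve `r ↦ c + exp r * (x -
c)`, whose initial velocity is `x - c`. -/
theorem tendsto_contractionMean {f : ℝ → ℝ} {x : ℝ} (hx : x ≠ c)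
    (hd : HasDerivAt (primitive c f) (f x) x) {θ : ℕ → ℝ} (hθ : ∀ n, 0 < θ n)
    (hlim : Filter.Tendsto θ Filter.atTop (nhds 0)) :
    Filter.Tendsto (fun n => contractionMean c f (θ n) x) Filter.atTop (nhds (f x)) := by
  have hxc : x - c ≠ 0 := sub_ne_zero.2 hx
  have h1 : HasDerivAt (fun r => primitive c f (c + Real.exp r * (x - c))) (f x * (x - c)) 0 := by
    have h2 : HasDerivAt (fun r : ℝ => c + Real.exp r * (x - c)) (Real.exp 0 * (x - c)) 0 :=
      ((Real.hasDerivAt_exp 0).mul_const _).const_add c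
    rw [Real.exp_zero, one_mul] at h2
    have h3 : HasDerivAt (primitive c f) (f x) (c + Real.exp 0 * (x - c)) := by
      rw [Real.exp_zero, one_mul, add_sub_cancel]; exact hd
    exact h3.comp (0 : ℝ) h2
  have h4 := h1.tendsto_slope_zero
  have h5 : Filter.Tendsto θ Filter.atTop (nhdsWithin 0 {0}ᶜ) :=
    tendsto_nhdsWithin_iff.2 ⟨hlim, Filter.Eventually.of_forall fun n => (hθ n).ne'⟩
  have h6 := (h4.comp h5).div_const (x - c)
  rw [mul_div_cancel_right₀ _ hxc] at h6
  refine h6.congr fun n => ?_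
  simp only [Function.comp_apply, zero_add, Real.exp_zero, one_mul, add_sub_cancel, smul_eq_mul,
    contractionMean]
  field_simp

/-- Fatou's lemma, carried out with nonnegative extended integrals. -/
theorem setIntegral_sq_le_of_tendsto {S : Set ℝ} {f : ℝ → ℝ} {q : ℕ → ℝ → ℝ} {B : ℝ}
    (hB : 0 ≤ B) (hf : MemLp f 2 (volume.restrict S))
    (hq : ∀ n, MemLp (q n) 2 (volume.restrict S)) (hle : ∀ n, ∫ x in S, q n x ^ 2 ≤ B)
    (hlim : ∀ᵐ x ∂volume.restrict S,
      Filter.Tendsto (fun n => q n x) Filter.atTop (nhds (f x))) :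
    ∫ x in S, f x ^ 2 ≤ B := by
  have h1 : ∫⁻ x in S, ENNReal.ofReal (f x ^ 2) ≤ ENNReal.ofReal B := by
    calc ∫⁻ x in S, ENNReal.ofReal (f x ^ 2)
        = ∫⁻ x in S, Filter.liminf (fun n => ENNReal.ofReal (q n x ^ 2)) Filter.atTop := by
          refine lintegral_congr_ae ?_
          filter_upwards [hlim] with x hx
          exact ((ENNReal.continuous_ofReal.tendsto _).comp (hx.pow 2)).liminf_eq.symm
      _ ≤ Filter.liminf (fun n => ∫⁻ x in S, ENNReal.ofReal (q n x ^ 2)) Filter.atTop :=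
          lintegral_liminf_le' fun n => ((hq n).1.aemeasurable.pow_const 2).ennreal_ofReal
      _ ≤ ENNReal.ofReal B := by
          refine Filter.liminf_le_of_le (by isBoundedDefault) fun y hy => ?_
          obtain ⟨n, hn⟩ := hy.exists
          refine hn.trans ?_
          rw [← ofReal_integral_eq_lintegral_ofReal (hq n).integrable_sq
            (Filter.Eventually.of_forall fun _ => sq_nonneg _)]
          exact ENNReal.ofReal_le_ofReal (hle n)
  rw [← ofReal_integral_eq_lintegral_ofReal hf.integrable_sq
    (Filter.Eventually.of_forall fun _ => sq_nonneg _)] at h1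
  exact (ENNReal.ofReal_le_ofReal_iff hB).1 h1

/-- The means of `w` at scales `2^(-n)` are telescoped. The squared step is a product of `θ^(-2)`
from the difference quotient, `θ^(2-σ)` from the increments and `θ` from the closeness of `w` to its
contraction, in all `θ^(1-σ)`. Since `σ < 1` the steps form a geometric series; the means converge
to `w` almost everywhere, and the bound passes to the limit. -/
theorem setIntegral_sq_le_of_equation (hσ₀ : 0 < σ) (hσ : σ < 1) (hab : a < b)
    (hc : c ∈ Icc a b) (hS : Icc s t ⊆ Icc a b)
    (hdist : ∀ x ∈ Icc s t, (b - a) / 2 ≤ |x - c|) {δ : ℝ} (hδ : 0 ≤ δ) {g w : ℝ → ℝ}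
    (hg : g ∈ L2On a b) (h0 : ∫ x in a..b, g x = 0) (hw : w ∈ L2On a b)
    (heq : ∀ φ ∈ L2On a b, rieszForm σ w φ + δ * ∫ x, w x * φ x = ∫ x, primitive a g x * φ x) :
    ∫ x in Icc s t, w x ^ 2 ≤ 10 * incrementConst σ (b - a) / (b - a) /
      (1 - (1 / 2 : ℝ) ^ ((1 - σ) / 2)) ^ 2 * (√(∫ x, g x ^ 2) * √(∫ x, w x ^ 2)) := by
  have hL0 : 0 < b - a := sub_pos.2 hab
  set K := incrementConst σ (b - a) with hK
  have hK0 : 0 < K := incrementConst_pos hσ hL0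
  set Y := √(∫ x, g x ^ 2) * √(∫ x, w x ^ 2) with hY
  have hY0 : 0 ≤ Y := by positivity
  -- Each step uses `5 (exp θ - 1) ≤ 10 θ`; the mean at scale `1` needs only the factor `4`, so one
  -- constant serves both.
  set A := 10 * K / (b - a) * Y with hA
  have hA0 : 0 ≤ A := by positivity
  set ρ := (1 / 2 : ℝ) ^ ((1 - σ) / 2) with hρ
  have hρ0 : 0 < ρ := by positivity
  have hρ1 : ρ < 1 := Real.rpow_lt_one (by norm_num) (by norm_num) (by linarith)
  set θ : ℕ → ℝ := fun n => (1 / 2 : ℝ) ^ n with hθ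
  have hθ0 : ∀ n, 0 < θ n := fun n => by positivity
  have hθ1 : ∀ n, θ n ≤ 1 := fun n => pow_le_one₀ (by norm_num) (by norm_num)
  have hwi := L2On.integrable hw
  have hm : ∀ n, MemLp (contractionMean c w (θ n)) 2 (volume.restrict (Icc s t)) :=
    fun n => memLp_contractionMean hab hdist hwi (hθ0 n)
  have hstep : ∀ n, √(∫ x in Icc s t, (contractionMean c w (θ (n + 1)) x
      - contractionMean c w (θ n) x) ^ 2) ≤ √A * ρ ^ (n + 1) := by
    intro n
    have e1 : 2 * θ (n + 1) = θ n := by simp only [hθ, pow_succ]; ring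
    have h1 := setIntegral_sq_contractionMean_sub_le hσ₀ hσ hab hc hS hdist hw (hθ0 (n + 1))
      (hθ1 (n + 1))
    rw [e1] at h1
    obtain ⟨hμ1, hμ2⟩ := exp_sub_one_le_two_mul (hθ0 (n + 1)).le (hθ1 (n + 1))
    have h2 := rieszForm_contract_sub_le hσ₀ hσ hc
      (show 1 ≤ Real.exp (θ (n + 1)) by linarith [hθ0 (n + 1)]) hδ hg h0 hw heq
    have h3 : rieszForm σ (contract c (Real.exp (θ (n + 1))) w - w)
        (contract c (Real.exp (θ (n + 1))) w - w) ≤ 10 * θ (n + 1) * (b - a) * Y := by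
      refine h2.trans ?_
      rw [← hY]
      refine mul_le_mul_of_nonneg_right ?_ hY0
      nlinarith
    have hsq : (√A * ρ ^ (n + 1)) ^ 2 = A * θ (n + 1) ^ (1 - σ) := by
      rw [mul_pow, Real.sq_sqrt hA0]
      congr 1
      simp only [hρ, hθ]
      rw [← Real.rpow_natCast, ← Real.rpow_natCast, ← Real.rpow_natCast,
        ← Real.rpow_mul (by positivity), ← Real.rpow_mul (by positivity),
        ← Real.rpow_mul (by positivity)]
      congr 1; push_cast; ring
    refine Real.sqrt_le_iff.2 ⟨by positivity, ?_⟩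
    rw [hsq]
    refine h1.trans ((mul_le_mul_of_nonneg_left h3 ?_).trans (le_of_eq ?_))
    · have := hθ0 (n + 1); positivity
    · have h5 := hθ0 (n + 1)
      have e2 : θ (n + 1) ^ (2 - σ) = θ (n + 1) ^ (1 - σ) * θ (n + 1) := by
        rw [show 2 - σ = (1 - σ) + 1 by ring, Real.rpow_add h5, Real.rpow_one]
      rw [e2, hA, ← hK]
      field_simp
  have hzero : √(∫ x in Icc s t, contractionMean c w (θ 0) x ^ 2) ≤ √A := by
    have e0 : θ 0 = 1 := by simp [hθ]
    rw [e0]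
    refine Real.sqrt_le_sqrt ?_
    refine (setIntegral_sq_contractionMean_one_le hσ₀ hσ hab hc hS hdist hw).trans ?_
    have h1 := rieszForm_self_le_of_equation hab.le hδ hg h0 hw heq
    refine (mul_le_mul_of_nonneg_left h1 (by positivity)).trans ?_
    rw [← hY, ← hK, hA]
    have : 4 * K / (b - a) ^ 2 * ((b - a) * Y) = 4 * K / (b - a) * Y := by field_simp
    rw [this]
    gcongr
    norm_num
  have hbound : ∀ n, √(∫ x in Icc s t, contractionMean c w (θ n) x ^ 2)
      ≤ √A * ∑ i ∈ Finset.range (n + 1), ρ ^ i := by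
    intro n
    induction n with
    | zero => simpa using hzero
    | succ n ih =>
      have h1 := sqrt_integral_sq_add_le (hm n) ((hm (n + 1)).sub (hm n))
      simp only [Pi.sub_apply, add_sub_cancel] at h1
      rw [Finset.sum_range_succ, mul_add]
      exact h1.trans (add_le_add ih (hstep n))
  have hgeo : ∀ n, ∫ x in Icc s t, contractionMean c w (θ n) x ^ 2 ≤ A / (1 - ρ) ^ 2 := by
    intro n
    have h1 : ∑ i ∈ Finset.range (n + 1), ρ ^ i ≤ 1 / (1 - ρ) := by
      rw [geom_sum_eq hρ1.ne, ← neg_div_neg_eq, neg_sub, neg_sub]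
      exact div_le_div_of_nonneg_right (by linarith [pow_pos hρ0 (n + 1)]) (by linarith)
    have h2 : √(∫ x in Icc s t, contractionMean c w (θ n) x ^ 2) ≤ √A * (1 / (1 - ρ)) :=
      (hbound n).trans (mul_le_mul_of_nonneg_left h1 (Real.sqrt_nonneg _))
    rw [Real.sqrt_le_left (mul_nonneg (Real.sqrt_nonneg _)
      (div_nonneg zero_le_one (by linarith))), mul_pow, Real.sq_sqrt hA0] at h2
    calc _ ≤ _ := h2
      _ = _ := by rw [div_pow, one_pow]; ring
  have hae : ∀ᵐ x ∂volume.restrict (Icc s t),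
      Filter.Tendsto (fun n => contractionMean c w (θ n) x) Filter.atTop (nhds (w x)) := by
    have h1 := ae_restrict_of_ae (s := Icc s t)
      (LocallyIntegrable.ae_hasDerivAt_integral hwi.locallyIntegrable)
    filter_upwards [h1, ae_restrict_mem measurableSet_Icc] with x hx hxS
    refine tendsto_contractionMean ?_ (hx c) hθ0
      (tendsto_pow_atTop_nhds_zero_of_lt_one (by norm_num) (by norm_num))
    intro hxc
    have := hdist x hxS
    rw [hxc, sub_self, abs_zero] at this
    linarith
  have hfin := setIntegral_sq_le_of_tendsto (div_nonneg hA0 (sq_nonneg _)) (hw.1.restrict _) hm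
    hgeo hae
  refine hfin.trans (le_of_eq ?_)
  rw [hA]; ring

/-- The constant in the a priori estimate for the regularized equation. -/
noncomputable def aPrioriConst (σ L : ℝ) : ℝ :=
  20 * incrementConst σ L / L / (1 - (1 / 2 : ℝ) ^ ((1 - σ) / 2)) ^ 2

/-- The density of a potential in `H¹₀` is bounded in `L²`, uniformly in the regularization. -/
theorem sqrt_integral_sq_le_of_equation (hσ₀ : 0 < σ) (hσ : σ < 1) (hab : a < b) {δ : ℝ}
    (hδ : 0 ≤ δ) {g w : ℝ → ℝ}
    (hg : g ∈ L2On a b) (h0 : ∫ x in a..b, g x = 0) (hw : w ∈ L2On a b)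
    (heq : ∀ φ ∈ L2On a b, rieszForm σ w φ + δ * ∫ x, w x * φ x = ∫ x, primitive a g x * φ x) :
    √(∫ x, w x ^ 2) ≤ aPrioriConst σ (b - a) * √(∫ x, g x ^ 2) := by
  set m := (a + b) / 2 with hm
  -- A contraction about `c` gives information only away from `c`: the right half is treated with
  -- centre `a`, the left half with centre `b`.
  have h1 := setIntegral_sq_le_of_equation hσ₀ hσ hab (c := a) (s := m) (t := b)
    (left_mem_Icc.2 hab.le) (Icc_subset_Icc_left (by linarith))
    (fun x hx => by
      have := hx.1
      rw [abs_of_nonneg (by linarith)]; linarith) hδ hg h0 hw heq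
  have h2 := setIntegral_sq_le_of_equation hσ₀ hσ hab (c := b) (s := a) (t := m)
    (right_mem_Icc.2 hab.le) (Icc_subset_Icc_right (by linarith))
    (fun x hx => by
      have := hx.2
      rw [abs_of_nonpos (by linarith)]; linarith) hδ hg h0 hw heq
  have h3 : ∫ x, w x ^ 2 ≤ (∫ x in Icc a m, w x ^ 2) + ∫ x in Icc m b, w x ^ 2 := by
    have hsq := L2On.integrable_sq hw
    calc ∫ x, w x ^ 2 = ∫ x in Icc a b, w x ^ 2 := by
          rw [setIntegral_eq_integral_of_forall_compl_eq_zero]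
          intro x hx; simp [hw.2 x hx]
      _ = ∫ x in a..b, w x ^ 2 := by
          rw [intervalIntegral.integral_of_le hab.le, integral_Icc_eq_integral_Ioc]
      _ = (∫ x in a..m, w x ^ 2) + ∫ x in m..b, w x ^ 2 :=
          (intervalIntegral.integral_add_adjacent_intervals hsq.intervalIntegrable
            hsq.intervalIntegrable).symm
      _ ≤ _ := by
          rw [intervalIntegral.integral_of_le (by linarith), integral_Icc_eq_integral_Ioc,
            intervalIntegral.integral_of_le (by linarith), integral_Icc_eq_integral_Ioc]
  have hw0 : 0 ≤ ∫ x, w x ^ 2 := integral_nonneg fun _ => sq_nonneg _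
  set y := √(∫ x, w x ^ 2) with hy
  have hy2 : y ^ 2 = ∫ x, w x ^ 2 := Real.sq_sqrt hw0
  have h4 : y ^ 2 ≤ aPrioriConst σ (b - a) * √(∫ x, g x ^ 2) * y := by
    rw [hy2]
    refine (h3.trans (add_le_add h2 h1)).trans (le_of_eq ?_)
    rw [aPrioriConst]; ring
  have hL0 : 0 < b - a := sub_pos.2 hab
  have hC : 0 ≤ aPrioriConst σ (b - a) := by
    have := incrementConst_pos hσ hL0
    unfold aPrioriConst
    positivity
  rcases (Real.sqrt_nonneg (∫ x, w x ^ 2)).eq_or_lt with h | h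
  · rw [hy, ← h]; positivity
  · rw [sq] at h4
    exact le_of_mul_le_mul_right h4 h

end APriori

end RieszForm

section RieszForm

open MeasureTheory Set

/-! ### The regularized equation -/

section Regularized

variable {σ a b : ℝ}

theorem rieszForm_congr_ae {f f' g g' : ℝ → ℝ} (hf : f =ᵐ[volume] f') (hg : g =ᵐ[volume] g') :
    rieszForm σ f g = rieszForm σ f' g' := by
  refine integral_congr_ae ?_
  rw [Measure.volume_eq_prod]
  have h1 : ∀ᵐ p : ℝ × ℝ ∂(volume.prod volume), f p.1 = f' p.1 :=
    Measure.quasiMeasurePreserving_fst.ae hf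
  have h2 : ∀ᵐ p : ℝ × ℝ ∂(volume.prod volume), g p.2 = g' p.2 :=
    Measure.quasiMeasurePreserving_snd.ae hg
  filter_upwards [h1, h2] with p hp1 hp2
  rw [hp1, hp2]

theorem abs_rieszForm_le (hσ₀ : 0 < σ) (hσ : σ < 1) (hab : a ≤ b) {f g : ℝ → ℝ}
    (hf : f ∈ L2On a b) (hg : g ∈ L2On a b) :
    |rieszForm σ f g| ≤ √(rieszForm σ f f) * √(rieszForm σ g g) := by
  have h := LinearMap.BilinForm.apply_sq_le_of_symm (rieszBilin hσ₀ hab)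
    (fun x => rieszForm_nonneg hσ₀ hσ hab x.2) ⟨fun x y => rieszForm_comm _ _⟩ ⟨f, hf⟩ ⟨g, hg⟩
  simp only [rieszBilin_apply] at h
  rw [← Real.sqrt_mul (rieszForm_nonneg hσ₀ hσ hab hf)]
  exact Real.abs_le_sqrt h

theorem abs_rieszForm_le_sqrt (hσ₀ : 0 < σ) (hσ : σ < 1) (hab : a ≤ b) {f g : ℝ → ℝ}
    (hf : f ∈ L2On a b) (hg : g ∈ L2On a b) :
    |rieszForm σ f g| ≤ 2 * ((b - a) ^ σ / σ) * (√(∫ x, f x ^ 2) * √(∫ x, g x ^ 2)) := by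
  have hC : 0 ≤ 2 * ((b - a) ^ σ / σ) := by
    have : 0 ≤ b - a := by linarith
    positivity
  have h := fun {f : ℝ → ℝ} (hf : f ∈ L2On a b) =>
    Real.sqrt_le_sqrt (rieszForm_self_le hσ₀ hab hf)
  refine (abs_rieszForm_le hσ₀ hσ hab hf hg).trans
    ((mul_le_mul (h hf) (h hg) (Real.sqrt_nonneg _) (Real.sqrt_nonneg _)).trans (le_of_eq ?_))
  rw [Real.sqrt_mul hC, Real.sqrt_mul hC]
  nth_rewrite 3 [← Real.mul_self_sqrt hC]
  ring

theorem indicator_mem {f : ℝ → ℝ} (hf : MemLp f 2 (volume.restrict (Icc a b))) :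
    (Icc a b).indicator f ∈ L2On a b :=
  ⟨(memLp_indicator_iff_restrict measurableSet_Icc).2 hf, fun _ hx => indicator_of_notMem hx f⟩

/-- Lax–Milgram on `L²` of the interval. The Riesz form enters only as a bounded nonnegative form;
the `δ` term supplies coercivity. -/
theorem exists_regularized_solution (hσ₀ : 0 < σ) (hσ : σ < 1) (hab : a ≤ b) {δ : ℝ}
    (hδ : 0 < δ) {v : ℝ → ℝ} (hv : v ∈ L2On a b) :
    ∃ w ∈ L2On a b, ∀ φ ∈ L2On a b,
      rieszForm σ w φ + δ * ∫ x, w x * φ x = ∫ x, v x * φ x := by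
  set ν := volume.restrict (Icc a b) with hν
  -- Classes are represented by functions extended by zero. The extension is additive only almost
  -- everywhere, which suffices for the form.
  let ext : Lp ℝ 2 ν → ℝ → ℝ := fun f => (Icc a b).indicator f
  have hext : ∀ f, ext f ∈ L2On a b := fun f => indicator_mem (Lp.memLp f)
  have hae : ∀ {f g : ℝ → ℝ}, f =ᵐ[ν] g →
      (Icc a b).indicator f =ᵐ[volume] (Icc a b).indicator g :=
    fun h => (ae_eq_restrict_iff_indicator_ae_eq measurableSet_Icc).1 h
  have hadd : ∀ f g, ext (f + g) =ᵐ[volume] ext f + ext g := fun f g => by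
    refine (hae (Lp.coeFn_add f g)).trans (Filter.EventuallyEq.of_eq ?_)
    simp only [ext]
    rw [indicator_add']
  have hsmul : ∀ (c : ℝ) f, ext (c • f) =ᵐ[volume] c • ext f := fun c f => by
    refine (hae (Lp.coeFn_smul c f)).trans (Filter.EventuallyEq.of_eq ?_)
    simp only [ext]
    ext x
    by_cases hx : x ∈ Icc a b <;> simp [hx]
  have hb_add : ∀ f f' g, f ∈ L2On a b → f' ∈ L2On a b → g ∈ L2On a b →
      rieszForm σ (f + f') g = rieszForm σ f g + rieszForm σ f' g := fun f f' g hf hf' hg =>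
    (rieszBilin hσ₀ hab).add_left ⟨f, hf⟩ ⟨f', hf'⟩ ⟨g, hg⟩
  have hb_smul : ∀ (c : ℝ) f g, f ∈ L2On a b → g ∈ L2On a b →
      rieszForm σ (c • f) g = c * rieszForm σ f g := fun c f g hf hg =>
    (rieszBilin hσ₀ hab).smul_left c ⟨f, hf⟩ ⟨g, hg⟩
  have hinner : ∀ f g : Lp ℝ 2 ν, inner ℝ f g = ∫ x, ext f x * ext g x := fun f g => by
    rw [L2.inner_def]
    have : ∀ x, ext f x * ext g x = (Icc a b).indicator (fun x => f x * g x) x := fun x => by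
      simp only [ext, indicator_apply]; split_ifs <;> simp
    simp only [this]
    rw [integral_indicator measurableSet_Icc]
    congr 1; ext x
    simp [mul_comm]
  have hnorm : ∀ f : Lp ℝ 2 ν, √(∫ x, ext f x ^ 2) = ‖f‖ := fun f => by
    rw [← Real.sqrt_sq (norm_nonneg f), ← real_inner_self_eq_norm_sq, hinner]
    congr 2; ext x; ring
  let β : Lp ℝ 2 ν →ₗ[ℝ] Lp ℝ 2 ν →ₗ[ℝ] ℝ := LinearMap.mk₂ ℝ
    (fun f g => rieszForm σ (ext f) (ext g) + δ * inner ℝ f g)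
    (fun f f' g => by
      rw [rieszForm_congr_ae (hadd f f') Filter.EventuallyEq.rfl,
        hb_add _ _ _ (hext f) (hext f') (hext g), inner_add_left]; ring)
    (fun c f g => by
      rw [rieszForm_congr_ae (hsmul c f) Filter.EventuallyEq.rfl,
        hb_smul _ _ _ (hext f) (hext g), real_inner_smul_left, smul_eq_mul]; ring)
    (fun f g g' => by
      rw [rieszForm_congr_ae Filter.EventuallyEq.rfl (hadd g g'), rieszForm_comm,
        hb_add _ _ _ (hext g) (hext g') (hext f), inner_add_right, rieszForm_comm (ext g),
        rieszForm_comm (ext g')]; ring)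
    (fun c f g => by
      rw [rieszForm_congr_ae Filter.EventuallyEq.rfl (hsmul c g), rieszForm_comm,
        hb_smul _ _ _ (hext g) (hext f), real_inner_smul_right, smul_eq_mul,
        rieszForm_comm (ext g)]; ring)
  have hβ : ∀ f g, β f g = rieszForm σ (ext f) (ext g) + δ * inner ℝ f g := fun f g => rfl
  let Bc : Lp ℝ 2 ν →L[ℝ] Lp ℝ 2 ν →L[ℝ] ℝ := β.mkContinuous₂ (2 * ((b - a) ^ σ / σ) + δ)
    (fun f g => by
      rw [hβ, Real.norm_eq_abs]
      have h1 := abs_rieszForm_le_sqrt hσ₀ hσ hab (hext f) (hext g)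
      rw [hnorm, hnorm] at h1
      have h2 := abs_real_inner_le_norm f g
      calc _ ≤ |rieszForm σ (ext f) (ext g)| + |δ * inner ℝ f g| := abs_add_le _ _
        _ ≤ 2 * ((b - a) ^ σ / σ) * (‖f‖ * ‖g‖) + δ * (‖f‖ * ‖g‖) := by
          rw [abs_mul, abs_of_pos hδ]
          exact add_le_add h1 (mul_le_mul_of_nonneg_left h2 hδ.le)
        _ = _ := by ring)
  have hBc : ∀ f g, Bc f g = rieszForm σ (ext f) (ext g) + δ * inner ℝ f g := fun f g => rfl
  have hco : IsCoercive Bc := ⟨δ, hδ, fun f => by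
    rw [hBc, real_inner_self_eq_norm_sq]
    have := rieszForm_nonneg hσ₀ hσ hab (hext f)
    nlinarith⟩
  have hvm : MemLp v 2 ν := hv.1.restrict _
  let V : Lp ℝ 2 ν := hvm.toLp v
  let W := hco.continuousLinearEquivOfBilin.symm V
  have hW : ∀ g, Bc W g = inner ℝ V g := fun g => by
    rw [← hco.continuousLinearEquivOfBilin_apply]
    simp [W]
  have hself : ∀ {f : ℝ → ℝ} (hf : f ∈ L2On a b),
      ext ((hf.1.restrict (Icc a b)).toLp f) =ᵐ[volume] f := fun {f} hf => by
    refine (hae (MemLp.coeFn_toLp _)).trans (Filter.EventuallyEq.of_eq ?_)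
    ext x
    by_cases hx : x ∈ Icc a b
    · simp [hx]
    · simp [hx, hf.2 x hx]
  refine ⟨ext W, hext W, fun φ hφ => ?_⟩
  have h := hW ((hφ.1.restrict (Icc a b)).toLp φ)
  rw [hBc, hinner, hinner, rieszForm_congr_ae Filter.EventuallyEq.rfl (hself hφ)] at h
  have e1 : ∫ x, ext W x * ext ((hφ.1.restrict (Icc a b)).toLp φ) x = ∫ x, ext W x * φ x := by
    refine integral_congr_ae ?_
    filter_upwards [hself hφ] with x hx
    rw [hx]
  have e2 : ∫ x, ext V x * ext ((hφ.1.restrict (Icc a b)).toLp φ) x = ∫ x, v x * φ x := by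
    refine integral_congr_ae ?_
    filter_upwards [hself hφ, hself hv] with x hx hx'
    rw [hx, hx']
  rw [e1, e2] at h
  exact h

end Regularized

/-! ### The fractional integral as a Riesz potential -/

/-- The constant of the Riesz potential `fracInt`. -/
noncomputable def fracConst (σ : ℝ) : ℝ :=
  1 / (2 * Real.cos (Real.pi * σ / 2) * Real.Gamma σ)

theorem fracConst_pos {σ : ℝ} (hσ₀ : 0 < σ) (hσ : σ < 1) : 0 < fracConst σ := by
  have h1 : 0 < Real.cos (Real.pi * σ / 2) := by
    refine Real.cos_pos_of_mem_Ioo ⟨?_, ?_⟩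
    · have := Real.pi_pos; nlinarith [mul_pos this hσ₀]
    · have := Real.pi_pos; nlinarith
  have h2 := Real.Gamma_pos_of_pos hσ₀
  unfold fracConst
  positivity

theorem fracInt_eq_integral {σ : ℝ} {f : ℝ → ℝ} {x : ℝ}
    (hi : Integrable fun y => |x - y| ^ (σ - 1) * f y) :
    fracInt σ f x = fracConst σ * ∫ y, |x - y| ^ (σ - 1) * f y := by
  have hsplit : ∫ y, |x - y| ^ (σ - 1) * f y
      = (∫ s in Iio x, f s / (x - s) ^ (1 - σ)) + ∫ s in Ioi x, f s / (s - x) ^ (1 - σ) := by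
    have hu : Iic x ∪ Ioi x = univ := Iic_union_Ioi
    rw [← setIntegral_univ, ← hu, setIntegral_union (Iic_disjoint_Ioi le_rfl) measurableSet_Ioi
      hi.integrableOn hi.integrableOn, integral_Iic_eq_integral_Iio]
    congr 1
    · refine setIntegral_congr_fun measurableSet_Iio fun s hs => ?_
      have h : 0 < x - s := sub_pos.2 hs
      rw [abs_of_pos h, show σ - 1 = -(1 - σ) by ring, Real.rpow_neg h.le]
      field_simp
    · refine setIntegral_congr_fun measurableSet_Ioi fun s hs => ?_
      have h : 0 < s - x := sub_pos.2 hs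
      rw [abs_sub_comm, abs_of_pos h, show σ - 1 = -(1 - σ) by ring, Real.rpow_neg h.le]
      field_simp
  rw [fracInt, rlLeft, rlRight, hsplit, fracConst]
  ring

theorem integrable_kernel_section {σ a b : ℝ} (hσ₀ : 0 < σ) {f : ℝ → ℝ} (hf : f ∈ L2On a b)
    {C : ℝ} (hC : ∀ x, |f x| ≤ C) {x : ℝ} (hx : x ∈ Icc a b) :
    Integrable fun y => |x - y| ^ (σ - 1) * f y := by
  have hab : a ≤ b := hx.1.trans hx.2
  have hk := (integrableOn_truncated_kernel hσ₀ (sub_nonneg.2 hab)).1.comp_sub_left x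
  refine (hk.mul_const C).mono' ?_ (Filter.Eventually.of_forall fun y => ?_)
  · refine AEStronglyMeasurable.mul ?_ hf.1.1
    exact Measurable.aestronglyMeasurable (by fun_prop)
  · rw [norm_mul, Real.norm_of_nonneg (Real.rpow_nonneg (abs_nonneg _) _), Real.norm_eq_abs]
    by_cases hy : y ∈ Icc a b
    · have h1 : |x - y| ≤ b - a := by
        rw [abs_le]; constructor <;> linarith [hx.1, hx.2, hy.1, hy.2]
      rw [indicator_of_mem (by exact h1)]
      exact mul_le_mul_of_nonneg_left (hC y) (Real.rpow_nonneg (abs_nonneg _) _)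
    · rw [hf.2 y hy, abs_zero, mul_zero]
      refine mul_nonneg ?_ ((abs_nonneg _).trans (hC y))
      by_cases h2 : |x - y| ∈ Iic (b - a)
      · rw [indicator_of_mem h2]; exact Real.rpow_nonneg (abs_nonneg _) _
      · rw [indicator_of_notMem h2]

theorem integral_fracInt_mul {σ a b : ℝ} (hσ₀ : 0 < σ) (hab : a ≤ b) {f g : ℝ → ℝ}
    (hf : f ∈ L2On a b) {C : ℝ} (hC : ∀ x, |f x| ≤ C) (hg : g ∈ L2On a b) :
    Integrable (fun x => fracInt σ f x * g x) ∧
      ∫ x, fracInt σ f x * g x = fracConst σ * rieszForm σ f g := by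
  have hk := integrable_kernel hσ₀ hab hg hf
  rw [Measure.volume_eq_prod] at hk
  have e : ∀ x, fracInt σ f x * g x
      = fracConst σ * ∫ y, |x - y| ^ (σ - 1) * (g x * f y) := fun x => by
    by_cases hx : x ∈ Icc a b
    · rw [fracInt_eq_integral (integrable_kernel_section hσ₀ hf hC hx), mul_assoc,
        ← integral_mul_const]
      congr 2; ext y; ring
    · simp [hg.2 x hx]
  simp only [e]
  refine ⟨hk.integral_prod_left.const_mul _, ?_⟩
  rw [integral_const_mul, ← integral_prod _ hk, rieszForm_comm, rieszForm, Measure.volume_eq_prod]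

end RieszForm

/-! ### Inverse estimates for polynomials -/

section Polynomials

open MeasureTheory Set Polynomial

/-- The polynomial with the given coefficients. -/
noncomputable def polynomialOfCoeffs (N : ℕ) : (Fin (N + 1) → ℝ) →ₗ[ℝ] ℝ[X] :=
  ∑ i : Fin (N + 1), (Polynomial.monomial (i : ℕ)).comp (LinearMap.proj i)

theorem polynomialOfCoeffs_apply (N : ℕ) (c : Fin (N + 1) → ℝ) :
    polynomialOfCoeffs N c = ∑ i : Fin (N + 1), Polynomial.monomial (i : ℕ) (c i) := by
  simp [polynomialOfCoeffs]

theorem polynomialOfCoeffs_coeff {N : ℕ} {p : ℝ[X]} (hp : p.natDegree ≤ N) :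
    polynomialOfCoeffs N (fun i => p.coeff i) = p := by
  rw [polynomialOfCoeffs_apply, Fin.sum_univ_eq_sum_range
    (fun i => Polynomial.monomial i (p.coeff i)) (N + 1)]
  exact (p.as_sum_range' (N + 1) (Nat.lt_succ_of_le hp)).symm

theorem coeff_polynomialOfCoeffs {N : ℕ} (c : Fin (N + 1) → ℝ) (i : Fin (N + 1)) :
    (polynomialOfCoeffs N c).coeff i = c i := by
  rw [polynomialOfCoeffs_apply, Polynomial.finsetSum_coeff, Finset.sum_eq_single i]
  · simp
  · intro j _ hj
    rw [Polynomial.coeff_monomial, if_neg (fun h => hj (Fin.ext h))]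
  · simp

theorem natDegree_polynomialOfCoeffs_le {N : ℕ} (c : Fin (N + 1) → ℝ) :
    (polynomialOfCoeffs N c).natDegree ≤ N := by
  rw [polynomialOfCoeffs_apply]
  exact Polynomial.natDegree_sum_le_of_forall_le _ _ fun i _ =>
    (Polynomial.natDegree_monomial_le _).trans (Nat.lt_succ_iff.1 i.2)

theorem polynomialOfCoeffs_injective (N : ℕ) : Function.Injective (polynomialOfCoeffs N) :=
  fun c d h => funext fun i => by
    rw [← coeff_polynomialOfCoeffs c i, h, coeff_polynomialOfCoeffs]

/-- A linear functional on polynomials of bounded degree is bounded for every inner product. -/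
theorem exists_sq_le_of_definite {N : ℕ} (B : LinearMap.BilinForm ℝ ℝ[X])
    (hs : ∀ p q, B p q = B q p) (h0 : ∀ p, 0 ≤ B p p)
    (hd : ∀ p : ℝ[X], B p p = 0 → p = 0) (L : ℝ[X] →ₗ[ℝ] ℝ) :
    ∃ C, 0 < C ∧ ∀ p : ℝ[X], p.natDegree ≤ N → (L p) ^ 2 ≤ C * B p p := by
  let A : LinearMap.BilinForm ℝ (Fin (N + 1) → ℝ) :=
    B.compl₁₂ (polynomialOfCoeffs N) (polynomialOfCoeffs N)
  have hA : ∀ c d, A c d = B (polynomialOfCoeffs N c) (polynomialOfCoeffs N d) :=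
    fun c d => rfl
  obtain ⟨S, hS⟩ := A.exists_representative fun c hc => by
    have := hd _ ((hA c c).symm.trans hc)
    exact polynomialOfCoeffs_injective N (this.trans (map_zero _).symm)
  set l : Module.Dual ℝ (Fin (N + 1) → ℝ) := L.comp (polynomialOfCoeffs N)
  refine ⟨A (S l) (S l) + 1, by rw [hA]; linarith [h0 (polynomialOfCoeffs N (S l))],
    fun p hp => ?_⟩
  set c : Fin (N + 1) → ℝ := fun i => p.coeff i
  have hc : polynomialOfCoeffs N c = p := polynomialOfCoeffs_coeff hp
  have h1 : A (S l) c = L p := by rw [hS, LinearMap.comp_apply, hc]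
  have h2 := LinearMap.BilinForm.apply_sq_le_of_symm B h0 ⟨fun x y => by simpa using hs x y⟩
    (polynomialOfCoeffs N (S l))
    (polynomialOfCoeffs N c)
  rw [← hA, ← hA, h1, hc] at h2
  refine h2.trans (mul_le_mul_of_nonneg_right ?_ (h0 p))
  linarith

theorem Polynomial.eq_zero_of_integral_sq_eq_zero {a b : ℝ} (hab : a < b) {p : ℝ[X]}
    (h : ∫ x in a..b, p.eval x * p.eval x = 0) : p = 0 := by
  refine Polynomial.eq_zero_of_infinite_isRoot p ((Ioo_infinite hab).mono fun x hx => ?_)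
  by_contra hne
  have hx2 : p.eval x ≠ 0 := hne
  have : 0 < ∫ x in a..b, p.eval x * p.eval x :=
    intervalIntegral.integral_pos hab (p.continuous.mul p.continuous).continuousOn
      (fun y _ => mul_self_nonneg _) ⟨x, Ioo_subset_Icc_self hx, mul_self_pos.2 hx2⟩
  linarith

/-- The `L²(a,b)` inner product of polynomials. -/
noncomputable def Polynomial.integralForm (a b : ℝ) : LinearMap.BilinForm ℝ ℝ[X] :=
  have hI : ∀ p q : ℝ[X], IntervalIntegrable (fun x => p.eval x * q.eval x) volume a b :=
    fun p q => (p.continuous.mul q.continuous).intervalIntegrable _ _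
  LinearMap.mk₂ ℝ (fun p q => ∫ x in a..b, p.eval x * q.eval x)
    (fun p p' q => by
      rw [← intervalIntegral.integral_add (hI p q) (hI p' q)]
      simp [add_mul])
    (fun c p q => by
      rw [smul_eq_mul, ← intervalIntegral.integral_const_mul]
      simp [mul_assoc])
    (fun p q q' => by
      rw [← intervalIntegral.integral_add (hI p q) (hI p q')]
      simp [mul_add])
    (fun c p q => by
      rw [smul_eq_mul, ← intervalIntegral.integral_const_mul]
      congr 1; ext x; simp; ring)

theorem Polynomial.integralForm_apply (a b : ℝ) (p q : ℝ[X]) :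
    Polynomial.integralForm a b p q = ∫ x in a..b, p.eval x * q.eval x := rfl

theorem exists_sq_le_integral_sq (N : ℕ) (L : ℝ[X] →ₗ[ℝ] ℝ) :
    ∃ C, 0 < C ∧ ∀ p : ℝ[X], p.natDegree ≤ N →
      (L p) ^ 2 ≤ C * ∫ x in (0 : ℝ)..1, p.eval x ^ 2 := by
  obtain ⟨C, hC, h⟩ := exists_sq_le_of_definite (N := N) (Polynomial.integralForm 0 1)
    (fun p q => by simp only [Polynomial.integralForm_apply, mul_comm])
    (fun p => intervalIntegral.integral_nonneg zero_le_one fun x _ => mul_self_nonneg _)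
    (fun p hp => Polynomial.eq_zero_of_integral_sq_eq_zero zero_lt_one hp) L
  refine ⟨C, hC, fun p hp => ?_⟩
  simpa only [Polynomial.integralForm_apply, ← sq] using h p hp

/-- Differentiating the hypothesis gives `p (x + 1/2) = p x`; a periodic polynomial is constant, and
a constant with vanishing window integral is zero. Hence `Polynomial.windowForm` is definite, and in
bounded degree increments of the antiderivative control the `L²` norm. -/
theorem Polynomial.eq_zero_of_window_eq_zero {p : ℝ[X]}
    (h : ∀ x ∈ Ioo (0 : ℝ) (1 / 2), ∫ t in x..(x + 1 / 2), p.eval t = 0) : p = 0 := by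
  have hper : p.comp (X + C (1 / 2)) = p := by
    refine sub_eq_zero.1 (Polynomial.eq_zero_of_infinite_isRoot _
      ((Ioo_infinite (show (0 : ℝ) < 1 / 2 by norm_num)).mono fun x hx => ?_))
    have hF : ∀ y, HasDerivAt (fun y => ∫ t in (0 : ℝ)..y, p.eval t) (p.eval y) y := fun y =>
      intervalIntegral.integral_hasDerivAt_right (p.continuous.intervalIntegrable _ _)
        p.continuous.aestronglyMeasurable.stronglyMeasurableAtFilter p.continuous.continuousAt
    have h1 : HasDerivAt (fun y => (∫ t in (0 : ℝ)..(y + 1 / 2), p.eval t)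
        - ∫ t in (0 : ℝ)..y, p.eval t) (p.eval (x + 1 / 2) - p.eval x) x :=
      ((hF (x + 1 / 2)).comp_add_const x (1 / 2)).sub (hF x)
    have h2 : (fun y => (∫ t in (0 : ℝ)..(y + 1 / 2), p.eval t)
        - ∫ t in (0 : ℝ)..y, p.eval t) =ᶠ[nhds x] fun _ => 0 := by
      filter_upwards [Ioo_mem_nhds hx.1 hx.2] with y hy
      rw [intervalIntegral.integral_interval_sub_left (p.continuous.intervalIntegrable _ _)
        (p.continuous.intervalIntegrable _ _)]
      exact h y hy
    have h3 := h1.unique ((hasDerivAt_const x (0 : ℝ)).congr_of_eventuallyEq h2)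
    simpa [IsRoot] using h3
  have hn : ∀ n : ℕ, p.eval ((n : ℝ) / 2) = p.eval 0 := fun n => by
    induction n with
    | zero => simp
    | succ n ih =>
      have := congrArg (Polynomial.eval ((n : ℝ) / 2)) hper
      rw [eval_comp] at this
      simp only [eval_add, eval_X, eval_C] at this
      rw [← ih, ← this]
      congr 1; push_cast; ring
  have hc : p = C (p.eval 0) := by
    refine sub_eq_zero.1 (Polynomial.eq_zero_of_infinite_isRoot _
      ((infinite_range_of_injective (f := fun n : ℕ => (n : ℝ) / 2) fun m n hmn => ?_).mono ?_))
    · have : (m : ℝ) / 2 = n / 2 := hmn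
      exact_mod_cast (div_left_inj' two_ne_zero).1 this
    · rintro _ ⟨n, rfl⟩
      simp [IsRoot, hn n]
  have h4 := h (1 / 4) ⟨by norm_num, by norm_num⟩
  rw [hc] at h4
  norm_num at h4
  rw [hc, h4, C_0]

theorem Polynomial.continuous_window (p : ℝ[X]) (d : ℝ) :
    Continuous fun x : ℝ => ∫ t in x..(x + d), p.eval t := by
  have : Continuous fun y : ℝ => ∫ t in (0 : ℝ)..y, p.eval t :=
    intervalIntegral.continuous_primitive (fun _ _ => p.continuous.intervalIntegrable _ _) 0
  have h2 := (this.comp (continuous_add_const d)).sub this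
  refine h2.congr fun x => ?_
  exact intervalIntegral.integral_interval_sub_left (p.continuous.intervalIntegrable _ _)
      (p.continuous.intervalIntegrable _ _)

/-- The inner product of the increments over half of the unit interval of two antiderivatives. -/
noncomputable def Polynomial.windowForm : LinearMap.BilinForm ℝ ℝ[X] :=
  have hI : ∀ p q : ℝ[X], IntervalIntegrable (fun x : ℝ =>
      (∫ t in x..(x + 1 / 2), p.eval t) * ∫ t in x..(x + 1 / 2), q.eval t) volume 0 (1 / 2) :=
    fun p q => ((p.continuous_window _).mul (q.continuous_window _)).intervalIntegrable _ _
  have hadd : ∀ (p q : ℝ[X]) (x : ℝ), ∫ t in x..(x + 1 / 2), (p + q).eval t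
      = (∫ t in x..(x + 1 / 2), p.eval t) + ∫ t in x..(x + 1 / 2), q.eval t := fun p q x => by
    rw [← intervalIntegral.integral_add (p.continuous.intervalIntegrable _ _)
        (q.continuous.intervalIntegrable _ _)]
    simp
  have hsmul : ∀ (c : ℝ) (p : ℝ[X]) (x : ℝ), ∫ t in x..(x + 1 / 2), (c • p).eval t
      = c * ∫ t in x..(x + 1 / 2), p.eval t := fun c p x => by
    rw [← intervalIntegral.integral_const_mul]
    simp
  LinearMap.mk₂ ℝ (fun p q => ∫ x in (0 : ℝ)..(1 / 2),
      (∫ t in x..(x + 1 / 2), p.eval t) * ∫ t in x..(x + 1 / 2), q.eval t)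
    (fun p p' q => by
      rw [← intervalIntegral.integral_add (hI p q)
        (hI p' q)]
      simp only [hadd, add_mul])
    (fun c p q => by
      rw [smul_eq_mul, ← intervalIntegral.integral_const_mul]
      simp only [hsmul, mul_assoc])
    (fun p q q' => by
      rw [← intervalIntegral.integral_add (hI p q)
        (hI p q')]
      simp only [hadd, mul_add])
    (fun c p q => by
      rw [smul_eq_mul, ← intervalIntegral.integral_const_mul]
      simp only [hsmul, mul_left_comm])

theorem Polynomial.windowForm_apply (p q : ℝ[X]) :
    Polynomial.windowForm p q = ∫ x in (0 : ℝ)..(1 / 2),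
      (∫ t in x..(x + 1 / 2), p.eval t) * ∫ t in x..(x + 1 / 2), q.eval t := rfl

theorem exists_sq_le_window (N : ℕ) (L : ℝ[X] →ₗ[ℝ] ℝ) :
    ∃ C, 0 < C ∧ ∀ p : ℝ[X], p.natDegree ≤ N →
      (L p) ^ 2 ≤ C * ∫ x in (0 : ℝ)..(1 / 2), (∫ t in x..(x + 1 / 2), p.eval t) ^ 2 := by
  obtain ⟨C, hC, h⟩ := exists_sq_le_of_definite (N := N) Polynomial.windowForm
    (fun p q => by simp only [Polynomial.windowForm_apply, mul_comm])
    (fun p => intervalIntegral.integral_nonneg (by norm_num) fun x _ => mul_self_nonneg _)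
    (fun p hp => Polynomial.eq_zero_of_window_eq_zero fun x hx => by
      by_contra hne
      rw [Polynomial.windowForm_apply] at hp
      have : 0 < ∫ x in (0 : ℝ)..(1 / 2),
          (∫ t in x..(x + 1 / 2), p.eval t) * ∫ t in x..(x + 1 / 2), p.eval t :=
        intervalIntegral.integral_pos (by norm_num)
          ((p.continuous_window _).mul (p.continuous_window _)).continuousOn
          (fun y _ => mul_self_nonneg _) ⟨x, Ioo_subset_Icc_self hx, mul_self_pos.2 hne⟩
      linarith) L
  refine ⟨C, hC, fun p hp => ?_⟩
  simpa only [Polynomial.windowForm_apply, ← sq] using h p hp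

theorem exists_integral_sq_le_window (N : ℕ) :
    ∃ C, 0 < C ∧ ∀ p : ℝ[X], p.natDegree ≤ N → ∫ x in (0 : ℝ)..1, p.eval x ^ 2 ≤
      C * ∫ x in (0 : ℝ)..(1 / 2), (∫ t in x..(x + 1 / 2), p.eval t) ^ 2 := by
  choose C hC h using fun i : ℕ => exists_sq_le_window N (Polynomial.lcoeff ℝ i)
  -- Each coefficient is bounded by the window form; on `[0,1]` the value is a sum of `N + 1`
  -- coefficients times powers at most `1`.
  refine ⟨(N + 1 : ℕ) * ∑ i ∈ Finset.range (N + 1), C i,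
    mul_pos (by positivity) (Finset.sum_pos (fun i _ => hC i) ⟨0, by simp⟩), fun p hp => ?_⟩
  set Q := ∫ x in (0 : ℝ)..(1 / 2), (∫ t in x..(x + 1 / 2), p.eval t) ^ 2
  have hpt : ∀ x ∈ Icc (0 : ℝ) 1, p.eval x ^ 2 ≤
      (N + 1 : ℕ) * (∑ i ∈ Finset.range (N + 1), C i) * Q := fun x hx => by
    rw [Polynomial.eval_eq_sum_range' (Nat.lt_succ_of_le hp)]
    refine sq_sum_le_card_mul_sum_sq.trans ?_
    rw [Finset.card_range, mul_assoc, Finset.sum_mul]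
    refine mul_le_mul_of_nonneg_left (Finset.sum_le_sum fun i _ => ?_) (by positivity)
    refine le_trans ?_ (h i p hp)
    rw [Polynomial.lcoeff_apply, mul_pow]
    refine mul_le_of_le_one_right (sq_nonneg _) ?_
    exact pow_le_one₀ (pow_nonneg hx.1 _) (pow_le_one₀ hx.1 hx.2)
  have := intervalIntegral.integral_mono_on zero_le_one
    ((p.continuous.pow 2).intervalIntegrable _ _) (intervalIntegrable_const (μ := volume)) hpt
  simpa using this

/-! #### Scaling to an interval -/

theorem integral_eval_comp_sq (p : ℝ[X]) {c d : ℝ} (hcd : c < d) :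
    ∫ x in (0 : ℝ)..1, (p.comp (C (d - c) * X + C c)).eval x ^ 2
      = (d - c)⁻¹ * ∫ x in c..d, p.eval x ^ 2 := by
  have h := intervalIntegral.integral_comp_mul_add (a := 0) (b := 1)
    (fun x => p.eval x ^ 2) (sub_pos.2 hcd).ne' c
  simp only [mul_zero, zero_add, mul_one, sub_add_cancel, smul_eq_mul] at h
  rw [← h]
  simp [eval_comp]

theorem natDegree_comp_affine_le {N : ℕ} {p : ℝ[X]} (hp : p.natDegree ≤ N) (r s : ℝ) :
    (p.comp (C r * X + C s)).natDegree ≤ N := by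
  rw [natDegree_comp]
  calc p.natDegree * (C r * X + C s).natDegree ≤ p.natDegree * 1 :=
        Nat.mul_le_mul_left _ (natDegree_linear_le)
    _ ≤ N := by omega

theorem eval_iterate_derivative_comp (p : ℝ[X]) (r s : ℝ) (n : ℕ) (x : ℝ) :
    (derivative^[n] (p.comp (C r * X + C s))).eval x
      = r ^ n * (derivative^[n] p).eval (r * x + s) := by
  have : derivative^[n] (p.comp (C r * X + C s))
      = C (r ^ n) * (derivative^[n] p).comp (C r * X + C s) := by
    induction n with
    | zero => simp
    | succ n ih =>
      rw [Function.iterate_succ_apply', ih, Function.iterate_succ_apply', derivative_C_mul,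
        derivative_comp]
      simp [pow_succ]
      ring
  rw [this]
  simp [eval_comp]

/-- The inverse trace estimate for the `n`-th derivative at an end point of an interval. -/
theorem exists_trace_sq_le (N n : ℕ) :
    ∃ C, 0 < C ∧ ∀ (c d : ℝ), c < d → ∀ p : ℝ[X], p.natDegree ≤ N →
      ((derivative^[n] p).eval c) ^ 2 * (d - c) ^ (2 * n + 1) ≤ C * ∫ x in c..d, p.eval x ^ 2 ∧
      ((derivative^[n] p).eval d) ^ 2 * (d - c) ^ (2 * n + 1) ≤
        C * ∫ x in c..d, p.eval x ^ 2 := by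
  obtain ⟨C₀, hC₀, h₀⟩ := exists_sq_le_integral_sq N
    ((Polynomial.leval (0 : ℝ)).comp (Polynomial.derivative ^ n))
  obtain ⟨C₁, hC₁, h₁⟩ := exists_sq_le_integral_sq N
    ((Polynomial.leval (1 : ℝ)).comp (Polynomial.derivative ^ n))
  refine ⟨C₀ + C₁, by positivity, fun c d hcd p hp => ?_⟩
  have hl : 0 < d - c := sub_pos.2 hcd
  have hI : 0 ≤ ∫ x in c..d, p.eval x ^ 2 :=
    intervalIntegral.integral_nonneg hcd.le fun x _ => sq_nonneg _
  have e0 := h₀ _ (natDegree_comp_affine_le hp (d - c) c)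
  have e1 := h₁ _ (natDegree_comp_affine_le hp (d - c) c)
  rw [integral_eval_comp_sq p hcd, LinearMap.comp_apply, Module.End.pow_apply,
    Polynomial.leval_apply, eval_iterate_derivative_comp] at e0 e1
  simp only [mul_zero, zero_add, mul_one, sub_add_cancel] at e0 e1
  have key : ∀ {y C' : ℝ}, ((d - c) ^ n * y) ^ 2 ≤ C' * ((d - c)⁻¹ * ∫ x in c..d, p.eval x ^ 2) →
      y ^ 2 * (d - c) ^ (2 * n + 1) ≤ C' * ∫ x in c..d, p.eval x ^ 2 := fun {y C'} h => by
    have := mul_le_mul_of_nonneg_right h hl.le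
    calc _ = ((d - c) ^ n * y) ^ 2 * (d - c) := by ring
      _ ≤ _ := this
      _ = _ := by field_simp
  exact ⟨(key e0).trans (mul_le_mul_of_nonneg_right (by linarith) hI),
    (key e1).trans (mul_le_mul_of_nonneg_right (by linarith) hI)⟩

theorem exists_integral_sq_le_window_cell (N : ℕ) :
    ∃ C, 0 < C ∧ ∀ (c d : ℝ), c < d → ∀ p : ℝ[X], p.natDegree ≤ N →
      (d - c) ^ 2 * ∫ x in c..d, p.eval x ^ 2 ≤
        C * ∫ x in c..((c + d) / 2), (∫ t in x..(x + (d - c) / 2), p.eval t) ^ 2 := by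
  obtain ⟨C₀, hC₀, h₀⟩ := exists_integral_sq_le_window N
  refine ⟨C₀, hC₀, fun c d hcd p hp => ?_⟩
  have hl : 0 < d - c := sub_pos.2 hcd
  have e0 := h₀ _ (natDegree_comp_affine_le hp (d - c) c)
  rw [integral_eval_comp_sq p hcd] at e0
  have e1 : ∀ x : ℝ, ∫ t in x..(x + 1 / 2), (p.comp (C (d - c) * X + C c)).eval t
      = (d - c)⁻¹ * ∫ t in ((d - c) * x + c)..(((d - c) * x + c) + (d - c) / 2),
        p.eval t := fun x => by
    have h := intervalIntegral.integral_comp_mul_add (a := x) (b := x + 1 / 2)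
      (fun x => p.eval x) hl.ne' c
    rw [smul_eq_mul, show (d - c) * (x + 1 / 2) + c = (d - c) * x + c + (d - c) / 2 by ring] at h
    rw [← h]
    simp [eval_comp]
  simp only [e1] at e0
  have h := intervalIntegral.integral_comp_mul_add (a := 0) (b := 1 / 2)
    (fun x => ((d - c)⁻¹ * ∫ t in x..(x + (d - c) / 2), p.eval t) ^ 2) hl.ne' c
  rw [h, smul_eq_mul, mul_zero, zero_add,
    show (d - c) * (1 / 2) + c = (c + d) / 2 by ring] at e0
  simp only [mul_pow, intervalIntegral.integral_const_mul] at e0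
  have := mul_le_mul_of_nonneg_left e0 (pow_pos hl 3).le
  calc _ = (d - c) ^ 3 * ((d - c)⁻¹ * ∫ x in c..d, p.eval x ^ 2) := by field_simp
    _ ≤ _ := this
    _ = _ := by
      generalize (∫ x in c..((c + d) / 2), (∫ t in x..(x + (d - c) / 2), p.eval t) ^ 2) = J
      field_simp

end Polynomials

/-! ### Piecewise polynomials on a mesh -/

section Mesh

open MeasureTheory Set Polynomial

namespace DGSpace

variable {K N : ℕ}

theorem poly_eq (v : DGSpace K N) (k : Fin K) : v.poly k = polynomialOfCoeffs N (v k) :=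
  (polynomialOfCoeffs_apply N (v k)).symm

theorem natDegree_poly_le (v : DGSpace K N) (k : Fin K) : (v.poly k).natDegree ≤ N := by
  rw [poly_eq]; exact natDegree_polynomialOfCoeffs_le _

@[simp] theorem poly_add (v w : DGSpace K N) (k : Fin K) :
    DGSpace.poly (v + w) k = v.poly k + w.poly k := by
  rw [poly_eq, poly_eq, poly_eq, ← map_add]; rfl

@[simp] theorem poly_smul (c : ℝ) (v : DGSpace K N) (k : Fin K) :
    DGSpace.poly (c • v) k = c • v.poly k := by
  rw [poly_eq, poly_eq, ← map_smul]; rfl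

@[simp] theorem poly_sub (v w : DGSpace K N) (k : Fin K) :
    DGSpace.poly (v - w) k = v.poly k - w.poly k := by
  rw [poly_eq, poly_eq, poly_eq, ← map_sub]; rfl

@[simp] theorem dpoly_add (n : ℕ) (v w : DGSpace K N) (k : Fin K) :
    DGSpace.dpoly n (v + w) k = v.dpoly n k + w.dpoly n k := by
  rw [dpoly, poly_add]
  exact iterate_map_add derivative n _ _

@[simp] theorem dpoly_smul (n : ℕ) (c : ℝ) (v : DGSpace K N) (k : Fin K) :
    DGSpace.dpoly n (c • v) k = c • v.dpoly n k := by
  simp [dpoly, iterate_derivative_smul]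

@[simp] theorem dpoly_zero (v : DGSpace K N) : v.dpoly 0 = v.poly := rfl

theorem dpoly_one (v : DGSpace K N) (k : Fin K) : v.dpoly 1 k = derivative (v.poly k) := rfl

theorem dpoly_two (v : DGSpace K N) (k : Fin K) :
    v.dpoly 2 k = derivative (derivative (v.poly k)) := rfl

theorem natDegree_dpoly_le (n : ℕ) (v : DGSpace K N) (k : Fin K) :
    (v.dpoly n k).natDegree ≤ N :=
  (natDegree_iterate_derivative _ _).trans ((Nat.sub_le _ _).trans (v.natDegree_poly_le k))

/-- The piecewise polynomial with the given pieces, of degree at most `N`. -/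
noncomputable def ofPoly (N : ℕ) (P : Fin K → ℝ[X]) : DGSpace K N := fun k i => (P k).coeff i

theorem poly_ofPoly {P : Fin K → ℝ[X]} {k : Fin K} (h : (P k).natDegree ≤ N) :
    (ofPoly N P).poly k = P k := by
  rw [poly_eq]; exact polynomialOfCoeffs_coeff h

theorem eq_zero_of_poly {v : DGSpace K N} (h : ∀ k, v.poly k = 0) : v = 0 :=
  funext fun k => polynomialOfCoeffs_injective N ((v.poly_eq k).symm.trans ((h k).trans
    (map_zero _).symm))

/-- The cellwise derivative. -/
noncomputable def grad (v : DGSpace K N) : DGSpace K N := ofPoly N (v.dpoly 1)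

@[simp] theorem poly_grad (v : DGSpace K N) (k : Fin K) : v.grad.poly k = v.dpoly 1 k :=
  poly_ofPoly (v.natDegree_dpoly_le 1 k)

end DGSpace

namespace DGMesh

variable {a b : ℝ} {K N : ℕ} (M : DGMesh a b K)

/-- The length of a cell. -/
def len (k : Fin K) : ℝ := M.node k.succ - M.node k.castSucc

theorem node_lt (k : Fin K) : M.node k.castSucc < M.node k.succ :=
  M.strictMono Fin.castSucc_lt_succ

theorem len_pos (k : Fin K) : 0 < M.len k := sub_pos.2 (M.node_lt k)

theorem len_le_size (k : Fin K) : M.len k ≤ M.size :=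
  le_ciSup (f := fun k : Fin K => M.node k.succ - M.node k.castSucc) (Finite.bddAbove_range _) k

theorem node_mem (j : Fin (K + 1)) : M.node j ∈ Icc a b :=
  ⟨M.node_zero.symm.trans_le (M.strictMono.monotone (Fin.zero_le j)),
    (M.strictMono.monotone (Fin.le_last j)).trans_eq M.node_last⟩

theorem card_pos (M : DGMesh a b K) (hab : a < b) : 0 < K := by
  rcases Nat.eq_zero_or_pos K with rfl | h
  · have h1 := M.node_zero
    have h2 := M.node_last
    rw [show Fin.last 0 = 0 from rfl, h1] at h2
    exact absurd h2 hab.ne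
  · exact h

theorem size_pos (hab : a < b) : 0 < M.size :=
  (M.len_pos ⟨0, M.card_pos hab⟩).trans_le (M.len_le_size _)

theorem le_of_mesh (M : DGMesh a b K) : a ≤ b := (M.node_mem 0).1.trans (M.node_mem 0).2

theorem cell_subset (k : Fin K) : Icc (M.node k.castSucc) (M.node k.succ) ⊆ Icc a b :=
  Icc_subset_Icc (M.node_mem _).1 (M.node_mem _).2

theorem sum_sub (F : ℝ → ℝ) :
    ∑ k : Fin K, (F (M.node k.succ) - F (M.node k.castSucc)) = F b - F a := by
  have h1 := Fin.sum_univ_castSucc fun j => F (M.node j)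
  have h2 := Fin.sum_univ_succ fun j => F (M.node j)
  rw [M.node_last] at h1
  rw [M.node_zero] at h2
  rw [Finset.sum_sub_distrib]
  linarith

theorem sum_len : ∑ k, M.len k = b - a := M.sum_sub fun x => x

theorem sum_cellInt {f : ℝ → ℝ} (hf : IntervalIntegrable f volume a b) :
    ∑ k, M.cellInt k f = ∫ x in a..b, f x := by
  have hi : ∀ x ∈ Icc a b, IntervalIntegrable f volume a x := fun x hx =>
    hf.mono_set (by rw [uIcc_of_le hx.1, uIcc_of_le (hx.1.trans hx.2)]
                    exact Icc_subset_Icc_right hx.2)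
  have := M.sum_sub fun x => ∫ t in a..x, f t
  rw [intervalIntegral.integral_same, sub_zero] at this
  rw [← this]
  refine Finset.sum_congr rfl fun k _ => ?_
  rw [intervalIntegral.integral_interval_sub_left (hi _ (M.node_mem _)) (hi _ (M.node_mem _))]
  rfl

theorem cellInt_nonneg {k : Fin K} {f : ℝ → ℝ} (hf : ∀ x, 0 ≤ f x) : 0 ≤ M.cellInt k f :=
  intervalIntegral.integral_nonneg (M.node_lt k).le fun x _ => hf x

/-! #### The associated functions -/

/-- The piece of `v` on the `k`-th cell, extended by zero. -/
noncomputable def pieceFun (v : DGSpace K N) (k : Fin K) : ℝ → ℝ :=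
  (Ico (M.node k.castSucc) (M.node k.succ)).indicator fun y => (v.poly k).eval y

theorem toFun_eq (v : DGSpace K N) : M.toFun v = ∑ k, M.pieceFun v k := by
  ext x; simp [toFun, pieceFun]

theorem pieceFun_mem_and_bounded (v : DGSpace K N) (k : Fin K) :
    M.pieceFun v k ∈ L2On a b ∧ ∃ C, ∀ x, |M.pieceFun v k x| ≤ C := by
  obtain ⟨C, hC⟩ :=
    (isCompact_Icc (a := M.node k.castSucc) (b := M.node k.succ)).exists_bound_of_continuousOn
    (v.poly k).continuous.continuousOn
  have hC0 : 0 ≤ C := (norm_nonneg _).trans (hC _ (left_mem_Icc.2 (M.node_lt k).le))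
  have hb : ∀ x, |M.pieceFun v k x| ≤ C := fun x => by
    by_cases hx : x ∈ Ico (M.node k.castSucc) (M.node k.succ)
    · rw [pieceFun, indicator_of_mem hx]; exact hC x (Ico_subset_Icc_self hx)
    · rw [pieceFun, indicator_of_notMem hx]; simpa using hC0
  refine ⟨L2On.of_bounded ?_ hb fun x hx => ?_, C, hb⟩
  · exact ((v.poly k).continuous.measurable.indicator measurableSet_Ico).aestronglyMeasurable
  · exact indicator_of_notMem (fun h => hx (M.cell_subset k (Ico_subset_Icc_self h))) _

theorem toFun_mem (v : DGSpace K N) : M.toFun v ∈ L2On a b := by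
  rw [toFun_eq]
  exact Submodule.sum_mem _ fun k _ => (M.pieceFun_mem_and_bounded v k).1

theorem toFun_bounded (v : DGSpace K N) : ∃ C, ∀ x, |M.toFun v x| ≤ C := by
  choose C hC using fun k => (M.pieceFun_mem_and_bounded v k).2
  refine ⟨∑ k, C k, fun x => ?_⟩
  rw [toFun_eq, Finset.sum_apply]
  exact (Finset.abs_sum_le_sum_abs _ _).trans (Finset.sum_le_sum fun k _ => hC k x)

theorem toFun_apply_of_mem (v : DGSpace K N) {k : Fin K} {x : ℝ}
    (hx : x ∈ Ico (M.node k.castSucc) (M.node k.succ)) : M.toFun v x = (v.poly k).eval x := by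
  rw [toFun, Finset.sum_eq_single k]
  · exact indicator_of_mem hx _
  · intro l _ hl
    refine indicator_of_notMem (fun h => ?_) _
    rcases lt_or_gt_of_ne hl with hlt | hlt
    · have := M.strictMono.monotone (show l.succ ≤ k.castSucc from hlt)
      linarith [h.2, hx.1]
    · have := M.strictMono.monotone (show k.succ ≤ l.castSucc from hlt)
      linarith [h.1, hx.2]
  · simp

/-- The embedding of the piecewise polynomials into the square integrable functions. -/
noncomputable def toFunLinear (N : ℕ) : DGSpace K N →ₗ[ℝ] L2On a b where
  toFun v := ⟨M.toFun v, M.toFun_mem v⟩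
  map_add' v w := by
    ext x
    simp only [toFun, Submodule.coe_add, Pi.add_apply, ← Finset.sum_add_distrib]
    refine Finset.sum_congr rfl fun k _ => ?_
    simp only [indicator_apply]; split_ifs <;> simp
  map_smul' c v := by
    ext x
    simp only [toFun, Submodule.coe_smul, Pi.smul_apply, RingHom.id_apply, smul_eq_mul,
      Finset.mul_sum]
    refine Finset.sum_congr rfl fun k _ => ?_
    simp only [indicator_apply]; split_ifs <;> simp

theorem toFunLinear_apply (v : DGSpace K N) : (M.toFunLinear N v : ℝ → ℝ) = M.toFun v := rfl

theorem toFun_sub (v w : DGSpace K N) : M.toFun (v - w) = M.toFun v - M.toFun w := by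
  rw [← toFunLinear_apply, map_sub]; rfl

theorem toFun_add (v w : DGSpace K N) : M.toFun (v + w) = M.toFun v + M.toFun w := by
  rw [← toFunLinear_apply, map_add]; rfl

theorem integral_mul_pieceFun (F : ℝ → ℝ) (v : DGSpace K N) (k : Fin K) :
    ∫ x, F x * M.pieceFun v k x = M.cellInt k fun x => F x * (v.poly k).eval x := by
  have : ∀ x, F x * M.pieceFun v k x = (Ico (M.node k.castSucc) (M.node k.succ)).indicator
      (fun x => F x * (v.poly k).eval x) x := fun x => by
    simp only [pieceFun, indicator_apply]; split_ifs <;> simp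
  simp only [this]
  rw [integral_indicator measurableSet_Ico, cellInt, intervalIntegral.integral_of_le
    (M.node_lt k).le, integral_Ico_eq_integral_Ioo, integral_Ioc_eq_integral_Ioo]

theorem integral_mul_toFun' {F : ℝ → ℝ} (v : DGSpace K N)
    (hF : ∀ k, Integrable fun x => F x * M.pieceFun v k x) :
    ∫ x, F x * M.toFun v x = ∑ k, M.cellInt k fun x => F x * (v.poly k).eval x := by
  simp only [toFun_eq, Finset.sum_apply, Finset.mul_sum]
  rw [integral_finsetSum _ fun k _ => hF k]
  exact Finset.sum_congr rfl fun k _ => M.integral_mul_pieceFun F v k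

theorem integral_mul_toFun {F : ℝ → ℝ} (hF : F ∈ L2On a b) (v : DGSpace K N) :
    ∫ x, F x * M.toFun v x = ∑ k, M.cellInt k fun x => F x * (v.poly k).eval x :=
  M.integral_mul_toFun' v fun k => L2On.integrable_mul hF (M.pieceFun_mem_and_bounded v k).1

theorem cellInt_congr {k : Fin K} {f g : ℝ → ℝ}
    (h : ∀ x ∈ Ico (M.node k.castSucc) (M.node k.succ), f x = g x) :
    M.cellInt k f = M.cellInt k g := by
  rw [cellInt, cellInt, intervalIntegral.integral_of_le (M.node_lt k).le,
    intervalIntegral.integral_of_le (M.node_lt k).le, integral_Ioc_eq_integral_Ioo,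
    integral_Ioc_eq_integral_Ioo]
  exact setIntegral_congr_fun measurableSet_Ioo fun x hx => h x (Ioo_subset_Ico_self hx)

/-! #### Mass form -/

/-- The derivative of the `k`-th piece as a linear map. -/
noncomputable def dpolyLinear (K N n : ℕ) (k : Fin K) : DGSpace K N →ₗ[ℝ] ℝ[X] where
  toFun v := v.dpoly n k
  map_add' v w := DGSpace.dpoly_add n v w k
  map_smul' c v := DGSpace.dpoly_smul n c v k

/-- The `L²(a,b)` inner product of the `n`-th derivatives of piecewise polynomials. -/
noncomputable def derivForm (N n : ℕ) : LinearMap.BilinForm ℝ (DGSpace K N) :=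
  ∑ k, (Polynomial.integralForm (M.node k.castSucc) (M.node k.succ)).compl₁₂
    (dpolyLinear K N n k) (dpolyLinear K N n k)

theorem derivForm_apply (n : ℕ) (v w : DGSpace K N) :
    M.derivForm N n v w
      = ∑ k, M.cellInt k fun x => (v.dpoly n k).eval x * (w.dpoly n k).eval x := by
  simp only [derivForm, LinearMap.sum_apply, LinearMap.compl₁₂_apply]
  rfl

/-- The `L²(a,b)` inner product of piecewise polynomials. -/
noncomputable def massForm (N : ℕ) : LinearMap.BilinForm ℝ (DGSpace K N) := M.derivForm N 0

theorem massForm_apply (v w : DGSpace K N) :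
    M.massForm N v w = ∑ k, M.cellInt k fun x => (v.poly k).eval x * (w.poly k).eval x :=
  M.derivForm_apply 0 v w

theorem derivForm_self (n : ℕ) (v : DGSpace K N) :
    M.derivForm N n v v = ∑ k, M.cellInt k fun x => (v.dpoly n k).eval x ^ 2 := by
  simp only [derivForm_apply, sq]

theorem massForm_self (v : DGSpace K N) :
    M.massForm N v v = ∑ k, M.cellInt k fun x => (v.poly k).eval x ^ 2 :=
  M.derivForm_self 0 v

theorem derivForm_comm (n : ℕ) (v w : DGSpace K N) :
    M.derivForm N n v w = M.derivForm N n w v := by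
  simp only [derivForm_apply, mul_comm]

theorem massForm_comm (v w : DGSpace K N) : M.massForm N v w = M.massForm N w v :=
  M.derivForm_comm 0 v w

theorem derivForm_nonneg (n : ℕ) (v : DGSpace K N) : 0 ≤ M.derivForm N n v v := by
  rw [derivForm_self]
  exact Finset.sum_nonneg fun k _ => M.cellInt_nonneg fun x => sq_nonneg _

theorem massForm_nonneg (v : DGSpace K N) : 0 ≤ M.massForm N v v := M.derivForm_nonneg 0 v

theorem massForm_definite {v : DGSpace K N} (h : M.massForm N v v = 0) : v = 0 := by
  rw [massForm_self, Finset.sum_eq_zero_iff_of_nonneg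
    fun k _ => M.cellInt_nonneg fun x => sq_nonneg _] at h
  refine DGSpace.eq_zero_of_poly fun k => ?_
  have := h k (Finset.mem_univ k)
  simp only [sq] at this
  exact Polynomial.eq_zero_of_integral_sq_eq_zero (M.node_lt k) this

theorem massForm_pos {v : DGSpace K N} (h : v ≠ 0) : 0 < M.massForm N v v :=
  (M.massForm_nonneg v).lt_of_ne fun h0 => h (M.massForm_definite h0.symm)

theorem integral_toFun_mul_toFun (v w : DGSpace K N) :
    ∫ x, M.toFun v x * M.toFun w x = M.massForm N v w := by
  rw [M.integral_mul_toFun (M.toFun_mem v), massForm_apply]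
  refine Finset.sum_congr rfl fun k _ => M.cellInt_congr fun x hx => ?_
  rw [M.toFun_apply_of_mem v hx]

theorem integral_toFun_sq (v : DGSpace K N) :
    ∫ x, M.toFun v x ^ 2 = M.massForm N v v := by
  simp only [sq, integral_toFun_mul_toFun]

theorem massForm_grad (v w : DGSpace K N) :
    M.massForm N v.grad w.grad = M.derivForm N 1 v w := by
  simp only [massForm_apply, derivForm_apply, DGSpace.poly_grad]

/-- The `L²` projection onto the piecewise polynomials. -/
theorem exists_l2_projection (N : ℕ) {f : ℝ → ℝ} (hf : f ∈ L2On a b) :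
    ∃ v : DGSpace K N, ∀ φ : DGSpace K N,
      ∫ x, (f x - M.toFun v x) * M.toFun φ x = 0 := by
  obtain ⟨S, hS⟩ := (M.massForm N).exists_representative fun v => M.massForm_definite
  let l : Module.Dual ℝ (DGSpace K N) :=
    { toFun := fun φ => ∫ x, f x * M.toFun φ x
      map_add' := fun φ ψ => by
        rw [toFun_add, ← integral_add (L2On.integrable_mul hf (M.toFun_mem φ))
          (L2On.integrable_mul hf (M.toFun_mem ψ))]
        simp [mul_add]
      map_smul' := fun c φ => by
        rw [← toFunLinear_apply, map_smul, RingHom.id_apply, smul_eq_mul, ← integral_const_mul]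
        simp only [Submodule.coe_smul, Pi.smul_apply, smul_eq_mul, toFunLinear_apply]
        congr 1; ext x; ring }
  refine ⟨S l, fun φ => ?_⟩
  have h : ∫ x, M.toFun (S l) x * M.toFun φ x = ∫ x, f x * M.toFun φ x := by
    rw [integral_toFun_mul_toFun, hS]; rfl
  simp only [sub_mul]
  rw [integral_sub (L2On.integrable_mul hf (M.toFun_mem φ))
    (L2On.integrable_mul (M.toFun_mem _) (M.toFun_mem φ)), h, sub_self]

/-! #### Traces -/

@[simp] theorem tracePlus_castSucc (P : Fin K → ℝ[X]) (k : Fin K) :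
    M.tracePlus P k.castSucc = (P k).eval (M.node k.castSucc) := by
  simp [tracePlus]

@[simp] theorem tracePlus_last (P : Fin K → ℝ[X]) : M.tracePlus P (Fin.last K) = 0 := by
  simp [tracePlus]

@[simp] theorem traceMinus_succ (P : Fin K → ℝ[X]) (k : Fin K) :
    M.traceMinus P k.succ = (P k).eval (M.node k.succ) := by
  simp [traceMinus]

@[simp] theorem traceMinus_zero (P : Fin K → ℝ[X]) : M.traceMinus P 0 = 0 := by
  simp [traceMinus]

theorem tracePlus_add (P Q : Fin K → ℝ[X]) (j : Fin (K + 1)) :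
    M.tracePlus (P + Q) j = M.tracePlus P j + M.tracePlus Q j := by
  simp only [tracePlus]; split_ifs <;> simp

theorem traceMinus_add (P Q : Fin K → ℝ[X]) (j : Fin (K + 1)) :
    M.traceMinus (P + Q) j = M.traceMinus P j + M.traceMinus Q j := by
  simp only [traceMinus]; split_ifs <;> simp

theorem tracePlus_smul (c : ℝ) (P : Fin K → ℝ[X]) (j : Fin (K + 1)) :
    M.tracePlus (c • P) j = c * M.tracePlus P j := by
  simp only [tracePlus]; split_ifs <;> simp

theorem traceMinus_smul (c : ℝ) (P : Fin K → ℝ[X]) (j : Fin (K + 1)) :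
    M.traceMinus (c • P) j = c * M.traceMinus P j := by
  simp only [traceMinus]; split_ifs <;> simp

theorem dpoly_add' (n : ℕ) (v w : DGSpace K N) :
    DGSpace.dpoly n (v + w) = v.dpoly n + w.dpoly n := funext fun k => by simp

theorem dpoly_smul' (n : ℕ) (c : ℝ) (v : DGSpace K N) :
    DGSpace.dpoly n (c • v) = c • v.dpoly n := funext fun k => by simp

theorem jump_add (v w : DGSpace K N) (j : Fin (K + 1)) :
    M.jump (v + w) j = M.jump v j + M.jump w j := by
  simp only [jump, dpoly_add', tracePlus_add, traceMinus_add]; ring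

theorem jump_smul (c : ℝ) (v : DGSpace K N) (j : Fin (K + 1)) :
    M.jump (c • v) j = c * M.jump v j := by
  simp only [jump, dpoly_smul', tracePlus_smul, traceMinus_smul]; ring

theorem avg_add (n : ℕ) (v w : DGSpace K N) (j : Fin (K + 1)) :
    M.avg n (v + w) j = M.avg n v j + M.avg n w j := by
  simp only [avg, dpoly_add', tracePlus_add, traceMinus_add]; split_ifs <;> ring

theorem avg_smul (n : ℕ) (c : ℝ) (v : DGSpace K N) (j : Fin (K + 1)) :
    M.avg n (c • v) j = c * M.avg n v j := by
  simp only [avg, dpoly_smul', tracePlus_smul, traceMinus_smul]; split_ifs <;> ring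

theorem flux_add (β₀ β₁ : ℝ) (v w : DGSpace K N) (j : Fin (K + 1)) :
    M.flux β₀ β₁ (v + w) j = M.flux β₀ β₁ v j + M.flux β₀ β₁ w j := by
  simp only [flux, jump_add, avg_add, jumpSecond, dpoly_add', tracePlus_add, traceMinus_add]
  split_ifs <;> ring

theorem flux_smul (β₀ β₁ c : ℝ) (v : DGSpace K N) (j : Fin (K + 1)) :
    M.flux β₀ β₁ (c • v) j = c * M.flux β₀ β₁ v j := by
  simp only [flux, jump_smul, avg_smul, jumpSecond, dpoly_smul', tracePlus_smul, traceMinus_smul]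
  split_ifs <;> ring

/-- This and the next lemma turn sums over nodes into sums over cells; the outer traces are zero, so
the end nodes need no separate treatment. -/
theorem sum_mul_tracePlus (η : Fin (K + 1) → ℝ) (P : Fin K → ℝ[X]) :
    ∑ j, η j * M.tracePlus P j = ∑ k : Fin K, η k.castSucc * (P k).eval (M.node k.castSucc) := by
  rw [Fin.sum_univ_castSucc]; simp

theorem sum_mul_traceMinus (η : Fin (K + 1) → ℝ) (P : Fin K → ℝ[X]) :
    ∑ j, η j * M.traceMinus P j = ∑ k : Fin K, η k.succ * (P k).eval (M.node k.succ) := by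
  rw [Fin.sum_univ_succ]; simp

theorem sum_mul_jump (η : Fin (K + 1) → ℝ) (v : DGSpace K N) :
    ∑ j, η j * M.jump v j = ∑ k : Fin K, (η k.castSucc * (v.poly k).eval (M.node k.castSucc)
      - η k.succ * (v.poly k).eval (M.node k.succ)) := by
  simp only [jump, mul_sub, Finset.sum_sub_distrib, sum_mul_tracePlus, sum_mul_traceMinus,
    DGSpace.dpoly_zero]

theorem sum_sq_trace (P : Fin K → ℝ[X]) :
    ∑ j, (M.tracePlus P j ^ 2 + M.traceMinus P j ^ 2) = ∑ k : Fin K,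
      ((P k).eval (M.node k.castSucc) ^ 2 + (P k).eval (M.node k.succ) ^ 2) := by
  have h1 := M.sum_mul_tracePlus (M.tracePlus P) P
  have h2 := M.sum_mul_traceMinus (M.traceMinus P) P
  simp only [tracePlus_castSucc, traceMinus_succ, ← sq] at h1 h2
  rw [Finset.sum_add_distrib, Finset.sum_add_distrib, h1, h2]

theorem sq_avg_le (n : ℕ) (v : DGSpace K N) (j : Fin (K + 1)) :
    M.avg n v j ^ 2 ≤
      2 * (M.tracePlus (v.dpoly n) j ^ 2 + M.traceMinus (v.dpoly n) j ^ 2) := by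
  simp only [avg]
  split_ifs
  · nlinarith [sq_nonneg (M.tracePlus (v.dpoly n) j - M.traceMinus (v.dpoly n) j),
      sq_nonneg (M.tracePlus (v.dpoly n) j), sq_nonneg (M.traceMinus (v.dpoly n) j)]
  · nlinarith [sq_nonneg (M.tracePlus (v.dpoly n) j - M.traceMinus (v.dpoly n) j)]

theorem sq_jumpSecond_le (v : DGSpace K N) (j : Fin (K + 1)) :
    M.jumpSecond v j ^ 2 ≤
      2 * (M.tracePlus (v.dpoly 2) j ^ 2 + M.traceMinus (v.dpoly 2) j ^ 2) := by
  simp only [jumpSecond]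
  split_ifs
  · nlinarith [sq_nonneg (M.tracePlus (v.dpoly 2) j + M.traceMinus (v.dpoly 2) j)]
  · nlinarith [sq_nonneg (M.tracePlus (v.dpoly 2) j), sq_nonneg (M.traceMinus (v.dpoly 2) j)]

/-! #### The form of the scheme and its energy -/

/-- The bilinear form of the discrete second derivative. -/
noncomputable def diffusionForm (N : ℕ) (β₀ β₁ : ℝ) : LinearMap.BilinForm ℝ (DGSpace K N) :=
  M.derivForm N 1 + LinearMap.mk₂ ℝ (M.interfaceForm β₀ β₁)
    (fun v v' φ => by
      simp only [interfaceForm, flux_add, jump_add, ← Finset.sum_add_distrib]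
      exact Finset.sum_congr rfl fun j _ => by ring)
    (fun c v φ => by
      simp only [interfaceForm, flux_smul, jump_smul, smul_eq_mul, Finset.mul_sum]
      exact Finset.sum_congr rfl fun j _ => by ring)
    (fun v φ φ' => by
      simp only [interfaceForm, avg_add, jump_add, ← Finset.sum_add_distrib]
      exact Finset.sum_congr rfl fun j _ => by ring)
    (fun c v φ => by
      simp only [interfaceForm, avg_smul, jump_smul, smul_eq_mul, Finset.mul_sum]
      exact Finset.sum_congr rfl fun j _ => by ring)

theorem diffusionForm_apply (β₀ β₁ : ℝ) (v φ : DGSpace K N) :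
    M.diffusionForm N β₀ β₁ v φ = M.derivForm N 1 v φ + M.interfaceForm β₀ β₁ v φ := rfl

/-- The square of the broken energy norm. -/
noncomputable def energy (v : DGSpace K N) : ℝ :=
  M.derivForm N 1 v v + ∑ j, M.jump v j ^ 2 / M.size

theorem size_nonneg : 0 ≤ M.size :=
  Real.iSup_nonneg fun k => (M.len_pos k).le

theorem energy_nonneg (v : DGSpace K N) : 0 ≤ M.energy v :=
  add_nonneg (M.derivForm_nonneg 1 v)
    (Finset.sum_nonneg fun _ _ => div_nonneg (sq_nonneg _) M.size_nonneg)

theorem derivForm_le_energy (v : DGSpace K N) : M.derivForm N 1 v v ≤ M.energy v :=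
  le_add_of_nonneg_right (Finset.sum_nonneg fun _ _ => div_nonneg (sq_nonneg _) M.size_nonneg)

theorem sum_sq_jump_le (hab : a < b) (v : DGSpace K N) :
    ∑ j, M.jump v j ^ 2 ≤ M.size * M.energy v := by
  have h := M.size_pos hab
  rw [energy, mul_add, ← Finset.sum_div, mul_div_cancel₀ _ h.ne']
  exact le_add_of_nonneg_left (mul_nonneg h.le (M.derivForm_nonneg 1 v))

/-- Admissibility trades the interface terms for the jumps at the price of the fraction `γ` of the
gradient, and `1 - γ` of it remains. -/
theorem energy_le_diffusionForm {β₀ β₁ γ μ : ℝ} (hM : M.Admissible N β₀ β₁ γ μ)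
    (v : DGSpace K N) : min (1 - γ) μ * M.energy v ≤ M.diffusionForm N β₀ β₁ v v := by
  have h := hM v
  have e : (∑ k, M.cellInt k fun x => ((v.dpoly 1 k).eval x) ^ 2) = M.derivForm N 1 v v :=
    (M.derivForm_self 1 v).symm
  rw [e] at h
  have h1 := M.derivForm_nonneg 1 v
  have h2 : 0 ≤ ∑ j, M.jump v j ^ 2 / M.size :=
    Finset.sum_nonneg fun j _ => div_nonneg (sq_nonneg _) M.size_nonneg
  rw [diffusionForm_apply, energy, mul_add]
  have h3 := mul_le_mul_of_nonneg_right (min_le_left (1 - γ) μ) h1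
  have h4 := mul_le_mul_of_nonneg_right (min_le_right (1 - γ) μ) h2
  linarith

end DGMesh

end Mesh

/-! ### Inequalities for piecewise polynomials on quasi-uniform meshes -/

section Mesh

open MeasureTheory Set Polynomial

namespace DGMesh

variable {a b : ℝ} {K N : ℕ} (M : DGMesh a b K)

theorem exists_cell {x : ℝ} (hx : x ∈ Ico a b) :
    ∃ k : Fin K, x ∈ Ico (M.node k.castSucc) (M.node k.succ) := by
  have h : ∀ j : Fin (K + 1), x < M.node j →
      ∃ k : Fin K, x ∈ Ico (M.node k.castSucc) (M.node k.succ) := fun j => by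
    induction j using Fin.induction with
    | zero => intro h; rw [M.node_zero] at h; exact absurd h (not_lt.2 hx.1)
    | succ k ih =>
      intro h
      rcases lt_or_ge x (M.node k.castSucc) with h1 | h1
      · exact ih h1
      · exact ⟨k, h1, h⟩
  exact h (Fin.last K) (M.node_last.symm ▸ hx.2)

/-! #### Piecewise linear functions -/

/-- The piecewise linear function with given one-sided values at the end points of the cells. -/
noncomputable def affine (N : ℕ) (p q : Fin K → ℝ) : DGSpace K N :=
  DGSpace.ofPoly N fun k =>
    C ((q k - p k) / M.len k) * X + C (p k - (q k - p k) / M.len k * M.node k.castSucc)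

theorem poly_affine (hN : 1 ≤ N) (p q : Fin K → ℝ) (k : Fin K) :
    (M.affine N p q).poly k =
      C ((q k - p k) / M.len k) * X + C (p k - (q k - p k) / M.len k * M.node k.castSucc) :=
  DGSpace.poly_ofPoly (natDegree_linear_le.trans hN)

theorem eval_affine (hN : 1 ≤ N) (p q : Fin K → ℝ) (k : Fin K) (x : ℝ) :
    ((M.affine N p q).poly k).eval x =
      p k + (q k - p k) * ((x - M.node k.castSucc) / M.len k) := by
  rw [M.poly_affine hN]; simp; ring

theorem eval_affine_left (hN : 1 ≤ N) (p q : Fin K → ℝ) (k : Fin K) :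
    ((M.affine N p q).poly k).eval (M.node k.castSucc) = p k := by
  rw [M.eval_affine hN]; simp

theorem eval_affine_right (hN : 1 ≤ N) (p q : Fin K → ℝ) (k : Fin K) :
    ((M.affine N p q).poly k).eval (M.node k.succ) = q k := by
  rw [M.eval_affine hN, show M.node k.succ - M.node k.castSucc = M.len k from rfl,
    div_self (M.len_pos k).ne']
  ring

theorem dpoly_one_affine (hN : 1 ≤ N) (p q : Fin K → ℝ) (k : Fin K) :
    (M.affine N p q).dpoly 1 k = C ((q k - p k) / M.len k) := by
  rw [DGSpace.dpoly_one, M.poly_affine hN]; simp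

theorem dpoly_two_affine (hN : 1 ≤ N) (p q : Fin K → ℝ) (k : Fin K) :
    (M.affine N p q).dpoly 2 k = 0 := by
  rw [DGSpace.dpoly_two, M.poly_affine hN]; simp

theorem massForm_affine_le (hN : 1 ≤ N) (p q : Fin K → ℝ) :
    M.massForm N (M.affine N p q) (M.affine N p q) ≤
      ∑ k, M.len k * (p k ^ 2 + q k ^ 2) := by
  rw [massForm_self]
  refine Finset.sum_le_sum fun k _ => ?_
  have h : ∀ x ∈ Icc (M.node k.castSucc) (M.node k.succ),
      ((M.affine N p q).poly k).eval x ^ 2 ≤ p k ^ 2 + q k ^ 2 := fun x hx => by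
    rw [M.eval_affine hN]
    set s := (x - M.node k.castSucc) / M.len k
    have hs0 : 0 ≤ s := div_nonneg (sub_nonneg.2 hx.1) (M.len_pos k).le
    have hs1 : s ≤ 1 := (div_le_one (M.len_pos k)).2 (sub_le_sub_right hx.2 _)
    have h1 := mul_nonneg hs0 (sub_nonneg.2 hs1)
    nlinarith [mul_nonneg h1 (sq_nonneg (p k - q k)), mul_nonneg hs0 (sq_nonneg (p k)),
      mul_nonneg (sub_nonneg.2 hs1) (sq_nonneg (q k))]
  have := intervalIntegral.integral_mono_on (M.node_lt k).le
    ((((M.affine N p q).poly k).continuous.pow 2).intervalIntegrable (μ := volume) _ _)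
    (intervalIntegrable_const (μ := volume)) h
  simpa [cellInt, len, mul_add] using this

theorem derivForm_affine (hN : 1 ≤ N) (p q : Fin K → ℝ) :
    M.derivForm N 1 (M.affine N p q) (M.affine N p q) =
      ∑ k, (q k - p k) ^ 2 / M.len k := by
  rw [derivForm_self]
  refine Finset.sum_congr rfl fun k _ => ?_
  have := (M.len_pos k).ne'
  simp only [M.dpoly_one_affine hN, eval_C, cellInt, intervalIntegral.integral_const, smul_eq_mul,
    show M.node k.succ - M.node k.castSucc = M.len k from rfl]
  field_simp

/-! #### Quasi-uniformity -/

/-- Admissibility is tested with the function of slope `1` that vanishes at the midpoint of the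
`k`-th cell and is zero on all other cells. Its jumps at the two ends are `-len/2`. The gradient
gives `γ len`, the penalty `β₀ len² / (2 h)`, and the averages contribute at most `-len`; hence `1 -
γ ≤ β₀ len / (2 h)`. -/
theorem size_le_of_admissible (hN : 1 ≤ N) {β₀ β₁ γ μ : ℝ} (hγ : γ < 1) (hμ : 0 ≤ μ)
    (hM : M.Admissible N β₀ β₁ γ μ) (k : Fin K) :
    M.size ≤ β₀ / (2 * (1 - γ)) * M.len k := by
  have hl := M.len_pos k
  have hh : 0 < M.size := hl.trans_le (M.len_le_size k)
  set p : Fin K → ℝ := fun i => if i = k then -(M.len k / 2) else 0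
  set q : Fin K → ℝ := fun i => if i = k then M.len k / 2 else 0
  set w := M.affine N p q
  have hpl : ∀ i, i ≠ k → w.poly i = 0 := fun i hi => by
    rw [M.poly_affine hN]; simp [p, q, hi]
  have hd1 : ∀ i, w.dpoly 1 i = if i = k then 1 else 0 := fun i => by
    rw [M.dpoly_one_affine hN]
    split_ifs with hi
    · subst hi; simp [p, q, hl.ne']
    · simp [p, q, hi]
  have hplus0 : ∀ (P : Fin K → ℝ[X]), (∀ i, i ≠ k → P i = 0) → ∀ j, j ≠ k.castSucc →
      M.tracePlus P j = 0 := fun P hP j hj => by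
    rw [tracePlus]
    split_ifs with h
    · rw [hP _ fun he => hj (by rw [← he]; rfl), eval_zero]
    · rfl
  have hminus0 : ∀ (P : Fin K → ℝ[X]), (∀ i, i ≠ k → P i = 0) → ∀ j, j ≠ k.succ →
      M.traceMinus P j = 0 := fun P hP j hj => by
    rw [traceMinus]
    split_ifs with h
    · rw [hP _ fun he => hj (by rw [← he]; ext; simp; omega), eval_zero]
    · rfl
  have hne : k.castSucc ≠ k.succ := (Fin.castSucc_lt_succ).ne
  have hdz : ∀ i, i ≠ k → w.dpoly 1 i = 0 := fun i hi => by rw [hd1, if_neg hi]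
  have hs : ∀ j, M.jumpSecond w j = 0 := fun j => by
    simp [jumpSecond, tracePlus, traceMinus, w, M.dpoly_two_affine hN]
  have hj1 : M.jump w k.castSucc = -(M.len k / 2) := by
    rw [jump, DGSpace.dpoly_zero, hminus0 _ hpl _ hne, tracePlus_castSucc]
    simp only [w, M.eval_affine_left hN]
    simp [p]
  have hj2 : M.jump w k.succ = -(M.len k / 2) := by
    rw [jump, DGSpace.dpoly_zero, hplus0 _ hpl _ hne.symm, traceMinus_succ]
    simp only [w, M.eval_affine_right hN]
    simp [q]
  have hj0 : ∀ j, j ≠ k.castSucc ∧ j ≠ k.succ → M.jump w j = 0 := fun j hj => by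
    rw [jump, DGSpace.dpoly_zero, hplus0 _ hpl _ hj.1, hminus0 _ hpl _ hj.2, sub_zero]
  -- The average is `1/2` at an interior node, where the neighbouring slope is zero, and `1` at an
  -- end point.
  have ha1 : 1 / 2 ≤ M.avg 1 w k.castSucc := by
    rw [avg, hminus0 _ hdz _ hne, tracePlus_castSucc, hd1, if_pos rfl]
    split_ifs <;> norm_num
  have ha2 : 1 / 2 ≤ M.avg 1 w k.succ := by
    rw [avg, hplus0 _ hdz _ hne.symm, traceMinus_succ, hd1, if_pos rfl]
    split_ifs <;> norm_num
  have h := hM w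
  have e1 : (∑ i, M.cellInt i fun x => ((w.dpoly 1 i).eval x) ^ 2) = M.len k := by
    rw [Finset.sum_eq_single k (fun i _ hi => by simp [hdz i hi, cellInt]) (by simp)]
    simp [hd1, cellInt, len]
  have e2 : M.interfaceForm β₀ β₁ w w = (β₀ / M.size * (M.len k / 2) ^ 2
      - M.avg 1 w k.castSucc * M.len k) + (β₀ / M.size * (M.len k / 2) ^ 2
      - M.avg 1 w k.succ * M.len k) := by
    rw [interfaceForm, Fintype.sum_eq_add _ _ hne fun j hj => by simp [hj0 j hj]]
    simp only [flux, hs, hj1, hj2]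
    ring
  rw [e1, e2] at h
  have h0 : 0 ≤ μ * ∑ j, M.jump w j ^ 2 / M.size :=
    mul_nonneg hμ (Finset.sum_nonneg fun j _ => div_nonneg (sq_nonneg _) hh.le)
  have h1 : 0 ≤ γ * M.len k + β₀ / M.size * (M.len k ^ 2 / 2) - M.len k := by
    nlinarith [mul_le_mul_of_nonneg_right ha1 hl.le, mul_le_mul_of_nonneg_right ha2 hl.le]
  have h2 : 0 ≤ γ + β₀ / M.size * (M.len k / 2) - 1 := by
    by_contra hc
    push Not at hc
    nlinarith
  have h3 : 1 - γ ≤ β₀ * M.len k / (2 * M.size) := by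
    have : β₀ / M.size * (M.len k / 2) = β₀ * M.len k / (2 * M.size) := by field_simp
    linarith
  rw [le_div_iff₀ (by positivity)] at h3
  rw [div_mul_eq_mul_div, le_div_iff₀ (by linarith)]
  linarith

/-- The mesh is quasi-uniform with constant `κ`. -/
def QuasiUniform (κ : ℝ) : Prop := ∀ k, M.size ≤ κ * M.len k

variable {M} {κ : ℝ}

theorem QuasiUniform.card_mul_size_le (h : M.QuasiUniform κ) : K * M.size ≤ κ * (b - a) := by
  have := Finset.sum_le_sum fun (k : Fin K) (_ : k ∈ Finset.univ) => h k
  rwa [← Finset.mul_sum, M.sum_len, Finset.sum_const, Finset.card_univ, Fintype.card_fin,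
    nsmul_eq_mul] at this

theorem QuasiUniform.pos (h : M.QuasiUniform κ) (hab : a < b) : 0 < κ := by
  have h1 := h ⟨0, M.card_pos hab⟩
  have h2 := M.size_pos hab
  have h3 := M.len_pos ⟨0, M.card_pos hab⟩
  by_contra hc
  push Not at hc
  nlinarith

theorem exists_sum_sq_trace_le (N n m : ℕ) (κ : ℝ) :
    ∃ C, 0 < C ∧ ∀ {a b : ℝ} {K : ℕ} (M : DGMesh a b K), a < b → M.QuasiUniform κ →
      ∀ v : DGSpace K N, M.size ^ (2 * n + 1) *
        ∑ j, (M.tracePlus (v.dpoly (n + m)) j ^ 2 + M.traceMinus (v.dpoly (n + m)) j ^ 2)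
        ≤ C * M.derivForm N m v v := by
  obtain ⟨C, hC, h⟩ := exists_trace_sq_le N n
  -- The constant is chosen before any mesh is given, when the sign of `κ` is unknown; this explains
  -- the absolute value and the summand `1`.
  refine ⟨2 * (|κ| ^ (2 * n + 1) * C) + 1, by positivity, fun {a b K} M hab hM v => ?_⟩
  have hκ := hM.pos hab
  have h0 := M.derivForm_nonneg m v
  refine le_trans ?_ (mul_le_mul_of_nonneg_right (le_add_of_nonneg_right zero_le_one) h0)
  rw [sum_sq_trace, Finset.mul_sum, derivForm_self, Finset.mul_sum]
  refine Finset.sum_le_sum fun k _ => ?_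
  have hd : v.dpoly (n + m) k = derivative^[n] (v.dpoly m k) :=
    Function.iterate_add_apply _ n m _
  obtain ⟨h1, h2⟩ := h _ _ (M.node_lt k) _ (v.natDegree_dpoly_le m k)
  rw [hd]
  have h3 : M.size ^ (2 * n + 1) ≤ |κ| ^ (2 * n + 1) * M.len k ^ (2 * n + 1) := by
    rw [← mul_pow, abs_of_pos hκ]
    exact pow_le_pow_left₀ M.size_nonneg (hM k) _
  have h4 := mul_le_mul_of_nonneg_right h3 (add_nonneg
    (sq_nonneg ((derivative^[n] (v.dpoly m k)).eval (M.node k.castSucc)))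
    (sq_nonneg ((derivative^[n] (v.dpoly m k)).eval (M.node k.succ))))
  refine h4.trans ?_
  have h5 : 0 ≤ |κ| ^ (2 * n + 1) := by positivity
  have h6 := mul_le_mul_of_nonneg_left (add_le_add h1 h2) h5
  rw [cellInt]
  simp only [len]
  linarith

theorem exists_sum_sq_avg_le (N : ℕ) (κ : ℝ) :
    ∃ C, 0 < C ∧ ∀ {a b : ℝ} {K : ℕ} (M : DGMesh a b K), a < b → M.QuasiUniform κ →
      ∀ v : DGSpace K N, M.size * ∑ j, M.avg 1 v j ^ 2 ≤ C * M.derivForm N 1 v v := by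
  obtain ⟨C, hC, h⟩ := exists_sum_sq_trace_le N 0 1 κ
  refine ⟨2 * C, by positivity, fun {a b K} M hab hM v => ?_⟩
  have h1 := h M hab hM v
  simp only [mul_zero, zero_add, pow_one] at h1
  have h2 := Finset.sum_le_sum fun (j : Fin (K + 1)) (_ : j ∈ Finset.univ) => M.sq_avg_le 1 v j
  rw [← Finset.mul_sum] at h2
  nlinarith [M.size_nonneg]

theorem exists_sum_sq_flux_le (N : ℕ) (β₀ β₁ κ : ℝ) :
    ∃ C, 0 < C ∧ ∀ {a b : ℝ} {K : ℕ} (M : DGMesh a b K), a < b → M.QuasiUniform κ →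
      ∀ v : DGSpace K N, M.size * ∑ j, M.flux β₀ β₁ v j ^ 2 ≤ C * M.energy v := by
  obtain ⟨C, hC, h⟩ := exists_sum_sq_avg_le N κ
  obtain ⟨C', hC', h'⟩ := exists_sum_sq_trace_le N 1 1 κ
  refine ⟨3 * (β₀ ^ 2 + C + 2 * (β₁ ^ 2 * C')), by positivity, fun {a b K} M hab hM v => ?_⟩
  have hh := M.size_pos hab
  have h1 := h M hab hM v
  have h2 := h' M hab hM v
  have h3 := Finset.sum_le_sum fun (j : Fin (K + 1)) (_ : j ∈ Finset.univ) =>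
    M.sq_jumpSecond_le v j
  rw [← Finset.mul_sum] at h3
  have h4 : M.size ^ 3 * ∑ j, M.jumpSecond v j ^ 2 ≤ 2 * (C' * M.derivForm N 1 v v) := by
    have := mul_le_mul_of_nonneg_left h3 (pow_pos hh 3).le
    norm_num at h2
    linarith
  have h5 := M.derivForm_le_energy v
  have h6 := M.sum_sq_jump_le hab v
  have hpt : ∀ j, M.size * M.flux β₀ β₁ v j ^ 2 ≤ 3 * (β₀ ^ 2 * (M.size⁻¹ * M.jump v j ^ 2)
      + M.size * M.avg 1 v j ^ 2 + β₁ ^ 2 * (M.size ^ 3 * M.jumpSecond v j ^ 2)) := fun j => by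
    have key : ∀ x y z : ℝ, (x + y + z) ^ 2 ≤ 3 * (x ^ 2 + y ^ 2 + z ^ 2) := fun x y z => by
      nlinarith [sq_nonneg (x - y), sq_nonneg (y - z), sq_nonneg (x - z)]
    refine (mul_le_mul_of_nonneg_left (key _ _ _) hh.le).trans (le_of_eq ?_)
    field_simp
  have h7 := Finset.sum_le_sum fun (j : Fin (K + 1)) (_ : j ∈ Finset.univ) => hpt j
  simp only [← Finset.mul_sum, Finset.sum_add_distrib] at h7
  have h8 : M.size⁻¹ * ∑ j, M.jump v j ^ 2 ≤ M.energy v := by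
    rw [inv_mul_le_iff₀ hh]; exact h6
  have h9 := mul_le_mul_of_nonneg_left h8 (sq_nonneg β₀)
  have h10 := mul_le_mul_of_nonneg_left (h4.trans (mul_le_mul_of_nonneg_left
    (mul_le_mul_of_nonneg_left h5 hC'.le) (by norm_num : (0 : ℝ) ≤ 2))) (sq_nonneg β₁)
  have h11 := h1.trans (mul_le_mul_of_nonneg_left h5 hC.le)
  linarith

theorem exists_diffusionForm_sq_le (N : ℕ) (β₀ β₁ κ : ℝ) :
    ∃ C, 0 < C ∧ ∀ {a b : ℝ} {K : ℕ} (M : DGMesh a b K), a < b → M.QuasiUniform κ →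
      ∀ v φ : DGSpace K N,
        M.diffusionForm N β₀ β₁ v φ ^ 2 ≤ C * (M.energy v * M.energy φ) := by
  obtain ⟨C, hC, h⟩ := exists_sum_sq_avg_le N κ
  obtain ⟨C', hC', h'⟩ := exists_sum_sq_flux_le N β₀ β₁ κ
  refine ⟨3 * (1 + C' + C), by positivity, fun {a b K} M hab hM v φ => ?_⟩
  have hh := M.size_pos hab
  have hE := M.energy_nonneg v
  have hE' := M.energy_nonneg φ
  have h1 : M.derivForm N 1 v φ ^ 2 ≤ M.energy v * M.energy φ :=
    (LinearMap.BilinForm.apply_sq_le_of_symm _ (M.derivForm_nonneg 1)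
      ⟨fun x y => by simpa using M.derivForm_comm 1 x y⟩ v φ).trans
    (mul_le_mul (M.derivForm_le_energy v) (M.derivForm_le_energy φ) (M.derivForm_nonneg 1 φ) hE)
  have hcs : ∀ {f g : Fin (K + 1) → ℝ} {A B : ℝ}, 0 ≤ A → M.size * ∑ j, f j ^ 2 ≤ A →
      ∑ j, g j ^ 2 ≤ M.size * B → (∑ j, f j * g j) ^ 2 ≤ A * B := fun {f g A B} hA hf hg => by
    refine (Finset.sum_mul_sq_le_sq_mul_sq _ f g).trans ?_
    have h1 : 0 ≤ ∑ j, f j ^ 2 := Finset.sum_nonneg fun _ _ => sq_nonneg _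
    have hB : 0 ≤ B := by
      have : 0 ≤ ∑ j, g j ^ 2 := Finset.sum_nonneg fun _ _ => sq_nonneg _
      by_contra hc
      push Not at hc
      nlinarith
    calc _ ≤ (∑ j, f j ^ 2) * (M.size * B) := mul_le_mul_of_nonneg_left hg h1
      _ = (M.size * ∑ j, f j ^ 2) * B := by ring
      _ ≤ A * B := mul_le_mul_of_nonneg_right hf hB
  have h2 := hcs (by positivity) (h' M hab hM v) (M.sum_sq_jump_le hab φ)
  have h3 := hcs (by positivity)
    ((h M hab hM φ).trans (mul_le_mul_of_nonneg_left (M.derivForm_le_energy φ) hC.le))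
    (M.sum_sq_jump_le hab v)
  rw [diffusionForm_apply, interfaceForm, Finset.sum_add_distrib]
  have key : ∀ x y z : ℝ, (x + (y + z)) ^ 2 ≤ 3 * (x ^ 2 + y ^ 2 + z ^ 2) := fun x y z => by
    nlinarith [sq_nonneg (x - y), sq_nonneg (y - z), sq_nonneg (x - z)]
  refine (key _ _ _).trans ?_
  linarith

/-! #### Conforming part -/

variable (M)

/-- Without jumps, the outer traces zero included, a piecewise polynomial lies in `H¹₀` and is the
primitive of its cellwise derivative. In this form it can stand on the right side of the continuous
a priori estimate. -/
theorem primitive_of_jump_eq_zero (hab : a < b) {w : DGSpace K N} (hw : ∀ j, M.jump w j = 0) :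
    (∫ x in a..b, M.toFun w.grad x = 0) ∧ primitive a (M.toFun w.grad) = M.toFun w := by
  have hint := L2On.integrable (M.toFun_mem w.grad)
  have htr : ∀ j, M.tracePlus w.poly j = M.traceMinus w.poly j := fun j => sub_eq_zero.1 (hw j)
  have hcell : ∀ k : Fin K, ∀ x ∈ Icc (M.node k.castSucc) (M.node k.succ),
      primitive a (M.toFun w.grad) x = primitive a (M.toFun w.grad) (M.node k.castSucc)
        + ((w.poly k).eval x - (w.poly k).eval (M.node k.castSucc)) := fun k x hx => by
    have h1 := primitive_sub hint (a := a) (M.node k.castSucc) x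
    have h2 : ∫ t in (M.node k.castSucc)..x, M.toFun w.grad t
        = ∫ t in (M.node k.castSucc)..x, (derivative (w.poly k)).eval t := by
      rw [intervalIntegral.integral_of_le hx.1, intervalIntegral.integral_of_le hx.1,
        integral_Ioc_eq_integral_Ioo, integral_Ioc_eq_integral_Ioo]
      refine setIntegral_congr_fun measurableSet_Ioo fun t ht => ?_
      rw [M.toFun_apply_of_mem w.grad (k := k) ⟨ht.1.le, ht.2.trans_le hx.2⟩, DGSpace.poly_grad,
        DGSpace.dpoly_one]
    have h3 : ∫ t in (M.node k.castSucc)..x, (derivative (w.poly k)).eval t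
        = (w.poly k).eval x - (w.poly k).eval (M.node k.castSucc) :=
      intervalIntegral.integral_eq_sub_of_hasDerivAt (fun t _ => (w.poly k).hasDerivAt t)
        ((derivative (w.poly k)).continuous.intervalIntegrable _ _)
    rw [h2, h3] at h1
    linarith
  have hnode : ∀ j : Fin (K + 1), primitive a (M.toFun w.grad) (M.node j)
      = M.tracePlus w.poly j := fun j => by
    induction j using Fin.induction with
    | zero => rw [htr, traceMinus_zero, M.node_zero, primitive, intervalIntegral.integral_same]
    | succ k ih =>
      rw [hcell k _ (right_mem_Icc.2 (M.node_lt k).le), ih, htr, htr, traceMinus_succ, ← htr,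
        tracePlus_castSucc]
      ring
  have h0 : ∫ x in a..b, M.toFun w.grad x = 0 := by
    have := hnode (Fin.last K)
    rwa [M.node_last, tracePlus_last] at this
  refine ⟨h0, funext fun x => ?_⟩
  by_cases hx : x ∈ Ico a b
  · obtain ⟨k, hk⟩ := M.exists_cell hx
    rw [hcell k x (Ico_subset_Icc_self hk), hnode, tracePlus_castSucc, M.toFun_apply_of_mem w hk]
    ring
  · have hr : M.toFun w x = 0 := Finset.sum_eq_zero fun k _ =>
      indicator_of_notMem (fun h => hx ⟨(M.node_mem _).1.trans h.1,
        h.2.trans_le (M.node_mem _).2⟩) _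
    rw [hr]
    rcases eq_or_ne x b with rfl | hb
    · exact h0
    · exact (primitive_mem hab.le (M.toFun_mem w.grad) h0).1.2 x
        fun h => hx ⟨h.1, h.2.lt_of_ne hb⟩

variable {M}

theorem massForm_le_of_jump_eq_zero (M : DGMesh a b K) (hab : a < b) {w : DGSpace K N}
    (hw : ∀ j, M.jump w j = 0) : M.massForm N w w ≤ (b - a) ^ 2 * M.derivForm N 1 w w := by
  obtain ⟨h0, hp⟩ := M.primitive_of_jump_eq_zero hab hw
  have := (primitive_mem hab.le (M.toFun_mem w.grad) h0).2
  rwa [hp, integral_toFun_sq, integral_toFun_sq, massForm_grad] at this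

/-- A piecewise polynomial is close to a continuous one that vanishes at the end points. -/
theorem QuasiUniform.exists_conforming (hM : M.QuasiUniform κ) (hab : a < b) (hN : 1 ≤ N)
    (v : DGSpace K N) : ∃ w : DGSpace K N, (∀ j, M.jump w j = 0) ∧
      M.massForm N (v - w) (v - w) ≤ 2 * M.size ^ 2 * M.energy v ∧
      M.derivForm N 1 w w ≤ (2 + 8 * κ) * M.energy v := by
  have hκ := hM.pos hab
  have hh := M.size_pos hab
  -- The nodal values of the conforming part: averages inside, zero at the end points. Every inner
  -- trace differs from them by at most the jump, since at an end point the jump is the trace itself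
  -- up to sign.
  set α : Fin (K + 1) → ℝ := fun j => if Interior K j then M.avg 0 v j else 0 with hα
  have hplus : ∀ j,
      (M.tracePlus v.poly j - α j) ^ 2 ≤ M.jump v j ^ 2 ∨ j = Fin.last K := fun j => by
    rcases eq_or_ne j (Fin.last K) with hj | hj
    · exact Or.inr hj
    · left
      have hlt : (j : ℕ) < K := lt_of_le_of_ne (Nat.lt_succ_iff.1 j.2) fun h => hj (Fin.ext h)
      simp only [hα, avg, jump, DGSpace.dpoly_zero]
      split_ifs with hi
      · nlinarith [sq_nonneg (M.tracePlus v.poly j - M.traceMinus v.poly j)]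
      · have : ¬ 0 < (j : ℕ) := fun h => hi ⟨h, hlt⟩
        rw [traceMinus, dif_neg this]
  have hminus : ∀ j, (M.traceMinus v.poly j - α j) ^ 2 ≤ M.jump v j ^ 2 ∨ j = 0 := fun j => by
    rcases eq_or_ne j 0 with hj | hj
    · exact Or.inr hj
    · left
      have hlt : 0 < (j : ℕ) := Nat.pos_of_ne_zero fun h => hj (Fin.ext h)
      simp only [hα, avg, jump, DGSpace.dpoly_zero]
      split_ifs with hi
      · nlinarith [sq_nonneg (M.tracePlus v.poly j - M.traceMinus v.poly j)]
      · have : ¬ (j : ℕ) < K := fun h => hi ⟨hlt, h⟩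
        rw [tracePlus, dif_neg this]
        nlinarith
  set p : Fin K → ℝ := fun k => (v.poly k).eval (M.node k.castSucc) - α k.castSucc
  set q : Fin K → ℝ := fun k => (v.poly k).eval (M.node k.succ) - α k.succ
  have hp : ∀ k, p k ^ 2 ≤ M.jump v k.castSucc ^ 2 := fun k => by
    have := (hplus k.castSucc).resolve_right (Fin.castSucc_lt_last k).ne
    rwa [tracePlus_castSucc] at this
  have hq : ∀ k, q k ^ 2 ≤ M.jump v k.succ ^ 2 := fun k => by
    have := (hminus k.succ).resolve_right (Fin.succ_ne_zero k)
    rwa [traceMinus_succ] at this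
  have hsum : ∑ k, (p k ^ 2 + q k ^ 2) ≤ 2 * (M.size * M.energy v) := by
    have h1 : ∑ k, p k ^ 2 ≤ ∑ j, M.jump v j ^ 2 := by
      rw [Fin.sum_univ_castSucc]
      exact (Finset.sum_le_sum fun k _ => hp k).trans (le_add_of_nonneg_right (sq_nonneg _))
    have h2 : ∑ k, q k ^ 2 ≤ ∑ j, M.jump v j ^ 2 := by
      rw [Fin.sum_univ_succ]
      exact (Finset.sum_le_sum fun k _ => hq k).trans (le_add_of_nonneg_left (sq_nonneg _))
    have := M.sum_sq_jump_le hab v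
    rw [Finset.sum_add_distrib]
    linarith
  -- The piecewise linear function carrying the trace errors is subtracted; its norms are controlled
  -- by the jumps alone.
  set l := M.affine N p q
  refine ⟨v - l, fun j => ?_, ?_, ?_⟩
  · have e1 : M.tracePlus (DGSpace.poly (v - l)) j = α j := by
      induction j using Fin.lastCases with
      | last => simp [hα, Interior]
      | cast k => simp [l, M.eval_affine_left hN, p]
    have e2 : M.traceMinus (DGSpace.poly (v - l)) j = α j := by
      induction j using Fin.cases with
      | zero => simp [hα, Interior]
      | succ k => simp [l, M.eval_affine_right hN, q]
    rw [jump, DGSpace.dpoly_zero, e1, e2, sub_self]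
  · rw [sub_sub_cancel]
    refine (M.massForm_affine_le hN p q).trans ?_
    calc _ ≤ ∑ k, M.size * (p k ^ 2 + q k ^ 2) := Finset.sum_le_sum fun k _ =>
          mul_le_mul_of_nonneg_right (M.len_le_size k) (by positivity)
      _ = M.size * ∑ k, (p k ^ 2 + q k ^ 2) := by rw [Finset.mul_sum]
      _ ≤ _ := (mul_le_mul_of_nonneg_left hsum hh.le).trans (le_of_eq (by ring))
  · have hl : M.derivForm N 1 l l ≤ 4 * κ * M.energy v := by
      rw [M.derivForm_affine hN]
      calc _ ≤ ∑ k, 2 * κ / M.size * (p k ^ 2 + q k ^ 2) := Finset.sum_le_sum fun k _ => by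
            have h1 : (q k - p k) ^ 2 ≤ 2 * (p k ^ 2 + q k ^ 2) := by
              nlinarith [sq_nonneg (p k + q k)]
            have h2 : 1 / M.len k ≤ κ / M.size := by
              rw [div_le_div_iff₀ (M.len_pos k) hh]
              simpa using hM k
            calc _ = (q k - p k) ^ 2 * (1 / M.len k) := by ring
              _ ≤ (2 * (p k ^ 2 + q k ^ 2)) * (κ / M.size) :=
                mul_le_mul h1 h2 (by have := M.len_pos k; positivity) (by positivity)
              _ = _ := by ring
        _ = 2 * κ / M.size * ∑ k, (p k ^ 2 + q k ^ 2) := by rw [Finset.mul_sum]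
        _ ≤ 2 * κ / M.size * (2 * (M.size * M.energy v)) :=
          mul_le_mul_of_nonneg_left hsum (by positivity)
        _ = _ := by field_simp; ring
    have h1 : M.derivForm N 1 (v - l) (v - l) ≤
        2 * (M.derivForm N 1 v v + M.derivForm N 1 l l) := by
      have := M.derivForm_nonneg 1 (v + l)
      simp only [map_add, map_sub, LinearMap.add_apply, LinearMap.sub_apply] at this ⊢
      linarith
    have := M.derivForm_le_energy v
    linarith

/-- A broken Poincaré inequality: the conforming part obeys the usual one, the rest is bounded by
the jumps. -/
theorem QuasiUniform.massForm_le_energy (hM : M.QuasiUniform κ) (hab : a < b) (hN : 1 ≤ N)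
    (hs : M.size ≤ b - a) (v : DGSpace K N) :
    M.massForm N v v ≤ (b - a) ^ 2 * (8 + 16 * κ) * M.energy v := by
  obtain ⟨w, hw, h1, h2⟩ := hM.exists_conforming hab hN v
  have h3 := massForm_le_of_jump_eq_zero M hab hw
  have h4 := M.massForm_nonneg (v - w - w)
  have h5 : M.massForm N v v ≤ 2 * (M.massForm N (v - w) (v - w) + M.massForm N w w) := by
    simp only [map_sub, LinearMap.sub_apply] at h4 ⊢
    linarith
  have hE := M.energy_nonneg v
  have h6 : M.size ^ 2 ≤ (b - a) ^ 2 := pow_le_pow_left₀ M.size_nonneg hs 2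
  have h7 := mul_le_mul_of_nonneg_right h6 hE
  have h8 := mul_le_mul_of_nonneg_left h2 (sq_nonneg (b - a))
  nlinarith

theorem size_le (M : DGMesh a b K) : M.size ≤ b - a := by
  refine Real.iSup_le (fun k => ?_) (sub_nonneg.2 M.le_of_mesh)
  linarith [(M.node_mem k.succ).2, (M.node_mem k.castSucc).1]

end DGMesh

end Mesh

/-! ### The fractional integral on piecewise polynomials -/

section Mesh

open MeasureTheory Set Polynomial

theorem integral_eq_intervalIntegral {a b : ℝ} (hab : a ≤ b) {f : ℝ → ℝ}
    (hf : ∀ x ∉ Icc a b, f x = 0) : ∫ x, f x = ∫ x in a..b, f x := by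
  rw [intervalIntegral.integral_of_le hab, ← integral_Icc_eq_integral_Ioc,
    setIntegral_eq_integral_of_forall_compl_eq_zero hf]

namespace DGMesh

/-- On a cell of length `2 r` the polynomial is controlled by the increments of length `r` of its
primitive, and these by the integral of `increments` over the same cell. Summing over cells and
applying `integral_increments_le` with `D = h / 2` compares `h³ ‖y‖²` with `h^(3-σ)` times the form.
-/
theorem exists_inverse_estimate (N : ℕ) (κ : ℝ) {σ : ℝ} (hσ₀ : 0 < σ) (hσ : σ < 1) :
    ∃ c, 0 < c ∧ ∀ {a b : ℝ} {K : ℕ} (M : DGMesh a b K), a < b → M.QuasiUniform κ →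
      ∀ y : DGSpace K N, c * (M.size ^ σ * M.massForm N y y) ≤
        rieszForm σ (M.toFun y) (M.toFun y) := by
  obtain ⟨C, hC, hwin⟩ := exists_integral_sq_le_window_cell N
  have h1σ : 0 < 1 - σ := by linarith
  have h2σ : 0 < 2 - σ := by linarith
  set A : ℝ := 4 * C * (2 / ((1 - σ) * (2 - σ)) * (1 / 2) ^ (3 - σ)) * (|κ| + 1) ^ 3 with hA
  have hApos : 0 < A := by positivity
  refine ⟨A⁻¹, by positivity, fun {a b K} M hab hM y => ?_⟩
  have hκ := hM.pos hab
  have hh := M.size_pos hab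
  rw [inv_mul_le_iff₀ hApos]
  set f := M.toFun y with hf
  have hfm : f ∈ L2On a b := M.toFun_mem y
  set F := primitive a f with hF
  have hFc : Continuous F := continuous_primitive' (L2On.integrable hfm)
  set D := M.size / 2 with hD
  have hD0 : 0 < D := by positivity
  obtain ⟨hinc, hle⟩ := integral_increments_le hσ₀ hσ hab.le hfm hD0 a
  set I := increments F D with hI
  have hI0 : ∀ x, 0 ≤ I x := fun x => increments_nonneg hD0.le x
  have hIi : ∀ x y : ℝ, IntervalIntegrable I volume x y := fun x y => hinc.intervalIntegrable
  have hcell : ∀ k : Fin K, M.len k ^ 3 * M.cellInt k (fun x => (y.poly k).eval x ^ 2) ≤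
      4 * C * M.cellInt k I := fun k => by
    set c := M.node k.castSucc with hc
    set d := M.node k.succ with hd
    have hcd : c < d := M.node_lt k
    set r := (d - c) / 2 with hr
    have hr0 : 0 < r := by rw [hr]; linarith
    have hrD : r ≤ D := by
      have : d - c ≤ M.size := M.len_le_size k
      rw [hr, hD]; linarith
    have hm : (c + d) / 2 = c + r := by rw [hr]; ring
    have hmd : c + r + r = d := by rw [hr]; ring
    have h1 := hwin c d hcd (y.poly k) (y.natDegree_poly_le k)
    have h2 : ∫ x in c..(c + r), (∫ t in x..(x + r), (y.poly k).eval t) ^ 2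
        = ∫ x in c..(c + r), (F (x + r) - F x) ^ 2 := by
      refine intervalIntegral.integral_congr fun x hx => ?_
      rw [uIcc_of_le (by linarith)] at hx
      congr 1
      rw [hF, primitive_sub (L2On.integrable hfm), intervalIntegral.integral_of_le (by linarith),
        intervalIntegral.integral_of_le (by linarith), integral_Ioc_eq_integral_Ioo,
        integral_Ioc_eq_integral_Ioo]
      refine setIntegral_congr_fun measurableSet_Ioo fun t ht => ?_
      exact (M.toFun_apply_of_mem y ⟨by linarith [hx.1, ht.1], by linarith [hx.2, ht.2]⟩).symm
    have h3 : r * ∫ x in c..(c + r), (F (x + r) - F x) ^ 2 ≤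
        ∫ x in c..(c + r), 2 * (I x + I (x + r)) := by
      rw [← intervalIntegral.integral_const_mul]
      refine intervalIntegral.integral_mono_on (by linarith)
        (Continuous.intervalIntegrable (by fun_prop) _ _)
        (((hIi _ _).add (hinc.comp_add_right r).intervalIntegrable).const_mul 2) fun x _ => ?_
      have := sq_sub_mul_le_increments hFc (D := D) (x := x) (y := x + r)
        (by rw [add_sub_cancel_left, abs_of_pos hr0]; exact hrD)
      rw [add_sub_cancel_left, abs_of_pos hr0] at this
      linarith
    have h4 : ∫ x in c..(c + r), 2 * (I x + I (x + r)) = 2 * ∫ x in c..d, I x := by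
      rw [intervalIntegral.integral_const_mul, intervalIntegral.integral_add (hIi _ _)
        (hinc.comp_add_right r).intervalIntegrable,
        intervalIntegral.integral_comp_add_right I r, hmd,
        intervalIntegral.integral_add_adjacent_intervals (hIi _ _) (hIi _ _)]
    rw [hm, h2] at h1
    rw [h4] at h3
    have hlen : M.len k = 2 * r := by rw [hr]; simp only [len]; ring
    have hdc : d - c = 2 * r := by rw [hr]; ring
    rw [hdc] at h1
    have h5 := mul_le_mul_of_nonneg_left h1 (show (0 : ℝ) ≤ 2 * r by linarith)
    have h6 := mul_le_mul_of_nonneg_left h3 (show (0 : ℝ) ≤ 2 * C by linarith)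
    rw [hlen]
    simp only [cellInt]
    linarith
  have hsum := Finset.sum_le_sum fun (k : Fin K) (_ : k ∈ Finset.univ) => hcell k
  rw [← Finset.mul_sum, M.sum_cellInt (hIi a b)] at hsum
  have hIle : ∫ x in a..b, I x ≤ ∫ x, I x := by
    rw [intervalIntegral.integral_of_le hab.le]
    exact setIntegral_le_integral hinc (Filter.Eventually.of_forall hI0)
  have hlow : (M.size / (|κ| + 1)) ^ 3 * M.massForm N y y ≤
      ∑ k, M.len k ^ 3 * M.cellInt k (fun x => (y.poly k).eval x ^ 2) := by
    rw [massForm_self, Finset.mul_sum]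
    refine Finset.sum_le_sum fun k _ => mul_le_mul_of_nonneg_right ?_
      (M.cellInt_nonneg fun x => sq_nonneg _)
    refine pow_le_pow_left₀ (by positivity) ?_ 3
    rw [div_le_iff₀ (by positivity), abs_of_pos hκ]
    have := hM k
    have := M.len_pos k
    linarith
  have hfin := (hlow.trans hsum).trans (mul_le_mul_of_nonneg_left (hIle.trans hle) (by positivity))
  have hpow : M.size ^ (3 - σ) * M.size ^ σ = M.size ^ 3 := by
    rw [← Real.rpow_add hh, sub_add_cancel]; norm_cast
  have hDp : D ^ (3 - σ) = M.size ^ (3 - σ) * (1 / 2) ^ (3 - σ) := by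
    rw [← Real.mul_rpow hh.le (by norm_num), hD]; congr 1; ring
  rw [hDp, div_pow, div_mul_eq_mul_div, div_le_iff₀ (by positivity), ← hpow] at hfin
  have hp : 0 < M.size ^ (3 - σ) := Real.rpow_pos_of_pos hh _
  refine le_of_mul_le_mul_left ?_ hp
  rw [hA]
  linarith

/-- The primitive of `g` vanishes at every node, so on each cell it is at most `h` times `g` in
`L²`, which is the hypothesis of `rieszForm_le_of_primitive`. -/
theorem rieszForm_le_of_cellInt_eq_zero {σ : ℝ} (hσ₀ : 0 < σ) (hσ : σ < 1) {a b : ℝ} {K : ℕ}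
    (M : DGMesh a b K) (hab : a < b) {g : ℝ → ℝ} (hg : g ∈ L2On a b)
    (h0 : ∀ k, M.cellInt k g = 0) :
    rieszForm σ g g ≤
      (1 - σ) * (2 - σ) * (1 / σ + 4 / (2 - σ)) * M.size ^ σ * ∫ x, g x ^ 2 := by
  have hh := M.size_pos hab
  have hgi := L2On.integrable hg
  have hg2 := L2On.integrable_sq hg
  have hzero : ∫ x in a..b, g x = 0 := by
    rw [← M.sum_cellInt hgi.intervalIntegrable, Finset.sum_eq_zero fun k _ => h0 k]
  have hP := (primitive_mem hab.le hg hzero).1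
  set F := primitive a g with hF
  have hnode : ∀ j : Fin (K + 1), F (M.node j) = 0 := fun j => by
    induction j using Fin.induction with
    | zero => rw [M.node_zero, hF, primitive, intervalIntegral.integral_same]
    | succ k ih =>
      have := primitive_sub hgi (a := a) (M.node k.castSucc) (M.node k.succ)
      rw [← hF, ih, sub_zero] at this
      rw [this]
      exact h0 k
  refine rieszForm_le_of_primitive hσ₀ hσ hab.le hg hh (L2On.integrable_sq hP) ?_
  rw [integral_eq_intervalIntegral hab.le fun x hx => by rw [← hF, hP.2 x hx]; simp,
    integral_eq_intervalIntegral hab.le fun x hx => by rw [hg.2 x hx]; simp,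
    ← M.sum_cellInt (L2On.integrable_sq hP).intervalIntegrable,
    ← M.sum_cellInt hg2.intervalIntegrable, Finset.mul_sum]
  refine Finset.sum_le_sum fun k _ => ?_
  have hk := M.node_lt k
  set J := M.cellInt k fun x => g x ^ 2 with hJ
  have hJ0 : 0 ≤ J := M.cellInt_nonneg fun x => sq_nonneg _
  have hpt : ∀ x ∈ Icc (M.node k.castSucc) (M.node k.succ), F x ^ 2 ≤ M.len k * J := fun x hx => by
    have h1 := primitive_sub hgi (a := a) (M.node k.castSucc) x
    rw [← hF, hnode, sub_zero] at h1
    rw [h1]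
    refine (sq_intervalIntegral_le hx.1 (hg.1.restrict _)).trans ?_
    refine mul_le_mul (sub_le_sub_right hx.2 _) ?_ (intervalIntegral.integral_nonneg hx.1
      fun _ _ => sq_nonneg _) (M.len_pos k).le
    exact intervalIntegral.integral_mono_interval le_rfl hx.1 hx.2
      (Filter.Eventually.of_forall fun _ => sq_nonneg _) hg2.intervalIntegrable
  have h2 := intervalIntegral.integral_mono_on hk.le
    (L2On.integrable_sq hP).intervalIntegrable (intervalIntegrable_const (μ := volume)) hpt
  rw [intervalIntegral.integral_const, smul_eq_mul] at h2
  refine h2.trans ?_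
  have h3 : M.len k ^ 2 ≤ M.size ^ 2 := pow_le_pow_left₀ (M.len_pos k).le (M.len_le_size k) 2
  calc (M.node k.succ - M.node k.castSucc) * (M.len k * J) = M.len k ^ 2 * J := by
        rw [len]; ring
    _ ≤ _ := mul_le_mul_of_nonneg_right h3 hJ0

theorem cellInt_eq_zero_of_orthogonal {a b : ℝ} {K N : ℕ} (M : DGMesh a b K) {g : ℝ → ℝ}
    (hg : g ∈ L2On a b) (h : ∀ φ : DGSpace K N, ∫ x, g x * M.toFun φ x = 0) (k : Fin K) :
    M.cellInt k g = 0 := by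
  have h1 := h (DGSpace.ofPoly N fun l => if l = k then 1 else 0)
  have hp : ∀ l, (DGSpace.ofPoly N fun l : Fin K => if l = k then (1 : ℝ[X]) else 0).poly l
      = if l = k then 1 else 0 := fun l => DGSpace.poly_ofPoly (by split_ifs <;> simp)
  rw [M.integral_mul_toFun hg, Finset.sum_eq_single k (fun l _ hl => by simp [hp, hl, cellInt])
    (by simp)] at h1
  simpa [hp] using h1

/-- The solution of the discrete equation of the first kind is bounded by the energy of the
right-hand side. -/
theorem exists_massForm_le_of_rieszForm_eq {N : ℕ} (hN : 1 ≤ N) (κ : ℝ) {σ a b : ℝ}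
    (hσ₀ : 0 < σ) (hσ : σ < 1) (hab : a < b) :
    ∃ C, 0 < C ∧ ∀ {K : ℕ} (M : DGMesh a b K), M.QuasiUniform κ → ∀ y v : DGSpace K N,
      (∀ φ : DGSpace K N, rieszForm σ (M.toFun y) (M.toFun φ) = M.massForm N v φ) →
        M.massForm N y y ≤ C * M.energy v := by
  obtain ⟨c, hc, hinv⟩ := exists_inverse_estimate N κ hσ₀ hσ
  set A := aPrioriConst σ (b - a)
  set B := (1 - σ) * (2 - σ) * (1 / σ + 4 / (2 - σ)) with hB
  have hBpos : 0 < B := by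
    have : 0 < 1 - σ := by linarith
    have : 0 < 2 - σ := by linarith
    positivity
  set L := (b - a) ^ (1 - σ)
  have hL : 0 < L := Real.rpow_pos_of_pos (by linarith) _
  set Z₀ := A ^ 2 * (2 + 8 * |κ|)
  have hZ₀ : 0 ≤ Z₀ := by positivity
  set X₀ := 2 * (2 * (2 * L ^ 2 + Z₀) / c + B * Z₀)
  have hX₀ : 0 ≤ X₀ := by positivity
  refine ⟨2 * (X₀ / c) + 2 * Z₀ + 1, by positivity, fun {K} M hM y v hy => ?_⟩
  have hκ := hM.pos hab
  have hh := M.size_pos hab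
  -- `h^σ` is the scale of the inverse estimate and of the projection error in the Riesz form. It is
  -- also taken as regularization parameter, so that all errors balance.
  set s := M.size ^ σ with hs
  have hs0 : 0 < s := Real.rpow_pos_of_pos hh _
  have hhs : M.size ≤ L * s := by
    have h1 : M.size ^ (1 - σ) ≤ L :=
      Real.rpow_le_rpow hh.le M.size_le (by linarith)
    calc M.size = M.size ^ (1 - σ) * s := by
          rw [hs, ← Real.rpow_add hh, sub_add_cancel, Real.rpow_one]
      _ ≤ L * s := mul_le_mul_of_nonneg_right h1 hs0.le
  set E := M.energy v
  have hE : 0 ≤ E := M.energy_nonneg v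
  obtain ⟨w, hw, hvw, hwE⟩ := hM.exists_conforming hab hN v
  obtain ⟨h0, hp⟩ := M.primitive_of_jump_eq_zero hab hw
  -- The discrete solution `y` is compared with the `L²` projection of a continuous solution `z`
  -- whose right side is the conforming part `w` of `v`; the a priori estimate bounds `z`
  -- independently of `s`.
  obtain ⟨z, hz, hzeq⟩ := exists_regularized_solution hσ₀ hσ hab.le hs0 (M.toFun_mem w)
  have hzn : ∫ x, z x ^ 2 ≤ Z₀ * E := by
    have h1 := sqrt_integral_sq_le_of_equation hσ₀ hσ hab hs0.le (M.toFun_mem w.grad) h0 hz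
      (by rw [hp]; exact hzeq)
    have hz0 : 0 ≤ ∫ x, z x ^ 2 := integral_nonneg fun _ => sq_nonneg _
    have h2 := pow_le_pow_left₀ (Real.sqrt_nonneg _) h1 2
    rw [Real.sq_sqrt hz0, mul_pow, integral_toFun_sq, massForm_grad,
      Real.sq_sqrt (M.derivForm_nonneg 1 w)] at h2
    refine h2.trans ?_
    have := mul_le_mul_of_nonneg_left hwE (sq_nonneg A)
    simp only [Z₀, abs_of_pos hκ]
    linarith
  set z2 := ∫ x, z x ^ 2
  have hz20 : 0 ≤ z2 := integral_nonneg fun _ => sq_nonneg _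
  obtain ⟨Z, hZ⟩ := M.exists_l2_projection N hz
  set θ := y - Z with hθ
  set r : ℝ → ℝ := z - M.toFun Z with hr
  have hrm : r ∈ L2On a b := (L2On a b).sub_mem hz (M.toFun_mem Z)
  have hpyth : (∫ x, r x ^ 2) + M.massForm N Z Z = z2 := by
    have h1 := hZ Z
    have h1' : ∫ x, r x * M.toFun Z x = 0 := h1
    have h2 : ∫ x, (r x ^ 2 + M.toFun Z x ^ 2) + 2 * (r x * M.toFun Z x) = z2 := by
      congr 1; ext x; simp only [hr, Pi.sub_apply]; ring
    have hi : Integrable fun x => r x ^ 2 + M.toFun Z x ^ 2 :=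
      (L2On.integrable_sq hrm).add (L2On.integrable_sq (M.toFun_mem Z))
    rw [integral_add hi
      ((L2On.integrable_mul hrm (M.toFun_mem Z)).const_mul 2), integral_const_mul, h1', mul_zero,
      add_zero, integral_add (L2On.integrable_sq hrm) (L2On.integrable_sq (M.toFun_mem Z)),
      integral_toFun_sq] at h2
    exact h2
  have hr2 : ∫ x, r x ^ 2 ≤ z2 := by have := M.massForm_nonneg Z; linarith
  have hZ2 : M.massForm N Z Z ≤ z2 := by
    have : 0 ≤ ∫ x, r x ^ 2 := integral_nonneg fun _ => sq_nonneg _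
    linarith
  have hrr : rieszForm σ r r ≤ B * s * z2 :=
    (rieszForm_le_of_cellInt_eq_zero hσ₀ hσ M hab hrm
      (M.cellInt_eq_zero_of_orthogonal hrm hZ)).trans
      (mul_le_mul_of_nonneg_left hr2 (by positivity))
  set X := rieszForm σ (M.toFun θ) (M.toFun θ) with hX
  set t2 := M.massForm N θ θ with ht2
  have ht20 : 0 ≤ t2 := M.massForm_nonneg θ
  have hinvθ : c * (s * t2) ≤ X := hinv M hab hM θ
  have hX0 : 0 ≤ X := rieszForm_nonneg hσ₀ hσ hab.le (M.toFun_mem θ)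
  -- Three error sources: nonconformity of `v`, of size `h ≤ L s`; the regularization `s z`; and the
  -- projection error `r`, whose Riesz form is of order `s`.
  have hsplit : X = M.massForm N (v - w) θ + s * (∫ x, z x * M.toFun θ x)
      + rieszForm σ r (M.toFun θ) := by
    let β := rieszBilin hσ₀ hab.le
    let zL : L2On a b := ⟨z, hz⟩
    have e1 : β (M.toFunLinear N θ) (M.toFunLinear N θ) = β (M.toFunLinear N y) (M.toFunLinear N θ)
        - β zL (M.toFunLinear N θ)
        + β (zL - M.toFunLinear N Z) (M.toFunLinear N θ) := by
      have e0 : M.toFunLinear N θ = M.toFunLinear N y - M.toFunLinear N Z := map_sub _ _ _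
      generalize M.toFunLinear N θ = τ at e0 ⊢
      rw [show β τ τ = β (M.toFunLinear N y - M.toFunLinear N Z) τ by rw [← e0], map_sub, map_sub,
        LinearMap.sub_apply, LinearMap.sub_apply]
      ring
    have e2 : β (M.toFunLinear N y) (M.toFunLinear N θ) = M.massForm N v θ := hy θ
    have e3 : β zL (M.toFunLinear N θ) + s * (∫ x, z x * M.toFun θ x) = M.massForm N w θ := by
      rw [← integral_toFun_mul_toFun]; exact hzeq _ (M.toFun_mem θ)
    have e4 : β (zL - M.toFunLinear N Z) (M.toFunLinear N θ) = rieszForm σ r (M.toFun θ) := rfl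
    have e5 : X = β (M.toFunLinear N θ) (M.toFunLinear N θ) := rfl
    have e6 : M.massForm N (v - w) θ = M.massForm N v θ - M.massForm N w θ := by
      rw [map_sub (M.massForm N) v w, LinearMap.sub_apply]
    rw [e5, e1, e2, e4, e6]
    linarith
  have b1 : |M.massForm N (v - w) θ| ≤ √(2 * L ^ 2 * E) * s * √t2 := by
    have h1 := LinearMap.BilinForm.apply_sq_le_of_symm _ (fun x => M.massForm_nonneg (N := N) x)
      ⟨fun x y => by simpa using M.massForm_comm x y⟩ (v - w) θ
    have h2 : M.massForm N (v - w) (v - w) ≤ 2 * L ^ 2 * E * s ^ 2 := by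
      refine hvw.trans ?_
      have : M.size ^ 2 ≤ (L * s) ^ 2 := pow_le_pow_left₀ hh.le hhs 2
      nlinarith
    have h3 := Real.abs_le_sqrt (h1.trans (mul_le_mul_of_nonneg_right h2 ht20))
    rwa [Real.sqrt_mul (by positivity), Real.sqrt_mul (by positivity), Real.sqrt_sq hs0.le] at h3
  have b2 : |s * (∫ x, z x * M.toFun θ x)| ≤ √z2 * s * √t2 := by
    have h1 := sq_integral_mul_le hz.1 (M.toFun_mem θ).1
    rw [integral_toFun_sq] at h1
    have h2 := Real.abs_le_sqrt h1
    rw [Real.sqrt_mul hz20] at h2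
    rw [abs_mul, abs_of_pos hs0]
    have := mul_le_mul_of_nonneg_left h2 hs0.le
    linarith
  have b3 : |rieszForm σ r (M.toFun θ)| ≤ √(B * s * z2) * √X :=
    (abs_rieszForm_le hσ₀ hσ hab.le hrm (M.toFun_mem θ)).trans
      (mul_le_mul_of_nonneg_right (Real.sqrt_le_sqrt hrr) (Real.sqrt_nonneg _))
  -- Young's inequality absorbs a quarter of `X` twice, once through the inverse estimate and once
  -- directly.
  have hXle : X ≤ X₀ * E * s := by
    have h1 : X ≤ (√(2 * L ^ 2 * E) + √z2) * s * √t2 + √(B * s * z2) * √X := by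
      have := (le_abs_self _).trans b1
      have := (le_abs_self _).trans b2
      have := (le_abs_self _).trans b3
      linarith
    set P := √(2 * L ^ 2 * E) + √z2
    have hP2 : P ^ 2 ≤ 2 * (2 * L ^ 2 * E + Z₀ * E) := by
      have e1 := Real.sq_sqrt (show 0 ≤ 2 * L ^ 2 * E by positivity)
      have e2 := Real.sq_sqrt hz20
      have e3 := sq_nonneg (√(2 * L ^ 2 * E) - √z2)
      simp only [P]
      linarith
    have h2 : P * s * √t2 ≤ c * (s * t2) / 4 + P ^ 2 * s / c := by
      have e1 := Real.sq_sqrt ht20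
      have e2 : 0 ≤ s / c * (c * √t2 / 2 - P) ^ 2 := by positivity
      have e3 : s / c * (c * √t2 / 2 - P) ^ 2
          = c * (s * (√t2 ^ 2)) / 4 + P ^ 2 * s / c - P * s * √t2 := by field_simp; ring
      rw [e3, e1] at e2
      linarith
    have h3 : √(B * s * z2) * √X ≤ X / 4 + B * s * z2 := by
      have e1 := Real.sq_sqrt hX0
      have e2 := Real.sq_sqrt (show 0 ≤ B * s * z2 by positivity)
      have e3 := sq_nonneg (√X / 2 - √(B * s * z2))
      linarith
    have h4 : P ^ 2 * s / c ≤ 2 * (2 * L ^ 2 * E + Z₀ * E) * s / c := by gcongr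
    have h5 : B * s * z2 ≤ B * s * (Z₀ * E) := by gcongr
    have h6 : X₀ * E * s = 2 * (2 * (2 * L ^ 2 * E + Z₀ * E) * s / c + B * s * (Z₀ * E)) := by
      simp only [X₀]; field_simp
    rw [h6]
    linarith
  -- The factor `s` gained in `X` is exactly the one lost in the inverse estimate.
  have ht2le : t2 ≤ X₀ / c * E := by
    rw [div_mul_eq_mul_div, le_div_iff₀ hc]
    have := hinvθ.trans hXle
    refine le_of_mul_le_mul_left ?_ hs0
    linarith
  have hyle : M.massForm N y y ≤ 2 * (t2 + M.massForm N Z Z) := by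
    have h1 := M.massForm_nonneg (θ - Z)
    have h2 : y = θ + Z := by rw [hθ, sub_add_cancel]
    rw [ht2, h2]
    simp only [map_sub, map_add, LinearMap.add_apply, LinearMap.sub_apply] at h1 ⊢
    linarith
  have := hZ2.trans hzn
  linarith

end DGMesh

end Mesh

/-! ### Interpolation of smooth functions -/

section Interpolation

open MeasureTheory Set Polynomial

/-- The functions `W 0, …, W n` are the successive derivatives of `W 0` on `[a,b]`, and they are
bounded by `R`. -/
structure DerivChain (a b : ℝ) (n : ℕ) (R : ℝ) (W : ℕ → ℝ → ℝ) : Prop where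
  hasDeriv : ∀ i < n, ∀ x ∈ Icc a b, HasDerivWithinAt (W i) (W (i + 1) x) (Icc a b) x
  bound : ∀ i ≤ n, ∀ x ∈ Icc a b, |W i x| ≤ R

namespace DerivChain

variable {a b R : ℝ} {n : ℕ} {W : ℕ → ℝ → ℝ}

theorem shift {k : ℕ} (h : DerivChain a b (n + k) R W) :
    DerivChain a b n R fun i => W (i + k) where
  hasDeriv i hi x hx := by
    have := h.hasDeriv (i + k) (by omega) x hx
    rwa [add_right_comm] at this
  bound i hi := h.bound (i + k) (by omega)

theorem mono {m : ℕ} (h : DerivChain a b n R W) (hm : m ≤ n) : DerivChain a b m R W where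
  hasDeriv i hi := h.hasDeriv i (by omega)
  bound i hi := h.bound i (by omega)

theorem continuousOn (h : DerivChain a b n R W) {i : ℕ} (hi : i < n) :
    ContinuousOn (W i) (Icc a b) :=
  fun x hx => (h.hasDeriv i hi x hx).continuousWithinAt

theorem restrict (h : DerivChain a b n R W) {c d : ℝ} (hs : Icc c d ⊆ Icc a b) :
    DerivChain c d n R W where
  hasDeriv i hi x hx := (h.hasDeriv i hi x (hs hx)).mono hs
  bound i hi x hx := h.bound i hi x (hs hx)

theorem nonneg (h : DerivChain a b n R W) (hab : a ≤ b) : 0 ≤ R :=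
  (abs_nonneg _).trans (h.bound 0 (Nat.zero_le _) a (left_mem_Icc.2 hab))

/-- Taylor's formula at the left end point, with the derivatives. -/
theorem exists_taylor {N : ℕ} (h : DerivChain a b (N + 1) R W) (hab : a ≤ b) :
    ∃ T : ℝ[X], T.natDegree ≤ N ∧ T.eval a = W 0 a ∧ ∀ j ≤ N + 1, ∀ x ∈ Icc a b,
      |W j x - (derivative^[j] T).eval x| ≤ R * (b - a) ^ (N + 1 - j) := by
  set T : ℝ[X] := ∑ i ∈ Finset.range (N + 1), C (W i a / (i.factorial : ℝ)) * (X - C a) ^ i with hT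
  have hdeg : T.natDegree ≤ N := by
    refine natDegree_sum_le_of_forall_le _ _ fun i hi => ?_
    refine (natDegree_C_mul_le _ _).trans ?_
    rw [natDegree_pow, natDegree_X_sub_C, mul_one]
    exact Nat.lt_succ_iff.1 (Finset.mem_range.1 hi)
  have hat : ∀ j ≤ N, (derivative^[j] T).eval a = W j a := fun j hj => by
    rw [hT, iterate_derivative_sum, eval_finsetSum, Finset.sum_eq_single j]
    · rw [iterate_derivative_C_mul, iterate_derivative_X_sub_pow]
      simp only [eval_mul, eval_C, Nat.sub_self, pow_zero, Nat.descFactorial_self,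
        nsmul_eq_mul, mul_one, eval_natCast]
      exact div_mul_cancel₀ _ (Nat.cast_ne_zero.2 j.factorial_ne_zero)
    · intro i _ hij
      rw [iterate_derivative_C_mul, iterate_derivative_X_sub_pow]
      rcases lt_or_gt_of_ne hij with hlt | hlt
      · simp [Nat.descFactorial_of_lt hlt]
      · simp [(Nat.sub_pos_of_lt hlt).ne']
    · intro hn
      exact absurd (Finset.mem_range.2 (Nat.lt_succ_of_le hj)) hn
  refine ⟨T, hdeg, hat 0 (Nat.zero_le _), ?_⟩
  -- Induction from the highest derivative downwards: that of order `N + 1` of `T` vanishes, and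
  -- each integration from `a`, where the derivatives agree, gains one length.
  have key : ∀ i ≤ N + 1, ∀ x ∈ Icc a b,
      |W (N + 1 - i) x - (derivative^[N + 1 - i] T).eval x| ≤ R * (b - a) ^ i := fun i => by
    induction i with
    | zero =>
      intro _ x hx
      rw [Nat.sub_zero, iterate_derivative_eq_zero (Nat.lt_succ_of_le hdeg), eval_zero, sub_zero,
        pow_zero, mul_one]
      exact h.bound _ le_rfl x hx
    | succ i ih =>
      intro hi x hx
      set j := N + 1 - (i + 1) with hj
      have hj1 : N + 1 - i = j + 1 := by omega
      rw [hj1] at ih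
      have hd : ∀ y ∈ Icc a b, HasDerivWithinAt (fun y => W j y - (derivative^[j] T).eval y)
          (W (j + 1) y - (derivative^[j + 1] T).eval y) (Icc a b) y := fun y hy => by
        rw [Function.iterate_succ_apply']
        exact (h.hasDeriv j (by omega) y hy).sub ((derivative^[j] T).hasDerivWithinAt y _)
      have := (convex_Icc a b).norm_image_sub_le_of_norm_hasDerivWithin_le hd
        (fun y hy => ih (by omega) y hy) (left_mem_Icc.2 hab) hx
      rw [hat j (by omega), sub_self, sub_zero, Real.norm_eq_abs, Real.norm_eq_abs,
        abs_of_nonneg (sub_nonneg.2 hx.1)] at this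
      refine this.trans ?_
      rw [pow_succ, ← mul_assoc]
      have : 0 ≤ b - a := sub_nonneg.2 hab
      exact mul_le_mul_of_nonneg_left (sub_le_sub_right hx.2 _)
        (mul_nonneg (h.nonneg hab) (by positivity))
  intro j hj x hx
  have := key (N + 1 - j) (by omega) x hx
  rwa [Nat.sub_sub_self hj] at this

/-- Interpolation at both end points, with the derivatives. -/
theorem exists_interpolant {N : ℕ} (hN : 1 ≤ N) (h : DerivChain a b (N + 1) R W) (hab : a < b) :
    ∃ T : ℝ[X], T.natDegree ≤ N ∧ T.eval a = W 0 a ∧ T.eval b = W 0 b ∧ ∀ x ∈ Icc a b,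
      |W 0 x - T.eval x| ≤ 2 * R * (b - a) ^ (N + 1) ∧
      |W 1 x - (derivative T).eval x| ≤ 2 * R * (b - a) ^ N ∧
      |W 2 x - (derivative (derivative T)).eval x| ≤ 2 * R * (b - a) ^ (N - 1) := by
  obtain ⟨T, hd, ha, hT⟩ := h.exists_taylor hab.le
  have hl : 0 < b - a := sub_pos.2 hab
  have hR := h.nonneg hab.le
  -- The slope of the linear correction that repairs the value at `b`; it is of the order of the
  -- error of the first derivative, so constants only double.
  set s := (W 0 b - T.eval b) / (b - a) with hs
  have hsle : |s| ≤ R * (b - a) ^ N := by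
    rw [hs, abs_div, abs_of_pos hl, div_le_iff₀ hl, mul_assoc, ← pow_succ]
    exact hT 0 (by omega) b (right_mem_Icc.2 hab.le)
  refine ⟨T + C s * (X - C a), ?_, by simp [ha], ?_, fun x hx => ⟨?_, ?_, ?_⟩⟩
  · refine (natDegree_add_le _ _).trans (max_le hd ?_)
    refine (natDegree_C_mul_le _ _).trans ?_
    rwa [natDegree_X_sub_C]
  · simp only [eval_add, eval_mul, eval_sub, eval_X, eval_C]
    rw [hs, div_mul_cancel₀ _ hl.ne']; ring
  · have h0 := hT 0 (by omega) x hx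
    simp only [Function.iterate_zero, id, Nat.sub_zero] at h0
    have h1 : |s * (x - a)| ≤ R * (b - a) ^ (N + 1) := by
      rw [abs_mul, abs_of_nonneg (sub_nonneg.2 hx.1), pow_succ, ← mul_assoc]
      exact mul_le_mul hsle (sub_le_sub_right hx.2 _) (sub_nonneg.2 hx.1) (by positivity)
    simp only [eval_add, eval_mul, eval_sub, eval_X, eval_C]
    rw [← sub_sub]
    refine (abs_sub _ _).trans ?_
    linarith
  · have h0 := hT 1 (by omega) x hx
    simp only [Function.iterate_one, Nat.add_sub_cancel] at h0
    simp only [derivative_add, derivative_mul, derivative_C, zero_mul, zero_add, derivative_sub,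
      derivative_X, sub_zero, mul_one, eval_add, eval_C]
    rw [← sub_sub]
    refine (abs_sub _ _).trans ?_
    linarith
  · have h0 := hT 2 (by omega) x hx
    simp only [Function.iterate_succ, Function.iterate_zero, id, Function.comp,
      show N + 1 - 2 = N - 1 by omega] at h0
    have h1 : 0 ≤ R * (b - a) ^ (N - 1) := by positivity
    simp only [derivative_add, derivative_mul, derivative_C, zero_mul, zero_add, derivative_sub,
      derivative_X, sub_zero, mul_one, add_zero]
    linarith

end DerivChain

end Interpolation

/-! ### The Ritz projection of the diffusion form -/

section Ritz

open MeasureTheory Set Polynomial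

theorem abs_sub_average_le {c d C : ℝ} (hcd : c < d) {f : ℝ → ℝ}
    (hf : IntervalIntegrable f volume c d)
    {x : ℝ} (h : ∀ y ∈ Icc c d, |f y - f x| ≤ C) :
    |f x - (∫ y in c..d, f y) / (d - c)| ≤ C := by
  have hl : 0 < d - c := sub_pos.2 hcd
  have h1 : ‖∫ y in c..d, (f y - f x)‖ ≤ C * |d - c| :=
    intervalIntegral.norm_integral_le_of_norm_le_const fun y hy => by
      rw [uIoc_of_le hcd.le] at hy
      exact h y (Ioc_subset_Icc_self hy)
  rw [intervalIntegral.integral_sub hf intervalIntegrable_const, intervalIntegral.integral_const,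
    smul_eq_mul, Real.norm_eq_abs, abs_of_pos hl] at h1
  have h2 : f x - (∫ y in c..d, f y) / (d - c)
      = -(((∫ y in c..d, f y) - (d - c) * f x) / (d - c)) := by field_simp; ring
  rw [h2, abs_neg, abs_div, abs_of_pos hl, div_le_iff₀ hl]
  exact h1

namespace DGMesh

variable {a b : ℝ} {K N : ℕ} (M : DGMesh a b K)

theorem sum_trace_const (μ : Fin K → ℝ) :
    ∑ j, (M.tracePlus (fun k => C (μ k)) j + M.traceMinus (fun k => C (μ k)) j)
      = 2 * ∑ k, μ k := by
  have h1 := M.sum_mul_tracePlus (fun _ => 1) fun k => C (μ k)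
  have h2 := M.sum_mul_traceMinus (fun _ => 1) fun k => C (μ k)
  simp only [one_mul, eval_C] at h1 h2
  rw [Finset.sum_add_distrib, h1, h2]
  ring

theorem sum_sq_sub_avg_le (hK : 0 < K) (n : ℕ) (v : DGSpace K N)
    {y : Fin (K + 1) → ℝ} {μ : Fin K → ℝ}
    (hl : ∀ k : Fin K, (y k.castSucc - (v.dpoly n k).eval (M.node k.castSucc)) ^ 2 ≤ μ k)
    (hr : ∀ k : Fin K, (y k.succ - (v.dpoly n k).eval (M.node k.succ)) ^ 2 ≤ μ k) :
    ∑ j, (y j - M.avg n v j) ^ 2 ≤ 2 * ∑ k, μ k := by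
  rw [← M.sum_trace_const]
  refine Finset.sum_le_sum fun j _ => ?_
  have hl' : ∀ h : (j : ℕ) < K,
      (y j - (v.dpoly n ⟨j, h⟩).eval (M.node j)) ^ 2 ≤ μ ⟨j, h⟩ := fun h => hl ⟨j, h⟩
  have hr' : ∀ h : 0 < (j : ℕ), (y j - (v.dpoly n ⟨(j : ℕ) - 1, by omega⟩).eval (M.node j)) ^ 2 ≤
      μ ⟨(j : ℕ) - 1, by omega⟩ := fun h => by
    have e : (⟨(j : ℕ) - 1, by omega⟩ : Fin K).succ = j := by ext; simp; omega
    have := hr ⟨(j : ℕ) - 1, by omega⟩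
    rwa [e] at this
  rcases lt_or_ge (j : ℕ) K with h | h
  · by_cases h0 : 0 < (j : ℕ)
    · have h1 := hl' h
      have h2 := hr' h0
      simp only [avg, tracePlus, traceMinus, Interior, h, h0, and_self, if_true, dif_pos, eval_C]
      nlinarith [sq_nonneg ((y j - (v.dpoly n ⟨j, h⟩).eval (M.node j)) -
        (y j - (v.dpoly n ⟨(j : ℕ) - 1, by omega⟩).eval (M.node j))),
        sq_nonneg (y j - (v.dpoly n ⟨j, h⟩).eval (M.node j)),
        sq_nonneg (y j - (v.dpoly n ⟨(j : ℕ) - 1, by omega⟩).eval (M.node j))]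
    · have h1 := hl' h
      simpa [avg, tracePlus, traceMinus, Interior, h, h0] using h1
  · have h' : ¬ (j : ℕ) < K := by omega
    have h0 : 0 < (j : ℕ) := by omega
    have h2 := hr' h0
    simpa [avg, tracePlus, traceMinus, Interior, h', h0] using h2

theorem sum_sq_jumpSecond_le (v : DGSpace K N) {y : Fin (K + 1) → ℝ} {μ : Fin K → ℝ}
    (hl : ∀ k : Fin K, (y k.castSucc - (v.dpoly 2 k).eval (M.node k.castSucc)) ^ 2 ≤ μ k)
    (hr : ∀ k : Fin K, (y k.succ - (v.dpoly 2 k).eval (M.node k.succ)) ^ 2 ≤ μ k) :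
    ∑ j, M.jumpSecond v j ^ 2 ≤ 4 * ∑ k, μ k := by
  have hμ : ∀ k, 0 ≤ μ k := fun k => (sq_nonneg _).trans (hl k)
  have hs := M.sum_trace_const μ
  have : ∑ j, M.jumpSecond v j ^ 2 ≤
      ∑ j, 2 * (M.tracePlus (fun k => C (μ k)) j + M.traceMinus (fun k => C (μ k)) j) := by
    refine Finset.sum_le_sum fun j _ => ?_
    by_cases hI : Interior K j
    · have hj0 : 0 < (j : ℕ) := hI.1
      have hjK : (j : ℕ) < K := hI.2
      have h1 : (y j - (v.dpoly 2 ⟨j, hI.2⟩).eval (M.node j)) ^ 2 ≤ μ ⟨j, hI.2⟩ := hl ⟨j, hI.2⟩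
      have h2 : (y j - (v.dpoly 2 ⟨(j : ℕ) - 1, by omega⟩).eval (M.node j)) ^ 2 ≤
          μ ⟨(j : ℕ) - 1, by omega⟩ := by
        have e : (⟨(j : ℕ) - 1, by omega⟩ : Fin K).succ = j := by
          ext; simp; omega
        have := hr ⟨(j : ℕ) - 1, by omega⟩
        rwa [e] at this
      simp only [jumpSecond, tracePlus, traceMinus, hI, if_true, dif_pos hI.1, dif_pos hI.2, eval_C]
      nlinarith [sq_nonneg ((y j - (v.dpoly 2 ⟨j, hI.2⟩).eval (M.node j)) +
        (y j - (v.dpoly 2 ⟨(j : ℕ) - 1, by omega⟩).eval (M.node j)))]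
    · simp only [jumpSecond, hI, if_false]
      have h1 : 0 ≤ M.tracePlus (fun k => C (μ k)) j := by
        simp only [tracePlus]; split_ifs
        · simpa using hμ _
        · exact le_rfl
      have h2 : 0 ≤ M.traceMinus (fun k => C (μ k)) j := by
        simp only [traceMinus]; split_ifs
        · simpa using hμ _
        · exact le_rfl
      nlinarith
  rw [← Finset.mul_sum, hs] at this
  linarith

theorem cellInt_deriv_mul (k : Fin K) {f f' : ℝ → ℝ} (p : ℝ[X])
    (hc : ContinuousOn f (Icc (M.node k.castSucc) (M.node k.succ)))
    (hd : ∀ x ∈ Ioo (M.node k.castSucc) (M.node k.succ), HasDerivAt f (f' x) x)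
    (hi : IntervalIntegrable f' volume (M.node k.castSucc) (M.node k.succ)) :
    M.cellInt k (fun x => f' x * p.eval x) = f (M.node k.succ) * p.eval (M.node k.succ)
      - f (M.node k.castSucc) * p.eval (M.node k.castSucc)
      - M.cellInt k fun x => f x * (derivative p).eval x := by
  have hlt := M.node_lt k
  have hp := (derivative p).continuous.intervalIntegrable (μ := volume) (M.node k.castSucc)
    (M.node k.succ)
  rw [← uIcc_of_le hlt.le] at hc
  have h := intervalIntegral.integral_deriv_mul_eq_sub_of_hasDerivAt hc p.continuous.continuousOn
    (by rwa [min_eq_left hlt.le, max_eq_right hlt.le]) (fun x _ => p.hasDerivAt x) hi hp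
  rw [intervalIntegral.integral_add (hi.mul_continuousOn p.continuous.continuousOn)
    (hp.continuousOn_mul hc)] at h
  simp only [cellInt]
  linarith

theorem cellInt_sub {k : Fin K} {f g : ℝ → ℝ}
    (hf : ContinuousOn f (Icc (M.node k.castSucc) (M.node k.succ)))
    (hg : ContinuousOn g (Icc (M.node k.castSucc) (M.node k.succ))) :
    M.cellInt k (fun x => f x - g x) = M.cellInt k f - M.cellInt k g :=
  intervalIntegral.integral_sub (hf.intervalIntegrable_of_Icc (M.node_lt k).le)
    (hg.intervalIntegrable_of_Icc (M.node_lt k).le)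

theorem cellInt_add {k : Fin K} {f g : ℝ → ℝ}
    (hf : ContinuousOn f (Icc (M.node k.castSucc) (M.node k.succ)))
    (hg : ContinuousOn g (Icc (M.node k.castSucc) (M.node k.succ))) :
    M.cellInt k (fun x => f x + g x) = M.cellInt k f + M.cellInt k g :=
  intervalIntegral.integral_add (hf.intervalIntegrable_of_Icc (M.node_lt k).le)
    (hg.intervalIntegrable_of_Icc (M.node_lt k).le)

theorem cellInt_const_mul {k : Fin K} (c : ℝ) (f : ℝ → ℝ) :
    M.cellInt k (fun x => c * f x) = c * M.cellInt k f :=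
  intervalIntegral.integral_const_mul _ _

theorem cellInt_mono {k : Fin K} {f g : ℝ → ℝ}
    (hf : ContinuousOn f (Icc (M.node k.castSucc) (M.node k.succ)))
    (hg : ContinuousOn g (Icc (M.node k.castSucc) (M.node k.succ)))
    (h : ∀ x ∈ Icc (M.node k.castSucc) (M.node k.succ), f x ≤ g x) :
    M.cellInt k f ≤ M.cellInt k g :=
  intervalIntegral.integral_mono_on (M.node_lt k).le
    (hf.intervalIntegrable_of_Icc (M.node_lt k).le)
    (hg.intervalIntegrable_of_Icc (M.node_lt k).le) h

theorem cellInt_le_mul_len {k : Fin K} {f : ℝ → ℝ} {C : ℝ}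
    (hf : ContinuousOn f (Icc (M.node k.castSucc) (M.node k.succ)))
    (h : ∀ x ∈ Icc (M.node k.castSucc) (M.node k.succ), f x ≤ C) :
    M.cellInt k f ≤ C * M.len k := by
  refine (M.cellInt_mono hf continuousOn_const h).trans (le_of_eq ?_)
  simp [cellInt, len, mul_comm]

/-- `P` is the Ritz projection of a function with second derivative `f`. -/
def IsRitzProjection (β₀ β₁ : ℝ) (f : ℝ → ℝ) (P : DGSpace K N) : Prop :=
  ∀ φ : DGSpace K N, M.diffusionForm N β₀ β₁ P φ
    = -∑ k, M.cellInt k fun x => f x * (φ.poly k).eval x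

variable {M} {R : ℝ} {n : ℕ} {W : ℕ → ℝ → ℝ}

theorem continuousOn_cell (h : DerivChain a b n R W) {i : ℕ} (hi : i < n) (k : Fin K) :
    ContinuousOn (W i) (Icc (M.node k.castSucc) (M.node k.succ)) :=
  (h.continuousOn hi).mono (M.cell_subset k)

theorem hasDerivAt_cell (h : DerivChain a b n R W) {i : ℕ} (hi : i < n) (k : Fin K) {x : ℝ}
    (hx : x ∈ Ioo (M.node k.castSucc) (M.node k.succ)) : HasDerivAt (W i) (W (i + 1) x) x :=
  (h.hasDeriv i hi x (M.cell_subset k (Ioo_subset_Icc_self hx))).hasDerivAt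
    (Filter.mem_of_superset (Icc_mem_nhds hx.1 hx.2) (M.cell_subset k))

theorem neg_sum_cellInt_second (h : DerivChain a b n R W) (hn : 3 ≤ n) (φ : DGSpace K N) :
    -∑ k, M.cellInt k (fun x => W 2 x * (φ.poly k).eval x)
      = ∑ k, M.cellInt k (fun x => W 1 x * (φ.dpoly 1 k).eval x)
        + ∑ j, W 1 (M.node j) * M.jump φ j := by
  rw [M.sum_mul_jump (fun j => W 1 (M.node j)), ← Finset.sum_add_distrib, ← Finset.sum_neg_distrib]
  refine Finset.sum_congr rfl fun k _ => ?_
  rw [M.cellInt_deriv_mul k (φ.poly k) (continuousOn_cell h (by omega) k)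
    (fun x hx => hasDerivAt_cell h (by omega) k hx)
    ((continuousOn_cell h (by omega) k).intervalIntegrable_of_Icc (M.node_lt k).le)]
  rw [DGSpace.dpoly_one]
  ring

/-- The flux-preserving projection is the Ritz projection. -/
theorem IsFluxProjection.isRitzProjection (h : DerivChain a b n R W) (hn : 3 ≤ n) (hab : a < b)
    (h0 : W 0 a = 0) (h1 : W 0 b = 0) {β₀ β₁ : ℝ} {P : DGSpace K N}
    (hP : M.IsFluxProjection β₀ β₁ (W 0) P) : M.IsRitzProjection β₀ β₁ (W 2) P := by
  intro φ
  rw [neg_sum_cellInt_second h hn, diffusionForm_apply, derivForm_apply, interfaceForm,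
    Finset.sum_add_distrib]
  have hflux : ∀ j, M.flux β₀ β₁ P j = W 1 (M.node j) := fun j => by
    rw [hP.flux_eq]
    exact (h.hasDeriv 0 (by omega) _ (M.node_mem j)).derivWithin
      (uniqueDiffOn_Icc hab _ (M.node_mem j))
  simp only [hflux]
  -- The flux condition has already matched the terms with `[φ]`; the two remaining conditions on
  -- `P` must account for the rest.
  have key : ∑ k, M.cellInt k (fun x => (P.dpoly 1 k).eval x * (φ.dpoly 1 k).eval x)
      + ∑ j, M.avg 1 φ j * M.jump P j
      = ∑ k, M.cellInt k (fun x => W 1 x * (φ.dpoly 1 k).eval x) := by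
    have hcell : ∀ k, M.cellInt k (fun x => (P.dpoly 1 k).eval x * (φ.dpoly 1 k).eval x)
        - M.cellInt k (fun x => W 1 x * (φ.dpoly 1 k).eval x)
        = ((P.poly k).eval (M.node k.succ) - W 0 (M.node k.succ)) *
            (φ.dpoly 1 k).eval (M.node k.succ)
          - ((P.poly k).eval (M.node k.castSucc) - W 0 (M.node k.castSucc)) *
            (φ.dpoly 1 k).eval (M.node k.castSucc) := fun k => by
      have hc := continuousOn_cell (M := M) h (i := 0) (by omega) k
      have hc1 := continuousOn_cell (M := M) h (i := 1) (by omega) k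
      have e := M.cellInt_deriv_mul k (f := fun x => (P.poly k).eval x - W 0 x)
        (f' := fun x => (P.dpoly 1 k).eval x - W 1 x) (φ.dpoly 1 k)
        ((P.poly k).continuous.continuousOn.sub hc)
        (fun x hx => ((P.poly k).hasDerivAt x).sub (hasDerivAt_cell h (by omega) k hx))
        (((P.dpoly 1 k).continuous.continuousOn.sub hc1).intervalIntegrable_of_Icc
          (M.node_lt k).le)
      -- After integration by parts `P - W 0` meets `φ''`, of degree at most `N - 2`: the moment
      -- condition applies, and for `N < 2` this second derivative is zero.
      have hz : M.cellInt k (fun x => ((P.poly k).eval x - W 0 x)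
          * (derivative (φ.dpoly 1 k)).eval x) = 0 := by
        rcases Nat.lt_or_ge N 2 with hN | hN
        · have : derivative (φ.dpoly 1 k) = 0 := by
            have h3 := φ.natDegree_poly_le k
            have := Polynomial.iterate_derivative_eq_zero
              (show (φ.poly k).natDegree < 2 by omega)
            simpa [DGSpace.dpoly_one] using this
          simp [this, cellInt]
        · refine hP.moments k _ ?_
          have h3 := φ.natDegree_poly_le k
          have h4 := natDegree_derivative_le (derivative (φ.poly k))
          have h5 := natDegree_derivative_le (φ.poly k)
          rw [DGSpace.dpoly_one]
          omega
      rw [hz, sub_zero] at e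
      rw [← e, ← M.cellInt_sub (f := fun x => (P.dpoly 1 k).eval x * (φ.dpoly 1 k).eval x)
        (g := fun x => W 1 x * (φ.dpoly 1 k).eval x)
        ((P.dpoly 1 k).continuous.mul (φ.dpoly 1 k).continuous).continuousOn
        (hc1.mul (φ.dpoly 1 k).continuous.continuousOn)]
      simp only [sub_mul]
    have hsum := Finset.sum_congr (rfl : (Finset.univ : Finset (Fin K)) = _)
      fun k _ => hcell k
    rw [Finset.sum_sub_distrib] at hsum
    -- At an interior node the identity holds because the average of `P` is the value of `W 0`; at
    -- an end point because `W 0` vanishes and the outer trace is zero.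
    have hnodes : ∑ j, M.avg 1 φ j * M.jump P j
        = ∑ j, ((M.tracePlus P.poly j - W 0 (M.node j)) * M.tracePlus (φ.dpoly 1) j
          - (M.traceMinus P.poly j - W 0 (M.node j)) * M.traceMinus (φ.dpoly 1) j) := by
      refine Finset.sum_congr rfl fun j _ => ?_
      by_cases hI : Interior K j
      · have h2 := hP.average j hI
        simp only [avg, hI, if_true, DGSpace.dpoly_zero] at h2
        simp only [avg, jump, hI, if_true, DGSpace.dpoly_zero, ← h2]
        ring
      · simp only [avg, jump, hI, if_false, DGSpace.dpoly_zero]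
        by_cases hj : 0 < (j : ℕ)
        · have hK : ¬ (j : ℕ) < K := fun h => hI ⟨hj, h⟩
          have hjl : j = Fin.last K := by ext; simp; omega
          subst hjl
          rw [M.node_last, h1]
          simp only [tracePlus_last]
          ring
        · have hj0 : j = 0 := Fin.ext (Nat.eq_zero_of_not_pos hj)
          subst hj0
          rw [M.node_zero, h0]
          simp only [traceMinus_zero]
          ring
    have hs1 := M.sum_mul_tracePlus (fun j => M.tracePlus P.poly j - W 0 (M.node j)) (φ.dpoly 1)
    have hs2 := M.sum_mul_traceMinus (fun j => M.traceMinus P.poly j - W 0 (M.node j)) (φ.dpoly 1)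
    simp only [tracePlus_castSucc, traceMinus_succ] at hs1 hs2
    rw [Finset.sum_sub_distrib] at hsum
    rw [hnodes, Finset.sum_sub_distrib, hs1, hs2]
    linarith
  linarith


/-! #### Error of the Ritz projection -/

variable (M)

theorem exists_piecewise_interpolant (hN : 1 ≤ N) (h : DerivChain a b (N + 1) R W)
    (h0 : W 0 a = 0) (h1 : W 0 b = 0) :
    ∃ χ : DGSpace K N, (∀ j, M.tracePlus χ.poly j = W 0 (M.node j)) ∧
      (∀ j, M.traceMinus χ.poly j = W 0 (M.node j)) ∧
      ∀ k, ∀ x ∈ Icc (M.node k.castSucc) (M.node k.succ),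
        |W 0 x - (χ.poly k).eval x| ≤ 2 * R * M.size ^ (N + 1) ∧
        |W 1 x - (χ.dpoly 1 k).eval x| ≤ 2 * R * M.size ^ N ∧
        |W 2 x - (χ.dpoly 2 k).eval x| ≤ 2 * R * M.size ^ (N - 1) := by
  have hR : 0 ≤ R := h.nonneg M.le_of_mesh
  choose T hT using fun k => (h.restrict (M.cell_subset k)).exists_interpolant hN (M.node_lt k)
  have hp : ∀ k, (DGSpace.ofPoly N T).poly k = T k := fun k => DGSpace.poly_ofPoly (hT k).1
  refine ⟨DGSpace.ofPoly N T, fun j => ?_, fun j => ?_, fun k x hx => ?_⟩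
  · induction j using Fin.lastCases with
    | last => rw [tracePlus_last, M.node_last, h1]
    | cast k => rw [tracePlus_castSucc, hp, (hT k).2.1]
  · induction j using Fin.cases with
    | zero => rw [traceMinus_zero, M.node_zero, h0]
    | succ k => rw [traceMinus_succ, hp, (hT k).2.2.1]
  · obtain ⟨e0, e1, e2⟩ := (hT k).2.2.2 x hx
    have hpow : ∀ m : ℕ, 2 * R * (M.node k.succ - M.node k.castSucc) ^ m ≤ 2 * R * M.size ^ m :=
      fun m => mul_le_mul_of_nonneg_left
        (pow_le_pow_left₀ (M.len_pos k).le (M.len_le_size k) m) (by linarith)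
    rw [DGSpace.dpoly_one, DGSpace.dpoly_two, hp]
    exact ⟨e0.trans (hpow _), e1.trans (hpow _), e2.trans (hpow _)⟩

variable {M} {κ : ℝ}

/-- `χ` has no jumps, so the flux error consists of the averaged gradient error, of order `h^N`, and
of `h` times a jump of second derivatives, of order `h^(N-1)`. The sum over the nodes is compensated
by `K h ≤ κ (b - a)`. -/
theorem QuasiUniform.sum_sq_sub_flux_le (hM : M.QuasiUniform κ) (hab : a < b) (hN : 1 ≤ N)
    {χ : DGSpace K N} (hplus : ∀ j, M.tracePlus χ.poly j = W 0 (M.node j))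
    (hminus : ∀ j, M.traceMinus χ.poly j = W 0 (M.node j))
    (he : ∀ k, ∀ x ∈ Icc (M.node k.castSucc) (M.node k.succ),
        |W 1 x - (χ.dpoly 1 k).eval x| ≤ 2 * R * M.size ^ N ∧
        |W 2 x - (χ.dpoly 2 k).eval x| ≤ 2 * R * M.size ^ (N - 1)) (β₀ β₁ : ℝ) :
    M.size * ∑ j, (W 1 (M.node j) - M.flux β₀ β₁ χ j) ^ 2 ≤
      κ * (b - a) * (16 + 32 * β₁ ^ 2) * (R * M.size ^ N) ^ 2 := by
  have hh := M.size_pos hab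
  have hl : ∀ k : Fin K, M.node k.castSucc ∈ Icc (M.node k.castSucc) (M.node k.succ) :=
    fun k => left_mem_Icc.2 (M.node_lt k).le
  have hr : ∀ k : Fin K, M.node k.succ ∈ Icc (M.node k.castSucc) (M.node k.succ) :=
    fun k => right_mem_Icc.2 (M.node_lt k).le
  have h1 := M.sum_sq_sub_avg_le (M.card_pos hab) 1 χ (y := fun j => W 1 (M.node j))
    (μ := fun _ => (2 * R * M.size ^ N) ^ 2)
    (fun k => sq_le_sq.2 (((he k _ (hl k)).1).trans (le_abs_self _)))
    (fun k => sq_le_sq.2 (((he k _ (hr k)).1).trans (le_abs_self _)))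
  have h2 := M.sum_sq_jumpSecond_le χ (y := fun j => W 2 (M.node j))
    (μ := fun _ => (2 * R * M.size ^ (N - 1)) ^ 2)
    (fun k => sq_le_sq.2 (((he k _ (hl k)).2).trans (le_abs_self _)))
    (fun k => sq_le_sq.2 (((he k _ (hr k)).2).trans (le_abs_self _)))
  rw [Finset.sum_const, Finset.card_univ, Fintype.card_fin, nsmul_eq_mul] at h1 h2
  have hjump : ∀ j, M.jump χ j = 0 := fun j => by
    rw [jump, DGSpace.dpoly_zero, hplus, hminus, sub_self]
  have hpt : ∀ j, (W 1 (M.node j) - M.flux β₀ β₁ χ j) ^ 2 ≤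
      2 * (W 1 (M.node j) - M.avg 1 χ j) ^ 2
        + 2 * (β₁ ^ 2 * M.size ^ 2 * M.jumpSecond χ j ^ 2) := fun j => by
    rw [flux, hjump, mul_zero, zero_add]
    nlinarith [sq_nonneg ((W 1 (M.node j) - M.avg 1 χ j) + β₁ * M.size * M.jumpSecond χ j)]
  have h3 := Finset.sum_le_sum fun (j : Fin (K + 1)) (_ : j ∈ Finset.univ) => hpt j
  rw [Finset.sum_add_distrib, ← Finset.mul_sum, ← Finset.mul_sum, ← Finset.mul_sum] at h3
  have hpow : M.size ^ 2 * (2 * R * M.size ^ (N - 1)) ^ 2 = 4 * (R * M.size ^ N) ^ 2 := by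
    obtain ⟨m, rfl⟩ : ∃ m, N = m + 1 := ⟨N - 1, by omega⟩
    simp only [Nat.add_sub_cancel]
    ring
  have h4 := mul_le_mul_of_nonneg_left h2 (show 0 ≤ β₁ ^ 2 * M.size ^ 2 by positivity)
  have h5 : ∑ j, (W 1 (M.node j) - M.flux β₀ β₁ χ j) ^ 2 ≤
      K * ((16 + 32 * β₁ ^ 2) * (R * M.size ^ N) ^ 2) := by
    calc _ ≤ _ := h3
      _ ≤ 2 * (2 * (K * (2 * R * M.size ^ N) ^ 2))
          + 2 * (β₁ ^ 2 * M.size ^ 2 * (4 * (K * (2 * R * M.size ^ (N - 1)) ^ 2))) := by linarith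
      _ = 2 * (2 * (K * (2 * R * M.size ^ N) ^ 2))
          + 8 * β₁ ^ 2 * K * (M.size ^ 2 * (2 * R * M.size ^ (N - 1)) ^ 2) := by ring
      _ = _ := by rw [hpow]; ring
  have h6 := mul_le_mul_of_nonneg_right hM.card_mul_size_le
    (show 0 ≤ (16 + 32 * β₁ ^ 2) * (R * M.size ^ N) ^ 2 by positivity)
  have h7 := mul_le_mul_of_nonneg_left h5 hh.le
  linarith

/-- Galerkin orthogonality, in terms of a continuous interpolant. -/
theorem IsRitzProjection.diffusionForm_sub (h : DerivChain a b n R W) (hn : 3 ≤ n) {β₀ β₁ : ℝ}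
    {P χ : DGSpace K N} (hP : M.IsRitzProjection β₀ β₁ (W 2) P)
    (hplus : ∀ j, M.tracePlus χ.poly j = W 0 (M.node j))
    (hminus : ∀ j, M.traceMinus χ.poly j = W 0 (M.node j)) (φ : DGSpace K N) :
    M.diffusionForm N β₀ β₁ (P - χ) φ =
      ∑ k, M.cellInt k (fun x => (W 1 x - (χ.dpoly 1 k).eval x) * (φ.dpoly 1 k).eval x)
        + ∑ j, (W 1 (M.node j) - M.flux β₀ β₁ χ j) * M.jump φ j := by
  have hjump : ∀ j, M.jump χ j = 0 := fun j => by
    rw [jump, DGSpace.dpoly_zero, hplus, hminus, sub_self]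
  have e : M.diffusionForm N β₀ β₁ (P - χ) φ
      = M.diffusionForm N β₀ β₁ P φ - M.diffusionForm N β₀ β₁ χ φ := by
    rw [map_sub (M.diffusionForm N β₀ β₁) P χ, LinearMap.sub_apply]
  rw [e, hP φ, neg_sum_cellInt_second h hn, diffusionForm_apply, derivForm_apply, interfaceForm]
  simp only [hjump, mul_zero, add_zero, sub_mul, Finset.sum_sub_distrib]
  have e2 : ∑ k, M.cellInt k (fun x => W 1 x * (φ.dpoly 1 k).eval x
        - (χ.dpoly 1 k).eval x * (φ.dpoly 1 k).eval x)
      = ∑ k, M.cellInt k (fun x => W 1 x * (φ.dpoly 1 k).eval x)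
        - ∑ k, M.cellInt k (fun x => (χ.dpoly 1 k).eval x * (φ.dpoly 1 k).eval x) := by
    rw [← Finset.sum_sub_distrib]
    exact Finset.sum_congr rfl fun k _ => M.cellInt_sub
      ((continuousOn_cell h (by omega) k).mul (φ.dpoly 1 k).continuous.continuousOn)
      ((χ.dpoly 1 k).continuous.mul (φ.dpoly 1 k).continuous).continuousOn
  rw [e2]
  ring

/-- Coercivity applied to `P - χ`, whose form is given by the interpolation errors alone. Young's
inequality uses `c / 4` of the gradients and `c / 4` of the jumps, so half of the coercivity
survives. -/
theorem QuasiUniform.energy_sub_le (hM : M.QuasiUniform κ) (hab : a < b) (hN : 1 ≤ N)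
    (h : DerivChain a b n R W) (hn : 3 ≤ n) {β₀ β₁ c : ℝ} (hc : 0 < c)
    (hB : ∀ v : DGSpace K N, c * M.energy v ≤ M.diffusionForm N β₀ β₁ v v)
    {P χ : DGSpace K N} (hP : M.IsRitzProjection β₀ β₁ (W 2) P)
    (hplus : ∀ j, M.tracePlus χ.poly j = W 0 (M.node j))
    (hminus : ∀ j, M.traceMinus χ.poly j = W 0 (M.node j))
    (he : ∀ k, ∀ x ∈ Icc (M.node k.castSucc) (M.node k.succ),
        |W 1 x - (χ.dpoly 1 k).eval x| ≤ 2 * R * M.size ^ N ∧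
        |W 2 x - (χ.dpoly 2 k).eval x| ≤ 2 * R * M.size ^ (N - 1)) :
    M.energy (P - χ) ≤ (b - a) * (8 + 32 * κ * (1 + 2 * β₁ ^ 2)) / c ^ 2
      * (R * M.size ^ N) ^ 2 := by
  have hh := M.size_pos hab
  set ξ := P - χ with hξ
  set Q := (R * M.size ^ N) ^ 2 with hQ
  have hflux := hM.sum_sq_sub_flux_le hab hN hplus hminus he β₀ β₁
  have hform := hP.diffusionForm_sub h hn hplus hminus ξ
  have h1 : ∑ k, M.cellInt k (fun x => (W 1 x - (χ.dpoly 1 k).eval x) * (ξ.dpoly 1 k).eval x) ≤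
      4 * Q / c * (b - a) + c / 4 * M.derivForm N 1 ξ ξ := by
    rw [derivForm_self, ← M.sum_len, Finset.mul_sum, Finset.mul_sum, ← Finset.sum_add_distrib]
    refine Finset.sum_le_sum fun k _ => ?_
    have hcont : ContinuousOn (fun x => (W 1 x - (χ.dpoly 1 k).eval x) * (ξ.dpoly 1 k).eval x)
        (Icc (M.node k.castSucc) (M.node k.succ)) :=
      ((continuousOn_cell h (by omega) k).sub (χ.dpoly 1 k).continuous.continuousOn).mul
        (ξ.dpoly 1 k).continuous.continuousOn
    have hcont2 : Continuous fun x => c / 4 * (ξ.dpoly 1 k).eval x ^ 2 :=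
      ((ξ.dpoly 1 k).continuous.pow 2).const_mul _
    refine (M.cellInt_mono hcont (g := fun x => 4 * Q / c + c / 4 * (ξ.dpoly 1 k).eval x ^ 2)
      (continuousOn_const.add hcont2.continuousOn) fun x hx => ?_).trans (le_of_eq ?_)
    · have h1 : (W 1 x - (χ.dpoly 1 k).eval x) ^ 2 ≤ 4 * Q := by
        refine (sq_le_sq.2 (((he k x hx).1).trans (le_abs_self _))).trans (le_of_eq ?_)
        rw [hQ]; ring
      have h2 : 0 ≤ 1 / c * (W 1 x - (χ.dpoly 1 k).eval x - c / 2 * (ξ.dpoly 1 k).eval x) ^ 2 := by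
        positivity
      have h3 : 1 / c * (W 1 x - (χ.dpoly 1 k).eval x - c / 2 * (ξ.dpoly 1 k).eval x) ^ 2
          = (W 1 x - (χ.dpoly 1 k).eval x) ^ 2 / c
            - (W 1 x - (χ.dpoly 1 k).eval x) * (ξ.dpoly 1 k).eval x
            + c / 4 * (ξ.dpoly 1 k).eval x ^ 2 := by field_simp; ring
      have h4 := div_le_div_of_nonneg_right h1 hc.le
      rw [h3] at h2
      linarith
    · rw [M.cellInt_add continuousOn_const hcont2.continuousOn, M.cellInt_const_mul]
      congr 1
      rw [cellInt, intervalIntegral.integral_const, smul_eq_mul, len, mul_comm]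
  have h2 : ∑ j, (W 1 (M.node j) - M.flux β₀ β₁ χ j) * M.jump ξ j ≤
      1 / c * (M.size * ∑ j, (W 1 (M.node j) - M.flux β₀ β₁ χ j) ^ 2)
        + c / 4 * ∑ j, M.jump ξ j ^ 2 / M.size := by
    rw [Finset.mul_sum, Finset.mul_sum, Finset.mul_sum, ← Finset.sum_add_distrib]
    refine Finset.sum_le_sum fun j _ => ?_
    set d := W 1 (M.node j) - M.flux β₀ β₁ χ j
    have h2 : 0 ≤ M.size / c * (d - c / (2 * M.size) * M.jump ξ j) ^ 2 := by positivity
    have h3 : M.size / c * (d - c / (2 * M.size) * M.jump ξ j) ^ 2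
        = 1 / c * (M.size * d ^ 2) - d * M.jump ξ j + c / 4 * (M.jump ξ j ^ 2 / M.size) := by
      field_simp; ring
    linarith
  have h3 := hB ξ
  rw [hform] at h3
  have h4 : c / 2 * M.energy ξ ≤ 4 * Q / c * (b - a)
      + 1 / c * (κ * (b - a) * (16 + 32 * β₁ ^ 2) * Q) := by
    have := mul_le_mul_of_nonneg_left hflux (show 0 ≤ 1 / c by positivity)
    have e : M.energy ξ = M.derivForm N 1 ξ ξ + ∑ j, M.jump ξ j ^ 2 / M.size := rfl
    have hE := M.energy_nonneg ξ
    rw [e] at hE h3 ⊢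
    nlinarith
  rw [div_mul_eq_mul_div, le_div_iff₀ (by positivity)]
  have h5 := mul_le_mul_of_nonneg_left h4 (show 0 ≤ 2 * c by positivity)
  have e1 : 2 * c * (4 * Q / c * (b - a) + 1 / c * (κ * (b - a) * (16 + 32 * β₁ ^ 2) * Q))
      = (b - a) * (8 + 32 * κ * (1 + 2 * β₁ ^ 2)) * Q := by field_simp; ring
  rw [e1] at h5
  linarith

end DGMesh

end Ritz

/-! ### Duality -/

section Duality

open MeasureTheory Set Polynomial

namespace DGMesh

variable {a b : ℝ} {K N : ℕ} {M : DGMesh a b K} {R κ : ℝ} {n : ℕ} {W : ℕ → ℝ → ℝ}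

/-- On each cell `c - primitive` has derivative `-ξ`, and it is continuous across nodes; integrating
by parts writes `‖ξ‖²` through the flux of a dual problem `-Ψ'' = ξ`. -/
theorem massForm_eq_of_primitive (M : DGMesh a b K) (ξ : DGSpace K N) (c : ℝ) :
    M.massForm N ξ ξ
      = ∑ k, M.cellInt k (fun x => (c - primitive a (M.toFun ξ) x) * (ξ.dpoly 1 k).eval x)
        + ∑ j, (c - primitive a (M.toFun ξ) (M.node j)) * M.jump ξ j := by
  have hint := L2On.integrable (M.toFun_mem ξ)
  set η : ℝ → ℝ := fun x => c - primitive a (M.toFun ξ) x with hη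
  have hηc : Continuous η := continuous_const.sub (continuous_primitive' hint)
  rw [massForm_apply, M.sum_mul_jump (fun j => η (M.node j)), ← Finset.sum_add_distrib]
  refine Finset.sum_congr rfl fun k _ => ?_
  have hd : ∀ x ∈ Ioo (M.node k.castSucc) (M.node k.succ),
      HasDerivAt η (-(ξ.poly k).eval x) x := fun x hx => by
    have hev : M.toFun ξ =ᶠ[nhds x] fun y => (ξ.poly k).eval y := by
      filter_upwards [Ioo_mem_nhds hx.1 hx.2] with y hy
      exact M.toFun_apply_of_mem ξ (Ioo_subset_Ico_self hy)
    have hcont : ContinuousAt (M.toFun ξ) x :=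
      ((ξ.poly k).continuous.continuousAt).congr hev.symm
    have := intervalIntegral.integral_hasDerivAt_right (hint.intervalIntegrable (a := a) (b := x))
      hint.aestronglyMeasurable.stronglyMeasurableAtFilter hcont
    rw [hev.eq_of_nhds] at this
    exact this.const_sub c
  have e := M.cellInt_deriv_mul k (ξ.poly k) hηc.continuousOn hd
    ((ξ.poly k).continuous.neg.intervalIntegrable _ _)
  have e2 : M.cellInt k (fun x => -(ξ.poly k).eval x * (ξ.poly k).eval x)
      = -M.cellInt k (fun x => (ξ.poly k).eval x * (ξ.poly k).eval x) := by
    simp only [neg_mul, cellInt, intervalIntegral.integral_neg]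
  rw [e2] at e
  rw [DGSpace.dpoly_one]
  linarith

/-- Duality made explicit in one dimension. With `-Ψ'' = ξ`, `Ψ' = η` and `Ψ` zero at both ends, `Ψ`
is compared with its piecewise linear interpolant `ψ`, whose slopes are the cell means of `η`. As
`ψ` has no jumps, the flux of `ξ`, the part that spoils symmetry, drops out of `B ξ ψ`. What remains
involves only the oscillation of `η` on cells, at most `√(len * m k)`, which gives the factor `h`.
-/
theorem massForm_sub_le (hab : a < b) (hN : 1 ≤ N)
    (h : DerivChain a b n R W) (hn : 3 ≤ n) {β₀ β₁ : ℝ}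
    {P χ : DGSpace K N} (hP : M.IsRitzProjection β₀ β₁ (W 2) P)
    (hplus : ∀ j, M.tracePlus χ.poly j = W 0 (M.node j))
    (hminus : ∀ j, M.traceMinus χ.poly j = W 0 (M.node j)) :
    M.massForm N (P - χ) (P - χ) ≤ 6 * M.size ^ 2 * M.energy (P - χ) := by
  have hh := M.size_pos hab
  set ξ := P - χ with hξ
  have hint := L2On.integrable (M.toFun_mem ξ)
  set G := primitive a (M.toFun ξ) with hG
  have hGc : Continuous G := continuous_primitive' hint
  -- This choice gives `η` mean zero, so that its primitive also vanishes at `b`.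
  set c₀ := (∫ x in a..b, G x) / (b - a) with hc₀
  set η : ℝ → ℝ := fun x => c₀ - G x with hη
  have hηc : Continuous η := continuous_const.sub hGc
  have hη0 : ∫ x in a..b, η x = 0 := by
    rw [intervalIntegral.integral_sub intervalIntegrable_const (hGc.intervalIntegrable _ _),
      intervalIntegral.integral_const, smul_eq_mul, hc₀, mul_div_cancel₀ _ (sub_pos.2 hab).ne',
      sub_self]
  set Ψ : Fin (K + 1) → ℝ := fun j => ∫ x in a..(M.node j), η x with hΨ
  set ψ := M.affine N (fun k : Fin K => Ψ k.castSucc) fun k => Ψ k.succ with hψ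
  set s : Fin K → ℝ := fun k => (∫ x in (M.node k.castSucc)..(M.node k.succ), η x) / M.len k
  have hs : ∀ k, ψ.dpoly 1 k = C (s k) := fun k => by
    rw [M.dpoly_one_affine hN]
    congr 2
    exact intervalIntegral.integral_interval_sub_left (hηc.intervalIntegrable _ _)
      (hηc.intervalIntegrable _ _)
  have hψj : ∀ j, M.jump ψ j = 0 := fun j => by
    have e1 : M.tracePlus ψ.poly j = Ψ j := by
      induction j using Fin.lastCases with
      | last => rw [tracePlus_last, hΨ]; simp only [M.node_last]; exact hη0.symm
      | cast k => rw [tracePlus_castSucc, M.eval_affine_left hN]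
    have e2 : M.traceMinus ψ.poly j = Ψ j := by
      induction j using Fin.cases with
      | zero => rw [traceMinus_zero, hΨ]; simp [M.node_zero]
      | succ k => rw [traceMinus_succ, M.eval_affine_right hN]
    rw [jump, DGSpace.dpoly_zero, e1, e2, sub_self]
  -- By Galerkin orthogonality only integrals of `(W 0 - χ)'` against constants remain, and `χ`
  -- equals `W 0` at the nodes.
  have hBψ : M.diffusionForm N β₀ β₁ ξ ψ = 0 := by
    rw [hP.diffusionForm_sub h hn hplus hminus ψ]
    simp only [hψj, mul_zero, Finset.sum_const_zero, add_zero, hs, eval_C]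
    refine Finset.sum_eq_zero fun k _ => ?_
    have e := M.cellInt_deriv_mul k (f := fun x => W 0 x - (χ.poly k).eval x)
      (f' := fun x => W 1 x - (χ.dpoly 1 k).eval x) (C (s k))
      ((continuousOn_cell h (by omega) k).sub (χ.poly k).continuous.continuousOn)
      (fun x hx => (hasDerivAt_cell h (by omega) k hx).sub ((χ.poly k).hasDerivAt x))
      (((continuousOn_cell h (by omega) k).sub
        (χ.dpoly 1 k).continuous.continuousOn).intervalIntegrable_of_Icc (M.node_lt k).le)
    simp only [eval_C, derivative_C, eval_zero, mul_zero] at e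
    rw [e]
    have e1 := hplus k.castSucc
    have e2 := hminus k.succ
    rw [tracePlus_castSucc] at e1
    rw [traceMinus_succ] at e2
    rw [e1, e2]
    simp [cellInt]
  have hBψ' : ∑ k, M.cellInt k (fun x => s k * (ξ.dpoly 1 k).eval x)
      + ∑ j, M.avg 1 ψ j * M.jump ξ j = 0 := by
    rw [← hBψ, diffusionForm_apply, derivForm_apply, interfaceForm]
    simp only [hψj, mul_zero, zero_add, hs, eval_C, mul_comm (s _)]
  have hmain : M.massForm N ξ ξ = ∑ k, M.cellInt k (fun x => (η x - s k) * (ξ.dpoly 1 k).eval x)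
      + ∑ j, (η (M.node j) - M.avg 1 ψ j) * M.jump ξ j := by
    have e1 : ∑ k, M.cellInt k (fun x => (η x - s k) * (ξ.dpoly 1 k).eval x)
        = ∑ k, M.cellInt k (fun x => η x * (ξ.dpoly 1 k).eval x)
          - ∑ k, M.cellInt k (fun x => s k * (ξ.dpoly 1 k).eval x) := by
      rw [← Finset.sum_sub_distrib]
      refine Finset.sum_congr rfl fun k _ => ?_
      simp only [sub_mul]
      exact M.cellInt_sub (hηc.mul (ξ.dpoly 1 k).continuous).continuousOn
        ((ξ.dpoly 1 k).continuous.const_mul _).continuousOn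
    have e2 := M.massForm_eq_of_primitive ξ c₀
    simp only [sub_mul (η _), Finset.sum_sub_distrib]
    simp only [sub_mul (η _)] at e1
    rw [e1]
    simp only [hη, hG] at *
    linarith
  set m : Fin K → ℝ := fun k => M.cellInt k fun x => (ξ.poly k).eval x ^ 2 with hm
  have hmass : M.massForm N ξ ξ = ∑ k, m k := M.massForm_self ξ
  have hosc : ∀ k, ∀ x ∈ Icc (M.node k.castSucc) (M.node k.succ),
      (η x - s k) ^ 2 ≤ M.len k * m k := fun k x hx => by
    have hm0 : 0 ≤ M.len k * m k :=
      mul_nonneg (M.len_pos k).le (M.cellInt_nonneg fun x => sq_nonneg _)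
    have hG2 : ∀ y ∈ Icc (M.node k.castSucc) (M.node k.succ),
        ∀ z ∈ Icc (M.node k.castSucc) (M.node k.succ), y ≤ z → (G z - G y) ^ 2 ≤ M.len k * m k :=
      fun y hy z hz hyz => by
        have e1 : G z - G y = ∫ t in y..z, (ξ.poly k).eval t := by
          rw [hG, primitive_sub hint, intervalIntegral.integral_of_le hyz,
            intervalIntegral.integral_of_le hyz, integral_Ioc_eq_integral_Ioo,
            integral_Ioc_eq_integral_Ioo]
          exact setIntegral_congr_fun measurableSet_Ioo fun t ht =>
            M.toFun_apply_of_mem ξ ⟨hy.1.trans ht.1.le, ht.2.trans_le hz.2⟩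
        rw [e1]
        have hmem : MemLp (fun t => (ξ.poly k).eval t) 2 (volume.restrict (Ioc y z)) :=
          (memLp_two_iff_integrable_sq (ξ.poly k).continuous.aestronglyMeasurable).2
            ((intervalIntegrable_iff_integrableOn_Ioc_of_le hyz).1
              (((ξ.poly k).continuous.pow 2).intervalIntegrable y z))
        refine (sq_intervalIntegral_le hyz hmem).trans ?_
        refine mul_le_mul (by simp only [len]; linarith [hy.1, hz.2]) ?_
          (intervalIntegral.integral_nonneg hyz fun _ _ => sq_nonneg _) (M.len_pos k).le
        exact intervalIntegral.integral_mono_interval hy.1 hyz hz.2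
          (Filter.Eventually.of_forall fun _ => sq_nonneg _)
          (((ξ.poly k).continuous.pow 2).intervalIntegrable _ _)
    have h1 : ∀ y ∈ Icc (M.node k.castSucc) (M.node k.succ), |η y - η x| ≤ √(M.len k * m k) :=
      fun y hy => by
        refine Real.abs_le_sqrt ?_
        rcases le_total x y with hxy | hxy
        · refine le_trans (le_of_eq ?_) (hG2 x hx y hy hxy); simp only [hη]; ring
        · refine le_trans (le_of_eq ?_) (hG2 y hy x hx hxy); simp only [hη]; ring
    have h2 := abs_sub_average_le (M.node_lt k) (hηc.intervalIntegrable _ _) h1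
    have h3 := pow_le_pow_left₀ (abs_nonneg _) h2 2
    rwa [sq_abs, Real.sq_sqrt hm0] at h3
  have hosc' : ∀ k, ∀ x ∈ Icc (M.node k.castSucc) (M.node k.succ),
      (η x - s k) ^ 2 ≤ M.size * m k := fun k x hx => (hosc k x hx).trans
    (mul_le_mul_of_nonneg_right (M.len_le_size k) (M.cellInt_nonneg fun x => sq_nonneg _))
  have h1 : ∑ k, M.cellInt k (fun x => (η x - s k) * (ξ.dpoly 1 k).eval x) ≤
      M.size ^ 2 * M.derivForm N 1 ξ ξ + 1 / 4 * ∑ k, m k := by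
    rw [derivForm_self, Finset.mul_sum, Finset.mul_sum, ← Finset.sum_add_distrib]
    refine Finset.sum_le_sum fun k _ => ?_
    have hcont2 : Continuous fun x => M.size ^ 2 * (ξ.dpoly 1 k).eval x ^ 2 :=
      ((ξ.dpoly 1 k).continuous.pow 2).const_mul _
    have hl := M.len_pos k
    have hm0 : 0 ≤ m k := M.cellInt_nonneg fun x => sq_nonneg _
    refine (M.cellInt_mono (f := fun x => (η x - s k) * (ξ.dpoly 1 k).eval x)
      ((hηc.sub continuous_const).mul (ξ.dpoly 1 k).continuous).continuousOn
      (g := fun x => M.size ^ 2 * (ξ.dpoly 1 k).eval x ^ 2 + 1 / 4 * (m k / M.len k))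
      (hcont2.continuousOn.add continuousOn_const) fun x hx => ?_).trans (le_of_eq ?_)
    · have e1 := hosc k x hx
      set d := η x - s k
      set q := (ξ.dpoly 1 k).eval x
      have e2 : d * q ≤ M.len k ^ 2 * q ^ 2 + 1 / 4 * (d ^ 2 / M.len k ^ 2) := by
        have : 0 ≤ (M.len k * q - 1 / 2 * (d / M.len k)) ^ 2 := sq_nonneg _
        have e : (M.len k * q - 1 / 2 * (d / M.len k)) ^ 2
            = M.len k ^ 2 * q ^ 2 + 1 / 4 * (d ^ 2 / M.len k ^ 2) - d * q := by
          field_simp; ring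
        linarith
      have e3 : M.len k ^ 2 * q ^ 2 ≤ M.size ^ 2 * q ^ 2 := mul_le_mul_of_nonneg_right
        (pow_le_pow_left₀ hl.le (M.len_le_size k) 2) (sq_nonneg _)
      have e4 : d ^ 2 / M.len k ^ 2 ≤ m k / M.len k := by
        rw [div_le_div_iff₀ (by positivity) hl]
        nlinarith
      linarith
    · rw [M.cellInt_add hcont2.continuousOn continuousOn_const, M.cellInt_const_mul]
      congr 1
      rw [cellInt, intervalIntegral.integral_const, smul_eq_mul,
        show M.node k.succ - M.node k.castSucc = M.len k from rfl]
      field_simp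
  -- The weights in this bound and the previous one each leave a quarter of `‖ξ‖²` on the right, so
  -- half can be absorbed.
  have h2 : ∑ j, (η (M.node j) - M.avg 1 ψ j) * M.jump ξ j ≤
      1 / 4 * ∑ k, m k + 2 * M.size ^ 2 * ∑ j, M.jump ξ j ^ 2 / M.size := by
    have e1 := M.sum_sq_sub_avg_le (M.card_pos hab) 1 ψ (y := fun j => η (M.node j))
      (μ := fun k => M.size * m k)
      (fun k => by rw [hs, eval_C]; exact hosc' k _ (left_mem_Icc.2 (M.node_lt k).le))
      (fun k => by rw [hs, eval_C]; exact hosc' k _ (right_mem_Icc.2 (M.node_lt k).le))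
    rw [← Finset.mul_sum] at e1
    have e2 : ∑ j, (η (M.node j) - M.avg 1 ψ j) * M.jump ξ j ≤
        1 / (8 * M.size) * ∑ j, (η (M.node j) - M.avg 1 ψ j) ^ 2
          + 2 * M.size ^ 2 * ∑ j, M.jump ξ j ^ 2 / M.size := by
      rw [Finset.mul_sum, Finset.mul_sum, ← Finset.sum_add_distrib]
      refine Finset.sum_le_sum fun j _ => ?_
      set d := η (M.node j) - M.avg 1 ψ j
      have e2 : 0 ≤ 1 / (8 * M.size) * (d - 4 * M.size * M.jump ξ j) ^ 2 := by positivity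
      have e3 : 1 / (8 * M.size) * (d - 4 * M.size * M.jump ξ j) ^ 2
          = 1 / (8 * M.size) * d ^ 2 - d * M.jump ξ j
            + 2 * M.size ^ 2 * (M.jump ξ j ^ 2 / M.size) := by
        field_simp; ring
      linarith
    have e3 : 1 / (8 * M.size) * ∑ j, (η (M.node j) - M.avg 1 ψ j) ^ 2 ≤ 1 / 4 * ∑ k, m k := by
      refine (mul_le_mul_of_nonneg_left e1 (by positivity)).trans (le_of_eq ?_)
      field_simp; ring
    linarith
  have hE : M.energy ξ = M.derivForm N 1 ξ ξ + ∑ j, M.jump ξ j ^ 2 / M.size := rfl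
  have hd0 := mul_nonneg (sq_nonneg M.size) (M.derivForm_nonneg 1 ξ)
  have hs0 : 0 ≤ M.size ^ 2 * ∑ j, M.jump ξ j ^ 2 / M.size :=
    mul_nonneg (sq_nonneg _) (Finset.sum_nonneg fun _ _ => div_nonneg (sq_nonneg _) hh.le)
  rw [hE, mul_add]
  rw [hmass] at hmain ⊢
  linarith

/-- The `L²` error of the Ritz projection. -/
theorem QuasiUniform.sum_cellInt_sq_sub_le (hM : M.QuasiUniform κ) (hab : a < b) (hN : 1 ≤ N)
    (h : DerivChain a b (N + 2) R W) (h0 : W 0 a = 0) (h1 : W 0 b = 0) {β₀ β₁ c : ℝ} (hc : 0 < c)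
    (hB : ∀ v : DGSpace K N, c * M.energy v ≤ M.diffusionForm N β₀ β₁ v v)
    {P : DGSpace K N} (hP : M.IsRitzProjection β₀ β₁ (W 2) P) :
    ∑ k, M.cellInt k (fun x => (W 0 x - (P.poly k).eval x) ^ 2) ≤
      (b - a) * (8 + 12 * (8 + 32 * κ * (1 + 2 * β₁ ^ 2)) / c ^ 2)
        * (R * M.size ^ (N + 1)) ^ 2 := by
  obtain ⟨χ, hplus, hminus, he⟩ := M.exists_piecewise_interpolant hN (h.mono (Nat.le_succ _)) h0 h1
  have hE := hM.energy_sub_le hab hN h (by omega) hc hB hP hplus hminus fun k x hx => (he k x hx).2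
  have hmass := massForm_sub_le hab hN h (by omega) hP hplus hminus
  set ξ := P - χ with hξ
  set Q := (R * M.size ^ (N + 1)) ^ 2 with hQ
  have hcell : ∀ k, M.cellInt k (fun x => (W 0 x - (P.poly k).eval x) ^ 2) ≤
      8 * Q * M.len k + 2 * M.cellInt k (fun x => (ξ.poly k).eval x ^ 2) := fun k => by
    have hcont : Continuous fun x => 2 * (ξ.poly k).eval x ^ 2 :=
      ((ξ.poly k).continuous.pow 2).const_mul _
    refine (M.cellInt_mono (f := fun x => (W 0 x - (P.poly k).eval x) ^ 2)
      (g := fun x => 8 * Q + 2 * (ξ.poly k).eval x ^ 2)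
      (((continuousOn_cell h (by omega) k).sub (P.poly k).continuous.continuousOn).pow 2)
      (continuousOn_const.add hcont.continuousOn) fun x hx => ?_).trans (le_of_eq ?_)
    · have e1 : (W 0 x - (χ.poly k).eval x) ^ 2 ≤ 4 * Q := by
        refine (sq_le_sq.2 (((he k x hx).1).trans (le_abs_self _))).trans (le_of_eq ?_)
        rw [hQ]; ring
      have e2 : (ξ.poly k).eval x = (P.poly k).eval x - (χ.poly k).eval x := by
        rw [hξ, DGSpace.poly_sub, eval_sub]
      rw [e2]
      nlinarith [sq_nonneg ((W 0 x - (χ.poly k).eval x) + ((P.poly k).eval x - (χ.poly k).eval x))]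
    · rw [M.cellInt_add continuousOn_const hcont.continuousOn,
        M.cellInt_const_mul 2 fun x => (ξ.poly k).eval x ^ 2]
      congr 1
      rw [cellInt, intervalIntegral.integral_const, smul_eq_mul, len]
      ring
  have hsum := Finset.sum_le_sum fun (k : Fin K) (_ : k ∈ Finset.univ) => hcell k
  rw [Finset.sum_add_distrib, ← Finset.mul_sum, ← Finset.mul_sum, M.sum_len, ← massForm_self]
    at hsum
  have h2 := mul_le_mul_of_nonneg_left hE (show 0 ≤ 6 * M.size ^ 2 by positivity)
  have e : 6 * M.size ^ 2 * ((b - a) * (8 + 32 * κ * (1 + 2 * β₁ ^ 2)) / c ^ 2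
      * (R * M.size ^ N) ^ 2)
      = (b - a) * (6 * (8 + 32 * κ * (1 + 2 * β₁ ^ 2)) / c ^ 2) * Q := by rw [hQ]; ring
  rw [e] at h2
  refine hsum.trans ?_
  have e3 : (b - a) * (8 + 12 * (8 + 32 * κ * (1 + 2 * β₁ ^ 2)) / c ^ 2) * Q
      = 8 * Q * (b - a) + 2 * ((b - a) * (6 * (8 + 32 * κ * (1 + 2 * β₁ ^ 2)) / c ^ 2) * Q) := by
    ring
  rw [e3]
  linarith

/-- Best approximation by piecewise polynomials. -/
theorem exists_sum_cellInt_sq_sub_le (M : DGMesh a b K) (h : DerivChain a b (N + 1) R W) :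
    ∃ v : DGSpace K N, ∑ k, M.cellInt k (fun x => (W 0 x - (v.poly k).eval x) ^ 2) ≤
      (b - a) * (R * M.size ^ (N + 1)) ^ 2 := by
  have hR : 0 ≤ R := h.nonneg M.le_of_mesh
  choose T hT using fun k => (h.restrict (M.cell_subset k)).exists_taylor (M.node_lt k).le
  refine ⟨DGSpace.ofPoly N T, ?_⟩
  rw [← M.sum_len, Finset.sum_mul]
  refine Finset.sum_le_sum fun k _ => ?_
  rw [DGSpace.poly_ofPoly (hT k).1, mul_comm]
  refine M.cellInt_le_mul_len (((continuousOn_cell h (by omega) k).sub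
    (T k).continuous.continuousOn).pow 2) fun x hx => ?_
  refine sq_le_sq.2 (((hT k).2.2 0 (by omega) x hx).trans ?_)
  refine le_trans ?_ (le_abs_self _)
  exact mul_le_mul_of_nonneg_left
    (pow_le_pow_left₀ (M.len_pos k).le (M.len_le_size k) _) hR

end DGMesh

end Duality

/-! ### Space and time derivatives of the exact solution -/

section SpaceTime

open Set

section Directional

variable {E : Type*} [NormedAddCommGroup E] [NormedSpace ℝ E] {S : Set E} {R : ℝ} {n : ℕ}
  {f : E → ℝ} {v w : E}

/-- `f` is `C^n` on `S` and all its derivatives of order at most `n` are bounded by `R`. -/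
structure BoundedContDiffOn (n : ℕ) (R : ℝ) (f : E → ℝ) (S : Set E) : Prop where
  contDiffOn : ContDiffOn ℝ n f S
  bound : ∀ i ≤ n, ∀ z ∈ S, ‖iteratedFDerivWithin ℝ i f S z‖ ≤ R

/-- The derivative of `f` within `S` in the direction `v`. -/
noncomputable def dirDerivWithin (S : Set E) (v : E) (f : E → ℝ) (z : E) : ℝ :=
  fderivWithin ℝ f S z v

theorem BoundedContDiffOn.mono {k : ℕ} (h : BoundedContDiffOn n R f S) (hk : k ≤ n) :
    BoundedContDiffOn k R f S where
  contDiffOn := h.contDiffOn.of_le (by exact_mod_cast hk)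
  bound i hi := h.bound i (hi.trans hk)

theorem BoundedContDiffOn.abs_le (h : BoundedContDiffOn n R f S) {z : E} (hz : z ∈ S) :
    |f z| ≤ R := by
  simpa using h.bound 0 (Nat.zero_le _) z hz

theorem BoundedContDiffOn.dirDerivWithin (h : BoundedContDiffOn (n + 1) R f S)
    (hS : UniqueDiffOn ℝ S) (hv : ‖v‖ ≤ 1) : BoundedContDiffOn n R (dirDerivWithin S v f) S where
  contDiffOn := (h.contDiffOn.fderivWithin hS (by norm_cast)).clm_apply contDiffOn_const
  bound i hi z hz := by
    have h1 : ContDiffOn ℝ n (fderivWithin ℝ f S) S := h.contDiffOn.fderivWithin hS (by norm_cast)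
    refine (norm_iteratedFDerivWithin_clm_apply_const (h1 z hz) hS hz
      (by exact_mod_cast hi)).trans ?_
    rw [norm_iteratedFDerivWithin_fderivWithin hS hz]
    exact (mul_le_of_le_one_left (norm_nonneg _) hv).trans (h.bound (i + 1) (by omega) z hz)

theorem BoundedContDiffOn.iterate_dirDerivWithin {k : ℕ} (h : BoundedContDiffOn (n + k) R f S)
    (hS : UniqueDiffOn ℝ S) (hv : ‖v‖ ≤ 1) :
    BoundedContDiffOn n R ((_root_.dirDerivWithin S v)^[k] f) S := by
  induction k generalizing n with
  | zero => exact h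
  | succ k ih =>
    rw [Function.iterate_succ_apply']
    exact (ih (n := n + 1) (by rwa [add_assoc, add_comm 1 k])).dirDerivWithin hS hv

theorem dirDerivWithin_congr {g : E → ℝ} (h : EqOn f g S) :
    EqOn (dirDerivWithin S v f) (dirDerivWithin S v g) S := fun z hz => by
  rw [dirDerivWithin, fderivWithin_congr h (h hz), dirDerivWithin]

/-- Symmetry of the second derivative within `S`; it reaches boundary points because they are limits
of interior ones. -/
theorem dirDerivWithin_comm (hf : ContDiffOn ℝ 2 f S) (hS : UniqueDiffOn ℝ S)
    (hi : S ⊆ closure (interior S)) :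
    EqOn (dirDerivWithin S v (dirDerivWithin S w f)) (dirDerivWithin S w (dirDerivWithin S v f))
      S := fun z hz => by
  have hd : DifferentiableWithinAt ℝ (fderivWithin ℝ f S) S z :=
    (hf.fderivWithin (m := 1) hS (by norm_num)).differentiableOn (by norm_num) z hz
  have key : ∀ v w : E, dirDerivWithin S v (dirDerivWithin S w f) z
      = fderivWithin ℝ (fderivWithin ℝ f S) S z v w := fun v w => by
    have := (hd.hasFDerivWithinAt.clm_apply (hasFDerivWithinAt_const w z S)).fderivWithin (hS z hz)
    unfold dirDerivWithin
    rw [this]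
    simp
  rw [key, key]
  exact ((hf z hz).isSymmSndFDerivWithinAt (by simp) hS (hi hz) hz).eq v w

theorem BoundedContDiffOn.hasFDerivWithinAt (h : BoundedContDiffOn (n + 1) R f S) {z : E}
    (hz : z ∈ S) : HasFDerivWithinAt f (fderivWithin ℝ f S z) S z :=
  (h.contDiffOn.differentiableOn (by norm_cast) z hz).hasFDerivWithinAt

end Directional

theorem HasFDerivWithinAt.hasDerivWithinAt_snd {f : ℝ × ℝ → ℝ} {A B : Set ℝ} {t x : ℝ}
    {f' : ℝ × ℝ →L[ℝ] ℝ} (h : HasFDerivWithinAt f f' (A ×ˢ B) (t, x)) (ht : t ∈ A) :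
    HasDerivWithinAt (fun y => f (t, y)) (f' (0, 1)) B x :=
  HasFDerivWithinAt.comp_hasDerivWithinAt (t := A ×ˢ B) x h
    ((hasDerivWithinAt_const x B t).prodMk (hasDerivWithinAt_id x B)) fun _ hy => ⟨ht, hy⟩

theorem HasFDerivWithinAt.hasDerivWithinAt_fst {f : ℝ × ℝ → ℝ} {A B : Set ℝ} {t x : ℝ}
    {f' : ℝ × ℝ →L[ℝ] ℝ} (h : HasFDerivWithinAt f f' (A ×ˢ B) (t, x)) (hx : x ∈ B) :
    HasDerivWithinAt (fun s => f (s, x)) (f' (1, 0)) A t :=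
  HasFDerivWithinAt.comp_hasDerivWithinAt (t := A ×ˢ B) t h
    ((hasDerivWithinAt_id t A).prodMk (hasDerivWithinAt_const t A x)) fun _ hs => ⟨hs, hx⟩

/-- The quadratic Taylor bound for a function whose second derivative is bounded by `R`. -/
theorem abs_sub_sub_le_of_hasDerivWithinAt {A : Set ℝ} (hA : Convex ℝ A) {R : ℝ}
    {f f' f'' : ℝ → ℝ} (h : ∀ t ∈ A, HasDerivWithinAt f (f' t) A t)
    (h' : ∀ t ∈ A, HasDerivWithinAt f' (f'' t) A t) (hR : ∀ t ∈ A, |f'' t| ≤ R) {s t : ℝ}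
    (hs : s ∈ A) (ht : t ∈ A) : |f s - f t - (s - t) * f' t| ≤ R * (s - t) ^ 2 := by
  have hR0 : 0 ≤ R := (abs_nonneg _).trans (hR s hs)
  have hseg : segment ℝ t s ⊆ A := hA.segment_subset ht hs
  have h1 : ∀ r ∈ A, |f' r - f' t| ≤ R * |r - t| := fun r hr => by
    simpa using hA.norm_image_sub_le_of_norm_hasDerivWithin_le h'
      (fun x hx => by simpa using hR x hx) ht hr
  have h2 : ∀ r ∈ segment ℝ t s,
      HasDerivWithinAt (fun r => f r - r * f' t) (f' r - 1 * f' t) (segment ℝ t s) r :=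
    fun r hr => ((h r (hseg hr)).mono hseg).sub ((hasDerivWithinAt_id r _).mul_const _)
  have h3 := (convex_segment t s).norm_image_sub_le_of_norm_hasDerivWithin_le h2
    (C := R * |s - t|) (fun r hr => by
      rw [one_mul]
      refine (h1 r (hseg hr)).trans (mul_le_mul_of_nonneg_left ?_ hR0)
      rw [segment_eq_uIcc] at hr
      exact abs_sub_left_of_mem_uIcc hr) (left_mem_segment ℝ t s) (right_mem_segment ℝ t s)
  rw [Real.norm_eq_abs, Real.norm_eq_abs, mul_assoc, ← sq, sq_abs] at h3
  calc |f s - f t - (s - t) * f' t| = |f s - s * f' t - (f t - t * f' t)| := by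
        congr 1; ring
    _ ≤ _ := h3

/-- The space derivatives `V i` of `V 0`, of its time derivative `V' 0`, and a quadratic Taylor
bound in time for `V 2`. -/
structure SpaceTimeChain (a b T : ℝ) (n : ℕ) (R : ℝ) (V V' : ℕ → ℝ → ℝ → ℝ) : Prop where
  chain : ∀ t ∈ Icc 0 T, DerivChain a b (n + 1) R fun i => V i t
  chain' : ∀ t ∈ Icc 0 T, DerivChain a b n R fun i => V' i t
  hasDeriv : ∀ t ∈ Icc 0 T, ∀ x ∈ Icc a b,
    HasDerivWithinAt (fun s => V 0 s x) (V' 0 t x) (Icc 0 T) t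
  taylor : ∀ s ∈ Icc 0 T, ∀ t ∈ Icc 0 T, ∀ x ∈ Icc a b,
    |V 2 s x - V 2 t x - (s - t) * V' 2 t x| ≤ R * (s - t) ^ 2

/-- One order of differentiability is spent on the time derivative, so its chain is shorter by one.
The Taylor bound for `V 2` uses two space and two time derivatives, whence `3 ≤ n`. -/
theorem exists_spaceTimeChain {a b T R : ℝ} {n : ℕ} (hab : a < b) (hT : 0 < T) (hn : 3 ≤ n)
    {u : ℝ → ℝ → ℝ}
    (hu : ContDiffOn ℝ ((n + 1 : ℕ) : ℕ∞ω) (fun z : ℝ × ℝ => u z.1 z.2) (Icc 0 T ×ˢ Icc a b))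
    (hR : DerivBound a b T (n + 1) R u) :
    ∃ V V' : ℕ → ℝ → ℝ → ℝ, V 0 = u ∧ SpaceTimeChain a b T n R V V' := by
  set S : Set (ℝ × ℝ) := Icc 0 T ×ˢ Icc a b with hSdef
  set f : ℝ × ℝ → ℝ := fun z => u z.1 z.2 with hf
  have hS : UniqueDiffOn ℝ S := (uniqueDiffOn_Icc hT).prod (uniqueDiffOn_Icc hab)
  have hi : S ⊆ closure (interior S) := by
    rw [hSdef, interior_prod_eq, closure_prod_eq, interior_Icc, interior_Icc,
      closure_Ioo hT.ne, closure_Ioo hab.ne]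
  have h0 : BoundedContDiffOn (n + 1) R f S := ⟨hu, hR⟩
  set Dx := dirDerivWithin S ((0, 1) : ℝ × ℝ) with hDx
  set Dt := dirDerivWithin S ((1, 0) : ℝ × ℝ) with hDt
  have ex : ‖((0, 1) : ℝ × ℝ)‖ ≤ 1 := by simp [Prod.norm_def]
  have et : ‖((1, 0) : ℝ × ℝ)‖ ≤ 1 := by simp [Prod.norm_def]
  have ht0 : BoundedContDiffOn n R (Dt f) S := h0.dirDerivWithin hS et
  have chain : ∀ (m : ℕ) (F : ℝ × ℝ → ℝ), BoundedContDiffOn m R F S → ∀ t ∈ Icc 0 T,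
      DerivChain a b m R fun i x => Dx^[i] F (t, x) := fun m F hF t ht =>
    { hasDeriv := fun i hi x hx => by
        have h1 : BoundedContDiffOn (m - i - 1 + 1) R (Dx^[i] F) S :=
          BoundedContDiffOn.iterate_dirDerivWithin (hF.mono (by omega)) hS ex
        rw [Function.iterate_succ_apply']
        exact (h1.hasFDerivWithinAt (z := (t, x)) ⟨ht, hx⟩).hasDerivWithinAt_snd ht
      bound := fun i hi x hx => by
        have h1 : BoundedContDiffOn (m - i) R (Dx^[i] F) S :=
          BoundedContDiffOn.iterate_dirDerivWithin (hF.mono (by omega)) hS ex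
        exact h1.abs_le (z := (t, x)) ⟨ht, hx⟩ }
  -- The time derivative of the second space derivative must be recognized as the second space
  -- derivative of `u_t`, because the Ritz projection only sees second space derivatives.
  have hcomm : EqOn (Dt (Dx (Dx f))) (Dx (Dx (Dt f))) S := by
    have h1 : EqOn (Dt (Dx (Dx f))) (Dx (Dt (Dx f))) S :=
      dirDerivWithin_comm ((h0.mono (k := 2 + 1) (by omega)).dirDerivWithin hS ex).contDiffOn hS hi
    have h2 : EqOn (Dt (Dx f)) (Dx (Dt f)) S :=
      dirDerivWithin_comm (h0.mono (k := 2) (by omega)).contDiffOn hS hi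
    exact h1.trans (dirDerivWithin_congr h2)
  have h2 : BoundedContDiffOn (0 + 1) R (Dx^[2] f) S :=
    BoundedContDiffOn.iterate_dirDerivWithin (h0.mono (by omega)) hS ex
  have h2' : BoundedContDiffOn (0 + 1) R (Dx^[2] (Dt f)) S :=
    BoundedContDiffOn.iterate_dirDerivWithin (ht0.mono (by omega)) hS ex
  refine ⟨fun i t x => Dx^[i] f (t, x), fun i t x => Dx^[i] (Dt f) (t, x), rfl,
    chain _ f h0, chain _ _ ht0, fun t ht x hx => ?_, fun s hs t ht x hx => ?_⟩
  · exact (h0.hasFDerivWithinAt (z := (t, x)) ⟨ht, hx⟩).hasDerivWithinAt_fst hx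
  · refine abs_sub_sub_le_of_hasDerivWithinAt (convex_Icc 0 T) (f := fun s => Dx^[2] f (s, x))
      (f' := fun s => Dx^[2] (Dt f) (s, x)) (f'' := fun s => Dt (Dx^[2] (Dt f)) (s, x))
      (fun r hr => ?_) (fun r hr => ?_) (fun r hr => ?_) hs ht
    · rw [show Dx^[2] (Dt f) (r, x) = Dt (Dx^[2] f) (r, x) from (hcomm ⟨hr, hx⟩).symm]
      exact (h2.hasFDerivWithinAt (z := (r, x)) ⟨hr, hx⟩).hasDerivWithinAt_fst hx
    · exact (h2'.hasFDerivWithinAt (z := (r, x)) ⟨hr, hx⟩).hasDerivWithinAt_fst hx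
    · exact (h2'.dirDerivWithin hS et).abs_le (z := (r, x)) ⟨hr, hx⟩

end SpaceTime

/-! ### The Ritz projection of a space-time function -/

section RitzCurve

open MeasureTheory Set

theorem hasDerivWithinAt_of_abs_sub_le_sq {A : Set ℝ} {f : ℝ → ℝ} {f' t C : ℝ}
    (h : ∀ s ∈ A, |f s - f t - (s - t) * f'| ≤ C * (s - t) ^ 2) : HasDerivWithinAt f f' A t := by
  rw [hasDerivWithinAt_iff_isLittleO]
  have h1 : (fun s => f s - f t - (s - t) • f') =O[nhdsWithin t A] fun s => (s - t) ^ 2 :=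
    Asymptotics.IsBigO.of_bound C (Filter.eventually_of_mem self_mem_nhdsWithin fun s hs => by
      simpa [abs_of_nonneg (sq_nonneg (s - t))] using h s hs)
  refine h1.trans_isLittleO ?_
  have h2 : Filter.Tendsto (fun s : ℝ => s - t) (nhdsWithin t A) (nhds 0) := by
    have : Filter.Tendsto (fun s : ℝ => s - t) (nhds t) (nhds (t - t)) :=
      (continuous_id.sub continuous_const).tendsto t
    rw [sub_self] at this
    exact this.mono_left nhdsWithin_le_nhds
  have h3 : (fun s : ℝ => s - t) =o[nhdsWithin t A] fun _ => (1 : ℝ) :=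
    (Asymptotics.isLittleO_one_iff ℝ).2 h2
  simpa [sq] using (Asymptotics.isBigO_refl (fun s : ℝ => s - t) (nhdsWithin t A)).mul_isLittleO h3

/-- Representatives of a differentiable family of functionals are differentiable. -/
theorem LinearMap.BilinForm.exists_hasDerivWithinAt_representative {V : Type*}
    [NormedAddCommGroup V] [NormedSpace ℝ V] [FiniteDimensional ℝ V] (B : LinearMap.BilinForm ℝ V)
    (hB : ∀ v, B v v = 0 → v = 0) {A : Set ℝ} {l l' : ℝ → Module.Dual ℝ V}
    (hl : ∀ φ, ∀ t ∈ A, HasDerivWithinAt (fun s => l s φ) (l' t φ) A t) :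
    ∃ P P' : ℝ → V, (∀ t φ, B (P t) φ = l t φ) ∧ (∀ t φ, B (P' t) φ = l' t φ) ∧
      ∀ t ∈ A, HasDerivWithinAt P (P' t) A t := by
  obtain ⟨S, hS⟩ := B.exists_representative hB
  set e := Module.finBasis ℝ V
  -- Expanding functionals in the dual basis makes the curve a finite combination of fixed vectors
  -- with differentiable scalar coefficients.
  have hexp : ∀ L : Module.Dual ℝ V, ∑ i, L (e i) • e.coord i = L := fun L => by
    refine e.ext fun j => ?_
    simp
  refine ⟨fun t => ∑ i, l t (e i) • S (e.coord i), fun t => ∑ i, l' t (e i) • S (e.coord i),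
    fun t φ => ?_, fun t φ => ?_, fun t ht => ?_⟩
  · simp only [← map_smul, ← map_sum, hexp, hS]
  · simp only [← map_smul, ← map_sum, hexp, hS]
  · exact HasDerivWithinAt.fun_sum fun i _ => (hl (e i) t ht).smul_const _

namespace DGMesh

variable {a b : ℝ} {K N : ℕ} (M : DGMesh a b K)

/-! #### Functions on the interval and piecewise polynomials -/

theorem indicator_mem_of_continuousOn {f : ℝ → ℝ} (hf : ContinuousOn f (Icc a b)) :
    (Icc a b).indicator f ∈ L2On a b := by
  obtain ⟨C, hC⟩ := isCompact_Icc.exists_bound_of_continuousOn hf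
  exact indicator_mem (MemLp.of_bound (hf.aestronglyMeasurable measurableSet_Icc) C
    (ae_restrict_of_forall_mem measurableSet_Icc hC))

theorem cell_mem {k : Fin K} {x : ℝ} (hx : x ∈ Ico (M.node k.castSucc) (M.node k.succ)) :
    x ∈ Icc a b := M.cell_subset k (Ico_subset_Icc_self hx)

theorem integral_indicator_mul_toFun {f : ℝ → ℝ} (hf : ContinuousOn f (Icc a b))
    (φ : DGSpace K N) : ∫ x, (Icc a b).indicator f x * M.toFun φ x
      = ∑ k, M.cellInt k fun x => f x * (φ.poly k).eval x := by
  rw [M.integral_mul_toFun (indicator_mem_of_continuousOn hf)]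
  refine Finset.sum_congr rfl fun k _ => M.cellInt_congr fun x hx => ?_
  rw [indicator_of_mem (M.cell_mem hx)]

theorem indicator_sub_toFun_mem {f : ℝ → ℝ} (hf : ContinuousOn f (Icc a b)) (v : DGSpace K N) :
    (fun x => (Icc a b).indicator f x - M.toFun v x) ∈ L2On a b :=
  (L2On a b).sub_mem (indicator_mem_of_continuousOn hf) (M.toFun_mem v)

theorem integral_indicator_sub_toFun_sq {f : ℝ → ℝ} (hf : ContinuousOn f (Icc a b))
    (v : DGSpace K N) : ∫ x, ((Icc a b).indicator f x - M.toFun v x) ^ 2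
      = ∑ k, M.cellInt k fun x => (f x - (v.poly k).eval x) ^ 2 := by
  have hm := M.indicator_sub_toFun_mem hf v
  have h0 : ∀ x ∉ Icc a b, ((Icc a b).indicator f x - M.toFun v x) ^ 2 = 0 := fun x hx => by
    rw [show (Icc a b).indicator f x - M.toFun v x = 0 from hm.2 x hx]; ring
  rw [integral_eq_intervalIntegral M.le_of_mesh h0, ← M.sum_cellInt]
  · refine Finset.sum_congr rfl fun k _ => M.cellInt_congr fun x hx => ?_
    rw [indicator_of_mem (M.cell_mem hx), M.toFun_apply_of_mem v hx]
  · exact (L2On.integrable_sq hm).intervalIntegrable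

theorem l2Dist_eq {f : ℝ → ℝ} (hf : ContinuousOn f (Icc a b)) (v : DGSpace K N) :
    M.l2Dist f v = √(∫ x, ((Icc a b).indicator f x - M.toFun v x) ^ 2) := by
  rw [integral_indicator_sub_toFun_sq M hf, l2Dist]

theorem l2Dist_le_add {f : ℝ → ℝ} (hf : ContinuousOn f (Icc a b)) (v w : DGSpace K N) :
    M.l2Dist f v ≤ M.l2Dist f w + √(M.massForm N (w - v) (w - v)) := by
  rw [M.l2Dist_eq hf, M.l2Dist_eq hf, ← integral_toFun_sq]
  refine le_trans (le_of_eq ?_) (sqrt_integral_sq_add_le (M.indicator_sub_toFun_mem hf w).1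
    (M.toFun_mem (w - v)).1)
  congr 2; ext x
  rw [toFun_sub, Pi.sub_apply]; ring

theorem sqrt_massForm_sub_le {f : ℝ → ℝ} (hf : ContinuousOn f (Icc a b)) (v w : DGSpace K N) :
    √(M.massForm N (w - v) (w - v)) ≤ M.l2Dist f v + M.l2Dist f w := by
  rw [M.l2Dist_eq hf, M.l2Dist_eq hf, ← integral_toFun_sq]
  have h := sqrt_integral_sq_add_le (M.indicator_sub_toFun_mem hf v).1
    ((L2On a b).neg_mem (M.indicator_sub_toFun_mem hf w)).1
  simp only [Pi.neg_apply, neg_sq] at h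
  refine le_trans (le_of_eq ?_) h
  congr 2; ext x
  rw [toFun_sub, Pi.sub_apply]; ring

theorem abs_integral_indicator_sub_mul_le {f : ℝ → ℝ} (hf : ContinuousOn f (Icc a b))
    (P v : DGSpace K N) :
    |∫ x, ((Icc a b).indicator f x - M.toFun P x) * M.toFun v x|
      ≤ M.l2Dist f P * √(M.massForm N v v) := by
  rw [M.l2Dist_eq hf, ← integral_toFun_sq, ← Real.sqrt_mul (integral_nonneg fun _ => sq_nonneg _)]
  exact Real.abs_le_sqrt (sq_integral_mul_le (M.indicator_sub_toFun_mem hf P).1 (M.toFun_mem v).1)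

/-- The `L²` projection is a best approximation. -/
theorem exists_l2_projection_le {R : ℝ} {W : ℕ → ℝ → ℝ} (h : DerivChain a b (N + 1) R W) :
    ∃ v : DGSpace K N,
      (∀ φ : DGSpace K N, ∫ x, ((Icc a b).indicator (W 0) x - M.toFun v x) * M.toFun φ x = 0) ∧
      M.l2Dist (W 0) v ≤ √(b - a) * (R * M.size ^ (N + 1)) := by
  have hf : ContinuousOn (W 0) (Icc a b) := h.continuousOn (Nat.succ_pos N)
  obtain ⟨v, hv⟩ := M.exists_l2_projection N (indicator_mem_of_continuousOn hf)
  obtain ⟨w, hw⟩ := M.exists_sum_cellInt_sq_sub_le h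
  refine ⟨v, hv, ?_⟩
  have h0 : 0 ≤ R * M.size ^ (N + 1) :=
    mul_nonneg (h.nonneg M.le_of_mesh) (pow_nonneg M.size_nonneg _)
  rw [← Real.sqrt_sq h0, ← Real.sqrt_mul (sub_nonneg.2 M.le_of_mesh)]
  refine Real.sqrt_le_sqrt (le_trans ?_ hw)
  rw [← M.integral_indicator_sub_toFun_sq hf, ← M.integral_indicator_sub_toFun_sq hf]
  have hv' := M.indicator_sub_toFun_mem hf v
  have e : ∀ x, ((Icc a b).indicator (W 0) x - M.toFun w x) ^ 2
      = ((Icc a b).indicator (W 0) x - M.toFun v x) ^ 2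
        + (2 * (((Icc a b).indicator (W 0) x - M.toFun v x) * M.toFun (v - w) x)
          + M.toFun (v - w) x ^ 2) := fun x => by
    rw [toFun_sub, Pi.sub_apply]; ring
  have i1 := L2On.integrable_sq hv'
  have i2 := (L2On.integrable_mul hv' (M.toFun_mem (v - w))).const_mul 2
  have i3 := L2On.integrable_sq (M.toFun_mem (v - w))
  have i23 : Integrable fun x => 2 * (((Icc a b).indicator (W 0) x - M.toFun v x)
      * M.toFun (v - w) x) + M.toFun (v - w) x ^ 2 := i2.add i3
  simp only [e]
  rw [integral_add i1 i23, integral_add i2 i3, integral_const_mul, hv]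
  have : 0 ≤ ∫ x, M.toFun (v - w) x ^ 2 := integral_nonneg fun x => sq_nonneg _
  linarith

/-! #### The Ritz projection in time -/

/-- The Ritz projection is linear in the second space derivative, and the Taylor bound, uniform in
`x`, lets one differentiate its pairing with test functions. So the time derivative of the
projection is the projection of the time derivative. -/
theorem exists_ritz_curve {β₀ β₁ T R : ℝ} {n : ℕ} (hn : 3 ≤ n)
    (hB : ∀ v : DGSpace K N, M.diffusionForm N β₀ β₁ v v = 0 → v = 0) {V V' : ℕ → ℝ → ℝ → ℝ}
    (h : SpaceTimeChain a b T n R V V') :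
    ∃ P P' : ℝ → DGSpace K N, (∀ t ∈ Icc 0 T, M.IsRitzProjection β₀ β₁ (V 2 t) (P t)) ∧
      (∀ t ∈ Icc 0 T, M.IsRitzProjection β₀ β₁ (V' 2 t) (P' t)) ∧
      ∀ t ∈ Icc 0 T, HasDerivWithinAt P (P' t) (Icc 0 T) t := by
  have hV : ∀ t ∈ Icc 0 T, ContinuousOn (V 2 t) (Icc a b) := fun t ht =>
    (h.chain t ht).continuousOn (i := 2) (by omega)
  have hV' : ∀ t ∈ Icc 0 T, ContinuousOn (V' 2 t) (Icc a b) := fun t ht =>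
    (h.chain' t ht).continuousOn (i := 2) (by omega)
  let L : (L2On a b) →ₗ[ℝ] Module.Dual ℝ (DGSpace K N) := LinearMap.mk₂ ℝ
    (fun f φ => -∫ x, (f : ℝ → ℝ) x * M.toFun φ x)
    (fun f g φ => by
      simp only [Submodule.coe_add, Pi.add_apply, add_mul]
      rw [integral_add (L2On.integrable_mul f.2 (M.toFun_mem φ))
        (L2On.integrable_mul g.2 (M.toFun_mem φ))]
      ring)
    (fun c f φ => by
      simp only [Submodule.coe_smul, Pi.smul_apply, smul_eq_mul, mul_assoc]
      rw [integral_const_mul]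
      ring)
    (fun f φ ψ => by
      simp only [toFun_add, Pi.add_apply, mul_add]
      rw [integral_add (L2On.integrable_mul f.2 (M.toFun_mem φ))
        (L2On.integrable_mul f.2 (M.toFun_mem ψ))]
      ring)
    (fun c f φ => by
      have : M.toFun (c • φ) = c • M.toFun φ :=
        congrArg Subtype.val ((M.toFunLinear N).map_smul c φ)
      simp only [this, Pi.smul_apply, smul_eq_mul, mul_left_comm _ c]
      rw [integral_const_mul]
      ring)
  have hLa : ∀ f φ, L f φ = -∫ x, (f : ℝ → ℝ) x * M.toFun φ x := fun f φ => rfl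
  classical
  let F : ℝ → L2On a b := fun t =>
    if ht : t ∈ Icc 0 T then ⟨_, indicator_mem_of_continuousOn (hV t ht)⟩ else 0
  let F' : ℝ → L2On a b := fun t =>
    if ht : t ∈ Icc 0 T then ⟨_, indicator_mem_of_continuousOn (hV' t ht)⟩ else 0
  have hF : ∀ t ∈ Icc 0 T, (F t : ℝ → ℝ) = (Icc a b).indicator (V 2 t) := fun t ht => by
    simp only [F, dif_pos ht]
  have hF' : ∀ t ∈ Icc 0 T, (F' t : ℝ → ℝ) = (Icc a b).indicator (V' 2 t) := fun t ht => by
    simp only [F', dif_pos ht]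
  obtain ⟨P, P', hP, hP', hd⟩ := (M.diffusionForm N β₀ β₁).exists_hasDerivWithinAt_representative hB
    (A := Icc 0 T) (l := fun t => L (F t)) (l' := fun t => L (F' t)) fun φ t ht => by
      refine hasDerivWithinAt_of_abs_sub_le_sq (C := R * ∫ x, |M.toFun φ x|) fun s hs => ?_
      have e : L (F s) φ - L (F t) φ - (s - t) * L (F' t) φ
          = L (F s - F t - (s - t) • F' t) φ := by
        simp only [map_sub, map_smul, LinearMap.sub_apply, LinearMap.smul_apply, smul_eq_mul]
      have hi : Integrable fun x => M.toFun φ x := L2On.integrable (M.toFun_mem φ)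
      rw [e, hLa, abs_neg]
      refine abs_integral_le_integral_abs.trans ?_
      rw [mul_right_comm, ← integral_const_mul]
      refine integral_mono_of_nonneg (Filter.Eventually.of_forall fun _ => abs_nonneg _)
        (hi.abs.const_mul _) (Filter.Eventually.of_forall fun x => ?_)
      simp only [abs_mul]
      refine mul_le_mul_of_nonneg_right ?_ (abs_nonneg _)
      simp only [Submodule.coe_sub, Submodule.coe_smul, hF s hs, hF t ht, hF' t ht, Pi.sub_apply,
        Pi.smul_apply, smul_eq_mul]
      by_cases hx : x ∈ Icc a b
      · simpa only [indicator_of_mem hx] using h.taylor s hs t ht x hx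
      · have hR : 0 ≤ R := (h.chain t ht).nonneg M.le_of_mesh
        simp only [indicator_of_notMem hx]
        simpa using mul_nonneg hR (sq_nonneg (s - t))
  refine ⟨P, P', fun t ht φ => ?_, fun t ht φ => ?_, hd⟩
  · rw [hP, hLa, hF t ht, M.integral_indicator_mul_toFun (hV t ht)]
  · rw [hP', hLa, hF' t ht, M.integral_indicator_mul_toFun (hV' t ht)]

end DGMesh

end RitzCurve

/-! ### The error equation -/

section ErrorEquation

open MeasureTheory Set

theorem fracLaplacian_eq (α a b : ℝ) (w : ℝ → ℝ) (x : ℝ) :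
    fracLaplacian α a b w x = -fracInt (2 - α) (secondDeriv a b w) x := by
  have h : Real.cos (Real.pi * (2 - α) / 2) = -Real.cos (Real.pi * α / 2) := by
    rw [← Real.cos_pi_sub]; congr 1; ring
  rw [fracLaplacian, fracInt, caputoLeft, caputoRight, h, mul_neg, div_neg, neg_neg]

theorem DerivChain.secondDeriv_eq {a b R : ℝ} {n : ℕ} {W : ℕ → ℝ → ℝ} (h : DerivChain a b n R W)
    (hn : 2 ≤ n) (hab : a < b) : secondDeriv a b (W 0) = (Icc a b).indicator (W 2) := by
  have hd : ∀ i < n, EqOn (derivWithin (W i) (Icc a b)) (W (i + 1)) (Icc a b) := fun i hi x hx =>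
    (h.hasDeriv i hi x hx).derivWithin (uniqueDiffOn_Icc hab x hx)
  refine indicator_congr fun x hx => ?_
  rw [iteratedDerivWithin_succ, iteratedDerivWithin_one]
  rw [derivWithin_congr (hd 0 (by omega)) (hd 0 (by omega) hx)]
  exact hd 1 (by omega) hx

namespace DGMesh

variable {a b : ℝ} {K N : ℕ} (M : DGMesh a b K)

/-- The bilinear form of the Riesz potential on piecewise polynomials. -/
noncomputable def potentialForm (N : ℕ) {σ : ℝ} (hσ₀ : 0 < σ) (hab : a ≤ b) :
    LinearMap.BilinForm ℝ (DGSpace K N) :=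
  (rieszBilin hσ₀ hab).compl₁₂ (M.toFunLinear N) (M.toFunLinear N)

theorem potentialForm_apply {σ : ℝ} (hσ₀ : 0 < σ) (hab : a ≤ b) (v w : DGSpace K N) :
    M.potentialForm N hσ₀ hab v w = rieszForm σ (M.toFun v) (M.toFun w) := rfl

/-- The source is known only through the equation in the open interval; the omitted end points are
null, so it can be replaced under the integral. -/
theorem integral_mul_toFun_of_Ioo {F G : ℝ → ℝ} (v : DGSpace K N) (h : ∀ x ∈ Ioo a b, F x = G x)
    (hF : ∀ φ ∈ L2On a b, Integrable fun x => F x * φ x) :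
    ∑ k, M.cellInt k (fun x => G x * (v.poly k).eval x) = ∫ x, F x * M.toFun v x := by
  rw [M.integral_mul_toFun' v fun k => hF _ (M.pieceFun_mem_and_bounded v k).1]
  refine Finset.sum_congr rfl fun k _ => ?_
  rw [cellInt, cellInt, intervalIntegral.integral_of_le (M.node_lt k).le,
    intervalIntegral.integral_of_le (M.node_lt k).le, integral_Ioc_eq_integral_Ioo,
    integral_Ioc_eq_integral_Ioo]
  refine setIntegral_congr_fun measurableSet_Ioo fun x hx => ?_
  rw [h x ⟨(M.node_mem _).1.trans_lt hx.1, hx.2.trans_le (M.node_mem _).2⟩]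

/-- The difference of the Ritz projection and the semidiscrete solution solves the scheme up to a
perturbation by the projection errors. -/
theorem IsSemidiscreteSolution.isPerturbedSolution {M : DGMesh a b K} {α ε β₀ β₁ T R ρ : ℝ}
    {g : ℝ → ℝ → ℝ} {uh ph qh : ℝ → DGSpace K N}
    (hs : M.IsSemidiscreteSolution α ε β₀ β₁ T g uh ph qh) (hσ₀ : 0 < 2 - α) (hσ : 2 - α < 1)
    (hε : 0 < ε) (hab : a < b) (hT : 0 < T) {n : ℕ} (hn : 3 ≤ n) (hnN : N + 2 ≤ n)
    {V V' : ℕ → ℝ → ℝ → ℝ} (h : SpaceTimeChain a b T n R V V')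
    (heq : ∀ t ∈ Ioc 0 T, ∀ x ∈ Ioo a b,
      derivWithin (fun s => V 0 s x) (Icc 0 T) t + ε * fracLaplacian α a b (V 0 t) x = g t x)
    {P P' : ℝ → DGSpace K N} (hP : ∀ t ∈ Icc 0 T, M.IsRitzProjection β₀ β₁ (V 2 t) (P t))
    (hd : ∀ t ∈ Icc 0 T, HasDerivWithinAt P (P' t) (Icc 0 T) t)
    (hP' : ∀ t ∈ Icc 0 T, M.l2Dist (V' 0 t) (P' t) ≤ ρ) :
    IsPerturbedSolution (M.massForm N) (M.potentialForm N hσ₀ hab.le) (M.diffusionForm N β₀ β₁)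
      (ε * fracConst (2 - α)) T (ρ + ε * fracConst (2 - α) * (2 * ((b - a) ^ (2 - α) / (2 - α)))
        * (√(b - a) * (R * M.size ^ (N + 1)))) (fun t => P t - uh t) := by
  intro t ht
  have ht' : t ∈ Icc 0 T := Ioc_subset_Icc_self ht
  set σ := 2 - α with hσdef
  obtain ⟨w, hw, hev⟩ := hs.evolution t ht
  have hc := h.chain t ht'
  have hc2 : DerivChain a b (N + 1) R fun i => V (i + 2) t := (hc.mono (by omega)).shift
  -- The `L²` projection of `u''` is paired with the Ritz projection of `u`: by definition of the
  -- latter they satisfy the discrete diffusion equation exactly.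
  obtain ⟨Q, hQ, hQe⟩ := M.exists_l2_projection_le hc2
  simp only [zero_add] at hQ hQe
  have hV2 : ContinuousOn (V 2 t) (Icc a b) := hc.continuousOn (i := 2) (by omega)
  have hV0' : ContinuousOn (V' 0 t) (Icc a b) := (h.chain' t ht').continuousOn (i := 0) (by omega)
  have hf := indicator_mem_of_continuousOn hV2
  have hf' := indicator_mem_of_continuousOn hV0'
  have hfb : ∀ x, |(Icc a b).indicator (V 2 t) x| ≤ R := fun x => by
    by_cases hx : x ∈ Icc a b
    · rw [indicator_of_mem hx]; exact hc.bound 2 (by omega) x hx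
    · rw [indicator_of_notMem hx, abs_zero]; exact hc.nonneg hab.le
  refine ⟨P' t - w, Q - qh t, (hd t ht').sub hw, fun φ => ?_, fun v => ?_⟩
  · have h1 : M.massForm N Q φ = -M.diffusionForm N β₀ β₁ (P t) φ := by
      have := hQ φ
      simp only [sub_mul] at this
      rw [integral_sub (L2On.integrable_mul hf (M.toFun_mem φ))
        (L2On.integrable_mul (M.toFun_mem Q) (M.toFun_mem φ)), integral_toFun_mul_toFun,
        M.integral_indicator_mul_toFun hV2] at this
      rw [hP t ht' φ]
      linarith
    have h2 : M.massForm N (qh t) φ = -M.diffusionForm N β₀ β₁ (uh t) φ := by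
      rw [massForm_apply, hs.diffusion t ht φ, diffusionForm_apply, derivForm_apply]
      ring
    simp only [map_sub, LinearMap.sub_apply, h1, h2]
    ring
  · have h1 : M.massForm N (ph t) v
        = fracConst σ * rieszForm σ (M.toFun (qh t)) (M.toFun v) := by
      obtain ⟨C, hC⟩ := M.toFun_bounded (qh t)
      rw [massForm_apply, Finset.sum_congr rfl fun k _ => hs.integral t ht v k,
        ← (integral_fracInt_mul hσ₀ hab.le (M.toFun_mem (qh t)) hC (M.toFun_mem v)).2]
      exact M.integral_mul_toFun_of_Ioo v (fun _ _ => rfl) fun φ hφ =>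
        (integral_fracInt_mul hσ₀ hab.le (M.toFun_mem (qh t)) hC hφ).1
    have h2 : ∑ k, M.cellInt k (fun x => g t x * (v.poly k).eval x)
        = (∫ x, (Icc a b).indicator (V' 0 t) x * M.toFun v x)
          - ε * (fracConst σ * rieszForm σ ((Icc a b).indicator (V 2 t)) (M.toFun v)) := by
      have hi : ∀ φ ∈ L2On a b, Integrable fun x => ε * (fracInt σ ((Icc a b).indicator (V 2 t)) x
          * φ x) := fun φ hφ => (integral_fracInt_mul hσ₀ hab.le hf hfb hφ).1.const_mul ε
      rw [← (integral_fracInt_mul hσ₀ hab.le hf hfb (M.toFun_mem v)).2, ← integral_const_mul,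
        ← integral_sub (L2On.integrable_mul hf' (M.toFun_mem v)) (hi _ (M.toFun_mem v)),
        M.integral_mul_toFun_of_Ioo (F := fun x => (Icc a b).indicator (V' 0 t) x
          - ε * fracInt σ ((Icc a b).indicator (V 2 t)) x) v]
      · congr 1; ext x; ring
      · intro x hx
        have hx' := Ioo_subset_Icc_self hx
        rw [← heq t ht x hx, (h.hasDeriv t ht' x hx').derivWithin (uniqueDiffOn_Icc hT t ht'),
          fracLaplacian_eq, hc.secondDeriv_eq (by omega) hab, indicator_of_mem hx']
        ring
      · intro φ hφ
        simp only [sub_mul, mul_assoc]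
        exact (L2On.integrable_mul hf' hφ).sub (hi φ hφ)
    have h3 : M.massForm N w v = ε * M.massForm N (ph t) v
        + ∑ k, M.cellInt k (fun x => g t x * (v.poly k).eval x) := by
      rw [massForm_apply, massForm_apply, Finset.mul_sum, ← Finset.sum_add_distrib]
      exact Finset.sum_congr rfl fun k _ => by linarith [hev v k]
    have h4 : M.massForm N (P' t) v = (∫ x, (Icc a b).indicator (V' 0 t) x * M.toFun v x)
        - ∫ x, ((Icc a b).indicator (V' 0 t) x - M.toFun (P' t) x) * M.toFun v x := by
      simp only [sub_mul]
      rw [integral_sub (L2On.integrable_mul hf' (M.toFun_mem v))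
        (L2On.integrable_mul (M.toFun_mem (P' t)) (M.toFun_mem v)), integral_toFun_mul_toFun]
      ring
    have h5 : rieszForm σ ((Icc a b).indicator (V 2 t)) (M.toFun v)
        - rieszForm σ (M.toFun Q) (M.toFun v)
        = rieszForm σ (fun x => (Icc a b).indicator (V 2 t) x - M.toFun Q x) (M.toFun v) := by
      have := (rieszBilin hσ₀ hab.le).map_sub₂ ⟨_, hf⟩ (M.toFunLinear N Q) (M.toFunLinear N v)
      exact this.symm
    -- The whole residual: the potential of the projection error of `u''` and the Ritz error of
    -- `u_t`.
    have e : M.massForm N (P' t - w) v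
        - ε * fracConst σ * M.potentialForm N hσ₀ hab.le (Q - qh t) v
        = ε * fracConst σ * rieszForm σ (fun x => (Icc a b).indicator (V 2 t) x - M.toFun Q x)
          (M.toFun v)
        - ∫ x, ((Icc a b).indicator (V' 0 t) x - M.toFun (P' t) x) * M.toFun v x := by
      simp only [map_sub, LinearMap.sub_apply, potentialForm_apply]
      rw [← h5, h3, h1, h2, h4]
      ring
    have hfc := fracConst_pos hσ₀ hσ
    have hA : 0 ≤ 2 * ((b - a) ^ σ / σ) := by
      have : 0 ≤ b - a := by linarith
      positivity
    have hr := abs_rieszForm_le_sqrt hσ₀ hσ hab.le (M.indicator_sub_toFun_mem hV2 Q)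
      (M.toFun_mem v)
    rw [integral_toFun_sq, ← M.l2Dist_eq hV2] at hr
    have hl := M.abs_integral_indicator_sub_mul_le hV0' (P' t) v
    have hm := Real.sqrt_nonneg (M.massForm N v v)
    rw [e]
    refine (abs_sub _ _).trans ?_
    rw [abs_mul, abs_of_pos (mul_pos hε hfc)]
    have k1 := mul_le_mul_of_nonneg_right (hP' t ht') hm
    have k2 := mul_le_mul_of_nonneg_left (hr.trans (mul_le_mul_of_nonneg_left
      (mul_le_mul_of_nonneg_right hQe hm) hA)) (mul_pos hε hfc).le
    linarith

end DGMesh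

end ErrorEquation

/-! ### The error estimate -/

section ErrorEstimate

open Set

namespace DGMesh

variable {a b : ℝ} {K N : ℕ}

/-- The energy structure of the scheme, with constants that do not depend on the mesh. -/
theorem exists_energyStructure (N : ℕ) (hN : 1 ≤ N) (β₀ β₁ γ μ : ℝ) {σ : ℝ} (hσ₀ : 0 < σ)
    (hσ : σ < 1) (hab : a < b) (hγ : γ < 1) (hμ : 0 < μ) :
    ∃ C₂ C₄ : ℝ, 0 < C₂ ∧ 0 < C₄ ∧ ∀ {K : ℕ} (M : DGMesh a b K), M.Admissible N β₀ β₁ γ μ →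
      EnergyStructure (M.massForm N) (M.potentialForm N hσ₀ hab.le) (M.diffusionForm N β₀ β₁)
        M.energy (2 * ((b - a) ^ σ / σ)) C₂ C₄ ((b - a) ^ 2 * (8 + 16 * (β₀ / (2 * (1 - γ)))))
        (min (1 - γ) μ) := by
  set κ := β₀ / (2 * (1 - γ))
  obtain ⟨C₂, hC₂, h₂⟩ := exists_massForm_le_of_rieszForm_eq hN κ hσ₀ hσ hab
  obtain ⟨C₄, hC₄, h₄⟩ := exists_diffusionForm_sq_le N β₀ β₁ κ
  obtain ⟨c, hc, hinv⟩ := exists_inverse_estimate N κ hσ₀ hσ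
  refine ⟨C₂, C₄, hC₂, hC₄, fun {K} M hM => ?_⟩
  have hq : M.QuasiUniform κ := M.size_le_of_admissible hN hγ hμ.le hM
  exact
    { m_symm := M.derivForm_comm 0
      m_pos := fun v hv => M.massForm_pos hv
      b_symm := fun v w => rieszForm_comm _ _
      b_pos := fun v hv => (mul_pos hc (mul_pos (Real.rpow_pos_of_pos (M.size_pos hab) _)
        (M.massForm_pos hv))).trans_le (hinv M hab hq v)
      b_le := fun v => by
        rw [← M.integral_toFun_sq]
        exact rieszForm_self_le hσ₀ hab.le (M.toFun_mem v)
      E_nonneg := M.energy_nonneg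
      inverse_le := h₂ M hq
      coercive := M.energy_le_diffusionForm hM
      bounded := h₄ M hab hq
      poincare := hq.massForm_le_energy hab hN M.size_le }

theorem QuasiUniform.l2Dist_le {M : DGMesh a b K} {κ R : ℝ} {W : ℕ → ℝ → ℝ}
    (hM : M.QuasiUniform κ) (hab : a < b)
    (hN : 1 ≤ N) (h : DerivChain a b (N + 2) R W) (h0 : W 0 a = 0) (h1 : W 0 b = 0)
    {β₀ β₁ c : ℝ} (hc : 0 < c)
    (hB : ∀ v : DGSpace K N, c * M.energy v ≤ M.diffusionForm N β₀ β₁ v v)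
    {P : DGSpace K N} (hP : M.IsRitzProjection β₀ β₁ (W 2) P) :
    M.l2Dist (W 0) P ≤ √((b - a) * (8 + 12 * (8 + 32 * κ * (1 + 2 * β₁ ^ 2)) / c ^ 2))
      * (R * M.size ^ (N + 1)) := by
  have h2 : 0 ≤ R * M.size ^ (N + 1) :=
    mul_nonneg (h.nonneg hab.le) (pow_nonneg M.size_nonneg _)
  refine (Real.sqrt_le_sqrt (hM.sum_cellInt_sq_sub_le hab hN h h0 h1 hc hB hP)).trans (le_of_eq ?_)
  rw [Real.sqrt_mul' _ (sq_nonneg _), Real.sqrt_sq h2]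

theorem IsRitzProjection.unique {M : DGMesh a b K} {β₀ β₁ : ℝ} {f : ℝ → ℝ} {P Q : DGSpace K N}
    (hB : ∀ v : DGSpace K N, M.diffusionForm N β₀ β₁ v v = 0 → v = 0)
    (hP : M.IsRitzProjection β₀ β₁ f P) (hQ : M.IsRitzProjection β₀ β₁ f Q) : P = Q := by
  refine sub_eq_zero.1 (hB _ ?_)
  rw [LinearMap.BilinForm.sub_left, hP, hQ, sub_self]

end DGMesh

end ErrorEstimate

/-! ### The main estimate. -/

open Set in
-- The boundary condition passes to `u_t`, which is therefore covered by the error bound for the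
-- Ritz projection.
theorem SpaceTimeChain.time_deriv_eq_zero {a b T R : ℝ} {n : ℕ} {V V' : ℕ → ℝ → ℝ → ℝ}
    (h : SpaceTimeChain a b T n R V V') (hT : 0 < T) {x : ℝ} (hx : x ∈ Icc a b)
    (h0 : ∀ t ∈ Icc 0 T, V 0 t x = 0) {t : ℝ} (ht : t ∈ Icc 0 T) : V' 0 t x = 0 :=
  (uniqueDiffOn_Icc hT t ht).eq_deriv _ (h.hasDeriv t ht x hx)
    ((hasDerivWithinAt_const t _ (0 : ℝ)).congr h0 (h0 t ht))

theorem theorem4p2 (α ε a b β₀ β₁ γ μ : ℝ) (N : ℕ)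
    (hα₁ : 1 < α) (hα₂ : α < 2) (hε : 0 < ε) (hab : a < b) (hN : 1 ≤ N)
    (hγ₀ : 0 < γ) (hγ₁ : γ < 1) (hμ₀ : 0 < μ) (hμ₁ : μ ≤ 1) :
    ∃ m : ℕ, ∀ T τ R C₀ : ℝ, 0 < τ → τ ≤ T → ∃ C h₀ : ℝ, 0 < C ∧ 0 < h₀ ∧
      ∀ g u : ℝ → ℝ → ℝ, IsExactSolution α ε a b T m g u → DerivBound a b T m R u →
      ∀ (K : ℕ) (M : DGMesh a b K), M.size ≤ h₀ → M.Admissible N β₀ β₁ γ μ →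
      ∀ uh ph qh : ℝ → DGSpace K N, M.IsSemidiscreteSolution α ε β₀ β₁ T g uh ph qh →
        (M.IsFluxProjection β₀ β₁ (u 0) (uh 0) →
          ∀ t ∈ Set.Icc 0 T, M.l2Dist (u t) (uh t) ≤ C * M.size ^ (N + 1)) ∧
        (M.l2Dist (u 0) (uh 0) ≤ C₀ * M.size ^ (N + 1) →
          ∀ t ∈ Set.Icc τ T, M.l2Dist (u t) (uh t) ≤ C * M.size ^ (N + 1)) := by
  have hσ₀ : 0 < 2 - α := by linarith
  have hσ : 2 - α < 1 := by linarith
  obtain ⟨C₂, C₄, hC₂, hC₄, hES⟩ :=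
    DGMesh.exists_energyStructure N hN β₀ β₁ γ μ hσ₀ hσ hab hγ₁ hμ₀
  -- `N + 2` derivatives for the Ritz error of `u_t`, and one more for the time derivative.
  refine ⟨N + 2 + 1, fun T τ R C₀ hτ hτT => ?_⟩
  have hT : 0 < T := hτ.trans_le hτT
  set c := min (1 - γ) μ with hcdef
  have hc : 0 < c := lt_min (by linarith) hμ₀
  set κ := β₀ / (2 * (1 - γ)) with hκ
  set C₁ := 2 * ((b - a) ^ (2 - α) / (2 - α)) with hC₁def
  have hC₁ : 0 ≤ C₁ := by
    have : 0 ≤ b - a := by linarith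
    positivity
  set C₅ := (b - a) ^ 2 * (8 + 16 * κ) with hC₅def
  set ε' := ε * fracConst (2 - α) with hε'def
  have hε' : 0 < ε' := mul_pos hε (fracConst_pos hσ₀ hσ)
  set A := √((b - a) * (8 + 12 * (8 + 32 * κ * (1 + 2 * β₁ ^ 2)) / c ^ 2)) with hA
  set D := A * R + ε' * C₁ * (√(b - a) * R) with hD
  set E₁ := C₁ * (C₂ / (2 * (ε' * c)) * T) with hE₁
  set Z := C₁ * (C₄ / (ε' * c) ^ 2 * (√C₂ * √C₅ * (C₂ / c ^ 2)) * (A * R + C₀) ^ 2 +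
      (C₂ * T ^ 2 / (ε' * c) + C₄ / (ε' * c) ^ 2 * (C₂ ^ 2 * C₅ / c ^ 2) / (ε' * c)) * T * D ^ 2)
    with hZ
  -- The summands are the Ritz error and the discrete errors of the two claims; `1` makes the
  -- constant positive. The absolute values are there because `R ≥ 0` is known only once a solution
  -- is given.
  refine ⟨|A * R| + √E₁ * |D| + √Z / τ + 1, 1, by positivity, one_pos, ?_⟩
  intro g u hu hR K M _ hM uh ph qh hs
  obtain ⟨V, V', hV, hST⟩ := exists_spaceTimeChain hab hT (n := N + 2) (by omega) hu.contDiffOn hR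
  subst hV
  have hq : M.QuasiUniform κ := M.size_le_of_admissible hN hγ₁ hμ₀.le hM
  have hκ0 : 0 < κ := hq.pos hab
  have hC₅ : 0 ≤ C₅ := by positivity
  have hE := hES M hM
  have hcoer : ∀ v : DGSpace K N, c * M.energy v ≤ M.diffusionForm N β₀ β₁ v v := hE.coercive
  have hdef : ∀ v : DGSpace K N, M.diffusionForm N β₀ β₁ v v = 0 → v = 0 := fun v hv => by
    have h1 := hcoer v
    rw [hv] at h1
    have h2 : M.energy v ≤ 0 := nonpos_of_mul_nonpos_right h1 hc
    have h3 : M.massForm N v v ≤ 0 :=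
      (hE.poincare v).trans (mul_nonpos_of_nonneg_of_nonpos hC₅ h2)
    exact M.massForm_definite (h3.antisymm (M.massForm_nonneg v))
  obtain ⟨P, P', hP, hP', hd⟩ := M.exists_ritz_curve (by omega) hdef hST
  have h0mem : (0 : ℝ) ∈ Set.Icc 0 T := ⟨le_rfl, hT.le⟩
  have hR0 : 0 ≤ R := (hST.chain 0 h0mem).nonneg hab.le
  set h := M.size ^ (N + 1) with hh
  have hh0 : 0 ≤ h := pow_nonneg M.size_nonneg _
  have hcont : ∀ t ∈ Set.Icc 0 T, ContinuousOn (V 0 t) (Set.Icc a b) := fun t ht =>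
    (hST.chain t ht).continuousOn (i := 0) (by omega)
  have hPe : ∀ t ∈ Set.Icc 0 T, M.l2Dist (V 0 t) (P t) ≤ A * (R * h) := fun t ht =>
    hq.l2Dist_le hab hN ((hST.chain t ht).mono (by omega)) (hu.boundary t ht).1
      (hu.boundary t ht).2 hc hcoer (hP t ht)
  have hPe' : ∀ t ∈ Set.Icc 0 T, M.l2Dist (V' 0 t) (P' t) ≤ A * (R * h) := fun t ht =>
    hq.l2Dist_le hab hN (hST.chain' t ht)
      (hST.time_deriv_eq_zero hT (Set.left_mem_Icc.2 hab.le) (fun s hs => (hu.boundary s hs).1) ht)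
      (hST.time_deriv_eq_zero hT (Set.right_mem_Icc.2 hab.le) (fun s hs => (hu.boundary s hs).2) ht)
      hc hcoer (hP' t ht)
  have hpert := hs.isPerturbedSolution hσ₀ hσ hε hab hT (by omega) le_rfl hST hu.equation hP hd hPe'
  have hρ : A * (R * h) + ε * fracConst (2 - α) * (2 * ((b - a) ^ (2 - α) / (2 - α)))
      * (√(b - a) * (R * M.size ^ (N + 1))) = D * h := by
    rw [hD]; ring
  rw [hρ] at hpert
  have hD0 : 0 ≤ D := by positivity
  have hAR : 0 ≤ A * R := by positivity
  have hec : ContinuousOn (fun t => P t - uh t) (Set.Icc 0 T) :=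
    ContinuousOn.sub (fun t ht => (hd t ht).continuousWithinAt) hs.continuousOn
  have htri : ∀ t ∈ Set.Icc 0 T, M.l2Dist (V 0 t) (uh t)
      ≤ A * R * h + √(M.massForm N (P t - uh t) (P t - uh t)) := fun t ht => by
    have := M.l2Dist_le_add (hcont t ht) (uh t) (P t)
    linarith [hPe t ht]
  have hZτ : 0 ≤ √Z / τ := by positivity
  have hED : 0 ≤ √E₁ * |D| := by positivity
  refine ⟨fun hinit t ht => ?_, fun hinit t ht => ?_⟩
  -- Both `P 0` and the special projection solve the Ritz equations, which have only one solution.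
  · have h0 : P 0 - uh 0 = 0 := sub_eq_zero.2 <| (hP 0 h0mem).unique hdef <|
      hinit.isRitzProjection (hST.chain 0 h0mem) (by omega) hab (hu.boundary 0 h0mem).1
        (hu.boundary 0 h0mem).2
    have hb := hE.bound_of_initial_zero hε' hc hC₁ hC₂.le (mul_nonneg hD0 hh0) hec hpert h0 ht
    have hb' := Real.sqrt_le_sqrt hb
    rw [Real.sqrt_mul' _ (sq_nonneg _), Real.sqrt_sq (mul_nonneg hD0 hh0)] at hb'
    refine (htri t ht).trans ?_
    rw [abs_of_nonneg hAR]
    rw [abs_of_nonneg hD0] at hED ⊢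
    have k1 : √E₁ * (D * h) = √E₁ * D * h := by ring
    have k2 := mul_nonneg hZτ hh0
    rw [k1] at hb'
    linarith
  · have ht' : t ∈ Set.Icc 0 T := ⟨hτ.le.trans ht.1, ht.2⟩
    have ht0 : 0 < t := hτ.trans_le ht.1
    have hη : √(M.massForm N (P 0 - uh 0) (P 0 - uh 0)) ≤ (A * R + C₀) * h := by
      have := M.sqrt_massForm_sub_le (hcont 0 h0mem) (uh 0) (P 0)
      linarith [hPe 0 h0mem]
    have hη0 : 0 ≤ (A * R + C₀) * h := (Real.sqrt_nonneg _).trans hη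
    have hb := hE.bound_of_initial_le hε' hc hC₁ hC₂.le hC₄.le hC₅ (mul_nonneg hD0 hh0) hη0 hec
      hpert ((Real.sqrt_le_left hη0).1 hη) ht'
    have hb' : t ^ 2 * M.massForm N (P t - uh t) (P t - uh t) ≤ Z * h ^ 2 :=
      hb.trans (le_of_eq (by rw [hZ]; ring))
    have hs' := Real.sqrt_le_sqrt hb'
    rw [Real.sqrt_mul (sq_nonneg _), Real.sqrt_sq ht0.le, Real.sqrt_mul' _ (sq_nonneg _),
      Real.sqrt_sq hh0] at hs'
    have hm := Real.sqrt_nonneg (M.massForm N (P t - uh t) (P t - uh t))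
    -- The weight `t` is divided out using `t ≥ τ`; this is the source of `1 / τ` in the constant.
    have h2 : √(M.massForm N (P t - uh t) (P t - uh t)) ≤ √Z / τ * h := by
      rw [div_mul_eq_mul_div, le_div_iff₀ hτ, mul_comm]
      exact (mul_le_mul_of_nonneg_right ht.1 hm).trans hs'
    refine (htri t ht').trans ?_
    rw [abs_of_nonneg hAR]
    have k1 := mul_nonneg hED hh0
    linarith
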